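/- **Setting.** Let $M\ge 1$ and $n\ge 0$ be integers, $m>0$, and let $\mathscr H^{(n)}=L^2(\mathbb R^{3M})\otimes L^2(\mathbb R^3)^{\otimes_{\rm sym} n}$, the functions $\psi(X,Y)\in L^2(\mathbb R^{3(M+n)})$, $X=(x_1,\dots,x_M)$, $Y=(y_1,\dots,y_n)$, that are symmetric in $y_1,\dots,y_n$. On the sector with $n$ $y$-particles let $L=-\frac1{2m}\sum_{\mu}\Delta_{x_\mu}+\sum_{i}(-\Delta_{y_i}+1)$, with Fourier symbol $L(P,K)=\frac1{2m}P^2+K^2+n$; the Fourier transform $\hat\psi(P,K)$ is the unitary one. Write $e_\mu$ for the inclusion of the $\mu$-th summand in $\mathbb R^{3M}$, $\hat P_\mu$ for $P$ without $p_\mu$, and $\hat Y_i,\hat K_i$ for $Y,K$ without the $i$-th entry. * For $\psi\in\mathscr H^{(n)}$ let $a^*(\delta_{x_\mu})\psi=\frac1{\sqrt{n+1}}\sum_{i=1}^{n+1}\delta_{x_\mu}(y_i)\psi(X,\hat Y_i)$ (a tempered distribution on $\mathbb R^{3(M+n+1)}$) and $G\psi=-\sum_{\mu=1}^M L^{-1}a^*(\delta_{x_\mu})\psi$.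 * For a function $\phi$ on $\mathbb R^{3(M+n+1)}$ that is continuous off the collision set $\{\prod_{\mu,i}|x_\mu-y_i|=0\}$ let $$(B\phi)(X,Y)=-\tfrac{2\pi(2m+1)}{m}\sqrt{n+1}\sum_{\mu=1}^M\lim_{y_{n+1}\to x_\mu}|x_\mu-y_{n+1}|\,\phi(X,Y,y_{n+1}),$$ $$(A\phi)(X,Y)=\lim_{r\downarrow0}\sum_{\mu=1}^M\frac1{4\pi}\int_{S^2}\Big(\sqrt{n+1}\,\phi(X,Y,x_\mu+r\omega)+\frac{m}{2\pi(2m+1)}\,\frac1r\,\frac{(B\phi)(X,Y)}{M}\Big)\,d\omega .$$ * Let $T=T_{\rm d}+T_{\rm od}$, where $$\widehat{T_{\rm d}\psi}(P,K)=\frac1{4\pi}\Big(\frac{2m}{2m+1}\Big)^{3/2}\sum_{\mu=1}^M\sqrt{n+1+\tfrac1{2m+1}p_\mu^2+\tfrac1{2m}\hat P_\mu^2+K^2}\;\hat\psi(P,K),$$ $$\widehat{T_{\rm od}\psi}(P,K)=-\frac1{(2\pi)^3}\Big(\sum_{\mu,\nu=1}^M\sum_{i=1}^n\int_{\mathbb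 R^3}\frac{\hat\psi(P-e_\mu\xi+e_\nu k_i,\hat K_i,\xi)}{n+1+\frac1{2m}(P-e_\mu\xi)^2+K^2+\xi^2}\,d\xi+\sum_{\mu\ne\nu}\int_{\mathbb R^3}\frac{\hat\psi(P-e_\mu\xi+e_\nu\xi,K)}{n+1+\frac1{2m}(P-e_\mu\xi)^2+K^2+\xi^2}\,d\xi\Big)$$ on $\mathscr H^{(n)}\cap H^1(\mathbb R^{3(M+n)})$, extended to a map $\mathscr H^{(n)}\to H^{-1}(\mathbb R^{3(M+n)})$ by duality, $\langle\chi,T\psi\rangle=\langle T\chi,\psi\rangle$ for $\chi\in\mathscr H^{(n)}\cap H^1$. **Lemma 3.6.** Let $\psi\in\mathscr H^{(n)}$. Then $G\psi\in\mathscr H^{(n+1)}$ has a representative that is continuous off the collision set, and for $\phi=G\psi$ given by this representative the limits defining $(B\phi)(X,Y)$ exist for almost every $(X,Y)$, for every $r>0$ the expression under the limit defining $A\phi$ is given by absolutely convergent integrals for almost every $(X,Y)$ and lies in $L^2(\mathbb R^{3(M+n)})$, and the limit $r\downarrow0$ exists in $H^{-1}(\mathbb R^{3(M+n)})$ and equals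 $T\psi$. So $AG\psi=T\psi$. Moreover the integrals in the formula for $\widehat{T_{\rm od}\psi}$ converge absolutely almost everywhere for every $\psi\in\mathscr H^{(n)}$, and the formulas for $T_{\rm d}$, $T_{\rm od}$ give the Fourier transform of the extension $T\psi\in H^{-1}$. -/

import Mathlib

open MeasureTheory Filter Topology
open scoped SchwartzMap FourierTransform ENNReal

noncomputable section

namespace IBC

/-! ### Configurations of `M` x-particles and `n` y-particles in `ℝ³` -/

/-- Physical space `ℝ³` with the Euclidean norm. -/
abbrev R3 : Type := EuclideanSpace ℝ (Fin 3)

/-- The configuration (and momentum) space `ℝ^{3M} × ℝ^{3n} = ℝ^{3(M+n)}`, with the Euclidean norm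
and Lebesgue measure. The index `(Sum.inl μ, j)` is the `j`-th coordinate of the `μ`-th x-particle,
`(Sum.inr i, j)` the `j`-th coordinate of the `i`-th y-particle. -/
abbrev Cfg (M n : ℕ) : Type := EuclideanSpace ℝ ((Fin M ⊕ Fin n) × Fin 3)

variable {M n : ℕ}

/-- The configuration `(X, Y)`. -/
def mk (X : Fin M → R3) (Y : Fin n → R3) : Cfg M n :=
  WithLp.toLp 2 fun q => Sum.elim X Y q.1 q.2

/-- The tuple `X = (x_1, …, x_M)` (or `P = (p_1, …, p_M)` for a momentum). -/
def xs (z : Cfg M n) : Fin M → R3 := fun μ => WithLp.toLp 2 fun j => z (Sum.inl μ, j)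

/-- The tuple `Y = (y_1, …, y_n)` (or `K = (k_1, …, k_n)` for a momentum). -/
def ys (z : Cfg M n) : Fin n → R3 := fun i => WithLp.toLp 2 fun j => z (Sum.inr i, j)

/-- The set of collision configurations, where some `x_μ` equals some `y_i`. -/
def collisions (M n : ℕ) : Set (Cfg M n) :=
  {z | ∏ μ : Fin M, ∏ i : Fin n, ‖xs z μ - ys z i‖ = 0}

/-- `L²(ℝ^{3(M+n)})`. -/
abbrev L2 (M n : ℕ) : Type := Lp ℂ 2 (volume : Measure (Cfg M n))

/-- Tempered distributions on `ℝ^{3(M+n)}`. -/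
abbrev Dist (M n : ℕ) : Type := 𝓢'(Cfg M n, ℂ)

/-- `ψ` lies in the `n`-particle sector `L²(ℝ^{3M}) ⊗ L²(ℝ³)^{⊗_sym n}`: it is invariant under
permutations of the y-particles. -/
def IsSector (ψ : L2 M n) : Prop :=
  ∀ σ : Equiv.Perm (Fin n), ∀ᵐ z : Cfg M n, ψ (mk (xs z) (ys z ∘ σ)) = ψ z

/-! ### The creation operator, the free resolvent and the operator `G` -/

/-- The linear map `(X, Ŷ) ↦ (X, Y)`, where `Y` is `Ŷ` with the position `x_μ` inserted as the
`i`-th entry. -/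
def insertL (μ : Fin M) (i : Fin (n + 1)) : Cfg M n →ₗ[ℝ] Cfg M (n + 1) where
  toFun z := mk (xs z) (Fin.insertNth i (xs z μ) (ys z))
  map_add' z w := by
    ext ⟨a | a, j⟩
    · simp [mk, xs]
    · refine Fin.succAboveCases i ?_ (fun k => ?_) a
      · simp [mk, xs]
      · simp [mk, ys]
  map_smul' c z := by
    ext ⟨a | a, j⟩
    · simp [mk, xs]
    · refine Fin.succAboveCases i ?_ (fun k => ?_) a
      · simp [mk, xs]
      · simp [mk, ys]

theorem insertL_injective (μ : Fin M) (i : Fin (n + 1)) :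
    Function.Injective (insertL (n := n) μ i) := by
  intro z w h
  ext ⟨a | a, j⟩
  · have := congrArg (fun v : Cfg M (n + 1) => v (Sum.inl a, j)) h
    simpa [insertL, mk, xs] using this
  · have := congrArg (fun v : Cfg M (n + 1) => v (Sum.inr (i.succAbove a), j)) h
    simpa [insertL, mk, ys] using this

theorem insertL_antilipschitz (μ : Fin M) (i : Fin (n + 1)) :
    ∃ K > 0, AntilipschitzWith K (insertL (n := n) μ i) :=
  (insertL (n := n) μ i).exists_antilipschitzWith
    (LinearMap.ker_eq_bot.2 (insertL_injective μ i))

/-- Restriction of a test function `f(X, Y)` to the plane `y_i = x_μ`, as a function of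
`(X, Ŷ_i)`. -/
def restrictTest (μ : Fin M) (i : Fin (n + 1)) : 𝓢(Cfg M (n + 1), ℂ) →L[ℂ] 𝓢(Cfg M n, ℂ) :=
  SchwartzMap.compCLMOfAntilipschitz ℂ (g := insertL (n := n) μ i)
    (LinearMap.toContinuousLinearMap (insertL (n := n) μ i)).hasTemperateGrowth
    (insertL_antilipschitz μ i).choose_spec.2

/-- The distribution `δ_{x_μ}(y_i) ψ(X, Ŷ_i)`, that is
`f ↦ ∫ ψ(X, Ŷ_i) f(X, Y)|_{y_i = x_μ} dX dŶ_i`. -/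
def deltaMul (μ : Fin M) (i : Fin (n + 1)) (ψ : L2 M n) : Dist M (n + 1) :=
  PointwiseConvergenceCLM.precomp ℂ (restrictTest μ i) (ψ : Dist M n)

/-- The creation operator `a^*(δ_{x_μ}) ψ = (n+1)^{-1/2} ∑_i δ_{x_μ}(y_i) ψ(X, Ŷ_i)`. -/
def create (μ : Fin M) (ψ : L2 M n) : Dist M (n + 1) :=
  ((1 / √((n : ℝ) + 1) : ℝ) : ℂ) • ∑ i : Fin (n + 1), deltaMul μ i ψ

/-- The Fourier symbol `L(P, K) = P²/(2m) + K² + n` of the free Hamiltonian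
`L = -(1/2m) ∑_μ Δ_{x_μ} + ∑_i (-Δ_{y_i} + 1)`. -/
def symL (m : ℝ) (p : Cfg M n) : ℝ :=
  1 / (2 * m) * (∑ μ, ‖xs p μ‖ ^ 2) + (∑ i, ‖ys p i‖ ^ 2) + n

/-- The inverse `L⁻¹` (for at least one y-particle) on tempered distributions. Mathlib's Fourier
transform has the kernel `exp(-2πi x·ζ)`, so the momentum is `p = 2πζ`. -/
def resolventL (m : ℝ) : Dist M n →L[ℂ] Dist M n :=
  TemperedDistribution.fourierMultiplierCLM ℂ
    fun ζ : Cfg M n => (((symL m ((2 * Real.pi) • ζ))⁻¹ : ℝ) : ℂ)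

/-- The multiplier in `resolventL` is of temperate growth, so that `resolventL` is the genuine Fourier
multiplier, as soon as there is at least one y-particle. -/
theorem hasTemperateGrowth_resolvent (m : ℝ) (hm : 0 < m) (hn : 0 < n) :
    Function.HasTemperateGrowth
      (fun ζ : Cfg M n => (((symL m ((2 * Real.pi) • ζ))⁻¹ : ℝ) : ℂ)) := by
  let c : (Fin M ⊕ Fin n) × Fin 3 → ℝ := fun q =>
    Sum.elim (fun _ => 2 * Real.pi / √(2 * m * n)) (fun _ => 2 * Real.pi / √n) q.1
  let A : Cfg M n →ₗ[ℝ] Cfg M n :=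
    { toFun := fun z => WithLp.toLp 2 fun q => c q * z q
      map_add' := fun z w => by ext q; simp [mul_add]
      map_smul' := fun a z => by ext q; simp; ring }
  have hn' : (0 : ℝ) < n := by exact_mod_cast hn
  have key : ∀ ζ, symL m ((2 * Real.pi) • ζ) = n * (1 + ‖A ζ‖ ^ 2) := by
    intro ζ
    simp only [symL, EuclideanSpace.norm_sq_eq, xs, ys, A, LinearMap.coe_mk, AddHom.coe_mk,
      Fintype.sum_prod_type, Fintype.sum_sum_type, c, Sum.elim_inl, Sum.elim_inr, norm_mul, mul_pow,
      PiLp.smul_apply, smul_eq_mul, Real.norm_eq_abs, sq_abs, div_pow]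
    rw [Real.sq_sqrt (by positivity), Real.sq_sqrt (by positivity)]
    simp only [← Finset.mul_sum]
    field_simp
    ring
  have h1 : (fun ζ : Cfg M n => (((symL m ((2 * Real.pi) • ζ))⁻¹ : ℝ) : ℂ)) =
      (fun ζ => (((n : ℝ)⁻¹ : ℝ) : ℂ) * (((fun x : Cfg M n => (1 + ‖x‖ ^ 2) ^ (-1 : ℝ))
        (LinearMap.toContinuousLinearMap A ζ) : ℝ) : ℂ)) := by
    funext ζ
    rw [key]
    simp [Real.rpow_neg_one]
    ring
  have h2 := (Function.hasTemperateGrowth_one_add_norm_sq_rpow (Cfg M n) (-1)).comp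
    (LinearMap.toContinuousLinearMap A).hasTemperateGrowth
  have h3 := (Complex.ofRealCLM.hasTemperateGrowth).comp h2
  rw [h1]
  exact (Function.HasTemperateGrowth.const (((n : ℝ)⁻¹ : ℝ) : ℂ)).mul h3

/-- `Gψ = -∑_μ L⁻¹ a^*(δ_{x_μ}) ψ`. -/
def G (m : ℝ) (ψ : L2 M n) : Dist M (n + 1) :=
  -∑ μ : Fin M, resolventL m (create μ ψ)

/-! ### The boundary operators `B` and `A` -/

/-- The configuration `(X, Y, x_μ + ε)`. -/
def addY (z : Cfg M n) (μ : Fin M) (ε : R3) : Cfg M (n + 1) :=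
  mk (xs z) (Fin.snoc (ys z) (xs z μ + ε))

/-- `b = B u`: for almost every `(X, Y)` the limits of `|x_μ - y_{n+1}| u(X, Y, y_{n+1})` for
`y_{n+1} → x_μ` exist, and
`b(X, Y) = -(2π(2m+1)/m) √(n+1) ∑_μ lim |x_μ - y_{n+1}| u(X, Y, y_{n+1})`. -/
def IsB (m : ℝ) (u : Cfg M (n + 1) → ℂ) (b : Cfg M n → ℂ) : Prop :=
  ∀ᵐ z : Cfg M n, ∃ l : Fin M → ℂ,
    (∀ μ, Tendsto (fun ε : R3 => (‖ε‖ : ℂ) * u (addY z μ ε)) (𝓝[≠] 0) (𝓝 (l μ))) ∧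
    b z = ((-(2 * Real.pi * (2 * m + 1) / m) * √((n : ℝ) + 1) : ℝ) : ℂ) * ∑ μ, l μ

/-- The integrand `√(n+1) u(X, Y, x_μ + rω) + (m / (2π(2m+1))) (1/r) b(X, Y) / M`. -/
def integrandA (m : ℝ) (u : Cfg M (n + 1) → ℂ) (b : Cfg M n → ℂ) (r : ℝ) (z : Cfg M n)
    (μ : Fin M) (ω : Metric.sphere (0 : R3) 1) : ℂ :=
  ((√((n : ℝ) + 1) : ℝ) : ℂ) * u (addY z μ (r • (ω : R3)))
    + ((m / (2 * Real.pi * (2 * m + 1)) * (1 / r) : ℝ) : ℂ) * (b z / M)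

/-- The expression whose limit for `r → 0` defines `A`: the sum over `μ` of `1/(4π)` times the
integral of `integrandA` over the unit sphere with its surface measure (of total mass `4π`). -/
def approxA (m : ℝ) (u : Cfg M (n + 1) → ℂ) (b : Cfg M n → ℂ) (r : ℝ) (z : Cfg M n) : ℂ :=
  ∑ μ : Fin M, ((1 / (4 * Real.pi) : ℝ) : ℂ) *
    ∫ ω, integrandA m u b r z μ ω ∂(volume : Measure R3).toSphere

/-- Convergence `F i → τ` in the Sobolev space `H^s` along the filter `l`. -/
def TendstoSobolev {ι : Type} (s : ℝ) (l : Filter ι) (F : ι → Dist M n) (τ : Dist M n) : Prop :=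
  ∃ (g : ι → L2 M n) (g₀ : L2 M n),
    (∀ᶠ i in l, TemperedDistribution.besselPotential (Cfg M n) ℂ s (F i) = (g i : Dist M n)) ∧
    TemperedDistribution.besselPotential (Cfg M n) ℂ s τ = (g₀ : Dist M n) ∧
    Tendsto g l (𝓝 g₀)

/-- The limit defining `A φ` exists in `H^{-1}` and equals `τ`. Here `φ` is evaluated pointwise
through its representative `u` that is continuous off the collision configurations (which form a
closed null set, so that `u` is determined by `φ` off this set). For every `r > 0` the sphere
integrals converge absolutely for almost every `(X, Y)` and give a function in `L²`. -/
def HasA (m : ℝ) (φ : L2 M (n + 1)) (τ : Dist M n) : Prop :=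
  ∃ u : Cfg M (n + 1) → ℂ, (φ =ᵐ[volume] u) ∧ ContinuousOn u (collisions M (n + 1))ᶜ ∧
    ∃ b : Cfg M n → ℂ, IsB m u b ∧
      ∃ F : ℝ → L2 M n,
        (∀ r : ℝ, 0 < r →
          (∀ᵐ z : Cfg M n, ∀ μ, Integrable (integrandA m u b r z μ)
            (volume : Measure R3).toSphere) ∧
          F r =ᵐ[volume] approxA m u b r) ∧
        TendstoSobolev (-1) (𝓝[>] 0) (fun r => (F r : Dist M n)) τ

/-! ### The operator `T` -/

/-- The unitary Fourier transform `ψ̂(p) = (2π)^{-d/2} ∫ exp(-ip·x) ψ(x) dx`, `d = 3(M+n)`. -/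
def hat (ψ : L2 M n) (p : Cfg M n) : ℂ :=
  (((2 * Real.pi) ^ (-(3 * ((M : ℝ) + n) / 2)) : ℝ) : ℂ) *
    (𝓕 ψ : L2 M n) ((2 * Real.pi)⁻¹ • p)

/-- The tempered distribution `τ` has the function `h` as its unitary Fourier transform, i.e.
`𝓕 τ`, in Mathlib's normalisation, is the function `ζ ↦ (2π)^{d/2} h(2πζ)`. -/
def HasHat (τ : Dist M n) (h : Cfg M n → ℂ) : Prop :=
  ∀ f : 𝓢(Cfg M n, ℂ),
    Integrable (fun ζ : Cfg M n => f ζ *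
      ((((2 * Real.pi) ^ (3 * ((M : ℝ) + n) / 2) : ℝ) : ℂ) * h ((2 * Real.pi) • ζ))) ∧
    (𝓕 τ : Dist M n) f = ∫ ζ : Cfg M n, f ζ *
      ((((2 * Real.pi) ^ (3 * ((M : ℝ) + n) / 2) : ℝ) : ℂ) * h ((2 * Real.pi) • ζ))

/-- `P - e_μ ξ`. -/
def subX (P : Fin M → R3) (μ : Fin M) (ξ : R3) : Fin M → R3 := P - Pi.single μ ξ

/-- The diagonal part of `T` in Fourier variables:
`(1/4π) (2m/(2m+1))^{3/2} ∑_μ √(n+1 + p_μ²/(2m+1) + P̂_μ²/(2m) + K²) ψ̂(P, K)`,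
where `P̂_μ` is `P` without the entry `p_μ`. -/
def TdHat (m : ℝ) (h : Cfg M n → ℂ) (p : Cfg M n) : ℂ :=
  ((1 / (4 * Real.pi) * (2 * m / (2 * m + 1)) ^ (3 / 2 : ℝ) *
    ∑ μ : Fin M, √((n : ℝ) + 1 + 1 / (2 * m + 1) * ‖xs p μ‖ ^ 2
      + 1 / (2 * m) * (∑ ν ∈ Finset.univ.erase μ, ‖xs p ν‖ ^ 2)
      + (∑ i, ‖ys p i‖ ^ 2)) : ℝ) : ℂ) * h p

/-- The integrand `ψ̂(P - e_μ ξ + e_ν k_i, K̂_i, ξ) / L(P - e_μ ξ, K, ξ)`. The y-momenta `K̂_i, ξ`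
are listed as `K` with `k_i` replaced by `ξ`; their order is immaterial, because `ψ̂` is symmetric
in the y-momenta. -/
def offInt₁ (m : ℝ) (h : Cfg M n → ℂ) (p : Cfg M n) (μ ν : Fin M) (i : Fin n) (ξ : R3) : ℂ :=
  h (mk (subX (xs p) μ ξ + Pi.single ν (ys p i)) (Function.update (ys p) i ξ)) /
    ((symL m (mk (subX (xs p) μ ξ) (Fin.snoc (ys p) ξ : Fin (n + 1) → R3)) : ℝ) : ℂ)

/-- The integrand `ψ̂(P - e_μ ξ + e_ν ξ, K) / L(P - e_μ ξ, K, ξ)`. -/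
def offInt₂ (m : ℝ) (h : Cfg M n → ℂ) (p : Cfg M n) (μ ν : Fin M) (ξ : R3) : ℂ :=
  h (mk (subX (xs p) μ ξ + Pi.single ν ξ) (ys p)) /
    ((symL m (mk (subX (xs p) μ ξ) (Fin.snoc (ys p) ξ : Fin (n + 1) → R3)) : ℝ) : ℂ)

/-- The off-diagonal part of `T` in Fourier variables. -/
def TodHat (m : ℝ) (h : Cfg M n → ℂ) (p : Cfg M n) : ℂ :=
  -((1 / (2 * Real.pi) ^ 3 : ℝ) : ℂ) *
    ((∑ μ : Fin M, ∑ ν : Fin M, ∑ i : Fin n, (∫ ξ : R3, offInt₁ m h p μ ν i ξ))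
      + (∑ μ : Fin M, ∑ ν ∈ Finset.univ.erase μ, (∫ ξ : R3, offInt₂ m h p μ ν ξ)))

/-- `T = T_d + T_od` in Fourier variables. -/
def THat (m : ℝ) (h : Cfg M n → ℂ) (p : Cfg M n) : ℂ := TdHat m h p + TodHat m h p

/-- `τ = Tψ` for `ψ` in the `n`-particle sector: `τ` is the element of `H^{-1}` whose Fourier
transform is given by the formula for `T`, with all integrals absolutely convergent almost
everywhere. On `H¹` this is the operator `T` itself; the last clause says that `τ` is the value at
`ψ` of the extension of `T` by duality, i.e. `⟨χ, τ⟩ = ⟨Tχ, ψ⟩` for all `χ` in the sector that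
belong to `H¹`. -/
structure IsT (m : ℝ) (ψ : L2 M n) (τ : Dist M n) : Prop where
  memSobolev : TemperedDistribution.MemSobolev (-1) 2 τ
  integrable₁ : ∀ᵐ p : Cfg M n, ∀ (μ ν : Fin M) (i : Fin n),
    Integrable (offInt₁ m (hat ψ) p μ ν i)
  integrable₂ : ∀ᵐ p : Cfg M n, ∀ μ ν : Fin M, μ ≠ ν → Integrable (offInt₂ m (hat ψ) p μ ν)
  hasHat : HasHat τ (THat m (hat ψ))
  duality : ∀ χ : L2 M n, IsSector χ → TemperedDistribution.MemSobolev 1 2 (χ : Dist M n) →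
    Integrable (fun p : Cfg M n => star (hat χ p) * THat m (hat ψ) p) ∧
    Integrable (fun p : Cfg M n => star (THat m (hat χ) p) * hat ψ p) ∧
    ∫ p : Cfg M n, star (hat χ p) * THat m (hat ψ) p =
      ∫ p : Cfg M n, star (THat m (hat χ) p) * hat ψ p

end IBC

end

/-!
Why `A G ψ = T ψ`.

*The function `Gψ`.* Since `1 / L = ∫ exp (-t L) dt` and `exp (-t L)` has a Gaussian kernel, `Gψ` is
given by an explicit integral `pot m ψ` with a nonpositive kernel (`toLp_pot_eq_G`). It is, up to a
factor, the sum over `ν` and `i` of the functions `L⁻¹ δ_{x_ν}(y_i) ψ`. Gaussian bounds uniform in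
`t` make the summand `(ν, i)` continuous off `y_i = x_ν` (`continuousOn_pot`).

*The boundary value.* At `y_{n+1} = x_μ` only the summand `ν = μ`, `i = n + 1` is singular, the
*diagonal* one. Integrating the heat kernel over a plane `y_{n+1} = x_μ + v` and then over the time
gives `α / (4π|v|) exp (-|v| √(α (n+1)))` with `α = 2m / (2m + 1)`, by the subordination formula.
As `v → 0` only small times matter, so that at Lebesgue points of `ψ` the summand is
asymptotic to `α / (4π|v|) ψ` (`ae_tendsto_potTerm_diag`). This gives `B G ψ = M ψ` (`isB_pot`).

*Sphere averages.* The average over `|y_{n+1} - x_μ| = r` of each summand is again an integral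
operator with a nonnegative kernel. For such an operator (`PosKernel`) a bound of its quadratic form
in momentum space, tested on Schwartz functions, bounds all integrals of absolute values; so the
averages converge absolutely almost everywhere, lie in `L²`, and are given by their momentum space
form (`PosKernel.integral_mul_apply`). The Fourier transform of the normalised surface measure of
a sphere of radius `r` is `sin (r|ξ|) / (r|ξ|)`. Hence an off-diagonal summand becomes an integral of the form
occurring in `T_od` with the cutoff `sin (r|ξ|) / (r|ξ|)` (`integral_mul_sphTerm_off`), and the
diagonal summand a multiplication operator whose symbol is `α / (4πr) exp (-r √(αΛ))` times a factor
`1 + O(r²)`, where `Λ` is the energy under the square root in `T_d` (`integral_mul_sphTerm_diag`).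

*The limit.* The term with `Bφ` in the definition of `A` is `α / (4πr) ψ`. It cancels the divergence
of the diagonal symbol and leaves `α^{3/2} √Λ / (4π)`, the symbol of `T_d` (`tendsto_diagRem`). The
off-diagonal terms are bounded from `L²` to `H⁻¹` by a Schur test (`offDiag_schur`). The convergence
in `H⁻¹` is then dominated convergence in momentum space (`tendstoSobolev_approxFun`), which also
gives the absolute convergence of the integrals in `T_od`.

*Duality.* The momentum space form of an off-diagonal term goes over to its transpose under the
interchange of two y-momenta (`offForm_permL`), so that `T` is symmetric, and `Tψ` is the value of
its extension by duality (`isT_TDist`).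
-/

noncomputable section

namespace IBC

/-! ### Coordinates on configuration space -/

section Coordinates

variable {M n : ℕ}

@[simp] theorem xs_mk (X : Fin M → R3) (Y : Fin n → R3) : xs (mk X Y) = X := by
  ext μ j; simp [xs, mk]

@[simp] theorem ys_mk (X : Fin M → R3) (Y : Fin n → R3) : ys (mk X Y) = Y := by
  ext i j; simp [ys, mk]

@[simp] theorem mk_xs_ys (z : Cfg M n) : mk (xs z) (ys z) = z := by
  ext ⟨a | a, j⟩ <;> simp [xs, ys, mk]

theorem cfg_ext {z w : Cfg M n} (hx : xs z = xs w) (hy : ys z = ys w) : z = w := by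
  rw [← mk_xs_ys z, ← mk_xs_ys w, hx, hy]

@[simp] theorem xs_add (z w : Cfg M n) : xs (z + w) = xs z + xs w := by ext; simp [xs]
@[simp] theorem ys_add (z w : Cfg M n) : ys (z + w) = ys z + ys w := by ext; simp [ys]
@[simp] theorem xs_sub (z w : Cfg M n) : xs (z - w) = xs z - xs w := by ext; simp [xs]
@[simp] theorem ys_sub (z w : Cfg M n) : ys (z - w) = ys z - ys w := by ext; simp [ys]
@[simp] theorem xs_smul (c : ℝ) (z : Cfg M n) : xs (c • z) = c • xs z := by ext; simp [xs]
@[simp] theorem ys_smul (c : ℝ) (z : Cfg M n) : ys (c • z) = c • ys z := by ext; simp [ys]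
@[simp] theorem xs_zero : xs (0 : Cfg M n) = 0 := by ext; simp [xs]
@[simp] theorem ys_zero : ys (0 : Cfg M n) = 0 := by ext; simp [ys]

@[fun_prop] theorem continuous_xs (μ : Fin M) : Continuous fun z : Cfg M n => xs z μ := by
  unfold xs; fun_prop

@[fun_prop] theorem continuous_ys (i : Fin n) : Continuous fun z : Cfg M n => ys z i := by
  unfold ys; fun_prop

theorem continuous_mk {α : Type*} [TopologicalSpace α] {X : α → Fin M → R3} {Y : α → Fin n → R3}
    (hX : ∀ μ, Continuous fun a => X a μ) (hY : ∀ i, Continuous fun a => Y a i) :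
    Continuous fun a => mk (X a) (Y a) := by
  unfold mk
  refine (PiLp.continuous_toLp 2 _).comp (continuous_pi fun q => ?_)
  rcases q with ⟨a | a, j⟩
  · exact (continuous_apply j).comp ((PiLp.continuous_ofLp 2 _).comp (hX a))
  · exact (continuous_apply j).comp ((PiLp.continuous_ofLp 2 _).comp (hY a))

theorem inner_cfg (z w : Cfg M n) :
    inner ℝ z w = ∑ μ, inner ℝ (xs z μ) (xs w μ) + ∑ i, inner ℝ (ys z i) (ys w i) := by
  simp only [PiLp.inner_apply, Fintype.sum_prod_type, Fintype.sum_sum_type, xs, ys]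

theorem norm_sq_cfg (z : Cfg M n) : ‖z‖ ^ 2 = ∑ μ, ‖xs z μ‖ ^ 2 + ∑ i, ‖ys z i‖ ^ 2 := by
  simp only [← real_inner_self_eq_norm_sq, inner_cfg]

theorem norm_xs_le (z : Cfg M n) (μ : Fin M) : ‖xs z μ‖ ≤ ‖z‖ := by
  refine le_of_sq_le_sq ?_ (norm_nonneg z)
  rw [norm_sq_cfg]
  have h1 := Finset.single_le_sum (f := fun ν => ‖xs z ν‖ ^ 2) (fun _ _ => by positivity)
    (Finset.mem_univ μ)
  have h2 : 0 ≤ ∑ i, ‖ys z i‖ ^ 2 := by positivity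
  linarith

theorem norm_ys_le (z : Cfg M n) (i : Fin n) : ‖ys z i‖ ≤ ‖z‖ := by
  refine le_of_sq_le_sq ?_ (norm_nonneg z)
  rw [norm_sq_cfg]
  have h1 := Finset.single_le_sum (f := fun ν => ‖ys z ν‖ ^ 2) (fun _ _ => by positivity)
    (Finset.mem_univ i)
  have h2 : 0 ≤ ∑ i, ‖xs z i‖ ^ 2 := by positivity
  linarith

/-! ### The linear maps between configurations -/

/-- Adding a y-particle at the position of the `μ`-th x-particle: `(X, Y) ↦ (X, Y, x_μ)`. -/
def diagL (μ : Fin M) : Cfg M n →L[ℝ] Cfg M (n + 1) := LinearMap.toContinuousLinearMap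
  { toFun := fun z => mk (xs z) (Fin.snoc (ys z) (xs z μ) : Fin (n + 1) → R3)
    map_add' := fun z w => by
      refine cfg_ext (by simp) ?_
      ext i : 1
      refine Fin.lastCases ?_ (fun i => ?_) i <;> simp
    map_smul' := fun c z => by
      refine cfg_ext (by simp) ?_
      ext i : 1
      refine Fin.lastCases ?_ (fun i => ?_) i <;> simp }

theorem diagL_apply (μ : Fin M) (z : Cfg M n) :
    diagL μ z = mk (xs z) (Fin.snoc (ys z) (xs z μ) : Fin (n + 1) → R3) := rfl

/-- The inclusion of `ℝ³` as the space of the last y-particle. -/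
def lastL : R3 →L[ℝ] Cfg M (n + 1) := LinearMap.toContinuousLinearMap
  { toFun := fun ε => mk 0 (Fin.snoc (0 : Fin n → R3) ε : Fin (n + 1) → R3)
    map_add' := fun z w => by
      refine cfg_ext (by simp) ?_
      ext i : 1
      refine Fin.lastCases ?_ (fun i => ?_) i <;> simp
    map_smul' := fun c z => by
      refine cfg_ext (by simp) ?_
      ext i : 1
      refine Fin.lastCases ?_ (fun i => ?_) i <;> simp }

theorem lastL_apply (ε : R3) :
    (lastL ε : Cfg M (n + 1)) = mk 0 (Fin.snoc (0 : Fin n → R3) ε : Fin (n + 1) → R3) := rfl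

/-- The adjoint of `diagL μ`, in momentum variables `(P, K, ξ) ↦ (P + e_μ ξ, K)`. -/
def totalL (μ : Fin M) : Cfg M (n + 1) →L[ℝ] Cfg M n := LinearMap.toContinuousLinearMap
  { toFun := fun z => mk (xs z + Pi.single μ (ys z (Fin.last n))) (fun i => ys z i.castSucc)
    map_add' := fun z w => by
      refine cfg_ext ?_ ?_
      · simp [Pi.single_add]; abel
      · ext i : 1; simp
    map_smul' := fun c z => by
      refine cfg_ext ?_ ?_
      · simp [Pi.single_smul]
      · ext i : 1; simp }

theorem totalL_apply (μ : Fin M) (z : Cfg M (n + 1)) : totalL μ z =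
    mk (xs z + Pi.single μ (ys z (Fin.last n))) (fun i => ys z i.castSucc) := rfl

theorem addY_eq (z : Cfg M n) (μ : Fin M) (ε : R3) : addY z μ ε = diagL μ z + lastL ε := by
  rw [diagL_apply, lastL_apply, addY]
  refine cfg_ext (by simp) ?_
  ext i : 1
  refine Fin.lastCases ?_ (fun i => ?_) i <;> simp

theorem inner_diagL (μ : Fin M) (z : Cfg M n) (ζ : Cfg M (n + 1)) :
    inner ℝ (diagL μ z) ζ = inner ℝ z (totalL μ ζ) := by
  simp only [inner_cfg, diagL_apply, totalL_apply, xs_mk, ys_mk, Fin.sum_univ_castSucc,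
    Fin.snoc_castSucc, Fin.snoc_last, Pi.add_apply, inner_add_right, Finset.sum_add_distrib]
  have : ∑ ν, inner ℝ (xs z ν) ((Pi.single μ (ys ζ (Fin.last n)) : Fin M → R3) ν) =
      inner ℝ (xs z μ) (ys ζ (Fin.last n)) := by
    rw [Finset.sum_eq_single μ]
    · simp
    · intro ν _ h; simp [h]
    · simp
  rw [this]; ring

theorem inner_lastL (ε : R3) (ζ : Cfg M (n + 1)) :
    inner ℝ (lastL ε) ζ = inner ℝ ε (ys ζ (Fin.last n)) := by
  simp [inner_cfg, lastL_apply, Fin.sum_univ_castSucc]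

/-- Permuting the y-particles: `(X, Y) ↦ (X, Y ∘ τ)`. -/
def permL (τ : Equiv.Perm (Fin n)) : Cfg M n ≃ₗᵢ[ℝ] Cfg M n :=
  LinearIsometryEquiv.piLpCongrLeft 2 ℝ ℝ
    (Equiv.prodCongr (Equiv.sumCongr (Equiv.refl (Fin M)) τ.symm) (Equiv.refl (Fin 3)))

@[simp] theorem xs_permL (τ : Equiv.Perm (Fin n)) (z : Cfg M n) : xs (permL τ z) = xs z := by
  ext μ j
  simp [permL, xs]

@[simp] theorem ys_permL (τ : Equiv.Perm (Fin n)) (z : Cfg M n) : ys (permL τ z) = ys z ∘ τ := by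
  ext μ j
  simp [permL, ys]

theorem permL_eq (τ : Equiv.Perm (Fin n)) (z : Cfg M n) :
    permL τ z = mk (xs z) (ys z ∘ τ) := cfg_ext (by simp) (by simp)

theorem permL_permL (σ τ : Equiv.Perm (Fin n)) (z : Cfg M n) :
    permL τ (permL σ z) = permL (σ * τ) z := cfg_ext (by simp) (by ext; simp)

@[simp] theorem permL_one (z : Cfg M n) : permL 1 z = z := cfg_ext (by simp) (by ext; simp)

theorem permL_symm (τ : Equiv.Perm (Fin n)) (z : Cfg M n) :
    (permL τ).symm z = permL τ⁻¹ z := by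
  rw [LinearIsometryEquiv.symm_apply_eq, permL_permL]; simp

theorem inner_permL (τ : Equiv.Perm (Fin n)) (z w : Cfg M n) :
    inner ℝ (permL τ z) w = inner ℝ z (permL τ⁻¹ w) := by
  rw [← permL_symm, ← (permL τ).inner_map_map z, LinearIsometryEquiv.apply_symm_apply]

/-! ### The change of variables separating the momentum `ξ` of the last y-particle -/

/-- Appending a last y-particle. -/
def snocE : Cfg M n × R3 ≃ᵐ Cfg M (n + 1) where
  toFun q := mk (xs q.1) (Fin.snoc (ys q.1) q.2 : Fin (n + 1) → R3)
  invFun z := (mk (xs z) (fun i => ys z i.castSucc), ys z (Fin.last n))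
  left_inv q := by
    refine Prod.ext (cfg_ext (by simp) ?_) (by simp)
    ext i : 1; simp
  right_inv z := by
    refine cfg_ext (by simp) ?_
    ext i : 1
    refine Fin.lastCases ?_ (fun i => ?_) i <;> simp
  measurable_toFun := by
    refine (continuous_mk (fun μ => by fun_prop) (fun i => ?_)).measurable
    refine Fin.lastCases ?_ (fun i => ?_) i
    · simpa using continuous_snd
    · simp only [Fin.snoc_castSucc]; fun_prop
  measurable_invFun := by
    refine Continuous.measurable (Continuous.prodMk ?_ (by fun_prop))
    exact continuous_mk (fun μ => by fun_prop) (fun i => by fun_prop)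

theorem snocE_apply (q : Cfg M n × R3) :
    snocE q = mk (xs q.1) (Fin.snoc (ys q.1) q.2 : Fin (n + 1) → R3) := rfl

/-- The index set of `ℝ^{3(M+n+1)}` with the last y-particle split off. -/
def splitIdx (M n : ℕ) :
    (Fin M ⊕ Fin n) × Fin 3 ⊕ Fin 3 ≃ (Fin M ⊕ Fin (n + 1)) × Fin 3 where
  toFun := Sum.elim (fun q => (Sum.map id Fin.castSucc q.1, q.2)) fun j => (Sum.inr (Fin.last n), j)
  invFun q := Sum.elim (fun a => Sum.inl (Sum.inl a, q.2))
    (fun i => Fin.lastCases (Sum.inr q.2) (fun i => Sum.inl (Sum.inr i, q.2)) i) q.1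
  left_inv q := by rcases q with ⟨a | a, j⟩ | j <;> simp
  right_inv q := by
    rcases q with ⟨a | a, j⟩
    · simp
    · refine Fin.lastCases ?_ (fun i => ?_) a <;> simp

theorem measurePreserving_snocE :
    MeasurePreserving (snocE (M := M) (n := n)) volume volume := by
  have h1 : MeasurePreserving (fun q : Cfg M n × R3 => (WithLp.ofLp q.1, WithLp.ofLp q.2))
      volume volume :=
    (PiLp.volume_preserving_ofLp _).prod (PiLp.volume_preserving_ofLp _)
  have h2 := (volume_measurePreserving_sumPiEquivProdPi_symm
    (fun _ : (Fin M ⊕ Fin n) × Fin 3 ⊕ Fin 3 => ℝ)).comp h1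
  have h3 := (volume_measurePreserving_piCongrLeft
    (fun _ : (Fin M ⊕ Fin (n + 1)) × Fin 3 => ℝ) (splitIdx M n)).comp h2
  have h4 := (PiLp.volume_preserving_toLp _).comp h3
  convert! h4 using 1
  funext q
  ext k
  obtain ⟨k, rfl⟩ := (splitIdx M n).surjective k
  simp only [Function.comp_apply, PiLp.toLp_apply, snocE_apply]
  rw [MeasurableEquiv.coe_piCongrLeft, Equiv.piCongrLeft_apply_apply]
  rcases k with ⟨a | a, j⟩ | j
  · simp [splitIdx, mk, xs, MeasurableEquiv.coe_sumPiEquivProdPi_symm]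
  · simp [splitIdx, mk, ys, MeasurableEquiv.coe_sumPiEquivProdPi_symm]
  · simp [splitIdx, mk, MeasurableEquiv.coe_sumPiEquivProdPi_symm]

/-- The inclusion of `ℝ³` as the space of the `μ`-th x-particle. -/
def singleX (μ : Fin M) : R3 →L[ℝ] Cfg M n := LinearMap.toContinuousLinearMap
  { toFun := fun ξ => mk (Pi.single μ ξ) 0
    map_add' := fun z w => cfg_ext (by simp [Pi.single_add]) (by simp)
    map_smul' := fun c z => cfg_ext (by simp [Pi.single_smul]) (by simp) }

theorem singleX_apply (μ : Fin M) (ξ : R3) :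
    (singleX μ ξ : Cfg M n) = mk (Pi.single μ ξ) 0 := rfl

/-- The map `(P, K, ξ) ↦ (P - e_μ ξ, K, ξ)`. -/
def shear (μ : Fin M) : Cfg M n × R3 ≃ᵐ Cfg M (n + 1) where
  toFun q := mk (subX (xs q.1) μ q.2) (Fin.snoc (ys q.1) q.2 : Fin (n + 1) → R3)
  invFun ζ := (totalL μ ζ, ys ζ (Fin.last n))
  left_inv q := by
    refine Prod.ext (cfg_ext (by simp [totalL_apply, subX]) ?_) (by simp)
    ext i : 1; simp [totalL_apply]
  right_inv z := by
    refine cfg_ext (by simp [totalL_apply, subX]) ?_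
    ext i : 1
    refine Fin.lastCases ?_ (fun i => ?_) i <;> simp [totalL_apply]
  measurable_toFun := by
    refine (continuous_mk (fun ν => ?_) (fun i => ?_)).measurable
    · unfold subX
      refine Continuous.sub (by fun_prop) ?_
      exact (continuous_apply ν).comp ((continuous_single μ).comp continuous_snd)
    · refine Fin.lastCases ?_ (fun i => ?_) i
      · simpa using continuous_snd
      · simp only [Fin.snoc_castSucc]; fun_prop
  measurable_invFun := by
    exact ((totalL μ).continuous.prodMk (by fun_prop)).measurable

theorem shear_apply (μ : Fin M) (p : Cfg M n) (ξ : R3) :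
    shear μ (p, ξ) = mk (subX (xs p) μ ξ) (Fin.snoc (ys p) ξ : Fin (n + 1) → R3) := rfl

@[simp] theorem totalL_shear (μ : Fin M) (q : Cfg M n × R3) : totalL μ (shear μ q) = q.1 :=
  congrArg Prod.fst ((shear μ).symm_apply_apply q)

@[simp] theorem last_shear (μ : Fin M) (q : Cfg M n × R3) :
    ys (shear μ q) (Fin.last n) = q.2 :=
  congrArg Prod.snd ((shear μ).symm_apply_apply q)

theorem measurePreserving_shear (μ : Fin M) :
    MeasurePreserving (shear (n := n) μ) volume volume := by
  have h1 : MeasurePreserving (fun q : R3 × Cfg M n => (q.1, q.2 - singleX μ q.1))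
      ((volume : Measure R3).prod volume) ((volume : Measure R3).prod volume) :=
    MeasurePreserving.skew_product (g := fun (ξ : R3) (p : Cfg M n) => p - singleX μ ξ)
      (MeasurePreserving.id _)
      (Continuous.measurable (by fun_prop))
      (Eventually.of_forall fun ξ => (measurePreserving_sub_right volume (singleX μ ξ)).map_eq)
  have h2 := (Measure.measurePreserving_swap.comp h1).comp
    (Measure.measurePreserving_swap (μ := (volume : Measure (Cfg M n))) (ν := (volume : Measure
      R3)))
  convert! measurePreserving_snocE.comp h2 using 1
  funext q
  simp only [Function.comp_apply, snocE_apply, Prod.swap, shear]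
  refine cfg_ext ?_ ?_
  · simp [subX, singleX_apply]
  · simp [singleX_apply]

end Coordinates

/-! ### The spherical average of a character -/

section Sphere

open Real Set

/-- The Fourier transform of the indicator of a ball in `ℝ³`, along the first axis. -/
theorem integral_ball_char (τ R : ℝ) (hR : 0 < R) :
    ∫ x : R3 in Metric.ball 0 R, Complex.exp ((τ * x 0 : ℝ) * Complex.I) =
      ∫ z in (-R)..R, (π * (R ^ 2 - z ^ 2) : ℝ) * Complex.exp ((τ * z : ℝ) * Complex.I) := by
  -- the ball is sliced into discs orthogonal to the first axis
  have e : MeasurePreserving (fun x : R3 => (x 0, WithLp.toLp 2 (fun i : Fin 2 => x i.succ)))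
      volume (volume : Measure (ℝ × EuclideanSpace ℝ (Fin 2))) := by
    have h1 := (volume_preserving_piFinSuccAbove (fun _ : Fin 3 => ℝ) 0).comp
      (PiLp.volume_preserving_ofLp (Fin 3))
    have h2 := (MeasurePreserving.id (volume : Measure ℝ)).prod
      (PiLp.volume_preserving_toLp (Fin 2))
    exact h2.comp h1
  have he : MeasurableEmbedding
      (fun x : R3 => (x 0, WithLp.toLp 2 (fun i : Fin 2 => x i.succ))) := by
    have h1 := (MeasurableEquiv.toLp 2 (Fin 3 → ℝ)).symm.trans
      (MeasurableEquiv.piFinSuccAbove (fun _ : Fin 3 => ℝ) 0)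
    exact (((MeasurableEquiv.toLp 2 (Fin 3 → ℝ)).symm.trans
      (MeasurableEquiv.piFinSuccAbove (fun _ : Fin 3 => ℝ) 0)).trans
      (MeasurableEquiv.prodCongr (MeasurableEquiv.refl ℝ)
        (MeasurableEquiv.toLp 2 (Fin 2 → ℝ)))).measurableEmbedding
  let S : Set (ℝ × EuclideanSpace ℝ (Fin 2)) := {q | q.1 ^ 2 + ‖q.2‖ ^ 2 < R ^ 2}
  have hSm : MeasurableSet S := by
    refine measurableSet_lt ?_ measurable_const
    exact Continuous.measurable (by fun_prop)
  have hS : Metric.ball (0 : R3) R =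
      (fun x : R3 => (x 0, WithLp.toLp 2 (fun i : Fin 2 => x i.succ))) ⁻¹' S := by
    ext x
    simp only [Metric.mem_ball, dist_zero_right, mem_preimage, S, mem_ofPred_eq]
    rw [← sq_lt_sq₀ (norm_nonneg _) hR.le, EuclideanSpace.norm_sq_eq, EuclideanSpace.norm_sq_eq,
      Fin.sum_univ_succ]
    simp
  rw [hS, e.setIntegral_preimage_emb he
    (fun q => Complex.exp ((τ * q.1 : ℝ) * Complex.I)) S, ← integral_indicator hSm]
  have hint : Integrable (S.indicator fun q : ℝ × EuclideanSpace ℝ (Fin 2) =>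
      Complex.exp ((τ * q.1 : ℝ) * Complex.I)) := by
    rw [integrable_indicator_iff hSm]
    refine Measure.integrableOn_of_bounded (M := 1) ?_ ?_ ?_
    · refine (measure_mono (t := Icc (-R) R ×ˢ Metric.closedBall 0 R) ?_).trans_lt ?_ |>.ne
      · rintro ⟨z, y⟩ h
        simp only [S, mem_ofPred_eq] at h
        have h1 : z ^ 2 ≤ R ^ 2 := by nlinarith [sq_nonneg ‖y‖]
        have h2 : ‖y‖ ^ 2 ≤ R ^ 2 := by nlinarith [sq_nonneg z]
        refine ⟨abs_le.1 (abs_le_of_sq_le_sq h1 hR.le), ?_⟩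
        simpa using abs_le_of_sq_le_sq h2 hR.le
      · rw [Measure.volume_eq_prod, Measure.prod_prod]
        exact ENNReal.mul_lt_top (by simp) measure_closedBall_lt_top
    · exact (Continuous.aestronglyMeasurable (by fun_prop))
    · refine Eventually.of_forall fun q => ?_
      rw [Complex.norm_exp_ofReal_mul_I]
  rw [Measure.volume_eq_prod, integral_prod _ hint]
  rw [intervalIntegral.integral_of_le (by linarith), ← integral_indicator measurableSet_Ioc]
  refine integral_congr_ae (Eventually.of_forall fun z => ?_)
  have hfun : (fun y : EuclideanSpace ℝ (Fin 2) =>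
      S.indicator (fun q => Complex.exp ((τ * q.1 : ℝ) * Complex.I)) (z, y)) =
      (Metric.ball (0 : EuclideanSpace ℝ (Fin 2)) (√(R ^ 2 - z ^ 2))).indicator
        (fun _ => Complex.exp ((τ * z : ℝ) * Complex.I)) := by
    funext y
    refine indicator_eq_indicator ?_ rfl
    simp only [S, mem_ofPred_eq, Metric.mem_ball, dist_zero_right]
    rw [Real.lt_sqrt (norm_nonneg _)]
    constructor <;> intro h <;> linarith
  simp only [hfun]
  rw [integral_indicator Metric.isOpen_ball.measurableSet, integral_const]
  rw [measureReal_def, Measure.restrict_apply_univ, EuclideanSpace.volume_ball_fin_two]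
  by_cases hz : z ∈ Ioc (-R) R
  · have h0 : 0 ≤ R ^ 2 - z ^ 2 := by nlinarith [hz.1, hz.2]
    rw [indicator_of_mem hz]
    rw [ENNReal.toReal_mul, ENNReal.toReal_pow, ENNReal.toReal_ofReal (Real.sqrt_nonneg _),
      ENNReal.toReal_ofReal pi_pos.le, Real.sq_sqrt h0, Complex.real_smul]
    push_cast; ring
  · have h0 : R ^ 2 - z ^ 2 ≤ 0 := by
      by_contra hc
      exact hz ⟨by nlinarith, by nlinarith⟩
    rw [indicator_of_notMem hz, Real.sqrt_eq_zero'.2 h0]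
    simp

/-- Integration in polar coordinates in `ℝ³`. -/
theorem integral_polar {g : R3 → ℂ} (hg : Integrable g) :
    ∫ x, g x = ∫ ρ in Ioi (0 : ℝ), ((ρ ^ 2 : ℝ) : ℂ) *
      ∫ ω, g (ρ • (ω : R3)) ∂(volume : Measure R3).toSphere := by
  have hfr : Module.finrank ℝ R3 = 3 := by simp
  have hmp := (volume : Measure R3).measurePreserving_homeomorphUnitSphereProd
  have hemb := (homeomorphUnitSphereProd R3).measurableEmbedding
  have hcomp : ∀ x : ({0}ᶜ : Set R3), g ((homeomorphUnitSphereProd R3 x).2.1 •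
      ((homeomorphUnitSphereProd R3 x).1 : R3)) = g x := by
    intro x
    have := congrArg Subtype.val ((homeomorphUnitSphereProd R3).symm_apply_apply x)
    rw [homeomorphUnitSphereProd_symm_apply_coe] at this
    rw [this]
  have h1 : ∫ x, g x = ∫ q, g (q.2.1 • (q.1 : R3))
      ∂((volume : Measure R3).toSphere.prod (Measure.volumeIoiPow (Module.finrank ℝ R3 - 1))) := by
    rw [← hmp.integral_comp hemb (fun q => g (q.2.1 • (q.1 : R3)))]
    simp only [hcomp]
    rw [integral_subtype_comap (measurableSet_singleton _).compl g, restrict_compl_singleton]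
  have h2 : Integrable (fun q : Metric.sphere (0 : R3) 1 × Ioi (0 : ℝ) => g (q.2.1 • (q.1 : R3)))
      ((volume : Measure R3).toSphere.prod (Measure.volumeIoiPow (Module.finrank ℝ R3 - 1))) := by
    rw [← hmp.integrable_comp_emb hemb]
    have : (fun q : Metric.sphere (0 : R3) 1 × Ioi (0 : ℝ) => g (q.2.1 • (q.1 : R3))) ∘
        homeomorphUnitSphereProd R3 = g ∘ ((↑) : ({0}ᶜ : Set R3) → R3) := funext hcomp
    rw [this, ← integrableOn_iff_comap_subtypeVal (measurableSet_singleton _).compl, IntegrableOn,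
      restrict_compl_singleton]
    exact hg
  rw [h1, integral_prod_symm _ h2, Measure.volumeIoiPow]
  simp only [ENNReal.ofReal]
  rw [integral_withDensity_eq_integral_smul
    (measurable_subtype_coe.pow_const _).real_toNNReal,
    integral_subtype_comap measurableSet_Ioi fun a =>
      Real.toNNReal (a ^ (Module.finrank ℝ R3 - 1)) •
        ∫ ω, g (a • (ω : R3)) ∂(volume : Measure R3).toSphere]
  refine setIntegral_congr_fun measurableSet_Ioi fun ρ hρ => ?_
  simp only [hfr]
  rw [NNReal.smul_def, Real.coe_toNNReal _ (sq_nonneg ρ), Complex.real_smul]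

/-- The Fourier transform of the surface measure of the unit sphere in `ℝ³`. -/
theorem integral_sphere_char (v : R3) :
    ∫ ω, Complex.exp ((inner ℝ v (ω : R3) : ℝ) * Complex.I) ∂(volume : Measure R3).toSphere =
      (4 * π * sinc ‖v‖ : ℝ) := by
  set S : ℝ → ℂ := fun ρ => ∫ ω, Complex.exp ((inner ℝ v (ρ • (ω : R3)) : ℝ) * Complex.I)
    ∂(volume : Measure R3).toSphere with hSdef
  have hScont : Continuous S := by
    refine continuous_of_dominated (bound := fun _ => 1)
      (fun ρ => (Continuous.aestronglyMeasurable (by fun_prop)))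
      (fun ρ => Eventually.of_forall fun ω => ?_) (integrable_const _)
      (Eventually.of_forall fun ω => by fun_prop)
    rw [Complex.norm_exp_ofReal_mul_I]
  set τ := ‖v‖ with hτ
  set e : ℝ → ℂ := fun z => Complex.exp ((τ * z : ℝ) * Complex.I) with he
  have hec : Continuous e := by fun_prop
  -- both sides are the integral of the character over the ball of radius `R`
  have key : ∀ R : ℝ, 0 < R → ∫ ρ in (0 : ℝ)..R, ((ρ ^ 2 : ℝ) : ℂ) * S ρ =
      ((π * R ^ 2 : ℝ) : ℂ) * (∫ z in (-R)..R, e z) -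
        ∫ z in (-R)..R, ((π * z ^ 2 : ℝ) : ℂ) * e z := by
    intro R hR
    -- a reflection moves `v` to the first axis
    let w : R3 := EuclideanSpace.single 0 τ
    have hw : ‖v‖ = ‖w‖ := by simp [w, hτ]
    let U := Submodule.reflection (ℝ ∙ (v - w))ᗮ
    have hU : U v = w := Submodule.reflection_sub hw
    have hb : ∫ x : R3 in Metric.ball 0 R, Complex.exp ((inner ℝ v x : ℝ) * Complex.I) =
        ∫ x : R3 in Metric.ball 0 R, Complex.exp ((τ * x 0 : ℝ) * Complex.I) := by
      have := U.measurePreserving.setIntegral_preimage_emb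
        U.toHomeomorph.measurableEmbedding
        (fun x : R3 => Complex.exp ((τ * x 0 : ℝ) * Complex.I)) (Metric.ball 0 R)
      rw [← this]
      have hpre : U ⁻¹' Metric.ball 0 R = Metric.ball 0 R := by
        ext x; simp
      rw [hpre]
      refine setIntegral_congr_fun Metric.isOpen_ball.measurableSet fun x _ => ?_
      have : inner ℝ v x = τ * (U x) 0 := by
        rw [← U.inner_map_map v x, hU]
        simp [w, EuclideanSpace.inner_single_left]
      simp only [this]
    have hpol := integral_polar (g := (Metric.ball (0 : R3) R).indicator fun x =>
      Complex.exp ((inner ℝ v x : ℝ) * Complex.I)) (by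
        rw [integrable_indicator_iff Metric.isOpen_ball.measurableSet]
        refine Measure.integrableOn_of_bounded (M := 1) measure_ball_lt_top.ne
          (Continuous.aestronglyMeasurable (by fun_prop)) (Eventually.of_forall fun x => ?_)
        rw [Complex.norm_exp_ofReal_mul_I])
    rw [integral_indicator Metric.isOpen_ball.measurableSet, hb, integral_ball_char τ R hR] at hpol
    have hL : ∫ ρ in Ioi (0 : ℝ), ((ρ ^ 2 : ℝ) : ℂ) *
        ∫ ω, (Metric.ball (0 : R3) R).indicator (fun x =>
          Complex.exp ((inner ℝ v x : ℝ) * Complex.I)) (ρ • (ω : R3))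
          ∂(volume : Measure R3).toSphere = ∫ ρ in (0 : ℝ)..R, ((ρ ^ 2 : ℝ) : ℂ) * S ρ := by
      rw [intervalIntegral.integral_of_le hR.le, integral_Ioc_eq_integral_Ioo,
        ← integral_indicator measurableSet_Ioi, ← integral_indicator measurableSet_Ioo]
      refine integral_congr_ae (Eventually.of_forall fun ρ => ?_)
      by_cases h0 : 0 < ρ
      · have hmem : ∀ ω : Metric.sphere (0 : R3) 1, ρ • (ω : R3) ∈ Metric.ball (0 : R3) R ↔
            ρ < R := by
          intro ω
          simp [norm_smul, abs_of_pos h0]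
        by_cases h1 : ρ < R
        · simp [indicator, h0, h1, hmem, hSdef, -Metric.mem_ball]
        · simp [indicator, h0, h1, hmem, -Metric.mem_ball]
      · simp [indicator, h0]
    rw [hL] at hpol
    rw [← hpol, ← intervalIntegral.integral_const_mul, ← intervalIntegral.integral_sub]
    · refine intervalIntegral.integral_congr fun z _ => ?_
      simp only [he]; push_cast; ring
    · exact (Continuous.intervalIntegrable (by fun_prop) _ _)
    · exact (Continuous.intervalIntegrable (by fun_prop) _ _)
  have hsym : ∀ h : ℝ → ℂ, Continuous h → ∀ R : ℝ,
      HasDerivAt (fun R => ∫ z in (-R)..R, h z) (h R + h (-R)) R := by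
    intro h hh R
    have h1 : ∀ R, HasDerivAt (fun R => ∫ z in (0 : ℝ)..R, h z) (h R) R := fun R =>
      intervalIntegral.integral_hasDerivAt_right (hh.intervalIntegrable _ _)
        hh.aestronglyMeasurable.stronglyMeasurableAtFilter hh.continuousAt
    have h2 : HasDerivAt (fun R => ∫ z in (0 : ℝ)..(-R), h z) (-h (-R)) R := by
      have := (h1 (-R)).scomp R (hasDerivAt_neg R)
      simpa [Function.comp_def] using this
    have h3 := (h1 R).sub h2
    rw [sub_neg_eq_add] at h3
    refine h3.congr_of_eventuallyEq (Eventually.of_forall fun R => ?_)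
    simp only [Pi.sub_apply]
    rw [intervalIntegral.integral_interval_sub_left (hh.intervalIntegrable _ _)
      (hh.intervalIntegrable _ _)]
  -- both sides are differentiated at `R = 1`
  have hd1 : HasDerivAt (fun R : ℝ => ∫ ρ in (0 : ℝ)..R, ((ρ ^ 2 : ℝ) : ℂ) * S ρ)
      (((1 ^ 2 : ℝ) : ℂ) * S 1) 1 := by
    have hc : Continuous fun ρ : ℝ => ((ρ ^ 2 : ℝ) : ℂ) * S ρ := by fun_prop
    exact intervalIntegral.integral_hasDerivAt_right (hc.intervalIntegrable _ _)
        hc.aestronglyMeasurable.stronglyMeasurableAtFilter hc.continuousAt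
  have hp : HasDerivAt (fun R : ℝ => ((π * R ^ 2 : ℝ) : ℂ)) ((π * (2 * 1) : ℝ) : ℂ) 1 := by
    refine HasDerivAt.ofReal_comp ?_
    simpa using (hasDerivAt_pow 2 (1 : ℝ)).const_mul π
  have hd2 := (hp.mul (hsym e hec 1)).sub
    (hsym (fun z => ((π * z ^ 2 : ℝ) : ℂ) * e z) (by fun_prop) 1)
  have hEq : S 1 = ((2 * π : ℝ) : ℂ) * ∫ z in (-1 : ℝ)..1, e z := by
    have := hd1.unique (hd2.congr_of_eventuallyEq
      ((eventually_gt_nhds one_pos).mono fun R hR => key R hR))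
    simp only [one_pow, Complex.ofReal_one, one_mul] at this
    rw [this]; push_cast; ring
  have hS1 : S 1 = ∫ ω, Complex.exp ((inner ℝ v (ω : R3) : ℝ) * Complex.I)
    ∂(volume : Measure R3).toSphere := by simp [hSdef]
  rw [← hS1, hEq]
  rcases eq_or_ne τ 0 with h0 | h0
  · simp [he, h0]; norm_num; ring
  · have h1 : ∫ z in (-1 : ℝ)..1, e z = (τ⁻¹ : ℝ) • ∫ z in (-τ)..τ, Complex.exp (z * Complex.I) :=
      by
      have := intervalIntegral.integral_comp_mul_left (a := -1) (b := 1)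
        (fun z : ℝ => Complex.exp ((z : ℂ) * Complex.I)) h0
      simpa [he] using this
    rw [h1, integral_exp_mul_I_eq_sinc, Complex.real_smul]
    have h2 : (τ : ℂ) ≠ 0 := by exact_mod_cast h0
    push_cast
    field_simp
    norm_num
    ring

theorem abs_sinc_sub_one_le_sq (x : ℝ) : |sinc x - 1| ≤ x ^ 2 := by
  wlog hx : 0 < x generalizing x
  · rcases eq_or_lt_of_le (not_lt.1 hx) with rfl | h
    · simp
    · simpa using this (-x) (by linarith)
  have h1 := sinc_le_one x
  rw [abs_of_nonpos (by linarith)]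
  rcases le_or_gt x 1 with h | h
  · have h2 := Real.sin_gt_sub_cube hx
    rw [sinc_of_ne_zero hx.ne', neg_sub, sub_le_iff_le_add, ← sub_le_iff_le_add', le_div_iff₀ hx]
    nlinarith [pow_pos hx 3]
  · rcases le_or_gt x π with h' | h'
    · have h2 : 0 ≤ sinc x := by
        rw [sinc_of_ne_zero hx.ne']
        exact div_nonneg (Real.sin_nonneg_of_nonneg_of_le_pi hx.le h') hx.le
      nlinarith
    · have := neg_one_le_sinc x
      nlinarith [Real.pi_gt_three]

theorem abs_sinc_sub_one_le (x : ℝ) : |sinc x - 1| ≤ 2 * |x| := by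
  rcases le_or_gt |x| 1 with h | h
  · refine (abs_sinc_sub_one_le_sq x).trans ?_
    rw [← sq_abs]; nlinarith [abs_nonneg x]
  · have h1 := sinc_le_one x
    have h2 := neg_one_le_sinc x
    rw [abs_le]; constructor <;> linarith

end Sphere

/-! ### Schur tests for the off-diagonal momentum kernels -/

section Schur

open Set

/-- The radial integral behind all Schur tests. -/
theorem integrable_rpow_mul_inv (a : ℝ) (h1 : 1 < a) (h3 : a < 3) :
    Integrable fun x : R3 => ‖x‖ ^ (-a) * (1 + ‖x‖ ^ 2)⁻¹ := by
  have := (integrable_fun_norm_addHaar (volume : Measure R3)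
    (f := fun y : ℝ => y ^ (-a) * (1 + y ^ 2)⁻¹)).2
  refine this ?_
  have hfr : Module.finrank ℝ R3 = 3 := by simp
  rw [hfr, ← Ioc_union_Ioi_eq_Ioi zero_le_one]
  have hm : AEStronglyMeasurable (fun y : ℝ => y ^ (3 - 1) • (y ^ (-a) * (1 + y ^ 2)⁻¹)) volume :=
    (by fun_prop : Measurable _).aestronglyMeasurable
  refine IntegrableOn.union ?_ ?_
  · have hI : IntegrableOn (fun y : ℝ => y ^ (2 - a)) (Ioc 0 1) := by
      rw [← intervalIntegrable_iff_integrableOn_Ioc_of_le zero_le_one]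
      exact intervalIntegral.intervalIntegrable_rpow' (by linarith)
    refine hI.mono' hm.restrict ?_
    filter_upwards [ae_restrict_mem measurableSet_Ioc] with y hy
    have hy0 : 0 < y := hy.1
    have e : y ^ (2 - a) = y ^ 2 * y ^ (-a) := by
      rw [sub_eq_add_neg, Real.rpow_add hy0]; norm_num
    rw [e, smul_eq_mul, Real.norm_of_nonneg (by positivity), ← mul_assoc]
    refine mul_le_of_le_one_right (by positivity) (inv_le_one_of_one_le₀ ?_)
    nlinarith [sq_nonneg y]
  · refine (integrableOn_Ioi_rpow_of_lt (a := -a) (by linarith) one_pos).mono' hm.restrict ?_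
    filter_upwards [ae_restrict_mem measurableSet_Ioi] with y hy
    have hy0 : 0 < y := one_pos.trans hy
    rw [smul_eq_mul, Real.norm_of_nonneg (by positivity)]
    have h : y ^ (3 - 1) * (1 + y ^ 2)⁻¹ ≤ 1 := by
      rw [← div_eq_mul_inv, div_le_one (by positivity)]; norm_num
    calc y ^ (3 - 1) * (y ^ (-a) * (1 + y ^ 2)⁻¹)
        = y ^ (-a) * (y ^ (3 - 1) * (1 + y ^ 2)⁻¹) := by ring
      _ ≤ y ^ (-a) := mul_le_of_le_one_right (by positivity) h

/-- The value of the integral in `integrable_rpow_mul_inv`. -/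
def schurConst (a : ℝ) : ℝ := ∫ x : R3, ‖x‖ ^ (-a) * (1 + ‖x‖ ^ 2)⁻¹

/-- By scaling, the radial integral depends on `c` only through the factor `c ^ (1 - a)`, which a
Schur weight can compensate. -/
theorem lintegral_rpow_mul_inv (a : ℝ) (h1 : 1 < a) (h3 : a < 3) {c : ℝ} (hc : 0 < c) :
    ∫⁻ x : R3, ENNReal.ofReal (‖x‖ ^ (-a) * (c ^ 2 + ‖x‖ ^ 2)⁻¹) =
      ENNReal.ofReal (schurConst a * c ^ (1 - a)) := by
  have key : ∀ x : R3, ‖x‖ ^ (-a) * (c ^ 2 + ‖x‖ ^ 2)⁻¹ =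
      c ^ (-a - 2) * (‖c⁻¹ • x‖ ^ (-a) * (1 + ‖c⁻¹ • x‖ ^ 2)⁻¹) := by
    intro x
    rw [norm_smul, Real.norm_of_nonneg (by positivity),
      Real.mul_rpow (by positivity) (norm_nonneg _), Real.inv_rpow hc.le, Real.rpow_neg hc.le a,
      Real.rpow_sub hc, Real.rpow_neg hc.le]
    have : c ^ a ≠ 0 := (Real.rpow_pos_of_pos hc a).ne'
    norm_num
    field_simp
  have hint : Integrable fun x : R3 => ‖x‖ ^ (-a) * (c ^ 2 + ‖x‖ ^ 2)⁻¹ := by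
    simp only [key]
    refine Integrable.const_mul ?_ _
    exact (integrable_comp_smul_iff volume (fun x : R3 => ‖x‖ ^ (-a) * (1 + ‖x‖ ^ 2)⁻¹)
      (inv_ne_zero hc.ne')).2 (integrable_rpow_mul_inv a h1 h3)
  rw [← ofReal_integral_eq_lintegral_ofReal hint (Eventually.of_forall fun x => by positivity)]
  congr 1
  simp only [key]
  rw [integral_const_mul, Measure.integral_comp_smul volume
    (fun x : R3 => ‖x‖ ^ (-a) * (1 + ‖x‖ ^ 2)⁻¹)]
  simp only [finrank_euclideanSpace, Fintype.card_fin, inv_pow, inv_inv, smul_eq_mul, schurConst]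
  rw [abs_of_pos (by positivity), ← Real.rpow_natCast c 3, ← mul_assoc, ← Real.rpow_add hc]
  rw [mul_comm]
  congr 2
  push_cast; ring

variable {X Y Z : Type*} [MeasurableSpace X] [MeasurableSpace Y] [MeasurableSpace Z]

/-- The Schur test for a kernel on a space `Z` that is fibred in two ways over `X`. -/
theorem schur_test {μX : Measure X} {μY : Measure Y} {μZ : Measure Z} [SFinite μX] [SFinite μY]
    {e₁ e₂ : X × Y ≃ᵐ Z} (he₁ : MeasurePreserving e₁ (μX.prod μY) μZ)
    (he₂ : MeasurePreserving e₂ (μX.prod μY) μZ)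
    {K K₁ K₂ : Z → ℝ≥0∞} (hK₁ : Measurable K₁) (hK₂ : Measurable K₂)
    (hK : ∀ᵐ ζ ∂μZ, K ζ ^ 2 ≤ K₁ ζ * K₂ ζ) {C : ℝ≥0∞}
    (hC₁ : ∀ᵐ x ∂μX, ∫⁻ y, K₁ (e₁ (x, y)) ∂μY ≤ C) (hC₂ : ∀ᵐ x ∂μX, ∫⁻ y, K₂ (e₂ (x, y)) ∂μY ≤ C)
    {F H : X → ℝ≥0∞} (hF : Measurable F) (hH : Measurable H) :
    ∫⁻ ζ, F (e₁.symm ζ).1 * H (e₂.symm ζ).1 * K ζ ∂μZ ≤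
      C * ((∫⁻ x, F x ^ 2 ∂μX) ^ (1 / 2 : ℝ) * (∫⁻ x, H x ^ 2 ∂μX) ^ (1 / 2 : ℝ)) := by
  -- each factor of the Cauchy–Schwarz inequality is integrated along its own fibration
  have half : ∀ (e : X × Y ≃ᵐ Z), MeasurePreserving e (μX.prod μY) μZ → ∀ k : Z → ℝ≥0∞,
      Measurable k → (∀ᵐ x ∂μX, ∫⁻ y, k (e (x, y)) ∂μY ≤ C) → ∀ f : X → ℝ≥0∞, Measurable f →
      ∫⁻ ζ, (f (e.symm ζ).1) ^ 2 * k ζ ∂μZ ≤ C * ∫⁻ x, f x ^ 2 ∂μX := by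
    intro e he k hk hC f hf
    rw [← he.lintegral_comp_emb e.measurableEmbedding]
    simp only [MeasurableEquiv.symm_apply_apply]
    rw [lintegral_prod _ (by fun_prop)]
    calc ∫⁻ x, ∫⁻ y, f x ^ 2 * k (e (x, y)) ∂μY ∂μX
        = ∫⁻ x, f x ^ 2 * ∫⁻ y, k (e (x, y)) ∂μY ∂μX := by
          refine lintegral_congr fun x => ?_
          rw [lintegral_const_mul _ (by fun_prop)]
      _ ≤ ∫⁻ x, C * f x ^ 2 ∂μX := by
          refine lintegral_mono_ae ?_
          filter_upwards [hC] with x hx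
          rw [mul_comm]; gcongr
      _ = C * ∫⁻ x, f x ^ 2 ∂μX := lintegral_const_mul _ (by fun_prop)
  have h2 : ∀ x : ℝ≥0∞, x ^ 2 = x ^ (2 : ℝ) := fun x => by norm_cast
  have hs : ∀ x : ℝ≥0∞, (x ^ (1 / 2 : ℝ)) ^ 2 = x := fun x => by
    rw [h2, ← ENNReal.rpow_mul]; norm_num
  have hs' : ∀ x : ℝ≥0∞, (x ^ 2) ^ (1 / 2 : ℝ) = x := fun x => by
    rw [h2, ← ENNReal.rpow_mul]; norm_num
  calc ∫⁻ ζ, F (e₁.symm ζ).1 * H (e₂.symm ζ).1 * K ζ ∂μZ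
      ≤ ∫⁻ ζ, (F (e₁.symm ζ).1 * K₁ ζ ^ (1 / 2 : ℝ)) * (H (e₂.symm ζ).1 * K₂ ζ ^ (1 / 2 : ℝ))
          ∂μZ := by
        refine lintegral_mono_ae ?_
        filter_upwards [hK] with ζ hζ
        have : K ζ ≤ K₁ ζ ^ (1 / 2 : ℝ) * K₂ ζ ^ (1 / 2 : ℝ) := by
          rw [← ENNReal.mul_rpow_of_nonneg _ _ (by norm_num), ← hs' (K ζ)]
          exact ENNReal.rpow_le_rpow hζ (by norm_num)
        calc _ ≤ F (e₁.symm ζ).1 * H (e₂.symm ζ).1 * (K₁ ζ ^ (1 / 2 : ℝ) * K₂ ζ ^ (1 / 2 : ℝ)) := by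
              gcongr
          _ = _ := by ring
    _ ≤ (∫⁻ ζ, (F (e₁.symm ζ).1 * K₁ ζ ^ (1 / 2 : ℝ)) ^ (2 : ℝ) ∂μZ) ^ (1 / 2 : ℝ) *
        (∫⁻ ζ, (H (e₂.symm ζ).1 * K₂ ζ ^ (1 / 2 : ℝ)) ^ (2 : ℝ) ∂μZ) ^ (1 / 2 : ℝ) :=
      ENNReal.lintegral_mul_le_Lp_mul_Lq μZ Real.HolderConjugate.two_two (by fun_prop) (by fun_prop)
    _ ≤ (C * ∫⁻ x, F x ^ 2 ∂μX) ^ (1 / 2 : ℝ) * (C * ∫⁻ x, H x ^ 2 ∂μX) ^ (1 / 2 : ℝ) := by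
      gcongr
      · simp only [← h2, mul_pow, hs]
        exact half e₁ he₁ K₁ hK₁ hC₁ F hF
      · simp only [← h2, mul_pow, hs]
        exact half e₂ he₂ K₂ hK₂ hC₂ H hH
    _ = C * ((∫⁻ x, F x ^ 2 ∂μX) ^ (1 / 2 : ℝ) * (∫⁻ x, H x ^ 2 ∂μX) ^ (1 / 2 : ℝ)) := by
      rw [ENNReal.mul_rpow_of_nonneg _ _ (by norm_num), ENNReal.mul_rpow_of_nonneg _ _ (by
        norm_num)]
      calc _ = (C ^ (1 / 2 : ℝ) * C ^ (1 / 2 : ℝ)) * ((∫⁻ x, F x ^ 2 ∂μX) ^ (1 / 2 : ℝ) *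
            (∫⁻ x, H x ^ 2 ∂μX) ^ (1 / 2 : ℝ)) := by ring
        _ = _ := by rw [← sq, hs]

/-- Schur test with the weights `|q|^{3/2}`, for a kernel bounded by `|q|⁻¹ (q² + q'²)⁻¹`, where
`q` is constant along the first fibration and `q'` along the second one. -/
theorem schur_test_left {μX : Measure X} {μZ : Measure Z} [SFinite μX]
    {e₁ e₂ : X × R3 ≃ᵐ Z} (he₁ : MeasurePreserving e₁ (μX.prod volume) μZ)
    (he₂ : MeasurePreserving e₂ (μX.prod volume) μZ)
    {q q' : Z → R3} (hq : Measurable q) (hq' : Measurable q')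
    (hne : ∀ᵐ ζ ∂μZ, q ζ ≠ 0 ∧ q' ζ ≠ 0)
    {a a' : X → R3} (ha : ∀ᵐ x ∂μX, a x ≠ 0) (ha' : ∀ᵐ x ∂μX, a' x ≠ 0)
    (h₁ : ∀ x y, q (e₁ (x, y)) = a x) (h₁' : ∀ x, MeasurePreserving fun y => q' (e₁ (x, y)))
    (h₂ : ∀ x y, q' (e₂ (x, y)) = a' x) (h₂' : ∀ x, MeasurePreserving fun y => q (e₂ (x, y)))
    {F H : X → ℝ≥0∞} (hF : Measurable F) (hH : Measurable H) :
    ∫⁻ ζ, F (e₁.symm ζ).1 * H (e₂.symm ζ).1 *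
        ENNReal.ofReal (‖q ζ‖⁻¹ * (‖q ζ‖ ^ 2 + ‖q' ζ‖ ^ 2)⁻¹) ∂μZ ≤
      ENNReal.ofReal (max (schurConst (3 / 2)) (schurConst (5 / 2))) *
        ((∫⁻ x, F x ^ 2 ∂μX) ^ (1 / 2 : ℝ) * (∫⁻ x, H x ^ 2 ∂μX) ^ (1 / 2 : ℝ)) := by
  refine schur_test he₁ he₂
    (K₁ := fun ζ => ENNReal.ofReal (‖q ζ‖ ^ (1 / 2 : ℝ) *
      (‖q' ζ‖ ^ (-(3 / 2) : ℝ) * (‖q ζ‖ ^ 2 + ‖q' ζ‖ ^ 2)⁻¹)))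
    (K₂ := fun ζ => ENNReal.ofReal (‖q' ζ‖ ^ (3 / 2 : ℝ) *
      (‖q ζ‖ ^ (-(5 / 2) : ℝ) * (‖q' ζ‖ ^ 2 + ‖q ζ‖ ^ 2)⁻¹)))
    (by fun_prop) (by fun_prop) ?_ ?_ ?_ hF hH
  · filter_upwards [hne] with ζ hζ
    have h1 : 0 < ‖q ζ‖ := norm_pos_iff.2 hζ.1
    have h2 : 0 < ‖q' ζ‖ := norm_pos_iff.2 hζ.2
    rw [← ENNReal.ofReal_pow (by positivity), ← ENNReal.ofReal_mul (by positivity)]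
    refine ENNReal.ofReal_le_ofReal (le_of_eq ?_)
    have e1 : ‖q ζ‖ ^ (1 / 2 : ℝ) * ‖q ζ‖ ^ (-(5 / 2) : ℝ) = (‖q ζ‖⁻¹) ^ 2 := by
      rw [← Real.rpow_add h1, ← Real.rpow_natCast, Real.inv_rpow h1.le, ← Real.rpow_neg h1.le]
      norm_num
    have e2 : ‖q' ζ‖ ^ (-(3 / 2) : ℝ) * ‖q' ζ‖ ^ (3 / 2 : ℝ) = 1 := by
      rw [← Real.rpow_add h2]; norm_num
    rw [add_comm (‖q' ζ‖ ^ 2) (‖q ζ‖ ^ 2), mul_pow, ← e1]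
    linear_combination (-(‖q ζ‖ ^ (1 / 2 : ℝ) * ‖q ζ‖ ^ (-(5 / 2) : ℝ)) *
      ((‖q ζ‖ ^ 2 + ‖q' ζ‖ ^ 2)⁻¹) ^ 2) * e2
  · filter_upwards [ha] with x hx
    have h0 : 0 < ‖a x‖ := norm_pos_iff.2 hx
    simp only [h₁]
    simp_rw [ENNReal.ofReal_mul (Real.rpow_nonneg (norm_nonneg (a x)) _)]
    rw [lintegral_const_mul' _ _ ENNReal.ofReal_ne_top,
      (h₁' x).lintegral_comp (f := fun y => ENNReal.ofReal
        (‖y‖ ^ (-(3 / 2) : ℝ) * (‖a x‖ ^ 2 + ‖y‖ ^ 2)⁻¹)) (by fun_prop),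
      lintegral_rpow_mul_inv _ (by norm_num) (by norm_num) h0, ← ENNReal.ofReal_mul (by positivity)]
    refine ENNReal.ofReal_le_ofReal (le_trans (le_of_eq ?_) (le_max_left _ _))
    rw [mul_left_comm, ← Real.rpow_add h0]; norm_num
  · filter_upwards [ha'] with x hx
    have h0 : 0 < ‖a' x‖ := norm_pos_iff.2 hx
    simp only [h₂]
    simp_rw [ENNReal.ofReal_mul (Real.rpow_nonneg (norm_nonneg (a' x)) _)]
    rw [lintegral_const_mul' _ _ ENNReal.ofReal_ne_top,
      (h₂' x).lintegral_comp (f := fun y => ENNReal.ofReal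
        (‖y‖ ^ (-(5 / 2) : ℝ) * (‖a' x‖ ^ 2 + ‖y‖ ^ 2)⁻¹)) (by fun_prop),
      lintegral_rpow_mul_inv _ (by norm_num) (by norm_num) h0, ← ENNReal.ofReal_mul (by positivity)]
    refine ENNReal.ofReal_le_ofReal (le_trans (le_of_eq ?_) (le_max_right _ _))
    rw [mul_left_comm, ← Real.rpow_add h0]; norm_num

/-- Schur test for a kernel bounded by `|ξ|⁻¹ (q² + q'² + ξ²)⁻¹`, where `q` is constant along the
first fibration and `q'` along the second one, while `ξ` varies along both. -/
theorem schur_test_cross {μX : Measure X} {μZ : Measure Z} [SFinite μX]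
    {e₁ e₂ : X × R3 ≃ᵐ Z} (he₁ : MeasurePreserving e₁ (μX.prod volume) μZ)
    (he₂ : MeasurePreserving e₂ (μX.prod volume) μZ)
    {q q' ξ : Z → R3} (hq : Measurable q) (hq' : Measurable q') (hξ : Measurable ξ)
    (hne : ∀ᵐ ζ ∂μZ, q ζ ≠ 0 ∧ q' ζ ≠ 0)
    {a a' : X → R3} (ha : ∀ᵐ x ∂μX, a x ≠ 0) (ha' : ∀ᵐ x ∂μX, a' x ≠ 0)
    (h₁ : ∀ x y, q (e₁ (x, y)) = a x) (h₁' : ∀ x, MeasurePreserving fun y => q' (e₁ (x, y)))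
    (h₂ : ∀ x y, q' (e₂ (x, y)) = a' x) (h₂' : ∀ x, MeasurePreserving fun y => q (e₂ (x, y)))
    (h₁ξ : ∀ x, MeasurePreserving fun y => ξ (e₁ (x, y)))
    (h₂ξ : ∀ x, MeasurePreserving fun y => ξ (e₂ (x, y)))
    {F H : X → ℝ≥0∞} (hF : Measurable F) (hH : Measurable H) :
    ∫⁻ ζ, F (e₁.symm ζ).1 * H (e₂.symm ζ).1 *
        ENNReal.ofReal (‖ξ ζ‖⁻¹ * (‖q ζ‖ ^ 2 + ‖q' ζ‖ ^ 2 + ‖ξ ζ‖ ^ 2)⁻¹) ∂μZ ≤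
      ENNReal.ofReal (2 * schurConst (5 / 2)) *
        ((∫⁻ x, F x ^ 2 ∂μX) ^ (1 / 2 : ℝ) * (∫⁻ x, H x ^ 2 ∂μX) ^ (1 / 2 : ℝ)) := by
  -- the larger of the two factors is replaced by the smaller one, so that each term of the sum
  -- depends on one of the variables only
  have split : ∀ {s t : ℝ}, 0 ≤ s → 0 < t → s⁻¹ * t ^ (-(3 / 2) : ℝ) ≤
      s ^ (-(5 / 2) : ℝ) + t ^ (-(5 / 2) : ℝ) := by
    intro s t hs ht
    rcases hs.eq_or_lt with rfl | hs
    · simp only [inv_zero, zero_mul]; positivity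
    rw [← Real.rpow_neg_one]
    rcases le_total s t with h | h
    · calc s ^ (-1 : ℝ) * t ^ (-(3 / 2) : ℝ) ≤ s ^ (-1 : ℝ) * s ^ (-(3 / 2) : ℝ) := by
            gcongr ?_ * ?_
            exact Real.rpow_le_rpow_of_nonpos hs h (by norm_num)
        _ = s ^ (-(5 / 2) : ℝ) := by rw [← Real.rpow_add hs]; norm_num
        _ ≤ _ := le_add_of_nonneg_right (by positivity)
    · calc s ^ (-1 : ℝ) * t ^ (-(3 / 2) : ℝ) ≤ t ^ (-1 : ℝ) * t ^ (-(3 / 2) : ℝ) := by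
            gcongr ?_ * ?_
            exact Real.rpow_le_rpow_of_nonpos ht h (by norm_num)
        _ = t ^ (-(5 / 2) : ℝ) := by rw [← Real.rpow_add ht]; norm_num
        _ ≤ _ := le_add_of_nonneg_left (by positivity)
  -- one half of the Schur test: `b` is fixed, `u` and `v` vary
  have half : ∀ (b : R3) (u v : R3 → R3), b ≠ 0 → MeasurePreserving u → MeasurePreserving v →
      ∫⁻ y, ENNReal.ofReal (‖b‖ ^ (3 / 2 : ℝ) *
        (‖u y‖ ^ (-(5 / 2) : ℝ) * (‖b‖ ^ 2 + ‖u y‖ ^ 2)⁻¹ +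
          ‖v y‖ ^ (-(5 / 2) : ℝ) * (‖b‖ ^ 2 + ‖v y‖ ^ 2)⁻¹)) ≤
      ENNReal.ofReal (2 * schurConst (5 / 2)) := by
    intro b u v hb hu hv
    have h0 : 0 < ‖b‖ := norm_pos_iff.2 hb
    simp_rw [ENNReal.ofReal_mul (Real.rpow_nonneg (norm_nonneg b) _)]
    rw [lintegral_const_mul' _ _ ENNReal.ofReal_ne_top]
    have hs : ∀ w : R3 → R3, MeasurePreserving w → ∫⁻ y, ENNReal.ofReal
        (‖w y‖ ^ (-(5 / 2) : ℝ) * (‖b‖ ^ 2 + ‖w y‖ ^ 2)⁻¹) =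
        ENNReal.ofReal (schurConst (5 / 2) * ‖b‖ ^ (1 - 5 / 2 : ℝ)) := by
      intro w hw
      rw [hw.lintegral_comp (f := fun y => ENNReal.ofReal
        (‖y‖ ^ (-(5 / 2) : ℝ) * (‖b‖ ^ 2 + ‖y‖ ^ 2)⁻¹)) (by fun_prop),
        lintegral_rpow_mul_inv _ (by norm_num) (by norm_num) h0]
    have hum := hu.measurable
    have hvm := hv.measurable
    have hJ : 0 ≤ schurConst (5 / 2) := integral_nonneg fun x => by positivity
    have : ∀ y, ENNReal.ofReal (‖u y‖ ^ (-(5 / 2) : ℝ) * (‖b‖ ^ 2 + ‖u y‖ ^ 2)⁻¹ +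
          ‖v y‖ ^ (-(5 / 2) : ℝ) * (‖b‖ ^ 2 + ‖v y‖ ^ 2)⁻¹) = 
        ENNReal.ofReal (‖u y‖ ^ (-(5 / 2) : ℝ) * (‖b‖ ^ 2 + ‖u y‖ ^ 2)⁻¹) +
          ENNReal.ofReal (‖v y‖ ^ (-(5 / 2) : ℝ) * (‖b‖ ^ 2 + ‖v y‖ ^ 2)⁻¹) := fun y =>
      ENNReal.ofReal_add (by positivity) (by positivity)
    simp_rw [this]
    rw [lintegral_add_left (by fun_prop), hs u hu, hs v hv,
      ← ENNReal.ofReal_add (by positivity) (by positivity), ← ENNReal.ofReal_mul (by positivity)]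
    refine ENNReal.ofReal_le_ofReal (le_of_eq ?_)
    have : ‖b‖ ^ (3 / 2 : ℝ) * ‖b‖ ^ (1 - 5 / 2 : ℝ) = 1 := by
      rw [← Real.rpow_add h0]; norm_num
    linear_combination (2 * schurConst (5 / 2)) * this
  have hJ : 0 ≤ schurConst (5 / 2) := integral_nonneg fun x => by positivity
  refine schur_test he₁ he₂
    (K₁ := fun ζ => ENNReal.ofReal (‖q ζ‖ ^ (3 / 2 : ℝ) *
      (‖ξ ζ‖ ^ (-(5 / 2) : ℝ) * (‖q ζ‖ ^ 2 + ‖ξ ζ‖ ^ 2)⁻¹ +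
        ‖q' ζ‖ ^ (-(5 / 2) : ℝ) * (‖q ζ‖ ^ 2 + ‖q' ζ‖ ^ 2)⁻¹)))
    (K₂ := fun ζ => ENNReal.ofReal (‖q' ζ‖ ^ (3 / 2 : ℝ) *
      (‖ξ ζ‖ ^ (-(5 / 2) : ℝ) * (‖q' ζ‖ ^ 2 + ‖ξ ζ‖ ^ 2)⁻¹ +
        ‖q ζ‖ ^ (-(5 / 2) : ℝ) * (‖q' ζ‖ ^ 2 + ‖q ζ‖ ^ 2)⁻¹)))
    (by fun_prop) (by fun_prop) ?_ ?_ ?_ hF hH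
  · filter_upwards [hne] with ζ hζ
    have h1 : 0 < ‖q ζ‖ := norm_pos_iff.2 hζ.1
    have h2 : 0 < ‖q' ζ‖ := norm_pos_iff.2 hζ.2
    have h3 : 0 ≤ ‖ξ ζ‖ := norm_nonneg _
    set x := ‖q ζ‖
    set y := ‖q' ζ‖
    set w := ‖ξ ζ‖
    rw [← ENNReal.ofReal_pow (by positivity), ← ENNReal.ofReal_mul (by positivity)]
    refine ENNReal.ofReal_le_ofReal ?_
    have hA : w⁻¹ * y ^ (-(3 / 2) : ℝ) * (x ^ 2 + y ^ 2 + w ^ 2)⁻¹ ≤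
        w ^ (-(5 / 2) : ℝ) * (x ^ 2 + w ^ 2)⁻¹ + y ^ (-(5 / 2) : ℝ) * (x ^ 2 + y ^ 2)⁻¹ := by
      calc _ ≤ (w ^ (-(5 / 2) : ℝ) + y ^ (-(5 / 2) : ℝ)) * (x ^ 2 + y ^ 2 + w ^ 2)⁻¹ := by
            gcongr; exact split h3 h2
        _ = w ^ (-(5 / 2) : ℝ) * (x ^ 2 + y ^ 2 + w ^ 2)⁻¹ +
            y ^ (-(5 / 2) : ℝ) * (x ^ 2 + y ^ 2 + w ^ 2)⁻¹ := by ring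
        _ ≤ _ := add_le_add
          (mul_le_mul_of_nonneg_left (inv_anti₀ (by positivity) (by nlinarith)) (by positivity))
          (mul_le_mul_of_nonneg_left (inv_anti₀ (by positivity) (by nlinarith)) (by positivity))
    have hB : w⁻¹ * x ^ (-(3 / 2) : ℝ) * (x ^ 2 + y ^ 2 + w ^ 2)⁻¹ ≤
        w ^ (-(5 / 2) : ℝ) * (y ^ 2 + w ^ 2)⁻¹ + x ^ (-(5 / 2) : ℝ) * (y ^ 2 + x ^ 2)⁻¹ := by
      calc _ ≤ (w ^ (-(5 / 2) : ℝ) + x ^ (-(5 / 2) : ℝ)) * (x ^ 2 + y ^ 2 + w ^ 2)⁻¹ := by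
            gcongr; exact split h3 h1
        _ = w ^ (-(5 / 2) : ℝ) * (x ^ 2 + y ^ 2 + w ^ 2)⁻¹ +
            x ^ (-(5 / 2) : ℝ) * (x ^ 2 + y ^ 2 + w ^ 2)⁻¹ := by ring
        _ ≤ _ := add_le_add
          (mul_le_mul_of_nonneg_left (inv_anti₀ (by positivity) (by nlinarith)) (by positivity))
          (mul_le_mul_of_nonneg_left (inv_anti₀ (by positivity) (by nlinarith)) (by positivity))
    have e1 : x ^ (3 / 2 : ℝ) * x ^ (-(3 / 2) : ℝ) = 1 := by
      rw [← Real.rpow_add h1]; norm_num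
    have e2 : y ^ (3 / 2 : ℝ) * y ^ (-(3 / 2) : ℝ) = 1 := by
      rw [← Real.rpow_add h2]; norm_num
    calc (w⁻¹ * (x ^ 2 + y ^ 2 + w ^ 2)⁻¹) ^ 2
        = (x ^ (3 / 2 : ℝ) * (w⁻¹ * y ^ (-(3 / 2) : ℝ) * (x ^ 2 + y ^ 2 + w ^ 2)⁻¹)) *
          (y ^ (3 / 2 : ℝ) * (w⁻¹ * x ^ (-(3 / 2) : ℝ) * (x ^ 2 + y ^ 2 + w ^ 2)⁻¹)) := by
          linear_combination (-(w⁻¹ * (x ^ 2 + y ^ 2 + w ^ 2)⁻¹) ^ 2) * (e1 * y ^ (3 / 2 : ℝ) *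
            y ^ (-(3 / 2) : ℝ) + e2)
      _ ≤ _ := by gcongr
  · filter_upwards [ha] with x hx
    simp only [h₁]
    exact half _ _ _ hx (h₁ξ x) (h₁' x)
  · filter_upwards [ha'] with x hx
    simp only [h₂]
    exact half _ _ _ hx (h₂ξ x) (h₂' x)

end Schur

/-! ### The free energy and the off-diagonal momentum kernels -/

section Energy

variable {M n : ℕ}

/-- The free energy `L(P, K)` in the variables `ζ = (P, K) / 2π` of Mathlib's Fourier transform. -/
def en (m : ℝ) (ζ : Cfg M n) : ℝ := symL m ((2 * Real.pi) • ζ)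

@[fun_prop] theorem continuous_symL (m : ℝ) : Continuous (symL (M := M) (n := n) m) := by
  unfold symL; fun_prop

@[fun_prop] theorem continuous_en (m : ℝ) : Continuous (en (M := M) (n := n) m) := by
  unfold en; fun_prop

/-- The ellipticity constant of `L`. -/
def ell (m : ℝ) : ℝ := min (1 / (2 * m)) 1

theorem ell_pos {m : ℝ} (hm : 0 < m) : 0 < ell m := lt_min (by positivity) one_pos

theorem symL_ge {m : ℝ} (p : Cfg M n) : ell m * ‖p‖ ^ 2 + n ≤ symL m p := by
  rw [norm_sq_cfg, symL, mul_add]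
  have h1 : ell m * ∑ μ, ‖xs p μ‖ ^ 2 ≤ 1 / (2 * m) * ∑ μ, ‖xs p μ‖ ^ 2 := by
    gcongr; exact min_le_left _ _
  have h2 : ell m * ∑ i, ‖ys p i‖ ^ 2 ≤ 1 * ∑ i, ‖ys p i‖ ^ 2 := by
    gcongr; exact min_le_right _ _
  linarith

/-- Ellipticity of the free energy. The factor `(2π)²` is dropped. -/
theorem en_ge {m : ℝ} (hm : 0 < m) (ζ : Cfg M n) : ell m * ‖ζ‖ ^ 2 + n ≤ en m ζ := by
  refine le_trans ?_ (symL_ge _)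
  rw [norm_smul, mul_pow]
  have : (1 : ℝ) ≤ ‖2 * Real.pi‖ ^ 2 := by
    rw [Real.norm_of_nonneg (by positivity)]; nlinarith [Real.pi_gt_three]
  have h := ell_pos hm
  gcongr
  exact le_mul_of_one_le_left (by positivity) this

theorem en_pos {m : ℝ} (hm : 0 < m) (ζ : Cfg M (n + 1)) : 0 < en m ζ := by
  have h1 := en_ge hm ζ
  have h2 := mul_nonneg (ell_pos hm).le (sq_nonneg ‖ζ‖)
  push_cast at h1
  have : (0 : ℝ) ≤ n := by positivity
  linarith

@[simp] theorem symL_permL (m : ℝ) (τ : Equiv.Perm (Fin n)) (p : Cfg M n) :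
    symL m (permL τ p) = symL m p := by
  simp only [symL, xs_permL, ys_permL, Function.comp_apply]
  rw [Equiv.sum_comp τ (fun i => ‖ys p i‖ ^ 2)]

@[simp] theorem en_permL (m : ℝ) (τ : Equiv.Perm (Fin n)) (p : Cfg M n) :
    en m (permL τ p) = en m p := by
  rw [en, ← map_smul, symL_permL, en]

/-- The transposition of the `i`-th and the last y-particle. -/
abbrev swp (i : Fin (n + 1)) : Equiv.Perm (Fin (n + 1)) := Equiv.swap i (Fin.last n)

/-- Adding a y-particle at the position of the `ν`-th x-particle, listed as the `i`-th one, the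
former `i`-th one being listed last. -/
def insL (ν : Fin M) (i : Fin (n + 1)) : Cfg M n →L[ℝ] Cfg M (n + 1) :=
  (permL (swp i)).toContinuousLinearEquiv.toContinuousLinearMap.comp (diagL ν)

theorem insL_apply (ν : Fin M) (i : Fin (n + 1)) (w : Cfg M n) :
    insL ν i w = permL (swp i) (diagL ν w) := rfl

/-- The adjoint of `insL ν i`. -/
def totL (ν : Fin M) (i : Fin (n + 1)) : Cfg M (n + 1) →L[ℝ] Cfg M n :=
  (totalL ν).comp (permL (swp i)).toContinuousLinearEquiv.toContinuousLinearMap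

theorem totL_apply (ν : Fin M) (i : Fin (n + 1)) (ζ : Cfg M (n + 1)) :
    totL ν i ζ = totalL ν (permL (swp i) ζ) := rfl

@[simp] theorem totL_last (ν : Fin M) (ζ : Cfg M (n + 1)) :
    totL ν (Fin.last n) ζ = totalL ν ζ := by
  rw [totL_apply, swp, Equiv.swap_self, ← Equiv.Perm.one_def, permL_one]

theorem permL_swp_swp (i : Fin (n + 1)) (ζ : Cfg M (n + 1)) :
    permL (swp i) (permL (swp i) ζ) = ζ := by
  rw [permL_permL, Equiv.swap_mul_self, permL_one]

theorem inner_insL (ν : Fin M) (i : Fin (n + 1)) (z : Cfg M n) (ζ : Cfg M (n + 1)) :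
    inner ℝ (insL ν i z) ζ = inner ℝ z (totL ν i ζ) := by
  rw [insL_apply, inner_permL, inner_diagL, totL_apply, Equiv.swap_inv]

/-- The parametrisation of momentum space by the value of `totL ν i` and one further momentum. -/
def shearP (ν : Fin M) (i : Fin (n + 1)) : Cfg M n × R3 ≃ᵐ Cfg M (n + 1) :=
  (shear ν).trans (permL (swp i)).toHomeomorph.toMeasurableEquiv

theorem shearP_apply (ν : Fin M) (i : Fin (n + 1)) (q : Cfg M n × R3) :
    shearP ν i q = permL (swp i) (shear ν q) := rfl

theorem shearP_symm_fst (ν : Fin M) (i : Fin (n + 1)) (ζ : Cfg M (n + 1)) :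
    ((shearP ν i).symm ζ).1 = totL ν i ζ := by
  obtain ⟨q, rfl⟩ := (shearP ν i).surjective ζ
  rw [MeasurableEquiv.symm_apply_apply, totL_apply, shearP_apply, permL_swp_swp, totalL_shear]

theorem measurePreserving_permL (τ : Equiv.Perm (Fin n)) :
    MeasurePreserving (permL (M := M) τ) volume volume := (permL τ).measurePreserving

theorem measurePreserving_shearP (ν : Fin M) (i : Fin (n + 1)) :
    MeasurePreserving (shearP ν i) volume volume :=
  (measurePreserving_permL (swp i)).comp (measurePreserving_shear ν)

/-- The zero set of a nonzero linear map is a null set. -/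
theorem ae_ne_zero_of_linear {E F : Type*} [NormedAddCommGroup E] [NormedSpace ℝ E]
    [MeasurableSpace E] [BorelSpace E] [FiniteDimensional ℝ E] {μ : Measure E}
    [μ.IsAddHaarMeasure] [AddCommGroup F] [Module ℝ F] (l : E →ₗ[ℝ] F) (h : ∃ x, l x ≠ 0) :
    ∀ᵐ x ∂μ, l x ≠ 0 := by
  have := Measure.addHaar_submodule μ (LinearMap.ker l) (by
    intro h'
    obtain ⟨x, hx⟩ := h
    exact hx (LinearMap.mem_ker.1 (h' ▸ Submodule.mem_top)))
  rw [ae_iff]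
  convert this using 2
  ext x; simp

theorem ae_xs_ne_zero (μ : Fin M) : ∀ᵐ z : Cfg M n, xs z μ ≠ 0 :=
  ae_ne_zero_of_linear (l := { toFun := fun z : Cfg M n => xs z μ
                               map_add' := by simp
                               map_smul' := by simp })
    ⟨mk (fun _ => EuclideanSpace.single 0 1) 0, by simp⟩

theorem ae_ys_ne_zero (i : Fin n) : ∀ᵐ z : Cfg M n, ys z i ≠ 0 :=
  ae_ne_zero_of_linear (l := { toFun := fun z : Cfg M n => ys z i
                               map_add' := by simp
                               map_smul' := by simp })
    ⟨mk 0 (fun _ => EuclideanSpace.single 0 1), by simp⟩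

theorem two_sq_le_norm_sq {ζ : Cfg M n} {a b c : ℝ} (h : a ^ 2 + b ^ 2 + c ^ 2 ≤ ‖ζ‖ ^ 2) :
    a ^ 2 + b ^ 2 ≤ ‖ζ‖ ^ 2 := by nlinarith

theorem ys_pair_le {i j : Fin n} (hij : i ≠ j) (ζ : Cfg M n) :
    ‖ys ζ i‖ ^ 2 + ‖ys ζ j‖ ^ 2 ≤ ‖ζ‖ ^ 2 := by
  rw [norm_sq_cfg, ← Finset.sum_pair (f := fun i => ‖ys ζ i‖ ^ 2) hij]
  have h1 := Finset.sum_le_sum_of_subset_of_nonneg (Finset.subset_univ {i, j})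
    (f := fun i => ‖ys ζ i‖ ^ 2) (fun _ _ _ => by positivity)
  have h2 : 0 ≤ ∑ i, ‖xs ζ i‖ ^ 2 := by positivity
  linarith

theorem xs_pair_ys_le {i j : Fin M} (hij : i ≠ j) (k : Fin n) (ζ : Cfg M n) :
    ‖xs ζ i‖ ^ 2 + ‖xs ζ j‖ ^ 2 + ‖ys ζ k‖ ^ 2 ≤ ‖ζ‖ ^ 2 := by
  rw [norm_sq_cfg, ← Finset.sum_pair (f := fun i => ‖xs ζ i‖ ^ 2) hij]
  have h1 := Finset.sum_le_sum_of_subset_of_nonneg (Finset.subset_univ {i, j})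
    (f := fun i => ‖xs ζ i‖ ^ 2) (fun _ _ _ => by positivity)
  have h2 := Finset.single_le_sum (f := fun i => ‖ys ζ i‖ ^ 2) (fun _ _ => by positivity)
    (Finset.mem_univ k)
  linarith

/-- The weight of `H¹` in momentum space. -/
def wt (p : Cfg M n) : ℝ := √(1 + ‖p‖ ^ 2)

theorem wt_pos (p : Cfg M n) : 0 < wt p := Real.sqrt_pos.2 (by positivity)

@[fun_prop] theorem continuous_wt : Continuous (wt (M := M) (n := n)) := by
  unfold wt; fun_prop

theorem norm_le_wt (p : Cfg M n) : ‖p‖ ≤ wt p := Real.le_sqrt_of_sq_le (by linarith)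

/-- Pairs of particles whose interaction contributes to the off-diagonal part of `T`. -/
def OffDiag (μ ν : Fin M) (i : Fin (n + 1)) : Prop := i ≠ Fin.last n ∨ μ ≠ ν

/-- The off-diagonal kernel is bounded from `L²` to `H⁻¹`, and bounded on `L²` if it is damped by
a factor `|ξ|⁻¹`. -/
theorem offDiag_schur {m : ℝ} (hm : 0 < m) {μ ν : Fin M} {i : Fin (n + 1)} (h : OffDiag μ ν i) :
    ∃ C : ℝ≥0∞, C ≠ ∞ ∧ ∀ F H : Cfg M n → ℝ≥0∞, Measurable F → Measurable H →
      (∫⁻ ζ, F (totalL μ ζ) * H (totL ν i ζ) *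
          ENNReal.ofReal ((wt (totalL μ ζ))⁻¹ * (en m ζ)⁻¹) ≤
        C * ((∫⁻ x, F x ^ 2) ^ (1 / 2 : ℝ) * (∫⁻ x, H x ^ 2) ^ (1 / 2 : ℝ))) ∧
      (∫⁻ ζ, F (totalL μ ζ) * H (totL ν i ζ) *
          ENNReal.ofReal (‖ys ζ (Fin.last n)‖⁻¹ * (en m ζ)⁻¹) ≤
        C * ((∫⁻ x, F x ^ 2) ^ (1 / 2 : ℝ) * (∫⁻ x, H x ^ 2) ^ (1 / 2 : ℝ))) := by
  have hc := ell_pos hm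
  have hF1 : ∀ ζ : Cfg M (n + 1), totalL μ ζ = ((shear μ).symm ζ).1 := fun ζ => rfl
  have hH1 : ∀ ζ : Cfg M (n + 1), totL ν i ζ = ((shearP ν i).symm ζ).1 := fun ζ => (shearP_symm_fst
    ν i ζ).symm
  have e1 := measurePreserving_shear (n := n) μ
  have e2 := measurePreserving_shearP (n := n) ν i
  have hmono : ∀ (F H : Cfg M n → ℝ≥0∞) (k k' : Cfg M (n + 1) → ℝ),
      (∀ᵐ ζ : Cfg M (n + 1), k ζ ≤ (ell m)⁻¹ * k' ζ) →
      ∫⁻ ζ, F (totalL μ ζ) * H (totL ν i ζ) * ENNReal.ofReal (k ζ) ≤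
      ENNReal.ofReal (ell m)⁻¹ *
        ∫⁻ ζ, F (totalL μ ζ) * H (totL ν i ζ) * ENNReal.ofReal (k' ζ) := by
    intro F H k k' hk
    rw [← lintegral_const_mul' _ _ ENNReal.ofReal_ne_top]
    refine lintegral_mono_ae (hk.mono fun ζ hζ => ?_)
    calc _ ≤ F (totalL μ ζ) * H (totL ν i ζ) * ENNReal.ofReal ((ell m)⁻¹ * k' ζ) := by gcongr
      _ = _ := by rw [ENNReal.ofReal_mul (by positivity)]; ring
  -- the free energy may be replaced by a sum of squares of some of the momenta
  have hen : ∀ (ζ : Cfg M (n + 1)) (d : ℝ), 0 < d → d ≤ ‖ζ‖ ^ 2 → (en m ζ)⁻¹ ≤ (ell m)⁻¹ * d⁻¹ := by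
    intro ζ d hd hdζ
    rw [← mul_inv]
    refine inv_anti₀ (by positivity) (le_trans ?_ (en_ge hm ζ))
    have : (0 : ℝ) ≤ (n + 1 : ℕ) := by positivity
    nlinarith
  refine ⟨ENNReal.ofReal (ell m)⁻¹ * max (ENNReal.ofReal (max (schurConst (3 / 2))
    (schurConst (5 / 2)))) (ENNReal.ofReal (2 * schurConst (5 / 2))),
    ENNReal.mul_ne_top ENNReal.ofReal_ne_top (max_lt ENNReal.ofReal_lt_top
      ENNReal.ofReal_lt_top).ne, fun F H hF hH => ?_⟩
  by_cases hi : i = Fin.last n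
  · have hμν : μ ≠ ν := h.resolve_left (not_not.2 hi)
    subst hi
    have hP : ∀ q : Cfg M n × R3, shearP ν (Fin.last n) q = shear ν q := by
      intro q; rw [shearP_apply, swp, Equiv.swap_self, ← Equiv.Perm.one_def, permL_one]
    have hx1 : ∀ (a b : Fin M) (x : Cfg M n) (y : R3), a ≠ b →
        xs (shear a (x, y)) b = xs x b := by
      intro a b x y hab
      simp [shear_apply, subX, hab.symm]
    have hx2 : ∀ (a : Fin M) (x : Cfg M n) (y : R3), xs (shear a (x, y)) a = xs x a - y := by
      intro a x y
      simp [shear_apply, subX]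
    have hmp : ∀ v : R3, MeasurePreserving (fun y : R3 => v - y) :=
      fun v => Measure.measurePreserving_sub_left volume v
    have hne : ∀ᵐ ζ : Cfg M (n + 1), xs ζ ν ≠ 0 ∧ xs ζ μ ≠ 0 :=
      (ae_xs_ne_zero ν).and (ae_xs_ne_zero μ)
    constructor
    -- the weight is at least `|x_ν|`, which the shift of the `μ`-th momentum does not change
    · refine (hmono F H _ (fun ζ => ‖xs ζ ν‖⁻¹ * (‖xs ζ ν‖ ^ 2 + ‖xs ζ μ‖ ^ 2)⁻¹) ?_).trans ?_
      · filter_upwards [hne] with ζ hζ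
        have h1 : 0 < ‖xs ζ ν‖ := norm_pos_iff.2 hζ.1
        rw [mul_left_comm]
        have hw : (wt (totalL μ ζ))⁻¹ ≤ ‖xs ζ ν‖⁻¹ := by
          refine inv_anti₀ h1 (le_trans ?_ (norm_le_wt _))
          refine le_trans (le_of_eq ?_) (norm_xs_le _ ν)
          simp [totalL_apply, hμν.symm]
        exact mul_le_mul hw (hen ζ _ (by positivity)
          (two_sq_le_norm_sq (xs_pair_ys_le hμν.symm (Fin.last n) ζ))) (inv_nonneg.2 (en_pos hm
            ζ).le)
          (by positivity)
      · rw [mul_assoc]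
        gcongr
        simp only [hF1, hH1]
        refine (schur_test_left e1 e2 (q := fun ζ => xs ζ ν) (q' := fun ζ => xs ζ μ)
          (by fun_prop) (by fun_prop) hne (ae_xs_ne_zero ν) (ae_xs_ne_zero μ)
          (fun x y => hx1 _ _ x y hμν) (fun x => ?_) (fun x y => ?_) (fun x => ?_) hF hH).trans ?_
        · simp only [hx2]; exact hmp _
        · rw [hP]; exact hx1 _ _ x y hμν.symm
        · simp only [hP, hx2]; exact hmp _
        · gcongr; exact le_max_left _ _
    · refine (hmono F H _ (fun ζ => ‖ys ζ (Fin.last n)‖⁻¹ *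
        (‖xs ζ ν‖ ^ 2 + ‖xs ζ μ‖ ^ 2 + ‖ys ζ (Fin.last n)‖ ^ 2)⁻¹) ?_).trans ?_
      · filter_upwards [hne] with ζ hζ
        have h1 : 0 < ‖xs ζ ν‖ := norm_pos_iff.2 hζ.1
        rw [mul_left_comm]
        gcongr
        exact hen ζ _ (by positivity) (xs_pair_ys_le hμν.symm (Fin.last n) ζ)
      · rw [mul_assoc]
        gcongr
        simp only [hF1, hH1]
        refine (schur_test_cross e1 e2 (q := fun ζ => xs ζ ν) (q' := fun ζ => xs ζ μ)
          (ξ := fun ζ => ys ζ (Fin.last n))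
          (by fun_prop) (by fun_prop) (by fun_prop) hne (ae_xs_ne_zero ν) (ae_xs_ne_zero μ)
          (fun x y => hx1 _ _ x y hμν) (fun x => ?_) (fun x y => ?_) (fun x => ?_)
          (fun x => ?_) (fun x => ?_) hF hH).trans ?_
        · simp only [hx2]; exact hmp _
        · rw [hP]; exact hx1 _ _ x y hμν.symm
        · simp only [hP, hx2]; exact hmp _
        · simp only [last_shear]; exact MeasurePreserving.id _
        · simp only [hP, last_shear]; exact MeasurePreserving.id _
        · gcongr; exact le_max_right _ _
  · obtain ⟨j, rfl⟩ := Fin.exists_castSucc_eq.2 hi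
    have hne : ∀ᵐ ζ : Cfg M (n + 1), ys ζ j.castSucc ≠ 0 ∧ ys ζ (Fin.last n) ≠ 0 :=
      (ae_ys_ne_zero _).and (ae_ys_ne_zero _)
    have hy1 : ∀ (x : Cfg M n) (y : R3), ys (shear μ (x, y)) j.castSucc = ys x j := by
      intro x y; simp [shear_apply]
    have hy2 : ∀ (x : Cfg M n) (y : R3), ys (shearP ν j.castSucc (x, y)) j.castSucc = y := by
      intro x y; simp [shearP_apply]
    have hy3 : ∀ (x : Cfg M n) (y : R3), ys (shearP ν j.castSucc (x, y)) (Fin.last n) = ys x j := by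
      intro x y; simp [shearP_apply, shear_apply]
    constructor
    -- the weight is at least `|y_j|`, which is constant along the first fibration
    · refine (hmono F H _ (fun ζ => ‖ys ζ j.castSucc‖⁻¹ *
        (‖ys ζ j.castSucc‖ ^ 2 + ‖ys ζ (Fin.last n)‖ ^ 2)⁻¹) ?_).trans ?_
      · filter_upwards [hne] with ζ hζ
        have h1 : 0 < ‖ys ζ j.castSucc‖ := norm_pos_iff.2 hζ.1
        rw [mul_left_comm]
        have hw : (wt (totalL μ ζ))⁻¹ ≤ ‖ys ζ j.castSucc‖⁻¹ := by
          refine inv_anti₀ h1 (le_trans ?_ (norm_le_wt _))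
          refine le_trans (le_of_eq ?_) (norm_ys_le _ j)
          simp [totalL_apply]
        exact mul_le_mul hw (hen ζ _ (by positivity) (ys_pair_le hi ζ))
          (inv_nonneg.2 (en_pos hm ζ).le) (by positivity)
      · rw [mul_assoc]
        gcongr
        simp only [hF1, hH1]
        refine (schur_test_left e1 e2 (q := fun ζ => ys ζ j.castSucc)
          (q' := fun ζ => ys ζ (Fin.last n))
          (by fun_prop) (by fun_prop) hne (ae_ys_ne_zero j) (ae_ys_ne_zero j)
          hy1 (fun x => ?_) hy3 (fun x => ?_) hF hH).trans ?_
        · simp only [last_shear]; exact MeasurePreserving.id _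
        · simp only [hy2]; exact MeasurePreserving.id _
        · gcongr; exact le_max_left _ _
    · refine (hmono F H _ (fun ζ => ‖ys ζ (Fin.last n)‖⁻¹ *
        (‖ys ζ (Fin.last n)‖ ^ 2 + ‖ys ζ j.castSucc‖ ^ 2)⁻¹) ?_).trans ?_
      · filter_upwards [hne] with ζ hζ
        have h1 : 0 < ‖ys ζ j.castSucc‖ := norm_pos_iff.2 hζ.1
        rw [mul_left_comm]
        gcongr
        exact hen ζ _ (by positivity) (ys_pair_le (Ne.symm hi) ζ)
      · rw [mul_assoc]
        gcongr
        simp only [hF1, hH1]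
        simp only [mul_comm (F _) (H _)]
        refine (schur_test_left e2 e1 (q' := fun ζ => ys ζ j.castSucc)
          (q := fun ζ => ys ζ (Fin.last n))
          (by fun_prop) (by fun_prop) (hne.mono fun _ h => h.symm) (ae_ys_ne_zero j)
          (ae_ys_ne_zero j) hy3 (fun x => ?_) hy1 (fun x => ?_) hH hF).trans ?_
        · simp only [hy2]; exact MeasurePreserving.id _
        · simp only [last_shear]; exact MeasurePreserving.id _
        · rw [mul_comm ((∫⁻ x, H x ^ 2) ^ (1 / 2 : ℝ))]
          gcongr; exact le_max_left _ _

end Energy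

/-! ### Nonnegative kernels with bounded Fourier representation -/

section Kernel

variable {V W E : Type*}
  [NormedAddCommGroup V] [InnerProductSpace ℝ V] [FiniteDimensional ℝ V] [MeasurableSpace V]
  [BorelSpace V]
  [NormedAddCommGroup W] [InnerProductSpace ℝ W] [FiniteDimensional ℝ W] [MeasurableSpace W]
  [BorelSpace W]
  [NormedAddCommGroup E] [InnerProductSpace ℝ E] [FiniteDimensional ℝ E] [MeasurableSpace E]
  [BorelSpace E]
  {Θ : Type*} [MeasurableSpace Θ]

theorem lintegral_sq_rpow_half {α : Type*} [MeasurableSpace α] {μ : Measure α} (f : α → ℂ) :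
    (∫⁻ x, ‖f x‖ₑ ^ 2 ∂μ) ^ (1 / 2 : ℝ) = eLpNorm f 2 μ := by
  rw [eLpNorm_eq_lintegral_rpow_enorm_toReal (by norm_num) (by norm_num)]
  norm_num

/-- Squares of absolute values of Schwartz functions approximate every nonnegative `L²` function:
this follows from the density of Schwartz functions in `L⁴`. -/
theorem exists_schwartz_sq_tendsto {F : V → ℝ≥0∞} (hF : Measurable F) (hF2 : ∫⁻ x, F x ^ 2 ≠ ∞) :
    ∃ f : ℕ → 𝓢(V, ℂ), (∀ᵐ x, Tendsto (fun k => ‖f k x‖ₑ ^ 2) atTop (𝓝 (F x))) ∧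
      Tendsto (fun k => ∫⁻ x, (‖f k x‖ₑ ^ 2) ^ 2) atTop (𝓝 (∫⁻ x, F x ^ 2)) := by
  have : Fact ((1 : ℝ≥0∞) ≤ 4) := ⟨by norm_num⟩
  have hfin : ∀ᵐ x, F x < ∞ := by
    refine (ae_lt_top (hF.pow_const 2) hF2).mono fun x hx => ?_
    by_contra h
    simp only [not_lt, top_le_iff] at h
    simp [h] at hx
  -- Schwartz functions approximate the square root of `F` in `L⁴`
  let g : V → ℂ := fun x => ((√((F x).toReal) : ℝ) : ℂ)
  have hgm : Measurable g := by fun_prop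
  have hg2 : ∀ x, F x < ∞ → ‖g x‖ₑ ^ 2 = F x := by
    intro x hx
    simp only [g]
    rw [← ofReal_norm, ← ENNReal.ofReal_pow (norm_nonneg _), Complex.norm_real,
      Real.norm_of_nonneg (Real.sqrt_nonneg _), Real.sq_sqrt ENNReal.toReal_nonneg,
      ENNReal.ofReal_toReal hx.ne]
  have h4 : ∀ h : V → ℂ, ∫⁻ x, (‖h x‖ₑ ^ 2) ^ 2 = eLpNorm h 4 volume ^ 4 := by
    intro h
    rw [eLpNorm_eq_lintegral_rpow_enorm_toReal (by norm_num) (by norm_num)]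
    rw [← ENNReal.rpow_natCast, ← ENNReal.rpow_mul]
    norm_num
    simp only [← pow_mul]
  have hg4 : ∫⁻ x, (‖g x‖ₑ ^ 2) ^ 2 = ∫⁻ x, F x ^ 2 :=
    lintegral_congr_ae (hfin.mono fun x hx => by simp only [hg2 x hx])
  have hgL : MemLp g 4 volume := by
    refine ⟨hgm.aestronglyMeasurable, ?_⟩
    have : eLpNorm g 4 volume ^ 4 < ∞ := by
      rw [← h4, hg4]; exact hF2.lt_top
    by_contra hc
    simp only [not_lt, top_le_iff] at hc
    simp [hc] at this
  have hdense := (SchwartzMap.denseRange_toLpCLM (E := V) (F := ℂ) (p := 4)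
    (μ := (volume : Measure V)) (by norm_num))
  obtain ⟨u, hu, hlim⟩ := mem_closure_iff_seq_limit.1 (hdense (hgL.toLp g))
  choose f0 hf0 using hu
  have hlim' : Tendsto (fun k => (f0 k).toLp 4 volume) atTop (𝓝 (hgL.toLp g)) := by
    convert hlim using 2 with k
    exact hf0 k
  obtain ⟨ns, hns, hae⟩ := (tendstoInMeasure_of_tendsto_Lp hlim').exists_seq_tendsto_ae
  refine ⟨fun k => f0 (ns k), ?_, ?_⟩
  · have hco : ∀ᵐ x, ∀ k, (f0 (ns k)).toLp 4 volume x = f0 (ns k) x :=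
      ae_all_iff.2 fun k => SchwartzMap.coeFn_toLp _ _ _
    filter_upwards [hae, hco, hgL.coeFn_toLp, hfin] with x h1 h2 h3 h5
    simp only [h2, h3] at h1
    rw [← hg2 x h5]
    exact ((ENNReal.continuous_pow 2).tendsto _).comp (h1.enorm)
  · rw [← hg4, h4]
    simp_rw [h4]
    refine ((ENNReal.continuous_pow 4).tendsto _).comp ?_
    have h6 : ∀ k, eLpNorm (f0 k) 4 volume = ‖(f0 k).toLp 4 volume‖ₑ := fun k => by
      rw [Lp.enorm_def]; exact eLpNorm_congr_ae (SchwartzMap.coeFn_toLp _ _ _).symm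
    have h7 : eLpNorm g 4 volume = ‖hgL.toLp g‖ₑ := by
      rw [Lp.enorm_def]; exact eLpNorm_congr_ae hgL.coeFn_toLp.symm
    simp_rw [h6, h7]
    exact (hlim'.comp hns.tendsto_atTop).enorm

theorem ae_ne_top_of_lintegral_sq {α : Type*} [MeasurableSpace α] {μ : Measure α}
    {F : α → ℝ≥0∞} (hF : Measurable F) (hF2 : ∫⁻ x, F x ^ 2 ∂μ ≠ ∞) : ∀ᵐ x ∂μ, F x ≠ ∞ := by
  refine (ae_lt_top (hF.pow_const 2) hF2).mono fun x hx h => ?_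
  simp [h] at hx

/-- The converse of the Cauchy–Schwarz inequality. -/
theorem lintegral_sq_le_of_forall_mul_le {U : V → ℝ≥0∞} (hU : Measurable U) {D : ℝ≥0∞}
    (h : ∀ F : V → ℝ≥0∞, Measurable F → ∫⁻ x, F x ^ 2 ≠ ∞ →
      ∫⁻ x, F x * U x ≤ D * (∫⁻ x, F x ^ 2) ^ (1 / 2 : ℝ)) :
    ∫⁻ x, U x ^ 2 ≤ D ^ 2 := by
  -- the hypothesis is applied to truncations of `U`, which are in `L²`
  let F : ℕ → V → ℝ≥0∞ := fun k => (Metric.ball (0 : V) k).indicator fun x => min (U x) k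
  have hFm : ∀ k, Measurable (F k) := fun k =>
    (hU.min measurable_const).indicator Metric.isOpen_ball.measurableSet
  have hFU : ∀ k x, F k x ≤ U x := fun k x => by
    by_cases hx : x ∈ Metric.ball (0 : V) k
    · simp only [F, Set.indicator_of_mem hx]; exact min_le_left _ _
    · simp only [F, Set.indicator_of_notMem hx]; exact zero_le
  have hfin : ∀ k, ∫⁻ x, F k x ^ 2 ≠ ∞ := by
    intro k
    have : ∀ x, F k x ^ 2 ≤ (Metric.ball (0 : V) k).indicator (fun _ => (k : ℝ≥0∞) ^ 2) x := by
      intro x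
      by_cases hx : x ∈ Metric.ball (0 : V) k
      · simp only [F, Set.indicator_of_mem hx]; gcongr; exact min_le_right _ _
      · simp [F, Set.indicator_of_notMem hx]
    refine ((lintegral_mono this).trans_lt ?_).ne
    rw [lintegral_indicator Metric.isOpen_ball.measurableSet, lintegral_const]
    refine ENNReal.mul_lt_top (by simp) ?_
    rw [Measure.restrict_apply_univ]
    exact measure_ball_lt_top
  have hbd : ∀ k, ∫⁻ x, F k x ^ 2 ≤ D ^ 2 := by
    intro k
    set I := ∫⁻ x, F k x ^ 2 with hI
    have h1 : I ≤ D * I ^ (1 / 2 : ℝ) := by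
      refine le_trans (lintegral_mono fun x => ?_) (h (F k) (hFm k) (hfin k))
      rw [sq]; gcongr; exact hFU k x
    rcases eq_or_ne I 0 with h0 | h0
    · simp [h0]
    have h2 : I ^ (1 / 2 : ℝ) * I ^ (1 / 2 : ℝ) = I := by
      rw [← ENNReal.rpow_add _ _ h0 (hfin k)]; norm_num
    have h3 : I ^ (1 / 2 : ℝ) ≠ 0 := by simp [h0]
    have h4 : I ^ (1 / 2 : ℝ) ≠ ∞ := by
      simp only [ne_eq, ENNReal.rpow_eq_top_iff]; norm_num; exact hfin k
    have h5 : I ^ (1 / 2 : ℝ) ≤ D := (ENNReal.mul_le_mul_iff_left h3 h4).1 (h2.le.trans h1)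
    calc I = I ^ (1 / 2 : ℝ) * I ^ (1 / 2 : ℝ) := h2.symm
      _ ≤ D ^ 2 := by rw [sq]; gcongr
  have hlim : ∀ x, ⨆ k, F k x ^ 2 = U x ^ 2 := by
    intro x
    refine le_antisymm (iSup_le fun k => by gcongr; exact hFU k x) ?_
    have ht : Tendsto (fun k : ℕ => F k x) atTop (𝓝 (U x)) := by
      have h1 : Tendsto (fun k : ℕ => min (U x) (k : ℝ≥0∞)) atTop (𝓝 (min (U x) ∞)) :=
        tendsto_const_nhds.min ENNReal.tendsto_nat_nhds_top
      rw [min_eq_left le_top] at h1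
      refine h1.congr' ?_
      obtain ⟨N, hN⟩ := exists_nat_gt ‖x‖
      filter_upwards [eventually_ge_atTop N] with k hk
      have : x ∈ Metric.ball (0 : V) k := by
        simp only [Metric.mem_ball, dist_zero_right]
        exact hN.trans_le (by exact_mod_cast hk)
      simp [F, Set.indicator_of_mem this]
    exact le_of_tendsto (((ENNReal.continuous_pow 2).tendsto _).comp ht)
      (Eventually.of_forall fun k => le_iSup (fun k => F k x ^ 2) k)
  have hmono : Monotone fun k x => F k x ^ 2 := by
    intro k l hkl x
    have hc : (k : ℝ≥0∞) ≤ l := by exact_mod_cast hkl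
    by_cases hx : x ∈ Metric.ball (0 : V) k
    · have hx' : x ∈ Metric.ball (0 : V) l :=
        Metric.ball_subset_ball (by exact_mod_cast hkl : (k : ℝ) ≤ l) hx
      simp only [F, Set.indicator_of_mem hx, Set.indicator_of_mem hx']
      gcongr
    · simp [F, Set.indicator_of_notMem hx]
  calc ∫⁻ x, U x ^ 2 = ∫⁻ x, ⨆ k, F k x ^ 2 := by simp_rw [hlim]
    _ = ⨆ k, ∫⁻ x, F k x ^ 2 := lintegral_iSup (fun k => (hFm k).pow_const 2) hmono
    _ ≤ D ^ 2 := iSup_le hbd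

/-- A nonnegative integral kernel `∫ γ_θ(A z - B w) dμ(θ)` from functions on `W` to functions on
`V`, given by functions `γ_θ` with Fourier transforms `Γ_θ`. In momentum variables it is the form
`∫ k(ζ) F(A* ζ) H(B* ζ) dζ` with `k = ∫ Γ_θ dμ(θ)`, which is assumed to be bounded on `L²`. The
adjoints of `A` and `B` are `A'` and `B'`. -/
structure PosKernel (μ : Measure Θ) (A : V →L[ℝ] E) (B : W →L[ℝ] E) (A' : E →L[ℝ] V)
    (B' : E →L[ℝ] W) (γ : Θ → E → ℝ) (Γ : Θ → E → ℂ) (C : ℝ≥0∞) : Prop where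
  inner_left : ∀ z ζ, inner ℝ (A z) ζ = inner ℝ z (A' ζ)
  inner_right : ∀ w ζ, inner ℝ (B w) ζ = inner ℝ w (B' ζ)
  measurable_γ : Measurable (Function.uncurry γ)
  nonneg : ∀ θ Z, 0 ≤ γ θ Z
  measurable_Γ : Measurable (Function.uncurry Γ)
  integrable : ∀ᵐ θ ∂μ, Integrable (Γ θ)
  fourier : ∀ᵐ θ ∂μ, ∀ Z, 𝓕⁻ (Γ θ) Z = (γ θ Z : ℂ)
  finite : ∀ (f : 𝓢(V, ℂ)) (g : 𝓢(W, ℂ)),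
    ∫⁻ q : Θ × E, ‖Γ q.1 q.2‖ₑ * (‖f (A' q.2)‖ₑ * ‖g (B' q.2)‖ₑ) ∂μ.prod volume ≠ ∞
  bound : ∀ (F : V → ℝ≥0∞) (H : W → ℝ≥0∞), Measurable F → Measurable H →
    ∫⁻ ζ, F (A' ζ) * H (B' ζ) * ‖∫ θ, Γ θ ζ ∂μ‖ₑ ≤
      C * ((∫⁻ x, F x ^ 2) ^ (1 / 2 : ℝ) * (∫⁻ x, H x ^ 2) ^ (1 / 2 : ℝ))
  const_ne_top : C ≠ ∞

namespace PosKernel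

variable {μ : Measure Θ} {A : V →L[ℝ] E} {B : W →L[ℝ] E} {A' : E →L[ℝ] V}
    {B' : E →L[ℝ] W} {γ : Θ → E → ℝ} {Γ : Θ → E → ℂ} {C : ℝ≥0∞}

/-- For a single `θ` and Schwartz functions, the Fourier representation is Fubini's theorem. -/
theorem slice (hK : PosKernel μ A B A' B' γ Γ C) {θ : Θ} (hint : Integrable (Γ θ))
    (hfou : ∀ Z, 𝓕⁻ (Γ θ) Z = (γ θ Z : ℂ)) (f : 𝓢(V, ℂ)) (g : 𝓢(W, ℂ)) :
    Integrable (fun q : V × W => f q.1 * g q.2 * γ θ (A q.1 - B q.2)) ∧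
    ∫ q : V × W, f q.1 * g q.2 * γ θ (A q.1 - B q.2) =
      ∫ ζ, Γ θ ζ * ((𝓕⁻ f) (A' ζ) * (𝓕 g) (B' ζ)) := by
  have hfg : Integrable (fun q : V × W => f q.1 * g q.2) := f.integrable.mul_prod g.integrable
  have hch : Continuous fun p : (V × W) × E =>
      Complex.exp ((2 * Real.pi * inner ℝ p.2 (A p.1.1 - B p.1.2) : ℝ) * Complex.I) := by fun_prop
  have hbig : Integrable (fun p : (V × W) × E =>
      Complex.exp ((2 * Real.pi * inner ℝ p.2 (A p.1.1 - B p.1.2) : ℝ) * Complex.I) *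
      (f p.1.1 * g p.1.2 * Γ θ p.2)) := by
    refine (hfg.mul_prod hint).bdd_mul (c := 1) hch.aestronglyMeasurable
      (Eventually.of_forall fun p => ?_)
    rw [Complex.norm_exp_ofReal_mul_I]
  have hinner : ∀ q : V × W, f q.1 * g q.2 * γ θ (A q.1 - B q.2) =
      ∫ ζ, Complex.exp ((2 * Real.pi * inner ℝ ζ (A q.1 - B q.2) : ℝ) * Complex.I) *
        (f q.1 * g q.2 * Γ θ ζ) := by
    intro q
    rw [← hfou, Real.fourierInv_eq', ← integral_const_mul]
    refine integral_congr_ae (Eventually.of_forall fun ζ => ?_)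
    simp only [smul_eq_mul]
    ring
  constructor
  · refine hbig.integral_prod_left.congr (Eventually.of_forall fun q => (hinner q).symm)
  rw [integral_congr_ae (Eventually.of_forall hinner), integral_integral_swap hbig]
  refine integral_congr_ae (Eventually.of_forall fun ζ => ?_)
  change ∫ q : V × W, Complex.exp ((2 * Real.pi * inner ℝ ζ (A q.1 - B q.2) : ℝ) * Complex.I) *
    (f q.1 * g q.2 * Γ θ ζ) = Γ θ ζ * ((𝓕⁻ f) (A' ζ) * (𝓕 g) (B' ζ))
  have hprod : ∀ q : V × W,
      Complex.exp ((2 * Real.pi * inner ℝ ζ (A q.1 - B q.2) : ℝ) * Complex.I) *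
        (f q.1 * g q.2 * Γ θ ζ) =
      Γ θ ζ * ((Complex.exp ((2 * Real.pi * inner ℝ q.1 (A' ζ) : ℝ) * Complex.I) * f q.1) *
        (Complex.exp ((-2 * Real.pi * inner ℝ q.2 (B' ζ) : ℝ) * Complex.I) * g q.2)) := by
    intro q
    have : Complex.exp ((2 * Real.pi * inner ℝ ζ (A q.1 - B q.2) : ℝ) * Complex.I) =
        Complex.exp ((2 * Real.pi * inner ℝ q.1 (A' ζ) : ℝ) * Complex.I) *
        Complex.exp ((-2 * Real.pi * inner ℝ q.2 (B' ζ) : ℝ) * Complex.I) := by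
      rw [← Complex.exp_add, inner_sub_right, real_inner_comm, hK.inner_left,
        real_inner_comm (B q.2), hK.inner_right]
      congr 1
      push_cast
      ring
    rw [this]
    ring
  rw [integral_congr_ae (Eventually.of_forall hprod), integral_const_mul, Measure.volume_eq_prod,
    integral_prod_mul
      (fun z => Complex.exp ((2 * Real.pi * inner ℝ z (A' ζ) : ℝ) * Complex.I) * f z)
      (fun w => Complex.exp ((-2 * Real.pi * inner ℝ w (B' ζ) : ℝ) * Complex.I) * g w),
    SchwartzMap.fourierInv_coe, SchwartzMap.fourier_coe, Real.fourierInv_eq', Real.fourier_eq']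
  simp only [smul_eq_mul]

/-- The Fourier representation for Schwartz functions. -/
theorem schwartz [SFinite μ] (hK : PosKernel μ A B A' B' γ Γ C) (f : 𝓢(V, ℂ)) (g : 𝓢(W, ℂ)) :
    Integrable (fun θ => ∫ q : V × W, f q.1 * g q.2 * γ θ (A q.1 - B q.2)) μ ∧
    ∫ θ, (∫ q : V × W, f q.1 * g q.2 * γ θ (A q.1 - B q.2)) ∂μ =
      ∫ ζ, (∫ θ, Γ θ ζ ∂μ) * ((𝓕⁻ f) (A' ζ) * (𝓕 g) (B' ζ)) := by
  have hbig : Integrable (fun q : Θ × E => Γ q.1 q.2 * ((𝓕⁻ f) (A' q.2) * (𝓕 g) (B' q.2)))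
      (μ.prod volume) := by
    refine ⟨?_, ?_⟩
    · have h1 : Measurable fun q : Θ × E => Γ q.1 q.2 := hK.measurable_Γ
      have h2 : Continuous fun ζ : E => (𝓕⁻ f) (A' ζ) * (𝓕 g) (B' ζ) := by fun_prop
      exact (h1.mul (h2.measurable.comp measurable_snd)).aestronglyMeasurable
    · have := (hK.finite (𝓕⁻ f) (𝓕 g)).lt_top
      simpa [HasFiniteIntegral, enorm_mul] using this
  have hae : ∀ᵐ θ ∂μ, ∫ ζ, Γ θ ζ * ((𝓕⁻ f) (A' ζ) * (𝓕 g) (B' ζ)) =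
      ∫ q : V × W, f q.1 * g q.2 * γ θ (A q.1 - B q.2) := by
    filter_upwards [hK.integrable, hK.fourier] with θ h1 h2
    exact (hK.slice h1 h2 f g).2.symm
  refine ⟨hbig.integral_prod_left.congr hae, ?_⟩
  rw [← integral_congr_ae hae, integral_integral_swap hbig]
  refine integral_congr_ae (Eventually.of_forall fun ζ => ?_)
  exact integral_mul_const _ _

/-- Plancherel's theorem for Schwartz functions, in terms of `ℝ≥0∞`-valued integrals. -/
theorem lintegral_fourier_sq (f : 𝓢(V, ℂ)) :
    (∫⁻ x, ‖(𝓕 f) x‖ₑ ^ 2) = ∫⁻ x, ‖f x‖ₑ ^ 2 := by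
  have h : ∀ h : 𝓢(V, ℂ), (∫⁻ x, ‖h x‖ₑ ^ 2) ^ (1 / 2 : ℝ) = ‖h.toLp 2 volume‖ₑ := fun h => by
    rw [lintegral_sq_rpow_half, Lp.enorm_def]
    exact eLpNorm_congr_ae (SchwartzMap.coeFn_toLp _ _ _).symm
  have h2 : (∫⁻ x, ‖(𝓕 f) x‖ₑ ^ 2) ^ (1 / 2 : ℝ) = (∫⁻ x, ‖f x‖ₑ ^ 2) ^ (1 / 2 : ℝ) := by
    rw [h, h, ← SchwartzMap.toLp_fourier_eq, ← ofReal_norm, ← ofReal_norm, Lp.norm_fourier_eq]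
  exact ENNReal.rpow_left_injective (by norm_num) h2

theorem lintegral_fourierInv_sq (f : 𝓢(V, ℂ)) :
    (∫⁻ x, ‖(𝓕⁻ f) x‖ₑ ^ 2) = ∫⁻ x, ‖f x‖ₑ ^ 2 := by
  rw [← lintegral_fourier_sq (𝓕⁻ f), FourierTransform.fourier_fourierInv_eq]

/-- The squared absolute value of a Schwartz function. -/
def normSq (f : 𝓢(V, ℂ)) : 𝓢(V, ℂ) :=
  SchwartzMap.pairing (ContinuousLinearMap.mul ℂ ℂ) f
    (SchwartzMap.postcompCLM (𝕜 := ℝ) (Complex.conjCLE : ℂ →L[ℝ] ℂ) f)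

omit [FiniteDimensional ℝ V] [MeasurableSpace V] [BorelSpace V] in
theorem normSq_apply (f : 𝓢(V, ℂ)) (x : V) : normSq f x = ((‖f x‖ ^ 2 : ℝ) : ℂ) := by
  simp [normSq, Complex.mul_conj, Complex.normSq_eq_norm_sq]

/-- The bound for squared absolute values of Schwartz functions, where positivity allows to
exchange the integrals. -/
theorem lintegral_schwartz_le [SFinite μ] (hK : PosKernel μ A B A' B' γ Γ C) (f : 𝓢(V, ℂ))
    (g : 𝓢(W, ℂ)) :
    ∫⁻ p : Θ × (V × W), ‖f p.2.1‖ₑ ^ 2 * ‖g p.2.2‖ₑ ^ 2 *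
        ENNReal.ofReal (γ p.1 (A p.2.1 - B p.2.2)) ∂μ.prod volume ≤
      C * ((∫⁻ x, (‖f x‖ₑ ^ 2) ^ 2) ^ (1 / 2 : ℝ) * (∫⁻ x, (‖g x‖ₑ ^ 2) ^ 2) ^ (1 / 2 : ℝ)) := by
  have hγm : Measurable fun p : Θ × (V × W) => γ p.1 (A p.2.1 - B p.2.2) :=
    hK.measurable_γ.comp (measurable_fst.prodMk
      ((Continuous.measurable (by fun_prop : Continuous fun q : V × W => A q.1 - B q.2)).comp
        measurable_snd))
  have hreal : ∀ θ, ∀ q : V × W, normSq f q.1 * normSq g q.2 * γ θ (A q.1 - B q.2) =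
      ((‖f q.1‖ ^ 2 * ‖g q.2‖ ^ 2 * γ θ (A q.1 - B q.2) : ℝ) : ℂ) := by
    intro θ q; rw [normSq_apply, normSq_apply]; push_cast; ring
  have hpos : ∀ θ, ∀ q : V × W, 0 ≤ ‖f q.1‖ ^ 2 * ‖g q.2‖ ^ 2 * γ θ (A q.1 - B q.2) := by
    intro θ q; have := hK.nonneg θ (A q.1 - B q.2); positivity
  have hMm : Measurable fun p : Θ × (V × W) => ‖f p.2.1‖ₑ ^ 2 * ‖g p.2.2‖ₑ ^ 2 *
      ENNReal.ofReal (γ p.1 (A p.2.1 - B p.2.2)) :=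
    (((f.continuous.measurable.comp (measurable_fst.comp measurable_snd)).enorm.pow_const 2).mul
      ((g.continuous.measurable.comp (measurable_snd.comp measurable_snd)).enorm.pow_const 2)).mul
        hγm.ennreal_ofReal
  obtain ⟨h1, h2⟩ := hK.schwartz (normSq f) (normSq g)
  have hslice : ∀ θ, ∫ q : V × W, normSq f q.1 * normSq g q.2 * γ θ (A q.1 - B q.2) =
      ((∫ q : V × W, ‖f q.1‖ ^ 2 * ‖g q.2‖ ^ 2 * γ θ (A q.1 - B q.2) : ℝ) : ℂ) := fun θ => by
    rw [← integral_complex_ofReal]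
    exact integral_congr_ae (Eventually.of_forall (hreal θ))
  replace h1 := h1.congr (Eventually.of_forall hslice)
  rw [integral_congr_ae (Eventually.of_forall hslice), integral_complex_ofReal] at h2
  have h1' : Integrable (fun θ => ∫ q : V × W, ‖f q.1‖ ^ 2 * ‖g q.2‖ ^ 2 *
      γ θ (A q.1 - B q.2)) μ := h1.re
  have h3 : ∫⁻ p : Θ × (V × W), ‖f p.2.1‖ₑ ^ 2 * ‖g p.2.2‖ₑ ^ 2 *
        ENNReal.ofReal (γ p.1 (A p.2.1 - B p.2.2)) ∂μ.prod volume =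
      ENNReal.ofReal (∫ θ, (∫ q : V × W, ‖f q.1‖ ^ 2 * ‖g q.2‖ ^ 2 *
        γ θ (A q.1 - B q.2)) ∂μ) := by
    rw [ofReal_integral_eq_lintegral_ofReal h1'
      (Eventually.of_forall fun θ => integral_nonneg (hpos θ)), lintegral_prod _ hMm.aemeasurable]
    refine lintegral_congr_ae ?_
    filter_upwards [hK.integrable, hK.fourier] with θ h4 h5
    have h6 := (hK.slice h4 h5 (normSq f) (normSq g)).1.congr (Eventually.of_forall (hreal θ))
    have h6' : Integrable (fun q : V × W => ‖f q.1‖ ^ 2 * ‖g q.2‖ ^ 2 *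
      γ θ (A q.1 - B q.2)) := h6.re
    rw [ofReal_integral_eq_lintegral_ofReal h6' (Eventually.of_forall (hpos θ))]
    refine lintegral_congr fun q => ?_
    rw [ENNReal.ofReal_mul (by positivity), ENNReal.ofReal_mul (by positivity),
      ENNReal.ofReal_pow (norm_nonneg _), ENNReal.ofReal_pow (norm_nonneg _), ofReal_norm,
      ofReal_norm]
  rw [h3]
  have h7 : ENNReal.ofReal (∫ θ, (∫ q : V × W, ‖f q.1‖ ^ 2 * ‖g q.2‖ ^ 2 *
        γ θ (A q.1 - B q.2)) ∂μ) ≤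
      ‖((∫ θ, (∫ q : V × W, ‖f q.1‖ ^ 2 * ‖g q.2‖ ^ 2 *
        γ θ (A q.1 - B q.2)) ∂μ : ℝ) : ℂ)‖ₑ := by
    rw [← ofReal_norm, Complex.norm_real]
    exact ENNReal.ofReal_le_ofReal (le_abs_self _)
  refine h7.trans ?_
  rw [h2]
  refine (enorm_integral_le_lintegral_enorm _).trans ?_
  have h8 := hK.bound (fun x => ‖(𝓕⁻ (normSq f)) x‖ₑ) (fun x => ‖(𝓕 (normSq g)) x‖ₑ)
    (by fun_prop) (by fun_prop)
  rw [lintegral_fourier_sq, lintegral_fourierInv_sq] at h8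
  have h9 : ∀ z : ℂ, ‖((‖z‖ ^ 2 : ℝ) : ℂ)‖ₑ = ‖z‖ₑ ^ 2 := fun z => by
    rw [← ofReal_norm, Complex.norm_real, Real.norm_of_nonneg (by positivity),
      ENNReal.ofReal_pow (norm_nonneg _), ofReal_norm]
  simp_rw [normSq_apply, h9] at h8
  refine le_trans (le_of_eq ?_) h8
  refine lintegral_congr fun ζ => ?_
  rw [enorm_mul, enorm_mul, mul_comm]

/-- The bound for all nonnegative functions. -/
theorem lintegral_le [SFinite μ] (hK : PosKernel μ A B A' B' γ Γ C) {F : V → ℝ≥0∞}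
    {H : W → ℝ≥0∞} (hF : Measurable F) (hH : Measurable H) (hF2 : ∫⁻ x, F x ^ 2 ≠ ∞)
    (hH2 : ∫⁻ x, H x ^ 2 ≠ ∞) :
    ∫⁻ p : Θ × (V × W), F p.2.1 * H p.2.2 *
        ENNReal.ofReal (γ p.1 (A p.2.1 - B p.2.2)) ∂μ.prod volume ≤
      C * ((∫⁻ x, F x ^ 2) ^ (1 / 2 : ℝ) * (∫⁻ x, H x ^ 2) ^ (1 / 2 : ℝ)) := by
  have hγm : Measurable fun p : Θ × (V × W) => γ p.1 (A p.2.1 - B p.2.2) :=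
    hK.measurable_γ.comp (measurable_fst.prodMk
      ((Continuous.measurable (by fun_prop : Continuous fun q : V × W => A q.1 - B q.2)).comp
        measurable_snd))
  obtain ⟨f, hf1, hf2⟩ := exists_schwartz_sq_tendsto hF hF2
  obtain ⟨g, hg1, hg2⟩ := exists_schwartz_sq_tendsto hH hH2
  have q1 : Measure.QuasiMeasurePreserving (fun p : Θ × (V × W) => p.2.1)
      (μ.prod volume) volume :=
    Measure.quasiMeasurePreserving_fst.comp Measure.quasiMeasurePreserving_snd
  have q2 : Measure.QuasiMeasurePreserving (fun p : Θ × (V × W) => p.2.2)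
      (μ.prod volume) volume :=
    Measure.quasiMeasurePreserving_snd.comp Measure.quasiMeasurePreserving_snd
  -- Fatou's lemma
  have hlim : ∀ᵐ p : Θ × (V × W) ∂μ.prod volume, F p.2.1 * H p.2.2 *
        ENNReal.ofReal (γ p.1 (A p.2.1 - B p.2.2)) =
      liminf (fun k => ‖f k p.2.1‖ₑ ^ 2 * ‖g k p.2.2‖ₑ ^ 2 *
        ENNReal.ofReal (γ p.1 (A p.2.1 - B p.2.2))) atTop := by
    filter_upwards [q1.ae hf1, q2.ae hg1, q1.ae (ae_ne_top_of_lintegral_sq hF hF2),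
      q2.ae (ae_ne_top_of_lintegral_sq hH hH2)]
      with p h1 h2 h3 h4
    refine (Tendsto.liminf_eq ?_).symm
    exact ENNReal.Tendsto.mul_const (ENNReal.Tendsto.mul h1 (Or.inr h4) h2 (Or.inr h3))
      (Or.inr ENNReal.ofReal_ne_top)
  rw [lintegral_congr_ae hlim]
  have hfm : ∀ k, Measurable (f k) := fun k => (f k).continuous.measurable
  have hgm : ∀ k, Measurable (g k) := fun k => (g k).continuous.measurable
  refine (lintegral_liminf_le fun k => ?_).trans ?_
  · have h1 := (hfm k).comp (measurable_fst.comp measurable_snd : Measurable fun p : Θ × (V × W) =>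
      p.2.1)
    have h2 := (hgm k).comp (measurable_snd.comp measurable_snd : Measurable fun p : Θ × (V × W) =>
      p.2.2)
    exact ((h1.enorm.pow_const 2).mul (h2.enorm.pow_const 2)).mul hγm.ennreal_ofReal
  have hbound : Tendsto (fun k => C * ((∫⁻ x, (‖f k x‖ₑ ^ 2) ^ 2) ^ (1 / 2 : ℝ) *
      (∫⁻ x, (‖g k x‖ₑ ^ 2) ^ 2) ^ (1 / 2 : ℝ))) atTop
      (𝓝 (C * ((∫⁻ x, F x ^ 2) ^ (1 / 2 : ℝ) * (∫⁻ x, H x ^ 2) ^ (1 / 2 : ℝ)))) := by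
    refine ENNReal.Tendsto.const_mul (ENNReal.Tendsto.mul
      ((ENNReal.continuous_rpow_const.tendsto _).comp hf2) (Or.inr ?_)
      ((ENNReal.continuous_rpow_const.tendsto _).comp hg2) (Or.inr ?_)) (Or.inr hK.const_ne_top)
    · exact ENNReal.rpow_ne_top_of_nonneg (by norm_num) hH2
    · exact ENNReal.rpow_ne_top_of_nonneg (by norm_num) hF2
  rw [← hbound.liminf_eq]
  exact liminf_le_liminf (Eventually.of_forall fun k => hK.lintegral_schwartz_le (f k) (g k))

end PosKernel

end Kernel

/-! ### The operator on `L²` given by a nonnegative kernel -/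

section KernelL2

variable {V W E : Type*}
  [NormedAddCommGroup V] [InnerProductSpace ℝ V] [FiniteDimensional ℝ V] [MeasurableSpace V]
  [BorelSpace V]
  [NormedAddCommGroup W] [InnerProductSpace ℝ W] [FiniteDimensional ℝ W] [MeasurableSpace W]
  [BorelSpace W]
  [NormedAddCommGroup E] [InnerProductSpace ℝ E] [FiniteDimensional ℝ E] [MeasurableSpace E]
  [BorelSpace E]
  {Θ : Type*} [MeasurableSpace Θ]

namespace PosKernel

variable {μ : Measure Θ} {A : V →L[ℝ] E} {B : W →L[ℝ] E} {A' : E →L[ℝ] V}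
    {B' : E →L[ℝ] W} {γ : Θ → E → ℝ} {Γ : Θ → E → ℂ} {C : ℝ≥0∞}

/-- The function `z ↦ ∫ γ_θ(A z - B w) ψ(w) dw dμ(θ)`. -/
def apply (μ : Measure Θ) (A : V →L[ℝ] E) (B : W →L[ℝ] E) (γ : Θ → E → ℝ) (ψ : W → ℂ) (z : V) : ℂ :=
  ∫ q : Θ × W, (γ q.1 (A z - B q.2) : ℂ) * ψ q.2 ∂μ.prod volume

/-- The kernel applied to the absolute value of a function. -/
def applyAbs (μ : Measure Θ) (A : V →L[ℝ] E) (B : W →L[ℝ] E) (γ : Θ → E → ℝ) (ψ : W → ℂ)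
    (z : V) : ℝ≥0∞ :=
  ∫⁻ q : Θ × W, ‖ψ q.2‖ₑ * ENNReal.ofReal (γ q.1 (A z - B q.2)) ∂μ.prod volume

theorem measurable_γ_comp (hK : PosKernel μ A B A' B' γ Γ C) :
    Measurable fun p : V × (Θ × W) => γ p.2.1 (A p.1 - B p.2.2) :=
  hK.measurable_γ.comp ((measurable_fst.comp measurable_snd).prodMk
    ((A.measurable.comp measurable_fst).sub
      (B.measurable.comp (measurable_snd.comp measurable_snd))))

theorem measurable_applyAbs_aux (hK : PosKernel μ A B A' B' γ Γ C) {ψ : W → ℂ}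
    (hψ : Measurable ψ) :
    Measurable fun p : V × (Θ × W) =>
      ‖ψ p.2.2‖ₑ * ENNReal.ofReal (γ p.2.1 (A p.1 - B p.2.2)) :=
  (hψ.comp (measurable_snd.comp measurable_snd)).enorm.mul hK.measurable_γ_comp.ennreal_ofReal

theorem measurable_applyAbs [SFinite μ] (hK : PosKernel μ A B A' B' γ Γ C) {ψ : W → ℂ}
    (hψ : Measurable ψ) : Measurable (applyAbs μ A B γ ψ) :=
  (hK.measurable_applyAbs_aux hψ).lintegral_prod_right'

theorem lintegral_mul_applyAbs [SFinite μ] (hK : PosKernel μ A B A' B' γ Γ C) {ψ : W → ℂ}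
    (hψ : Measurable ψ) {F : V → ℝ≥0∞} (hF : Measurable F) :
    ∫⁻ z, F z * applyAbs μ A B γ ψ z = ∫⁻ p : Θ × (V × W), F p.2.1 * ‖ψ p.2.2‖ₑ *
      ENNReal.ofReal (γ p.1 (A p.2.1 - B p.2.2)) ∂μ.prod volume := by
  have hm := (hF.comp measurable_fst).mul (hK.measurable_applyAbs_aux hψ)
  have h1 : ∀ z, F z * applyAbs μ A B γ ψ z = ∫⁻ θ, ∫⁻ w, F z * (‖ψ w‖ₑ *
      ENNReal.ofReal (γ θ (A z - B w))) ∂volume ∂μ := by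
    intro z
    have hz : Measurable fun q : Θ × W => ‖ψ q.2‖ₑ * ENNReal.ofReal (γ q.1 (A z - B q.2)) :=
      (hK.measurable_applyAbs_aux hψ).comp measurable_prodMk_left
    rw [applyAbs, ← lintegral_const_mul _ hz, lintegral_prod]
    exact (hm.comp measurable_prodMk_left).aemeasurable
  have hm3 : Measurable fun p : Θ × (V × W) => F p.2.1 * (‖ψ p.2.2‖ₑ *
      ENNReal.ofReal (γ p.1 (A p.2.1 - B p.2.2))) :=
    hm.comp ((measurable_fst.comp measurable_snd).prodMk
      (measurable_fst.prodMk (measurable_snd.comp measurable_snd)))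
  simp_rw [h1, mul_assoc]
  rw [lintegral_prod _ hm3.aemeasurable]
  have h2 : ∀ θ, ∫⁻ p : V × W, F p.1 * (‖ψ p.2‖ₑ * ENNReal.ofReal (γ θ (A p.1 - B p.2))) =
      ∫⁻ z, ∫⁻ w, F z * (‖ψ w‖ₑ * ENNReal.ofReal (γ θ (A z - B w))) := fun θ => by
    rw [Measure.volume_eq_prod, lintegral_prod]
    exact (hm3.comp measurable_prodMk_left).aemeasurable
  simp_rw [h2]
  refine lintegral_lintegral_swap ?_
  refine Measurable.aemeasurable ?_
  exact (Measurable.lintegral_prod_right' (f := fun q : (V × Θ) × W =>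
    F q.1.1 * (‖ψ q.2‖ₑ * ENNReal.ofReal (γ q.1.2 (A q.1.1 - B q.2))))
    (hm.comp ((measurable_fst.comp measurable_fst).prodMk
      ((measurable_snd.comp measurable_fst).prodMk measurable_snd))))

theorem lintegral_mul_applyAbs_le [SFinite μ] (hK : PosKernel μ A B A' B' γ Γ C) {ψ : W → ℂ}
    (hψ : Measurable ψ) (hψ2 : eLpNorm ψ 2 volume ≠ ∞) {F : V → ℝ≥0∞} (hF : Measurable F)
    (hF2 : ∫⁻ x, F x ^ 2 ≠ ∞) :
    ∫⁻ z, F z * applyAbs μ A B γ ψ z ≤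
      C * eLpNorm ψ 2 volume * (∫⁻ x, F x ^ 2) ^ (1 / 2 : ℝ) := by
  rw [hK.lintegral_mul_applyAbs hψ hF]
  refine (hK.lintegral_le hF hψ.enorm hF2 ?_).trans (le_of_eq ?_)
  · rw [← lintegral_sq_rpow_half] at hψ2
    contrapose! hψ2
    simp [hψ2]
  · rw [lintegral_sq_rpow_half]; ring

/-- A positive operator is bounded on `L²` together with the integrals of absolute values. -/
theorem lintegral_applyAbs_sq_le [SFinite μ] (hK : PosKernel μ A B A' B' γ Γ C) {ψ : W → ℂ}
    (hψ : Measurable ψ) (hψ2 : eLpNorm ψ 2 volume ≠ ∞) :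
    ∫⁻ z, applyAbs μ A B γ ψ z ^ 2 ≤ (C * eLpNorm ψ 2 volume) ^ 2 :=
  lintegral_sq_le_of_forall_mul_le (hK.measurable_applyAbs hψ) fun _ hF hF2 =>
    hK.lintegral_mul_applyAbs_le hψ hψ2 hF hF2

/-- For `ψ` in `L²` the defining integral converges absolutely almost everywhere. -/
theorem ae_applyAbs_lt_top [SFinite μ] (hK : PosKernel μ A B A' B' γ Γ C) {ψ : W → ℂ}
    (hψ : Measurable ψ) (hψ2 : eLpNorm ψ 2 volume ≠ ∞) : ∀ᵐ z, applyAbs μ A B γ ψ z ≠ ∞ :=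
  ae_ne_top_of_lintegral_sq (hK.measurable_applyAbs hψ)
    ((hK.lintegral_applyAbs_sq_le hψ hψ2).trans_lt
      (ENNReal.pow_lt_top (ENNReal.mul_lt_top hK.const_ne_top.lt_top hψ2.lt_top))).ne

theorem integrable_of_applyAbs (hK : PosKernel μ A B A' B' γ Γ C) {ψ : W → ℂ}
    (hψ : Measurable ψ) {z : V} (hz : applyAbs μ A B γ ψ z ≠ ∞) :
    Integrable (fun q : Θ × W => (γ q.1 (A z - B q.2) : ℂ) * ψ q.2) (μ.prod volume) := by
  refine ⟨?_, ?_⟩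
  · exact ((Complex.measurable_ofReal.comp (hK.measurable_γ_comp.comp
      measurable_prodMk_left)).mul (hψ.comp measurable_snd)).aestronglyMeasurable
  · rw [hasFiniteIntegral_iff_enorm]
    refine lt_of_le_of_lt (le_of_eq ?_) hz.lt_top
    refine lintegral_congr fun q => ?_
    rw [enorm_mul, mul_comm, ← ofReal_norm (((γ q.1 (A z - B q.2) : ℝ)) : ℂ), Complex.norm_real,
      Real.norm_of_nonneg (hK.nonneg _ _)]

theorem enorm_apply_le (hK : PosKernel μ A B A' B' γ Γ C) (ψ : W → ℂ) (z : V) :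
    ‖apply μ A B γ ψ z‖ₑ ≤ applyAbs μ A B γ ψ z := by
  refine (enorm_integral_le_lintegral_enorm _).trans (le_of_eq ?_)
  refine lintegral_congr fun q => ?_
  rw [enorm_mul, mul_comm, ← ofReal_norm (((γ q.1 (A z - B q.2) : ℝ)) : ℂ), Complex.norm_real,
    Real.norm_of_nonneg (hK.nonneg _ _)]

theorem stronglyMeasurable_apply [SFinite μ] (hK : PosKernel μ A B A' B' γ Γ C) {ψ : W → ℂ}
    (hψ : Measurable ψ) : StronglyMeasurable (apply μ A B γ ψ) :=
  StronglyMeasurable.integral_prod_right' (f := fun p : V × (Θ × W) =>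
    (γ p.2.1 (A p.1 - B p.2.2) : ℂ) * ψ p.2.2)
    ((Complex.measurable_ofReal.comp hK.measurable_γ_comp).mul
      (hψ.comp (measurable_snd.comp measurable_snd))).stronglyMeasurable

theorem eLpNorm_apply_le [SFinite μ] (hK : PosKernel μ A B A' B' γ Γ C) {ψ : W → ℂ}
    (hψ : Measurable ψ) (hψ2 : eLpNorm ψ 2 volume ≠ ∞) :
    eLpNorm (apply μ A B γ ψ) 2 volume ≤ C * eLpNorm ψ 2 volume := by
  rw [← lintegral_sq_rpow_half (apply μ A B γ ψ)]
  calc (∫⁻ z, ‖apply μ A B γ ψ z‖ₑ ^ 2) ^ (1 / 2 : ℝ)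
      ≤ ((C * eLpNorm ψ 2 volume) ^ 2) ^ (1 / 2 : ℝ) := by
        gcongr
        refine le_trans (lintegral_mono fun z => ?_) (hK.lintegral_applyAbs_sq_le hψ hψ2)
        gcongr
        exact hK.enorm_apply_le ψ z
    _ = C * eLpNorm ψ 2 volume := by
        rw [← ENNReal.rpow_natCast, ← ENNReal.rpow_mul]; norm_num

theorem memLp_apply [SFinite μ] (hK : PosKernel μ A B A' B' γ Γ C) {ψ : W → ℂ}
    (hψ : Measurable ψ) (hψ2 : eLpNorm ψ 2 volume ≠ ∞) : MemLp (apply μ A B γ ψ) 2 volume :=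
  ⟨(hK.stronglyMeasurable_apply hψ).aestronglyMeasurable, (hK.eLpNorm_apply_le hψ hψ2).trans_lt
    (ENNReal.mul_lt_top hK.const_ne_top.lt_top hψ2.lt_top)⟩

theorem apply_sub [SFinite μ] (hK : PosKernel μ A B A' B' γ Γ C) {ψ φ : W → ℂ}
    (hψ : Measurable ψ) (hψ2 : eLpNorm ψ 2 volume ≠ ∞)
    (hφ : Measurable φ) (hφ2 : eLpNorm φ 2 volume ≠ ∞) :
    apply μ A B γ (ψ - φ) =ᵐ[volume] apply μ A B γ ψ - apply μ A B γ φ := by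
  filter_upwards [hK.ae_applyAbs_lt_top hψ hψ2, hK.ae_applyAbs_lt_top hφ hφ2] with z h1 h2
  rw [Pi.sub_apply, apply, apply, apply, ← integral_sub (hK.integrable_of_applyAbs hψ h1)
    (hK.integrable_of_applyAbs hφ h2)]
  simp only [Pi.sub_apply, mul_sub]

/-- The Fourier representation, for Schwartz functions. -/
theorem integral_mul_apply_schwartz [SFinite μ] (hK : PosKernel μ A B A' B' γ Γ C)
    (f : 𝓢(V, ℂ)) (g : 𝓢(W, ℂ)) :
    ∫ z, f z * apply μ A B γ g z =
      ∫ ζ, (∫ θ, Γ θ ζ ∂μ) * ((𝓕⁻ f) (A' ζ) * (𝓕 g) (B' ζ)) := by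
  rw [← (hK.schwartz f g).2]
  have hg : Measurable (g : W → ℂ) := g.continuous.measurable
  have hf : Measurable (f : V → ℂ) := f.continuous.measurable
  have hm : Measurable fun p : V × (Θ × W) => f p.1 * ((γ p.2.1 (A p.1 - B p.2.2) : ℂ) * g p.2.2) :=
    (hf.comp measurable_fst).mul ((Complex.measurable_ofReal.comp hK.measurable_γ_comp).mul
      (hg.comp (measurable_snd.comp measurable_snd)))
  have hfin : ∫⁻ p : Θ × (V × W), ‖f p.2.1‖ₑ * ‖g p.2.2‖ₑ *
      ENNReal.ofReal (γ p.1 (A p.2.1 - B p.2.2)) ∂μ.prod volume < ∞ := by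
    rw [← hK.lintegral_mul_applyAbs hg hf.enorm]
    refine (hK.lintegral_mul_applyAbs_le hg (g.memLp 2 volume).2.ne hf.enorm ?_).trans_lt ?_
    · have := (f.memLp 2 volume).2.ne
      rw [← lintegral_sq_rpow_half] at this
      contrapose! this
      simp [this]
    · rw [lintegral_sq_rpow_half]
      exact ENNReal.mul_lt_top (ENNReal.mul_lt_top hK.const_ne_top.lt_top (g.memLp 2 volume).2)
        (f.memLp 2 volume).2
  have hbig : Integrable (fun p : Θ × (V × W) => f p.2.1 * g p.2.2 *
      (γ p.1 (A p.2.1 - B p.2.2) : ℂ)) (μ.prod volume) := by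
    refine ⟨?_, ?_⟩
    · have := hm.comp ((measurable_fst.comp measurable_snd).prodMk
        (measurable_fst.prodMk (measurable_snd.comp measurable_snd)) :
        Measurable fun p : Θ × (V × W) => (p.2.1, (p.1, p.2.2)))
      refine (this.aestronglyMeasurable).congr (Eventually.of_forall fun p => ?_)
      simp only [Function.comp_apply]; ring
    · rw [hasFiniteIntegral_iff_enorm]
      refine lt_of_le_of_lt (le_of_eq ?_) hfin
      refine lintegral_congr fun p => ?_
      rw [enorm_mul, enorm_mul, ← ofReal_norm (((γ p.1 (A p.2.1 - B p.2.2) : ℝ)) : ℂ),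
        Complex.norm_real, Real.norm_of_nonneg (hK.nonneg _ _)]
  let e : V × (Θ × W) ≃ᵐ Θ × (V × W) :=
    { toFun := fun p => (p.2.1, (p.1, p.2.2))
      invFun := fun p => (p.2.1, (p.1, p.2.2))
      left_inv := fun p => rfl
      right_inv := fun p => rfl
      measurable_toFun := (measurable_fst.comp measurable_snd).prodMk
        (measurable_fst.prodMk (measurable_snd.comp measurable_snd))
      measurable_invFun := (measurable_fst.comp measurable_snd).prodMk
        (measurable_fst.prodMk (measurable_snd.comp measurable_snd)) }
  have hmp : MeasurePreserving e ((volume : Measure V).prod (μ.prod (volume : Measure W)))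
      (μ.prod ((volume : Measure V).prod (volume : Measure W))) := by
    refine ⟨e.measurable, ?_⟩
    have h1 := (measurePreserving_prodAssoc μ (volume : Measure V) (volume : Measure W)).comp
      (((Measure.measurePreserving_swap (μ := (volume : Measure V)) (ν := μ)).prod
        (MeasurePreserving.id (volume : Measure W))).comp
      (measurePreserving_prodAssoc (volume : Measure V) μ (volume : Measure W)).symm)
    exact h1.map_eq
  rw [← integral_prod _ hbig]
  rw [Measure.volume_eq_prod] at hbig ⊢
  rw [← hmp.integral_comp e.measurableEmbedding]
  have hbig' := (hmp.integrable_comp_emb e.measurableEmbedding).2 hbig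
  have := integral_prod _ hbig'
  simp only [Function.comp_def] at this
  rw [this]
  refine integral_congr_ae (Eventually.of_forall fun z => ?_)
  simp only [apply, e, MeasurableEquiv.coe_mk, Equiv.coe_fn_mk]
  rw [← integral_const_mul]
  refine integral_congr_ae (Eventually.of_forall fun q => ?_)
  simp only; ring

theorem integrable_mul_apply [SFinite μ] (hK : PosKernel μ A B A' B' γ Γ C)
    (f : 𝓢(V, ℂ)) {H : W → ℂ} (hH : Measurable H) (hH2 : eLpNorm H 2 volume ≠ ∞) :
    Integrable (fun z => f z * apply μ A B γ H z) ∧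
      ‖∫ z, f z * apply μ A B γ H z‖ₑ ≤ C * (eLpNorm f 2 volume * eLpNorm H 2 volume) := by
  have hle : ∫⁻ z, ‖f z * apply μ A B γ H z‖ₑ ≤
      C * (eLpNorm f 2 volume * eLpNorm H 2 volume) := by
    calc _ ≤ ∫⁻ z, ‖f z‖ₑ * applyAbs μ A B γ H z := by
          refine lintegral_mono fun z => ?_
          rw [enorm_mul]; gcongr; exact hK.enorm_apply_le H z
      _ ≤ C * eLpNorm H 2 volume * (∫⁻ x, ‖f x‖ₑ ^ 2) ^ (1 / 2 : ℝ) := by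
          refine hK.lintegral_mul_applyAbs_le hH hH2 f.continuous.measurable.enorm ?_
          have := (f.memLp 2 volume).2.ne
          rw [← lintegral_sq_rpow_half] at this
          contrapose! this
          simp [this]
      _ = _ := by rw [lintegral_sq_rpow_half]; ring
  refine ⟨⟨?_, ?_⟩, (enorm_integral_le_lintegral_enorm _).trans hle⟩
  · exact (f.continuous.stronglyMeasurable.mul
      (hK.stronglyMeasurable_apply hH)).aestronglyMeasurable
  · rw [hasFiniteIntegral_iff_enorm]
    exact hle.trans_lt (ENNReal.mul_lt_top hK.const_ne_top.lt_top
      (ENNReal.mul_lt_top (f.memLp 2 volume).2 hH2.lt_top))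

/-- Continuity in `ψ`, by which identities extend from Schwartz functions to `L²`. -/
theorem continuous_integral_mul_apply [SFinite μ] (hK : PosKernel μ A B A' B' γ Γ C)
    (f : 𝓢(V, ℂ)) :
    Continuous fun ψ : Lp ℂ 2 (volume : Measure W) => ∫ z, f z * apply μ A B γ ψ z := by
  have hLm : ∀ φ : Lp ℂ 2 (volume : Measure W), Measurable (φ : W → ℂ) := fun φ =>
    (Lp.stronglyMeasurable φ).measurable
  refine continuous_iff_continuousAt.2 fun ψ => ?_
  rw [ContinuousAt, tendsto_iff_edist_tendsto_0]
  have hzero : Tendsto (fun φ : Lp ℂ 2 (volume : Measure W) =>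
      C * (eLpNorm f 2 volume * ‖φ - ψ‖ₑ)) (𝓝 ψ) (𝓝 0) := by
    have h1 : Tendsto (fun φ : Lp ℂ 2 (volume : Measure W) => ‖φ - ψ‖ₑ) (𝓝 ψ) (𝓝 0) := by
      have : Tendsto (fun φ : Lp ℂ 2 (volume : Measure W) => φ) (𝓝 ψ) (𝓝 ψ) := tendsto_id
      have := (this.sub_const ψ).enorm
      simpa using this
    have h2 := ENNReal.Tendsto.const_mul (a := C) (ENNReal.Tendsto.const_mul
      (a := eLpNorm f 2 volume) h1 (Or.inr (f.memLp 2 volume).2.ne)) (Or.inr hK.const_ne_top)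
    simpa using h2
  refine tendsto_of_tendsto_of_tendsto_of_le_of_le tendsto_const_nhds hzero
    (fun _ => zero_le) fun φ => ?_
  have hφ2 := (Lp.memLp φ).2.ne
  have hψ2 := (Lp.memLp ψ).2.ne
  have hs : eLpNorm (⇑φ - ⇑ψ) 2 volume = ‖φ - ψ‖ₑ := by
    rw [Lp.enorm_def]; exact eLpNorm_congr_ae (Lp.coeFn_sub φ ψ).symm
  have h := hK.integrable_mul_apply f ((hLm φ).sub (hLm ψ)) (by rw [hs]; exact enorm_ne_top)
  rw [hs] at h
  simp only
  rw [edist_eq_enorm_sub, ← integral_sub (hK.integrable_mul_apply f (hLm φ) hφ2).1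
    (hK.integrable_mul_apply f (hLm ψ) hψ2).1]
  refine le_trans (le_of_eq ?_) h.2
  congr 1
  refine integral_congr_ae ?_
  filter_upwards [hK.apply_sub (hLm φ) hφ2 (hLm ψ) hψ2] with z hz
  rw [hz, Pi.sub_apply, mul_sub]

set_option maxHeartbeats 800000 in
/-- The Fourier representation: the kernel maps `L²` to `L²`, and is given by the form
`∫ k(ζ) F(A* ζ) H(B* ζ) dζ` in momentum variables. -/
theorem integral_mul_apply [SFinite μ] (hK : PosKernel μ A B A' B' γ Γ C)
    (f : 𝓢(V, ℂ)) (ψ : Lp ℂ 2 (volume : Measure W)) :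
    ∫ z, f z * apply μ A B γ ψ z =
      ∫ ζ, (∫ θ, Γ θ ζ ∂μ) * ((𝓕⁻ f) (A' ζ) * (𝓕 ψ : Lp ℂ 2 (volume : Measure W)) (B' ζ)) := by
  have hΓm : StronglyMeasurable fun ζ => ∫ θ, Γ θ ζ ∂μ :=
    StronglyMeasurable.integral_prod_left' (f := fun p : Θ × E => Γ p.1 p.2)
      (hK.measurable_Γ.stronglyMeasurable)
  have hLm : ∀ φ : Lp ℂ 2 (volume : Measure W), Measurable (φ : W → ℂ) := fun φ =>
    (Lp.stronglyMeasurable φ).measurable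
  -- the momentum form is Lipschitz in the second argument
  have key : ∀ {H : W → ℂ}, Measurable H → eLpNorm H 2 volume ≠ ∞ →
      Integrable (fun ζ => (∫ θ, Γ θ ζ ∂μ) * ((𝓕⁻ f) (A' ζ) * H (B' ζ))) ∧
      ‖∫ ζ, (∫ θ, Γ θ ζ ∂μ) * ((𝓕⁻ f) (A' ζ) * H (B' ζ))‖ₑ ≤
        C * (eLpNorm f 2 volume * eLpNorm H 2 volume) := by
    intro H hH hH2
    have hb := hK.bound (fun x => ‖(𝓕⁻ f) x‖ₑ) (fun x => ‖H x‖ₑ) (by fun_prop) (by fun_prop)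
    rw [lintegral_fourierInv_sq, lintegral_sq_rpow_half, lintegral_sq_rpow_half] at hb
    have hle : ∫⁻ ζ, ‖(∫ θ, Γ θ ζ ∂μ) * ((𝓕⁻ f) (A' ζ) * H (B' ζ))‖ₑ ≤
        C * (eLpNorm f 2 volume * eLpNorm H 2 volume) := by
      refine le_trans (le_of_eq (lintegral_congr fun ζ => ?_)) hb
      rw [enorm_mul, enorm_mul, mul_comm]
    refine ⟨⟨?_, ?_⟩, (enorm_integral_le_lintegral_enorm _).trans hle⟩
    · refine (hΓm.mul (Measurable.stronglyMeasurable ?_)).aestronglyMeasurable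
      exact ((𝓕⁻ f).continuous.measurable.comp A'.measurable).mul (hH.comp B'.measurable)
    · rw [hasFiniteIntegral_iff_enorm]
      exact hle.trans_lt (ENNReal.mul_lt_top hK.const_ne_top.lt_top
        (ENNReal.mul_lt_top (f.memLp 2 volume).2 hH2.lt_top))
  -- approximation by Schwartz functions
  obtain ⟨u, hu, hlim⟩ := mem_closure_iff_seq_limit.1
    ((SchwartzMap.denseRange_toLpCLM (E := W) (F := ℂ) (p := 2)
      (μ := (volume : Measure W)) (by norm_num)) ψ)
  choose g hg using hu
  have hlim' : Tendsto (fun k => (g k).toLp 2 volume) atTop (𝓝 ψ) := by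
    convert hlim using 2 with k
    exact hg k
  have hsm : ∀ h : Lp ℂ 2 (volume : Measure W), ∀ k : 𝓢(W, ℂ),
      eLpNorm (⇑k - ⇑h) 2 volume = ‖k.toLp 2 volume - h‖ₑ := by
    intro h k
    rw [Lp.enorm_def]
    refine eLpNorm_congr_ae ?_
    filter_upwards [Lp.coeFn_sub (k.toLp 2 volume) h, SchwartzMap.coeFn_toLp k 2 volume]
      with x h1 h2
    rw [h1, Pi.sub_apply, Pi.sub_apply, h2]
  have hzero : Tendsto (fun k => C * (eLpNorm f 2 volume * ‖(g k).toLp 2 volume - ψ‖ₑ)) atTop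
      (𝓝 0) := by
    have h1 : Tendsto (fun k => ‖(g k).toLp 2 volume - ψ‖ₑ) atTop (𝓝 0) := by
      have := (hlim'.sub_const ψ).enorm
      simpa using this
    have h2 := ENNReal.Tendsto.const_mul (a := C) (ENNReal.Tendsto.const_mul
      (a := eLpNorm f 2 volume) h1 (Or.inr (f.memLp 2 volume).2.ne)) (Or.inr hK.const_ne_top)
    simpa using h2
  have L1 : Tendsto (fun k => ∫ z, f z * apply μ A B γ (g k) z) atTop
      (𝓝 (∫ z, f z * apply μ A B γ ψ z)) := by
    refine (((hK.continuous_integral_mul_apply f).tendsto ψ).comp hlim').congr fun k => ?_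
    refine integral_congr_ae (Eventually.of_forall fun z => ?_)
    simp only [apply]
    congr 1
    refine integral_congr_ae ?_
    have := (Measure.quasiMeasurePreserving_snd (μ := μ) (ν := (volume : Measure W))).ae
      (SchwartzMap.coeFn_toLp (g k) 2 volume)
    filter_upwards [this] with q hq
    rw [hq]
  have L2 : Tendsto (fun k => ∫ ζ, (∫ θ, Γ θ ζ ∂μ) * ((𝓕⁻ f) (A' ζ) * (𝓕 (g k) : 𝓢(W, ℂ)) (B' ζ)))
    atTop
      (𝓝 (∫ ζ, (∫ θ, Γ θ ζ ∂μ) *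
        ((𝓕⁻ f) (A' ζ) * (𝓕 ψ : Lp ℂ 2 (volume : Measure W)) (B' ζ)))) := by
    rw [tendsto_iff_edist_tendsto_0]
    refine tendsto_of_tendsto_of_tendsto_of_le_of_le tendsto_const_nhds hzero
      (fun _ => zero_le) fun k => ?_
    have hgm : Measurable (⇑(𝓕 (g k) : 𝓢(W, ℂ))) :=
      (𝓕 (g k) : 𝓢(W, ℂ)).continuous.measurable
    have hg2 := ((𝓕 (g k) : 𝓢(W, ℂ)).memLp 2 volume).2.ne
    have hψ2 := (Lp.memLp (𝓕 ψ : Lp ℂ 2 (volume : Measure W))).2.ne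
    have hsub : ∀ a b : Lp ℂ 2 (volume : Measure W), 𝓕 (a - b) = 𝓕 a - 𝓕 b := fun a b => by
      rw [sub_eq_add_neg, FourierTransform.fourier_add, FourierTransform.fourier_neg,
        ← sub_eq_add_neg]
    have hnorm : ‖(g k).toLp 2 volume - ψ‖ₑ = eLpNorm (⇑(𝓕 (g k) : 𝓢(W, ℂ)) -
        ⇑(𝓕 ψ : Lp ℂ 2 (volume : Measure W))) 2 volume := by
      rw [hsm, ← SchwartzMap.toLp_fourier_eq, ← hsub, ← ofReal_norm,
        ← ofReal_norm, Lp.norm_fourier_eq]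
    simp only
    rw [edist_eq_enorm_sub, ← integral_sub (key hgm hg2).1 (key (hLm _) hψ2).1, hnorm]
    have hs2 : eLpNorm (⇑(𝓕 (g k) : 𝓢(W, ℂ)) - ⇑(𝓕 ψ : Lp ℂ 2 (volume : Measure W))) 2 volume ≠ ∞
      := by
      rw [← hnorm]; exact enorm_ne_top
    refine le_trans (le_of_eq ?_) (key (hgm.sub (hLm _)) hs2).2
    congr 1
    refine integral_congr_ae (Eventually.of_forall fun ζ => ?_)
    simp only [Pi.sub_apply]; ring
  refine tendsto_nhds_unique L1 (L2.congr fun k => ?_)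
  rw [hK.integral_mul_apply_schwartz]

end PosKernel

end KernelL2

/-! ### The heat kernel of the free Hamiltonian -/

section Heat

variable {M n : ℕ}

/-- The coefficients of the quadratic form `en`. -/
def enCoeff (m : ℝ) (q : (Fin M ⊕ Fin n) × Fin 3) : ℝ :=
  (2 * Real.pi) ^ 2 * Sum.elim (fun _ => 1 / (2 * m)) (fun _ => 1) q.1

theorem enCoeff_pos {m : ℝ} (hm : 0 < m) (q : (Fin M ⊕ Fin n) × Fin 3) : 0 < enCoeff m q := by
  obtain ⟨q | q, j⟩ := q <;> simp only [enCoeff, Sum.elim_inl, Sum.elim_inr] <;> positivity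

theorem en_eq_sum (m : ℝ) (ζ : Cfg M n) : en m ζ = ∑ q, enCoeff m q * ζ q ^ 2 + n := by
  simp only [en, symL, EuclideanSpace.norm_sq_eq, xs, ys, Fintype.sum_prod_type,
    Fintype.sum_sum_type, enCoeff, Sum.elim_inl, Sum.elim_inr, PiLp.smul_apply, smul_eq_mul,
    Real.norm_eq_abs, sq_abs, mul_pow, Finset.mul_sum]
  congr 2
  · refine Finset.sum_congr rfl fun _ _ => Finset.sum_congr rfl fun _ _ => by ring
  · refine Finset.sum_congr rfl fun _ _ => Finset.sum_congr rfl fun _ _ => by ring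

/-- The kernel of the semigroup `exp (-t L)`. -/
def heat (m t : ℝ) (Z : Cfg M n) : ℝ :=
  Real.exp (-(t * n)) *
    ∏ q, √(Real.pi / (t * enCoeff m q)) * Real.exp (-(Real.pi ^ 2 * Z q ^ 2 / (t * enCoeff m q)))

theorem heat_nonneg (m t : ℝ) (Z : Cfg M n) : 0 ≤ heat m t Z := by
  unfold heat; positivity

theorem measurable_heat (m : ℝ) :
    Measurable fun q : ℝ × Cfg M n => heat m q.1 q.2 := by
  unfold heat
  refine Measurable.mul (by fun_prop) (Finset.measurable_prod _ fun q _ => Measurable.mul ?_ ?_)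
  · exact (measurable_const.div (measurable_fst.mul_const _)).sqrt
  · refine Real.measurable_exp.comp (Measurable.neg (Measurable.div ?_ (measurable_fst.mul_const
      _)))
    exact ((EuclideanSpace.proj (𝕜 := ℝ) q).continuous.measurable.comp
      measurable_snd).pow_const 2 |>.const_mul _

@[fun_prop] theorem continuous_heat (m t : ℝ) : Continuous (heat (M := M) (n := n) m t) := by
  unfold heat
  refine continuous_const.mul (continuous_finsetProd _ fun q _ => continuous_const.mul ?_)
  refine Real.continuous_exp.comp (Continuous.neg (Continuous.div_const ?_ _))
  fun_prop

/-- The semigroup `exp (-t L)` has the symbol `exp (-t en)`. -/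
theorem fourierInv_exp_en {m t : ℝ} (hm : 0 < m) (ht : 0 < t) :
    Integrable (fun ζ : Cfg M n => (Real.exp (-(t * en m ζ)) : ℂ)) ∧
    ∀ Z : Cfg M n, 𝓕⁻ (fun ζ : Cfg M n => (Real.exp (-(t * en m ζ)) : ℂ)) Z = (heat m t Z : ℂ) := by
  have hb : ∀ q : (Fin M ⊕ Fin n) × Fin 3, 0 < (((t * enCoeff m q : ℝ)) : ℂ).re := fun q => by
    rw [Complex.ofReal_re]; exact mul_pos ht (enCoeff_pos hm q)
  have key : ∀ (Z : Cfg M n) (v : (Fin M ⊕ Fin n) × Fin 3 → ℝ),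
      Complex.exp ((2 * Real.pi * inner ℝ (WithLp.toLp 2 v : Cfg M n) Z : ℝ) * Complex.I) *
        (Real.exp (-(t * en m (WithLp.toLp 2 v : Cfg M n))) : ℂ) =
      (Real.exp (-(t * n)) : ℂ) * Complex.exp (-∑ q, ((t * enCoeff m q : ℝ) : ℂ) * (v q : ℂ) ^ 2 +
        ∑ q, ((2 * Real.pi * Z q : ℝ) * Complex.I) * (v q : ℂ)) := by
    intro Z v
    rw [Complex.ofReal_exp, Complex.ofReal_exp, ← Complex.exp_add, ← Complex.exp_add]
    congr 1
    have h1 : ((2 * Real.pi * inner ℝ (WithLp.toLp 2 v : Cfg M n) Z : ℝ) : ℂ) * Complex.I =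
        ∑ q, ((2 * Real.pi * Z q : ℝ) * Complex.I) * (v q : ℂ) := by
      rw [PiLp.inner_apply, Finset.mul_sum, Complex.ofReal_sum, Finset.sum_mul]
      refine Finset.sum_congr rfl fun q _ => ?_
      simp only [RCLike.inner_apply, conj_trivial]
      push_cast; ring
    have h2 : ((-(t * en m (WithLp.toLp 2 v : Cfg M n)) : ℝ) : ℂ) =
        ((-(t * n) : ℝ) : ℂ) + -∑ q, ((t * enCoeff m q : ℝ) : ℂ) * (v q : ℂ) ^ 2 := by
      rw [en_eq_sum, mul_add, Finset.mul_sum]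
      push_cast
      simp only [mul_assoc]
      ring
    rw [h1, h2]
    ring
  have hvol := PiLp.volume_preserving_toLp ((Fin M ⊕ Fin n) × Fin 3)
  have hemb := (MeasurableEquiv.toLp 2 ((Fin M ⊕ Fin n) × Fin 3 → ℝ)).measurableEmbedding
  constructor
  · rw [← hvol.integrable_comp_emb hemb]
    have := (GaussianFourier.integrable_cexp_neg_sum_mul_add hb fun _ => 0).const_mul
      (Real.exp (-(t * n)) : ℂ)
    refine this.congr (Eventually.of_forall fun v => ?_)
    have := key 0 v
    simp only [inner_zero_right, mul_zero, Complex.ofReal_zero, zero_mul, Complex.exp_zero, one_mul,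
      PiLp.zero_apply] at this
    simpa using this.symm
  · intro Z
    rw [Real.fourierInv_eq', ← hvol.integral_comp hemb]
    simp only [smul_eq_mul]
    rw [integral_congr_ae (Eventually.of_forall (key Z)), integral_const_mul,
      GaussianFourier.integral_cexp_neg_sum_mul_add hb, heat, Complex.ofReal_mul,
      Complex.ofReal_prod]
    congr 1
    refine Finset.prod_congr rfl fun q _ => ?_
    have hp : 0 < t * enCoeff m q := mul_pos ht (enCoeff_pos hm q)
    have h1 : ((Real.pi : ℂ) / ((t * enCoeff m q : ℝ) : ℂ)) ^ (1 / 2 : ℂ) =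
        ((√(Real.pi / (t * enCoeff m q)) : ℝ) : ℂ) := by
      rw [Real.sqrt_eq_rpow, Complex.ofReal_cpow (by positivity)]
      push_cast; rfl
    have h2 : (((2 * Real.pi * Z q : ℝ) : ℂ) * Complex.I) ^ 2 / (4 * ((t * enCoeff m q : ℝ) : ℂ)) =
        ((-(Real.pi ^ 2 * Z q ^ 2 / (t * enCoeff m q)) : ℝ) : ℂ) := by
      have : ((t * enCoeff m q : ℝ) : ℂ) ≠ 0 := by exact_mod_cast hp.ne'
      rw [mul_pow, Complex.I_sq]
      push_cast at this ⊢
      field_simp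
      ring
    rw [h1, h2, Complex.ofReal_mul, Complex.ofReal_exp]

/-- The resolvent is the time integral of the semigroup. -/
theorem integral_exp_en {m : ℝ} (hm : 0 < m) (ζ : Cfg M (n + 1)) :
    IntegrableOn (fun t => Real.exp (-(t * en m ζ))) (Set.Ioi 0) ∧
    ∫ t in Set.Ioi 0, Real.exp (-(t * en m ζ)) = (en m ζ)⁻¹ := by
  have h := en_pos hm ζ
  have h1 := integrableOn_exp_mul_Ioi (a := -en m ζ) (by linarith) 0
  have h2 := integral_exp_mul_Ioi (a := -en m ζ) (by linarith) 0
  have h3 : ∀ t, -en m ζ * t = -(t * en m ζ) := fun t => by ring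
  simp only [h3] at h1 h2
  refine ⟨h1, h2.trans ?_⟩
  simp

theorem heat_permL (m t : ℝ) (τ : Equiv.Perm (Fin n)) (Z : Cfg M n) :
    heat m t (permL τ Z) = heat m t Z := by
  simp only [heat, Fintype.prod_prod_type, Fintype.prod_sum_type, enCoeff, Sum.elim_inl,
    Sum.elim_inr]
  congr 2
  exact Equiv.prod_comp τ (fun i => ∏ j, √(Real.pi / (t * ((2 * Real.pi) ^ 2 * 1))) *
    Real.exp (-(Real.pi ^ 2 * Z (Sum.inr i, j) ^ 2 / (t * ((2 * Real.pi) ^ 2 * 1)))))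

/-- The rate in the Gaussian bound for the heat kernel. -/
def heatRate (m : ℝ) : ℝ := min (m / 2) (1 / 4)

theorem heatRate_pos {m : ℝ} (hm : 0 < m) : 0 < heatRate m := lt_min (by positivity) (by norm_num)

/-- The constant in the Gaussian bound for the heat kernel. -/
def heatConst (M n : ℕ) (m : ℝ) : ℝ :=
  ∏ q : (Fin M ⊕ Fin n) × Fin 3, √(Real.pi / enCoeff m q)

theorem heatConst_nonneg (m : ℝ) : 0 ≤ heatConst M n m := by
  unfold heatConst; positivity

/-- The Gaussian bound for the heat kernel. -/
theorem heat_le {m t : ℝ} (hm : 0 < m) (ht : 0 < t) (Z : Cfg M n) :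
    heat m t Z ≤ heatConst M n m * (√t)⁻¹ ^ Fintype.card ((Fin M ⊕ Fin n) × Fin 3) *
      Real.exp (-(t * n)) * Real.exp (-(heatRate m * ‖Z‖ ^ 2 / t)) := by
  have hc : ∀ q : (Fin M ⊕ Fin n) × Fin 3, heatRate m ≤ Real.pi ^ 2 / enCoeff m q := by
    rintro ⟨q | q, j⟩ <;> simp only [enCoeff, Sum.elim_inl, Sum.elim_inr, heatRate]
    · refine (min_le_left _ _).trans (le_of_eq ?_)
      have := Real.pi_pos
      field_simp
    · refine (min_le_right _ _).trans (le_of_eq ?_)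
      have := Real.pi_pos
      field_simp; norm_num
  have h1 : ∀ q : (Fin M ⊕ Fin n) × Fin 3, √(Real.pi / (t * enCoeff m q)) *
      Real.exp (-(Real.pi ^ 2 * Z q ^ 2 / (t * enCoeff m q))) ≤
      √(Real.pi / enCoeff m q) * (√t)⁻¹ * Real.exp (-(heatRate m * Z q ^ 2 / t)) := by
    intro q
    have hq := enCoeff_pos hm q
    gcongr ?_ * Real.exp (-?_)
    · rw [← Real.sqrt_inv, ← Real.sqrt_mul (by positivity)]
      refine le_of_eq (congrArg _ ?_)
      field_simp
    · calc heatRate m * Z q ^ 2 / t ≤ Real.pi ^ 2 / enCoeff m q * Z q ^ 2 / t := by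
            gcongr; exact hc q
        _ = _ := by field_simp
  calc heat m t Z ≤ Real.exp (-(t * n)) * ∏ q, √(Real.pi / enCoeff m q) * (√t)⁻¹ *
        Real.exp (-(heatRate m * Z q ^ 2 / t)) := by
        unfold heat
        exact mul_le_mul_of_nonneg_left (Finset.prod_le_prod (fun q _ => by positivity)
          fun q _ => h1 q) (Real.exp_pos _).le
    _ = _ := by
        rw [Finset.prod_mul_distrib, Finset.prod_mul_distrib, ← Real.exp_sum, heatConst,
          Finset.prod_const, Finset.card_univ]
        have : ∑ q, -(heatRate m * Z q ^ 2 / t) = -(heatRate m * ‖Z‖ ^ 2 / t) := by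
          rw [EuclideanSpace.norm_sq_eq]
          simp only [Finset.sum_neg_distrib, Real.norm_eq_abs, sq_abs, mul_div_assoc,
            Finset.mul_sum, Finset.sum_div]
        rw [this]; ring

end Heat

/-! ### The subordination formula -/

section Subordination

/-- The primitive of the Gaussian function. -/
def gaussPrim (x : ℝ) : ℝ := ∫ s in (0 : ℝ)..x, Real.exp (-1 * s ^ 2)

theorem hasDerivAt_gaussPrim (x : ℝ) : HasDerivAt gaussPrim (Real.exp (-1 * x ^ 2)) x :=
  intervalIntegral.integral_hasDerivAt_right (by apply Continuous.intervalIntegrable; fun_prop)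
    (by apply Continuous.stronglyMeasurableAtFilter; fun_prop) (by fun_prop)

theorem tendsto_gaussPrim_atTop : Tendsto gaussPrim atTop (𝓝 (√Real.pi / 2)) := by
  have h := intervalIntegral_tendsto_integral_Ioi (0 : ℝ)
    (integrable_exp_neg_mul_sq one_pos).integrableOn tendsto_id
  rw [integral_gaussian_Ioi 1, div_one] at h
  exact h

theorem gaussPrim_neg (x : ℝ) : gaussPrim (-x) = -gaussPrim x := by
  have := intervalIntegral.integral_comp_neg (a := 0) (b := x)
    (fun s : ℝ => Real.exp (-1 * s ^ 2))
  simp only [neg_sq, neg_zero] at this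
  rw [gaussPrim, gaussPrim, this, intervalIntegral.integral_symm]

theorem tendsto_gaussPrim_atBot : Tendsto gaussPrim atBot (𝓝 (-(√Real.pi / 2))) := by
  have h := (tendsto_gaussPrim_atTop.comp tendsto_neg_atBot_atTop).neg
  refine h.congr fun x => ?_
  simp [gaussPrim_neg]

/-- The subordination formula, in the form of an explicit primitive. -/
theorem subordination_aux {a b : ℝ} (ha : 0 < a) (hb : 0 < b) :
    IntegrableOn (fun t => (√t)⁻¹ ^ 3 * Real.exp (-(a ^ 2 / t + b ^ 2 * t))) (Set.Ioi 0) ∧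
    ∫ t in Set.Ioi 0, (√t)⁻¹ ^ 3 * Real.exp (-(a ^ 2 / t + b ^ 2 * t)) =
      √Real.pi / a * Real.exp (-(2 * a * b)) := by
  -- a primitive of the integrand, and its limits at `0` and `∞`
  let F : ℝ → ℝ := fun t => -(1 / a) * (Real.exp (-(2 * a * b)) * gaussPrim (a * (√t)⁻¹ - b * √t) +
    Real.exp (2 * a * b) * gaussPrim (a * (√t)⁻¹ + b * √t))
  let l₀ : ℝ := -(1 / a) * (Real.exp (-(2 * a * b)) * (√Real.pi / 2) +
    Real.exp (2 * a * b) * (√Real.pi / 2))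
  let l₁ : ℝ := -(1 / a) * (Real.exp (-(2 * a * b)) * (-(√Real.pi / 2)) +
    Real.exp (2 * a * b) * (√Real.pi / 2))
  have hs0 : Tendsto (fun t : ℝ => √t) (𝓝[>] 0) (𝓝[>] 0) := by
    refine tendsto_nhdsWithin_iff.2 ⟨?_, ?_⟩
    · have := Real.continuous_sqrt.tendsto 0
      rw [Real.sqrt_zero] at this
      exact this.mono_left nhdsWithin_le_nhds
    · filter_upwards [self_mem_nhdsWithin] with t ht using Real.sqrt_pos.2 ht
  have hi0 : Tendsto (fun t : ℝ => a * (√t)⁻¹) (𝓝[>] 0) atTop :=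
    (tendsto_inv_nhdsGT_zero.comp hs0).const_mul_atTop ha
  have hb0 : Tendsto (fun t : ℝ => b * √t) (𝓝[>] 0) (𝓝 0) := by
    have := (hs0.mono_right nhdsWithin_le_nhds).const_mul b
    simpa using this
  have hF0 : Tendsto F (𝓝[>] 0) (𝓝 l₀) := by
    refine Tendsto.const_mul _ (Tendsto.add (Tendsto.const_mul _ ?_) (Tendsto.const_mul _ ?_))
    · refine tendsto_gaussPrim_atTop.comp ?_
      simpa [sub_eq_add_neg] using hi0.atTop_add hb0.neg
    · exact tendsto_gaussPrim_atTop.comp (hi0.atTop_add hb0)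
  have hs1 : Tendsto (fun t : ℝ => b * √t) atTop atTop :=
    Real.tendsto_sqrt_atTop.const_mul_atTop hb
  have hi1 : Tendsto (fun t : ℝ => a * (√t)⁻¹) atTop (𝓝 0) := by
    have := (tendsto_inv_atTop_zero.comp Real.tendsto_sqrt_atTop).const_mul a
    simpa using this
  have hF1 : Tendsto F atTop (𝓝 l₁) := by
    refine Tendsto.const_mul _ (Tendsto.add (Tendsto.const_mul _ ?_) (Tendsto.const_mul _ ?_))
    · refine tendsto_gaussPrim_atBot.comp ?_
      simpa [sub_eq_add_neg] using hi1.add_atBot (tendsto_neg_atTop_atBot.comp hs1)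
    · exact tendsto_gaussPrim_atTop.comp (hi1.add_atTop hs1)
  have hd : ∀ t ∈ Set.Ioi (0 : ℝ), HasDerivAt F
      ((√t)⁻¹ ^ 3 * Real.exp (-(a ^ 2 / t + b ^ 2 * t))) t := by
    intro t ht
    have ht' : (0 : ℝ) < t := ht
    have hst : 0 < √t := Real.sqrt_pos.2 ht'
    have h1 := Real.hasDerivAt_sqrt ht'.ne'
    have h2 := h1.inv hst.ne'
    have h3 := (hasDerivAt_gaussPrim (a * (√t)⁻¹ - b * √t)).comp t
      ((h2.const_mul a).sub (h1.const_mul b))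
    have h4 := (hasDerivAt_gaussPrim (a * (√t)⁻¹ + b * √t)).comp t
      ((h2.const_mul a).add (h1.const_mul b))
    have h5 := ((h3.const_mul (Real.exp (-(2 * a * b)))).add
      (h4.const_mul (Real.exp (2 * a * b)))).const_mul (-(1 / a))
    refine h5.congr_deriv ?_
    have hsq : √t ^ 2 = t := Real.sq_sqrt ht'.le
    have e1 : Real.exp (-1 * (a * (√t)⁻¹ - b * √t) ^ 2) =
        Real.exp (-(a ^ 2 / t + b ^ 2 * t)) * Real.exp (2 * a * b) := by
      rw [← Real.exp_add]; congr 1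
      rw [sub_sq, mul_pow, mul_pow, inv_pow, hsq]; field_simp; ring
    have e2 : Real.exp (-1 * (a * (√t)⁻¹ + b * √t) ^ 2) =
        Real.exp (-(a ^ 2 / t + b ^ 2 * t)) * Real.exp (-(2 * a * b)) := by
      rw [← Real.exp_add]; congr 1
      rw [add_sq, mul_pow, mul_pow, inv_pow, hsq]; field_simp; ring
    rw [e1, e2]
    have e3 : Real.exp (-(2 * a * b)) * Real.exp (2 * a * b) = 1 := by
      rw [← Real.exp_add]; simp
    generalize Real.exp (-(a ^ 2 / t + b ^ 2 * t)) = X at *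
    generalize Real.exp (-(2 * a * b)) = Y at *
    generalize Real.exp (2 * a * b) = Y' at *
    have e4 : -(1 / a) * (Y * (X * Y' * (a * (-(1 / (2 * √t)) / √t ^ 2) - b * (1 / (2 * √t)))) +
        Y' * (X * Y * (a * (-(1 / (2 * √t)) / √t ^ 2) + b * (1 / (2 * √t))))) =
        -(1 / a) * X * (Y * Y') * (2 * a * (-(1 / (2 * √t)) / √t ^ 2)) := by ring
    rw [e4, e3]
    field_simp
  have hc : ContinuousWithinAt (Function.update F 0 l₀) (Set.Ici 0) 0 := by
    rw [continuousWithinAt_update_same]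
    refine hF0.mono_left (le_of_eq ?_)
    congr 1
    exact Set.Ici_sdiff_left
  have hd' : ∀ t ∈ Set.Ioi (0 : ℝ), HasDerivAt (Function.update F 0 l₀)
      ((√t)⁻¹ ^ 3 * Real.exp (-(a ^ 2 / t + b ^ 2 * t))) t := by
    intro t ht
    refine (hd t ht).congr_of_eventuallyEq ?_
    filter_upwards [Ioi_mem_nhds ht] with s hs
    exact Function.update_of_ne (ne_of_gt hs) _ _
  have hlim : Tendsto (Function.update F 0 l₀) atTop (𝓝 l₁) := by
    refine hF1.congr' ?_
    filter_upwards [eventually_gt_atTop 0] with s hs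
    exact (Function.update_of_ne (ne_of_gt hs) _ _).symm
  have hp : ∀ t ∈ Set.Ioi (0 : ℝ), 0 ≤ (√t)⁻¹ ^ 3 * Real.exp (-(a ^ 2 / t + b ^ 2 * t)) :=
    fun t _ => by positivity
  refine ⟨integrableOn_Ioi_deriv_of_nonneg hc hd' hp hlim, ?_⟩
  rw [integral_Ioi_of_hasDerivAt_of_nonneg hc hd' hp hlim, Function.update_self]
  simp only [l₀, l₁]
  ring

/-- The subordination formula for the kernel of `exp (-r √(αΛ))` in three dimensions. -/
theorem subordination {α r Λ : ℝ} (hα : 0 < α) (hr : 0 < r) (hΛ : 0 < Λ) :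
    IntegrableOn (fun t => √(α / (4 * Real.pi * t)) ^ 3 *
      Real.exp (-(t * Λ + α * r ^ 2 / (4 * t)))) (Set.Ioi 0) ∧
    ∫ t in Set.Ioi 0, √(α / (4 * Real.pi * t)) ^ 3 *
      Real.exp (-(t * Λ + α * r ^ 2 / (4 * t))) =
      α / (4 * Real.pi * r) * Real.exp (-(r * √(α * Λ))) := by
  have ha : 0 < r * √α / 2 := by positivity
  have hb : 0 < √Λ := Real.sqrt_pos.2 hΛ
  obtain ⟨h1, h2⟩ := subordination_aux ha hb
  have hfun : Set.EqOn (fun t => √(α / (4 * Real.pi)) ^ 3 * ((√t)⁻¹ ^ 3 *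
      Real.exp (-((r * √α / 2) ^ 2 / t + √Λ ^ 2 * t)))) (fun t => √(α / (4 * Real.pi * t)) ^ 3 *
      Real.exp (-(t * Λ + α * r ^ 2 / (4 * t)))) (Set.Ioi 0) := by
    intro t ht
    have ht' : (0 : ℝ) < t := ht
    simp only
    rw [← mul_assoc, ← mul_pow, ← Real.sqrt_inv, ← Real.sqrt_mul (by positivity),
      Real.sq_sqrt hΛ.le, div_pow, mul_pow, Real.sq_sqrt hα.le]
    congr 2
    · congr 1; field_simp
    · congr 1; field_simp; ring
  constructor
  · exact IntegrableOn.congr_fun (h1.const_mul _) hfun measurableSet_Ioi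
  · rw [← setIntegral_congr_fun measurableSet_Ioi hfun, integral_const_mul, h2]
    have hπ := Real.pi_pos
    have e : 2 * (r * √α / 2) * √Λ = r * √(α * Λ) := by rw [Real.sqrt_mul hα.le]; ring
    rw [e, ← mul_assoc]
    congr 1
    rw [Real.sqrt_div hα.le, Real.sqrt_mul (by norm_num), show (4 : ℝ) = 2 ^ 2 by norm_num,
      Real.sqrt_sq (by norm_num)]
    have h3 : √α ^ 2 = α := Real.sq_sqrt hα.le
    have h4 : √Real.pi ^ 2 = Real.pi := Real.sq_sqrt hπ.le
    have h5 : 0 < √α := Real.sqrt_pos.2 hα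
    have h6 : 0 < √Real.pi := Real.sqrt_pos.2 hπ
    rw [div_pow, mul_pow]
    field_simp
    rw [h3, h4]; ring

end Subordination

/-! ### The heat kernel on the planes `y_{n+1} = x_μ + v` -/

section DiagonalSymbol

variable {M n : ℕ}

/-- The reduced mass parameter `2m / (2m + 1)`. -/
def redMass (m : ℝ) : ℝ := 2 * m / (2 * m + 1)

theorem redMass_pos {m : ℝ} (hm : 0 < m) : 0 < redMass m := by unfold redMass; positivity

/-- The energy `n + 1 + p_μ²/(2m+1) + P̂_μ²/(2m) + K²` of the diagonal part of `T`, as a function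
of the momentum `p = (P, K)`. -/
def lam (m : ℝ) (μ : Fin M) (p : Cfg M n) : ℝ :=
  (n : ℝ) + 1 + 1 / (2 * m + 1) * ‖xs p μ‖ ^ 2
    + 1 / (2 * m) * (∑ ν ∈ Finset.univ.erase μ, ‖xs p ν‖ ^ 2) + (∑ i, ‖ys p i‖ ^ 2)

theorem one_le_lam {m : ℝ} (hm : 0 < m) (μ : Fin M) (p : Cfg M n) : 1 ≤ lam m μ p := by
  have h1 : 0 ≤ 1 / (2 * m + 1) * ‖xs p μ‖ ^ 2 := by positivity
  have h2 : 0 ≤ 1 / (2 * m) * (∑ ν ∈ Finset.univ.erase μ, ‖xs p ν‖ ^ 2) := by positivity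
  have h3 : 0 ≤ ∑ i, ‖ys p i‖ ^ 2 := by positivity
  have h4 : (0 : ℝ) ≤ n := by positivity
  unfold lam; linarith

theorem lam_pos {m : ℝ} (hm : 0 < m) (μ : Fin M) (p : Cfg M n) : 0 < lam m μ p :=
  one_pos.trans_le (one_le_lam hm μ p)

@[fun_prop] theorem continuous_lam (m : ℝ) (μ : Fin M) :
    Continuous (lam (n := n) m μ) := by
  unfold lam; fun_prop

/-- Completing the square in the momentum of the last y-particle. -/
theorem en_shear {m : ℝ} (hm : 0 < m) (μ : Fin M) (p : Cfg M n) (ξ : R3) :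
    en m (shear μ (p, ξ)) = lam m μ ((2 * Real.pi) • p) +
      (2 * Real.pi) ^ 2 / redMass m * ‖ξ - (1 / (2 * m + 1)) • xs p μ‖ ^ 2 := by
  have hx : ∑ ν, ‖xs (shear μ (p, ξ)) ν‖ ^ 2 =
      ‖xs p μ - ξ‖ ^ 2 + ∑ ν ∈ Finset.univ.erase μ, ‖xs p ν‖ ^ 2 := by
    rw [← Finset.add_sum_erase _ _ (Finset.mem_univ μ)]
    congr 1
    · simp [shear_apply, subX]
    · refine Finset.sum_congr rfl fun ν hν => ?_
      have := Finset.ne_of_mem_erase hν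
      simp [shear_apply, subX, Pi.single_eq_of_ne this]
  have hy : ∑ i, ‖ys (shear μ (p, ξ)) i‖ ^ 2 = (∑ i, ‖ys p i‖ ^ 2) + ‖ξ‖ ^ 2 := by
    rw [Fin.sum_univ_castSucc]
    simp [shear_apply]
  have hsc : ∀ (k : ℕ) (q : Cfg M k), en m q = (2 * Real.pi) ^ 2 *
      (1 / (2 * m) * (∑ ν, ‖xs q ν‖ ^ 2) + (∑ i, ‖ys q i‖ ^ 2)) + k := by
    intro k q
    simp only [en, symL, xs_smul, ys_smul, Pi.smul_apply, norm_smul, mul_pow, ← Finset.mul_sum,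
      Real.norm_eq_abs, sq_abs]
    ring
  have hl : lam m μ ((2 * Real.pi) • p) = (2 * Real.pi) ^ 2 * (1 / (2 * m + 1) * ‖xs p μ‖ ^ 2
    + 1 / (2 * m) * (∑ ν ∈ Finset.univ.erase μ, ‖xs p ν‖ ^ 2) + (∑ i, ‖ys p i‖ ^ 2)) + (n + 1) := by
    simp only [lam, xs_smul, ys_smul, Pi.smul_apply, norm_smul, mul_pow, ← Finset.mul_sum,
      Real.norm_eq_abs, sq_abs]
    ring
  rw [hsc, hl, hx, hy, norm_sub_sq_real, norm_sub_sq_real, inner_smul_right, norm_smul,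
    mul_pow ‖_‖, real_inner_comm, Real.norm_eq_abs, sq_abs, redMass]
  push_cast
  field_simp
  ring

/-- The symbol of the operator whose kernel is the restriction of the heat kernel to the planes
`y_{n+1} = x_μ + v`. -/
def diagSym (m : ℝ) (μ : Fin M) (t : ℝ) (v : R3) (p : Cfg M n) : ℂ :=
  ((√(redMass m / (4 * Real.pi * t)) ^ 3 *
    Real.exp (-(t * lam m μ ((2 * Real.pi) • p) + redMass m * ‖v‖ ^ 2 / (4 * t))) : ℝ) : ℂ) *
  Complex.exp ((2 * Real.pi * inner ℝ v ((1 / (2 * m + 1)) • xs p μ) : ℝ) * Complex.I)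

/-- The momentum of the last y-particle is integrated out, by completing the square. -/
theorem integral_diagSym {m t : ℝ} (hm : 0 < m) (ht : 0 < t) (μ : Fin M) (v : R3) (p : Cfg M n) :
    ∫ ξ, Complex.exp ((2 * Real.pi * inner ℝ ξ v : ℝ) * Complex.I) *
      (Real.exp (-(t * en m (shear μ (p, ξ)))) : ℂ) = diagSym m μ t v p := by
  have hα := redMass_pos hm
  set b : ℝ := t * ((2 * Real.pi) ^ 2 / redMass m) with hb
  have hbp : 0 < b := by positivity
  set s : R3 := (1 / (2 * m + 1)) • xs p μ with hs
  have key : ∀ η : R3, Complex.exp ((2 * Real.pi * inner ℝ (η + s) v : ℝ) * Complex.I) *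
      (Real.exp (-(t * en m (shear μ (p, η + s)))) : ℂ) =
      (Real.exp (-(t * lam m μ ((2 * Real.pi) • p))) : ℂ) *
        Complex.exp ((2 * Real.pi * inner ℝ v s : ℝ) * Complex.I) *
      Complex.exp (-(b : ℂ) * ‖η‖ ^ 2 + ((2 * Real.pi : ℝ) * Complex.I) * (inner ℝ v η : ℝ)) := by
    intro η
    rw [en_shear hm, ← hs, add_sub_cancel_right, Complex.ofReal_exp, Complex.ofReal_exp,
      ← Complex.exp_add, ← Complex.exp_add, ← Complex.exp_add, inner_add_left, real_inner_comm,
      real_inner_comm v s, hb]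
    congr 1
    push_cast
    ring
  rw [← integral_add_right_eq_self _ s, integral_congr_ae (Eventually.of_forall key),
    integral_const_mul, GaussianFourier.integral_cexp_neg_mul_sq_norm_add (by simpa using hbp)]
  have h1 : ((Real.pi : ℂ) / (b : ℂ)) ^ ((Module.finrank ℝ R3 : ℂ) / 2) =
      ((√(redMass m / (4 * Real.pi * t)) ^ 3 : ℝ) : ℂ) := by
    have e : redMass m / (4 * Real.pi * t) = Real.pi / b := by
      rw [hb]; have := Real.pi_pos; field_simp; norm_num
    rw [e, Real.sqrt_eq_rpow, ← Real.rpow_natCast, ← Real.rpow_mul (by positivity),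
      Complex.ofReal_cpow (by positivity)]
    simp
    norm_num
  have h2 : (((2 * Real.pi : ℝ) : ℂ) * Complex.I) ^ 2 * (‖v‖ : ℂ) ^ 2 / (4 * (b : ℂ)) =
      ((-(redMass m * ‖v‖ ^ 2 / (4 * t)) : ℝ) : ℂ) := by
    have e : (redMass m : ℂ) ≠ 0 := by exact_mod_cast hα.ne'
    have e2 : (t : ℂ) ≠ 0 := by exact_mod_cast ht.ne'
    have e3 : (Real.pi : ℂ) ≠ 0 := by exact_mod_cast Real.pi_pos.ne'
    rw [hb, mul_pow, Complex.I_sq]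
    push_cast
    field_simp
  rw [h1, h2, diagSym, neg_add, Real.exp_add, ← Complex.ofReal_exp]
  push_cast
  ring

/-- The heat kernel restricted to the plane `y_{n+1} = x_μ + v` has the Fourier transform
`diagSym`. -/
theorem fourierInv_diagSym {m t : ℝ} (hm : 0 < m) (ht : 0 < t) (μ : Fin M) (v : R3) :
    Integrable (diagSym (n := n) m μ t v) ∧
    ∀ z : Cfg M n, 𝓕⁻ (diagSym (n := n) m μ t v) z =
      (heat m t (diagL μ z + lastL v) : ℂ) := by
  obtain ⟨hint, hfou⟩ := fourierInv_exp_en (M := M) (n := n + 1) hm ht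
  have hmp := measurePreserving_shear (n := n) μ
  have hemb := (shear (n := n) μ).measurableEmbedding
  have hch : ∀ z : Cfg M n, Integrable (fun q : Cfg M n × R3 =>
      Complex.exp ((2 * Real.pi * inner ℝ q.1 z : ℝ) * Complex.I) *
      (Complex.exp ((2 * Real.pi * inner ℝ q.2 v : ℝ) * Complex.I) *
      (Real.exp (-(t * en m (shear μ q))) : ℂ))) := by
    intro z
    have h1 := (hmp.integrable_comp_emb hemb).2 hint
    have hc : Continuous fun q : Cfg M n × R3 =>
      Complex.exp ((2 * Real.pi * inner ℝ q.1 z : ℝ) * Complex.I) *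
      Complex.exp ((2 * Real.pi * inner ℝ q.2 v : ℝ) * Complex.I) := by fun_prop
    have := h1.bdd_mul (c := 1) hc.aestronglyMeasurable (Eventually.of_forall fun q => by
      rw [norm_mul, Complex.norm_exp_ofReal_mul_I, Complex.norm_exp_ofReal_mul_I, one_mul])
    refine this.congr (Eventually.of_forall fun q => ?_)
    simp only [Function.comp_apply]; ring
  have hinner : ∀ (z p : Cfg M n), ∫ ξ : R3,
      Complex.exp ((2 * Real.pi * inner ℝ p z : ℝ) * Complex.I) *
      (Complex.exp ((2 * Real.pi * inner ℝ ξ v : ℝ) * Complex.I) *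
      (Real.exp (-(t * en m (shear μ (p, ξ)))) : ℂ)) =
      Complex.exp ((2 * Real.pi * inner ℝ p z : ℝ) * Complex.I) * diagSym m μ t v p := by
    intro z p
    rw [integral_const_mul, integral_diagSym hm ht]
  constructor
  · have h0 := hch 0
    rw [Measure.volume_eq_prod] at h0
    have := h0.integral_prod_left
    refine this.congr (Eventually.of_forall fun p => ?_)
    have h1 := hinner 0 p
    simp only [inner_zero_right, mul_zero, Complex.ofReal_zero, zero_mul, Complex.exp_zero,
      one_mul] at h1 ⊢
    exact h1
  · intro z
    have hz := hch z
    rw [← hfou, Real.fourierInv_eq', Real.fourierInv_eq', ← hmp.integral_comp hemb]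
    have e : ∀ q : Cfg M n × R3, Complex.exp ((2 * Real.pi *
        inner ℝ (shear μ q) (diagL μ z + lastL v) : ℝ) * Complex.I) •
        (Real.exp (-(t * en m (shear μ q))) : ℂ) =
        Complex.exp ((2 * Real.pi * inner ℝ q.1 z : ℝ) * Complex.I) *
        (Complex.exp ((2 * Real.pi * inner ℝ q.2 v : ℝ) * Complex.I) *
        (Real.exp (-(t * en m (shear μ q))) : ℂ)) := by
      intro q
      rw [inner_add_right, real_inner_comm, inner_diagL, totalL_shear, real_inner_comm (lastL v),
        inner_lastL, last_shear, real_inner_comm q.1, real_inner_comm q.2, mul_add,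
        Complex.ofReal_add, add_mul, Complex.exp_add, smul_eq_mul, mul_assoc]
    rw [integral_congr_ae (Eventually.of_forall e), Measure.volume_eq_prod,
      integral_prod _ (by rwa [← Measure.volume_eq_prod])]
    refine integral_congr_ae (Eventually.of_forall fun p => ?_)
    exact (hinner z p).symm

end DiagonalSymbol

/-! ### Averages over times and directions -/

section SphereAverage

/-- The unit sphere. -/
abbrev S2 : Type := Metric.sphere (0 : R3) 1

/-- The normalised surface measure of the unit sphere. -/
def sphAvg : Measure S2 := ENNReal.ofReal (1 / (4 * Real.pi)) • (volume : Measure R3).toSphere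

instance : IsFiniteMeasure sphAvg := by
  refine ⟨?_⟩
  rw [sphAvg, Measure.smul_apply, smul_eq_mul]
  exact ENNReal.mul_lt_top ENNReal.ofReal_lt_top (measure_lt_top _ _)

theorem integral_sphAvg (f : S2 → ℂ) :
    ∫ ω, f ω ∂sphAvg = ((1 / (4 * Real.pi) : ℝ) : ℂ) * ∫ ω, f ω ∂(volume : Measure R3).toSphere :=
      by
  rw [sphAvg, integral_smul_measure, ENNReal.toReal_ofReal (by positivity), Complex.real_smul]

theorem integral_sphAvg_char (v : R3) :
    ∫ ω, Complex.exp ((inner ℝ v (ω : R3) : ℝ) * Complex.I) ∂sphAvg = (Real.sinc ‖v‖ : ℝ) := by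
  rw [integral_sphAvg, integral_sphere_char, ← Complex.ofReal_mul]
  congr 1
  have := Real.pi_pos
  field_simp

instance : IsProbabilityMeasure sphAvg := ⟨by
  have h := integral_sphAvg_char 0
  simp only [inner_zero_left, Complex.ofReal_zero, zero_mul, Complex.exp_zero, norm_zero,
    Real.sinc_zero, integral_const, Complex.ofReal_one] at h
  rw [measureReal_def, Complex.real_smul, mul_one] at h
  have h2 : (sphAvg Set.univ).toReal = 1 := by exact_mod_cast h
  rw [← ENNReal.ofReal_toReal (measure_ne_top sphAvg Set.univ), h2, ENNReal.ofReal_one]⟩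

theorem integrable_sphAvg_iff {f : S2 → ℂ} :
    Integrable f sphAvg ↔ Integrable f (volume : Measure R3).toSphere :=
  integrable_smul_measure (by simp [Real.pi_pos]) ENNReal.ofReal_ne_top

/-- The measure `dt dω / 4π` on pairs of a time and a direction. -/
def timeSph : Measure (ℝ × S2) := (volume.restrict (Set.Ioi 0)).prod sphAvg

instance : SFinite timeSph := by unfold timeSph; infer_instance

theorem integral_timeSph_char {a : ℝ → ℝ} (v : R3) :
    ∫ θ, (a θ.1 : ℂ) * Complex.exp ((inner ℝ v (θ.2 : R3) : ℝ) * Complex.I) ∂timeSph =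
      ((∫ t in Set.Ioi 0, a t : ℝ) : ℂ) * (Real.sinc ‖v‖ : ℝ) := by
  have h := integral_prod_mul (μ := volume.restrict (Set.Ioi 0)) (ν := sphAvg)
    (fun t : ℝ => (a t : ℂ))
    (fun ω : S2 => Complex.exp ((inner ℝ v (ω : R3) : ℝ) * Complex.I))
  rw [timeSph, h, integral_sphAvg_char, integral_complex_ofReal]

theorem lintegral_timeSph {a : ℝ → ℝ} (ha : IntegrableOn a (Set.Ioi 0)) (h0 : ∀ t, 0 ≤ a t)
    (v : R3) :
    ∫⁻ θ, ‖(a θ.1 : ℂ) * Complex.exp ((inner ℝ v (θ.2 : R3) : ℝ) * Complex.I)‖ₑ ∂timeSph =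
      ENNReal.ofReal (∫ t in Set.Ioi 0, a t) := by
  have h1 : ∀ θ : ℝ × S2, ‖(a θ.1 : ℂ) * Complex.exp ((inner ℝ v (θ.2 : R3) : ℝ) * Complex.I)‖ₑ =
      ENNReal.ofReal (a θ.1) := by
    intro θ
    rw [← ofReal_norm, norm_mul, Complex.norm_exp_ofReal_mul_I, mul_one, Complex.norm_real,
      Real.norm_of_nonneg (h0 _)]
  simp_rw [h1]
  rw [timeSph, lintegral_prod _ (ha.aestronglyMeasurable.aemeasurable.ennreal_ofReal.comp_fst)]
  simp only [lintegral_const, measure_univ, mul_one]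
  rw [ofReal_integral_eq_lintegral_ofReal ha (Eventually.of_forall h0)]

theorem ae_timeSph {p : ℝ × S2 → Prop} (h : ∀ t : ℝ, 0 < t → ∀ ω, p (t, ω)) :
    ∀ᵐ θ ∂timeSph, p θ := by
  have h1 : ∀ᵐ t ∂(volume.restrict (Set.Ioi (0 : ℝ))), 0 < t := by
    filter_upwards [ae_restrict_mem measurableSet_Ioi] with t ht using ht
  have h2 := Measure.quasiMeasurePreserving_fst (μ := volume.restrict (Set.Ioi (0 : ℝ)))
    (ν := sphAvg)
  filter_upwards [h2.ae h1] with θ hθ using h θ.1 hθ θ.2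

end SphereAverage

/-! ### The free resolvent as a nonnegative kernel -/

section Kernels

variable {M n : ℕ}

/-- The Cauchy–Schwarz inequality. -/
theorem lintegral_mul_le_sq {α : Type*} [MeasurableSpace α] {μ : Measure α} {f g : α → ℝ≥0∞}
    (hf : Measurable f) (hg : Measurable g) : ∫⁻ x, f x * g x ∂μ ≤
      (∫⁻ x, f x ^ 2 ∂μ) ^ (1 / 2 : ℝ) * (∫⁻ x, g x ^ 2 ∂μ) ^ (1 / 2 : ℝ) := by
  have := ENNReal.lintegral_mul_le_Lp_mul_Lq μ Real.HolderConjugate.two_two hf.aemeasurable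
    hg.aemeasurable
  simpa [ENNReal.rpow_two] using this

theorem lintegral_enorm_sq_ne_top {α : Type*} [MeasurableSpace α] {μ : Measure α} {f : α → ℂ}
    (hf : MemLp f 2 μ) : ∫⁻ x, ‖f x‖ₑ ^ 2 ∂μ ≠ ∞ := by
  have := hf.2.ne
  rw [← lintegral_sq_rpow_half] at this
  contrapose! this
  simp [this]

theorem sq_rpow_half_ne_top {α : Type*} [MeasurableSpace α] {μ : Measure α} {F : α → ℝ≥0∞}
    (hF : ∫⁻ x, F x ^ 2 ∂μ ≠ ∞) : (∫⁻ x, F x ^ 2 ∂μ) ^ (1 / 2 : ℝ) ≠ ∞ :=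
  ENNReal.rpow_ne_top_of_nonneg (by norm_num) hF

theorem lintegral_mul_prod_ne_top {Θ E : Type*} [MeasurableSpace Θ] [MeasurableSpace E]
    {μ : Measure Θ} {ν : Measure E} [SFinite μ] [SFinite ν] {Γ : Θ → E → ℂ}
    (hΓ : Measurable (Function.uncurry Γ)) {N w : E → ℝ≥0∞}
    (hN : ∀ ζ, ∫⁻ θ, ‖Γ θ ζ‖ₑ ∂μ ≤ N ζ) (hw : Measurable w) (h : ∫⁻ ζ, w ζ * N ζ ∂ν ≠ ∞) :
    ∫⁻ q : Θ × E, ‖Γ q.1 q.2‖ₑ * w q.2 ∂μ.prod ν ≠ ∞ := by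
  have h1 : Measurable fun q : Θ × E => ‖Γ q.1 q.2‖ₑ * w q.2 :=
    hΓ.enorm.mul (hw.comp measurable_snd)
  rw [lintegral_prod_symm' _ h1]
  refine (lt_of_le_of_lt (lintegral_mono fun ζ => ?_) h.lt_top).ne
  have h2 : Measurable fun θ => ‖Γ θ ζ‖ₑ := (hΓ.comp measurable_prodMk_right).enorm
  simp only
  rw [lintegral_mul_const _ h2, mul_comm]
  gcongr
  exact hN ζ

theorem measurable_exp_en (m : ℝ) :
    Measurable fun q : ℝ × Cfg M n => Real.exp (-(q.1 * en m q.2)) :=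
  Continuous.measurable (by fun_prop)

theorem en_inv_le {m : ℝ} (hm : 0 < m) (ζ : Cfg M (n + 1)) (i : Fin (n + 1)) :
    (en m ζ)⁻¹ ≤ (ell m)⁻¹ * (1 + ‖ys ζ i‖ ^ 2)⁻¹ := by
  have h1 := en_ge hm ζ
  have h2 := ell_pos hm
  have h3 : ell m ≤ 1 := min_le_right _ _
  have h4 := norm_ys_le ζ i
  have h5 : ‖ys ζ i‖ ^ 2 ≤ ‖ζ‖ ^ 2 := by gcongr
  have h6 : (0 : ℝ) ≤ n := by positivity
  push_cast at h1
  rw [← mul_inv]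
  refine inv_anti₀ (by positivity) ?_
  nlinarith

/-- The free resolvent, applied to a function on a plane `y_i = x_ν`, is bounded on `L²`. -/
theorem heat_schur {m : ℝ} (hm : 0 < m) (ν : Fin M) (i : Fin (n + 1)) :
    ∃ C : ℝ≥0∞, C ≠ ∞ ∧ ∀ (F : Cfg M (n + 1) → ℝ≥0∞) (H : Cfg M n → ℝ≥0∞), Measurable F →
      Measurable H → ∫⁻ ζ, F ζ * H (totL ν i ζ) * ENNReal.ofReal (en m ζ)⁻¹ ≤
        C * ((∫⁻ x, F x ^ 2) ^ (1 / 2 : ℝ) * (∫⁻ x, H x ^ 2) ^ (1 / 2 : ℝ)) := by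
  set K : ℝ≥0∞ := ∫⁻ ξ : R3, ENNReal.ofReal ((ell m)⁻¹ * (1 + ‖ξ‖ ^ 2)⁻¹) ^ 2 with hK
  have hKt : K ≠ ∞ := by
    have h1 := (integrable_rpow_neg_one_add_norm_sq (E := R3) (μ := volume) (r := 4)
      (by simp; norm_num)).const_mul ((ell m)⁻¹ ^ 2)
    -- the inverse energy is square integrable in the one momentum that `totL ν i` leaves free
    have h2 := h1.lintegral_lt_top.ne
    convert h2 using 3 with ξ
    rw [← ENNReal.ofReal_pow (by have := ell_pos hm; positivity), mul_pow]
    congr 2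
    rw [show (-4 / 2 : ℝ) = -(2 : ℕ) by norm_num, Real.rpow_neg (by positivity),
      Real.rpow_natCast, inv_pow]
  have hen : Measurable fun ζ : Cfg M (n + 1) => ENNReal.ofReal (en m ζ)⁻¹ :=
    ((continuous_en m).measurable.inv).ennreal_ofReal
  refine ⟨K ^ (1 / 2 : ℝ), ENNReal.rpow_ne_top_of_nonneg (by norm_num) hKt, fun F H hF hH => ?_⟩
  have hHe : Measurable fun ζ => H (totL ν i ζ) * ENNReal.ofReal (en m ζ)⁻¹ :=
    (hH.comp (totL ν i).measurable).mul hen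
  have h1 := lintegral_mul_le_sq (μ := (volume : Measure (Cfg M (n + 1)))) hF hHe
  have h2 : ∫⁻ ζ, (H (totL ν i ζ) * ENNReal.ofReal (en m ζ)⁻¹) ^ 2 ≤ (∫⁻ x, H x ^ 2) * K := by
    rw [← (measurePreserving_shearP (n := n) ν i).lintegral_comp
      (hHe.pow_const 2)]
    calc _ ≤ ∫⁻ q : Cfg M n × R3, H q.1 ^ 2 *
          ENNReal.ofReal ((ell m)⁻¹ * (1 + ‖q.2‖ ^ 2)⁻¹) ^ 2 := by
          refine lintegral_mono fun q => ?_
          simp only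
          rw [← shearP_symm_fst, MeasurableEquiv.symm_apply_apply, mul_pow]
          gcongr
          refine (en_inv_le hm (shearP ν i q) i).trans (le_of_eq ?_)
          rw [shearP_apply, ys_permL, Function.comp_apply, Equiv.swap_apply_left, last_shear]
      _ = _ := by
          rw [Measure.volume_eq_prod, lintegral_prod_mul (f := fun p => H p ^ 2)
            (g := fun ξ : R3 => ENNReal.ofReal ((ell m)⁻¹ * (1 + ‖ξ‖ ^ 2)⁻¹) ^ 2)
            (hH.pow_const 2).aemeasurable (by fun_prop)]
  calc _ = ∫⁻ ζ, F ζ * (H (totL ν i ζ) * ENNReal.ofReal (en m ζ)⁻¹) := by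
        simp_rw [mul_assoc]
    _ ≤ _ := h1
    _ ≤ (∫⁻ x, F x ^ 2) ^ (1 / 2 : ℝ) * ((∫⁻ x, H x ^ 2) * K) ^ (1 / 2 : ℝ) := by
        gcongr
    _ = _ := by
        rw [ENNReal.mul_rpow_of_nonneg _ _ (by norm_num)]; ring

/-- The free resolvent as a superposition of positive kernels. -/
theorem exists_posKernel_heat {m : ℝ} (hm : 0 < m) (ν : Fin M) (i : Fin (n + 1)) :
    ∃ C, PosKernel (volume.restrict (Set.Ioi 0)) (ContinuousLinearMap.id ℝ (Cfg M (n + 1)))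
      (insL ν i) (ContinuousLinearMap.id ℝ (Cfg M (n + 1))) (totL ν i) (fun t => heat m t)
      (fun t ζ => (Real.exp (-(t * en m ζ)) : ℂ)) C := by
  obtain ⟨C, hC, hb⟩ := heat_schur (n := n) hm ν i
  have hΓ : ∀ ζ : Cfg M (n + 1),
      ∫⁻ t in Set.Ioi 0, ‖(Real.exp (-(t * en m ζ)) : ℂ)‖ₑ = ENNReal.ofReal (en m ζ)⁻¹ := by
    intro ζ
    obtain ⟨h1, h2⟩ := integral_exp_en hm ζ
    rw [← h2, ofReal_integral_eq_lintegral_ofReal h1 (Eventually.of_forall fun _ => by positivity)]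
    refine lintegral_congr fun t => ?_
    rw [← ofReal_norm, Complex.norm_real, Real.norm_of_nonneg (Real.exp_pos _).le]
  have hm1 : Measurable fun q : ℝ × Cfg M (n + 1) => (Real.exp (-(q.1 * en m q.2)) : ℂ) :=
    Complex.measurable_ofReal.comp (measurable_exp_en m)
  refine ⟨C, fun _ _ => rfl, inner_insL ν i, measurable_heat m, heat_nonneg m, hm1, ?_, ?_, ?_,
    ?_, hC⟩
  · filter_upwards [ae_restrict_mem measurableSet_Ioi] with t ht
    exact (fourierInv_exp_en hm ht).1
  · filter_upwards [ae_restrict_mem measurableSet_Ioi] with t ht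
    exact (fourierInv_exp_en hm ht).2
  · intro f g
    refine lintegral_mul_prod_ne_top hm1 (fun ζ => (hΓ ζ).le) (w := fun ζ => ‖f ζ‖ₑ *
      ‖g (totL ν i ζ)‖ₑ) (f.continuous.measurable.enorm.mul
        (g.continuous.measurable.comp (totL ν i).measurable).enorm) ?_
    refine ((hb (fun x => ‖f x‖ₑ) (fun x => ‖g x‖ₑ) (by fun_prop) (by fun_prop)).trans_lt ?_).ne
    exact ENNReal.mul_lt_top hC.lt_top (ENNReal.mul_lt_top
      (sq_rpow_half_ne_top (lintegral_enorm_sq_ne_top (f.memLp 2 volume))).lt_top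
      (sq_rpow_half_ne_top (lintegral_enorm_sq_ne_top (g.memLp 2 volume))).lt_top)
  · intro F H hF hH
    refine le_trans (le_of_eq (lintegral_congr fun ζ => ?_)) (hb F H hF hH)
    rw [integral_complex_ofReal, (integral_exp_en hm ζ).2, ← ofReal_norm, Complex.norm_real,
      Real.norm_of_nonneg (inv_nonneg.2 (en_pos hm ζ).le)]
    rfl

end Kernels

/-! ### Sphere averages of the heat kernel -/

section SphereKernels

variable {M n : ℕ}

/-- The symbol of `exp (-t L)` followed by the translation of the last y-particle by `r ω`. -/
def transSym (m r : ℝ) (θ : ℝ × S2) (ζ : Cfg M (n + 1)) : ℂ :=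
  (Real.exp (-(θ.1 * en m ζ)) : ℂ) *
    Complex.exp ((inner ℝ ((2 * Real.pi * r) • ys ζ (Fin.last n)) (θ.2 : R3) : ℝ) * Complex.I)

/-- The kernel of `exp (-t L)` followed by the translation of the last y-particle by `r ω`. -/
def transHeat (m r : ℝ) (θ : ℝ × S2) (Z : Cfg M (n + 1)) : ℝ :=
  heat m θ.1 (Z + lastL (r • (θ.2 : R3)))

theorem measurable_transHeat (m r : ℝ) :
    Measurable (Function.uncurry (transHeat (M := M) (n := n) m r)) := by
  have h : Measurable fun q : (ℝ × S2) × Cfg M (n + 1) =>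
      (q.1.1, q.2 + lastL (r • (q.1.2 : R3))) :=
    Continuous.measurable (by fun_prop)
  exact (measurable_heat m).comp h

theorem measurable_transSym (m r : ℝ) :
    Measurable (Function.uncurry (transSym (M := M) (n := n) m r)) := by
  have h1 : Continuous fun q : (ℝ × S2) × Cfg M (n + 1) =>
      (Real.exp (-(q.1.1 * en m q.2)) : ℂ) := Complex.continuous_ofReal.comp (by fun_prop)
  have h2 : Continuous fun q : (ℝ × S2) × Cfg M (n + 1) =>
      inner ℝ ((2 * Real.pi * r) • ys q.2 (Fin.last n)) (q.1.2 : R3) := by fun_prop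
  have h3 : Continuous fun x : ℝ => Complex.exp ((x : ℂ) * Complex.I) := by fun_prop
  exact (h1.mul (h3.comp h2)).measurable

theorem integrable_transSym {m : ℝ} (hm : 0 < m) (r : ℝ) {t : ℝ} (ht : 0 < t) (ω : S2) :
    Integrable (transSym (M := M) (n := n) m r (t, ω)) := by
  have h1 : Continuous fun q : Cfg M (n + 1) => Complex.exp ((inner ℝ ((2 * Real.pi * r) •
    ys q (Fin.last n)) (ω : R3) : ℝ) * Complex.I) := by fun_prop
  refine ((fourierInv_exp_en hm ht).1.bdd_mul (c := 1) h1.aestronglyMeasurable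
    (Eventually.of_forall fun q => (Complex.norm_exp_ofReal_mul_I _).le)).congr
    (Eventually.of_forall fun q => ?_)
  simp only [transSym]; ring

theorem fourierInv_transSym {m : ℝ} (hm : 0 < m) (r : ℝ) {t : ℝ} (ht : 0 < t) (ω : S2)
    (Z : Cfg M (n + 1)) :
    𝓕⁻ (transSym m r (t, ω)) Z = (transHeat m r (t, ω) Z : ℂ) := by
  rw [transHeat, ← (fourierInv_exp_en hm ht).2, Real.fourierInv_eq', Real.fourierInv_eq']
  refine integral_congr_ae (Eventually.of_forall fun ζ => ?_)
  simp only [transSym, smul_eq_mul]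
  rw [inner_add_right, real_inner_comm (lastL _) ζ, inner_lastL, inner_smul_left, inner_smul_left,
    real_inner_comm, conj_trivial, conj_trivial, mul_add, Complex.ofReal_add, add_mul,
      Complex.exp_add]
  rw [real_inner_comm (ω : R3)]
  have : (2 * Real.pi * (r * inner ℝ (ω : R3) (ys ζ (Fin.last n)))) =
    2 * Real.pi * r * inner ℝ (ω : R3) (ys ζ (Fin.last n)) := by ring
  rw [this]
  ring

/-- Averaging over the sphere turns the translation by `r ω` into a cutoff factor. -/
theorem integral_transSym {m : ℝ} (hm : 0 < m) {r : ℝ} (hr : 0 < r) (ζ : Cfg M (n + 1)) :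
    ∫ θ, transSym m r θ ζ ∂timeSph =
      (((en m ζ)⁻¹ * Real.sinc (2 * Real.pi * r * ‖ys ζ (Fin.last n)‖) : ℝ) : ℂ) := by
  have := integral_timeSph_char (a := fun t => Real.exp (-(t * en m ζ)))
    ((2 * Real.pi * r) • ys ζ (Fin.last n))
  rw [(integral_exp_en hm ζ).2, norm_smul, Real.norm_of_nonneg (by positivity)] at this
  rw [Complex.ofReal_mul, ← this]
  rfl

theorem lintegral_transSym {m : ℝ} (hm : 0 < m) (r : ℝ) (ζ : Cfg M (n + 1)) :
    ∫⁻ θ, ‖transSym m r θ ζ‖ₑ ∂timeSph = ENNReal.ofReal (en m ζ)⁻¹ := by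
  rw [← (integral_exp_en hm ζ).2]
  exact lintegral_timeSph (integral_exp_en hm ζ).1 (fun _ => (Real.exp_pos _).le) _

theorem abs_sinc_le_inv {x : ℝ} (hx : 0 < x) : |Real.sinc x| ≤ x⁻¹ := by
  rw [Real.sinc_of_ne_zero hx.ne', abs_div, abs_of_pos hx, div_eq_mul_inv]
  exact mul_le_of_le_one_left (by positivity) (Real.abs_sin_le_one x)

theorem memLp_wt_mul (f : 𝓢(Cfg M n, ℂ)) : MemLp (fun x => (wt x : ℂ) * f x) 2 volume := by
  have hw : Function.HasTemperateGrowth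
      fun x : Cfg M n => (((1 + ‖x‖ ^ 2) ^ (1 / 2 : ℝ) : ℝ) : ℂ) :=
    (Complex.ofRealCLM.hasTemperateGrowth).comp
      (Function.hasTemperateGrowth_one_add_norm_sq_rpow (Cfg M n) (1 / 2))
  have := ((SchwartzMap.smulLeftCLM ℂ fun x : Cfg M n =>
    (((1 + ‖x‖ ^ 2) ^ (1 / 2 : ℝ) : ℝ) : ℂ)) f).memLp 2 volume
  refine (memLp_congr_ae (Eventually.of_forall fun x => ?_)).1 this
  rw [SchwartzMap.smulLeftCLM_apply_apply hw, wt, Real.sqrt_eq_rpow, smul_eq_mul]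

/-- The sphere averages of the off-diagonal terms as superpositions of positive kernels. -/
theorem exists_posKernel_off {m : ℝ} (hm : 0 < m) {r : ℝ} (hr : 0 < r) {μ ν : Fin M}
    {i : Fin (n + 1)} (h : OffDiag μ ν i) :
    ∃ C, PosKernel timeSph (diagL μ) (insL ν i) (totalL μ) (totL ν i) (transHeat m r)
      (transSym m r) C := by
  obtain ⟨C, hC, hb⟩ := offDiag_schur hm h
  -- the bound on `L²` comes from the damping `|sinc x| ≤ 1 / x`; its constant diverges as `r → 0`
  refine ⟨ENNReal.ofReal (2 * Real.pi * r)⁻¹ * C, inner_diagL μ, inner_insL ν i,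
    measurable_transHeat m r, fun θ Z => heat_nonneg _ _ _, measurable_transSym m r,
    ae_timeSph fun t ht ω => integrable_transSym hm r ht ω,
    ae_timeSph fun t ht ω => fourierInv_transSym hm r ht ω, ?_, ?_,
    ENNReal.mul_ne_top ENNReal.ofReal_ne_top hC⟩
  · intro f g
    refine lintegral_mul_prod_ne_top (measurable_transSym m r)
      (fun ζ => (lintegral_transSym hm r ζ).le) (w := fun ζ => ‖f (totalL μ ζ)‖ₑ *
      ‖g (totL ν i ζ)‖ₑ) ((f.continuous.measurable.comp (totalL μ).measurable).enorm.mul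
        (g.continuous.measurable.comp (totL ν i).measurable).enorm) ?_
    refine ((lintegral_mono fun ζ => ?_).trans_lt ((hb (fun x => ‖(wt x : ℂ) * f x‖ₑ)
      (fun x => ‖g x‖ₑ) ((Complex.measurable_ofReal.comp continuous_wt.measurable).mul
        f.continuous.measurable).enorm g.continuous.measurable.enorm).1.trans_lt ?_)).ne
    · have hw := wt_pos (totalL μ ζ)
      have hen := en_pos hm ζ
      rw [enorm_mul, ← ofReal_norm (wt (totalL μ ζ) : ℂ), Complex.norm_real,
        Real.norm_of_nonneg hw.le, ENNReal.ofReal_mul (inv_nonneg.2 hw.le),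
          ENNReal.ofReal_inv_of_pos hw]
      have h0 : ENNReal.ofReal (wt (totalL μ ζ)) ≠ 0 := by simpa using hw
      rw [show ∀ a b c d e : ℝ≥0∞, a * b * c * (d * e) = (a * d) * (b * c * e) by
        intros; ring, ENNReal.mul_inv_cancel h0 ENNReal.ofReal_ne_top, one_mul]
    · exact ENNReal.mul_lt_top hC.lt_top (ENNReal.mul_lt_top
        (sq_rpow_half_ne_top (lintegral_enorm_sq_ne_top (memLp_wt_mul f))).lt_top
        (sq_rpow_half_ne_top (lintegral_enorm_sq_ne_top (g.memLp 2 volume))).lt_top)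
  · intro F H hF hH
    have h2 := (hb F H hF hH).2
    calc _ ≤ ∫⁻ ζ, ENNReal.ofReal (2 * Real.pi * r)⁻¹ * (F (totalL μ ζ) * H (totL ν i ζ) *
          ENNReal.ofReal (‖ys ζ (Fin.last n)‖⁻¹ * (en m ζ)⁻¹)) := by
          refine lintegral_mono_ae ((ae_ys_ne_zero (Fin.last n)).mono fun ζ hζ => ?_)
          have hξ : 0 < ‖ys ζ (Fin.last n)‖ := norm_pos_iff.2 hζ
          have hen := en_pos hm ζ
          rw [integral_transSym hm hr, ← ofReal_norm, Complex.norm_real, norm_mul,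
            Real.norm_of_nonneg (inv_nonneg.2 hen.le), mul_left_comm,
            ← ENNReal.ofReal_mul (by positivity)]
          refine mul_le_mul_right (ENNReal.ofReal_le_ofReal ?_) _
          calc (en m ζ)⁻¹ * ‖Real.sinc (2 * Real.pi * r * ‖ys ζ (Fin.last n)‖)‖
              ≤ (en m ζ)⁻¹ * (2 * Real.pi * r * ‖ys ζ (Fin.last n)‖)⁻¹ := by
                gcongr
                exact abs_sinc_le_inv (by positivity)
            _ = _ := by rw [mul_inv]; ring
      _ ≤ _ := by
          rw [lintegral_const_mul' _ _ ENNReal.ofReal_ne_top, mul_assoc (ENNReal.ofReal _) C]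
          exact mul_le_mul_right h2 _

theorem diagSym_eq (m : ℝ) {r : ℝ} (hr : 0 < r) (μ : Fin M) (θ : ℝ × S2) (p : Cfg M n) :
    diagSym m μ θ.1 (r • (θ.2 : R3)) p = ((√(redMass m / (4 * Real.pi * θ.1)) ^ 3 *
      Real.exp (-(θ.1 * lam m μ ((2 * Real.pi) • p) + redMass m * r ^ 2 / (4 * θ.1))) : ℝ) : ℂ) *
      Complex.exp ((inner ℝ ((2 * Real.pi * r / (2 * m + 1)) • xs p μ) (θ.2 : R3) : ℝ) *
        Complex.I) := by
  have h1 : ‖r • (θ.2 : R3)‖ = r := by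
    rw [norm_smul, Real.norm_of_nonneg hr.le, norm_eq_of_mem_sphere, mul_one]
  have h2 : 2 * Real.pi * inner ℝ (r • (θ.2 : R3)) ((1 / (2 * m + 1)) • xs p μ) =
      inner ℝ ((2 * Real.pi * r / (2 * m + 1)) • xs p μ) (θ.2 : R3) := by
    rw [inner_smul_left, inner_smul_right, inner_smul_left, real_inner_comm]
    simp only [conj_trivial]; ring
  rw [diagSym, h1, h2]

/-- The symbol of the sphere average of the diagonal term. -/
def diagMult (m r : ℝ) (μ : Fin M) (p : Cfg M n) : ℝ :=
  redMass m / (4 * Real.pi * r) *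
    Real.exp (-(r * √(redMass m * lam m μ ((2 * Real.pi) • p)))) *
    Real.sinc (2 * Real.pi * r / (2 * m + 1) * ‖xs p μ‖)

/-- The time integral is the subordination formula, the average over directions gives the factor
`sinc`. -/
theorem integral_diagSym_timeSph {m : ℝ} (hm : 0 < m) {r : ℝ} (hr : 0 < r) (μ : Fin M)
    (p : Cfg M n) :
    ∫ θ : ℝ × S2, diagSym m μ θ.1 (r • (θ.2 : R3)) p ∂timeSph = (diagMult m r μ p : ℂ) := by
  simp_rw [diagSym_eq m hr]
  have := integral_timeSph_char (a := fun t => √(redMass m / (4 * Real.pi * t)) ^ 3 *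
      Real.exp (-(t * lam m μ ((2 * Real.pi) • p) + redMass m * r ^ 2 / (4 * t))))
    ((2 * Real.pi * r / (2 * m + 1)) • xs p μ)
  rw [(subordination (redMass_pos hm) hr (lam_pos hm μ _)).2, norm_smul,
    Real.norm_of_nonneg (by positivity), ← Complex.ofReal_mul] at this
  exact this

theorem lintegral_diagSym_timeSph {m : ℝ} (hm : 0 < m) {r : ℝ} (hr : 0 < r) (μ : Fin M)
    (p : Cfg M n) :
    ∫⁻ θ : ℝ × S2, ‖diagSym m μ θ.1 (r • (θ.2 : R3)) p‖ₑ ∂timeSph ≤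
      ENNReal.ofReal (redMass m / (4 * Real.pi * r)) := by
  have hα := redMass_pos hm
  simp_rw [diagSym_eq m hr]
  rw [lintegral_timeSph (subordination (redMass_pos hm) hr (lam_pos hm μ _)).1
    (fun t => by positivity), (subordination (redMass_pos hm) hr (lam_pos hm μ _)).2]
  gcongr
  refine mul_le_of_le_one_right (by positivity) (Real.exp_le_one_iff.2 ?_)
  have : 0 ≤ r * √(redMass m * lam m μ ((2 * Real.pi) • p)) := by positivity
  linarith

theorem measurable_diagSym_timeSph (m r : ℝ) (μ : Fin M) :
    Measurable fun q : (ℝ × S2) × Cfg M n => diagSym m μ q.1.1 (r • (q.1.2 : R3)) q.2 := by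
  have ht : Measurable fun q : (ℝ × S2) × Cfg M n => q.1.1 := measurable_fst.comp measurable_fst
  have hω : Continuous fun q : (ℝ × S2) × Cfg M n => ‖r • (q.1.2 : R3)‖ ^ 2 := by fun_prop
  have hl : Continuous fun q : (ℝ × S2) × Cfg M n => lam m μ ((2 * Real.pi) • q.2) := by fun_prop
  have h2 : Continuous fun q : (ℝ × S2) × Cfg M n => 2 * Real.pi *
      inner ℝ (r • (q.1.2 : R3)) ((1 / (2 * m + 1)) • xs q.2 μ) := by fun_prop
  have h3 : Continuous fun x : ℝ => Complex.exp ((x : ℂ) * Complex.I) := by fun_prop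
  unfold diagSym
  refine Measurable.mul (Complex.measurable_ofReal.comp (Measurable.mul ?_ ?_))
    (h3.measurable.comp h2.measurable)
  · exact ((measurable_const.div (ht.const_mul _)).sqrt).pow_const 3
  · exact (((ht.mul hl.measurable).add
      ((hω.measurable.const_mul _).div (ht.const_mul 4))).neg).exp

/-- The sphere averages of the diagonal terms as superpositions of positive kernels. -/
theorem exists_posKernel_diag {m : ℝ} (hm : 0 < m) {r : ℝ} (hr : 0 < r) (μ : Fin M) :
    ∃ C, PosKernel timeSph (ContinuousLinearMap.id ℝ (Cfg M n)) (ContinuousLinearMap.id ℝ (Cfg M n))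
      (ContinuousLinearMap.id ℝ (Cfg M n)) (ContinuousLinearMap.id ℝ (Cfg M n))
      (fun θ z => transHeat m r θ (diagL μ z))
      (fun θ p => diagSym m μ θ.1 (r • (θ.2 : R3)) p) C := by
  have hα := redMass_pos hm
  have hbd : ∀ (F H : Cfg M n → ℝ≥0∞), Measurable F → Measurable H →
      ∫⁻ ζ, F ζ * H ζ * ENNReal.ofReal (redMass m / (4 * Real.pi * r)) ≤
        ENNReal.ofReal (redMass m / (4 * Real.pi * r)) *
          ((∫⁻ x, F x ^ 2) ^ (1 / 2 : ℝ) * (∫⁻ x, H x ^ 2) ^ (1 / 2 : ℝ)) := by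
    intro F H hF hH
    rw [lintegral_mul_const' _ _ ENNReal.ofReal_ne_top, mul_comm]
    gcongr
    exact lintegral_mul_le_sq hF hH
  refine ⟨ENNReal.ofReal (redMass m / (4 * Real.pi * r)), fun _ _ => rfl, fun _ _ => rfl, ?_,
    fun θ Z => heat_nonneg _ _ _, measurable_diagSym_timeSph m r μ,
    ae_timeSph fun t ht ω => (fourierInv_diagSym hm ht μ _).1,
    ae_timeSph fun t ht ω z => (fourierInv_diagSym hm ht μ _).2 z, ?_, ?_, ENNReal.ofReal_ne_top⟩
  · exact (measurable_transHeat m r).comp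
      (measurable_fst.prodMk ((diagL μ).measurable.comp measurable_snd))
  · intro f g
    refine lintegral_mul_prod_ne_top (measurable_diagSym_timeSph m r μ)
      (fun ζ => lintegral_diagSym_timeSph hm hr μ ζ) (w := fun ζ => ‖f ζ‖ₑ * ‖g ζ‖ₑ)
      (f.continuous.measurable.enorm.mul g.continuous.measurable.enorm) ?_
    refine ((hbd (fun x => ‖f x‖ₑ) (fun x => ‖g x‖ₑ) f.continuous.measurable.enorm
      g.continuous.measurable.enorm).trans_lt ?_).ne
    exact ENNReal.mul_lt_top ENNReal.ofReal_lt_top (ENNReal.mul_lt_top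
      (sq_rpow_half_ne_top (lintegral_enorm_sq_ne_top (f.memLp 2 volume))).lt_top
      (sq_rpow_half_ne_top (lintegral_enorm_sq_ne_top (g.memLp 2 volume))).lt_top)
  · intro F H hF hH
    refine le_trans (lintegral_mono fun ζ => ?_) (hbd F H hF hH)
    simp only [ContinuousLinearMap.id_apply]
    gcongr
    exact (enorm_integral_le_lintegral_enorm _).trans (lintegral_diagSym_timeSph hm hr μ ζ)

end SphereKernels

/-! ### Permutations of the y-particles -/

section Permutations

variable {M n : ℕ}

/-- Two permutations that send the same entry to the last one differ by a permutation of the other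
entries. -/
theorem exists_perm_diagL (τ τ' : Equiv.Perm (Fin (n + 1))) (i : Fin (n + 1))
    (h : τ i = Fin.last n) (h' : τ' i = Fin.last n) : ∃ σ : Equiv.Perm (Fin n),
      ∀ (ν : Fin M) (w : Cfg M n), permL τ' (diagL ν w) = permL τ (diagL ν (permL σ w)) := by
  set ρ : Equiv.Perm (Fin (n + 1)) := τ' * τ⁻¹ with hρ
  have hρl : ρ (Fin.last n) = Fin.last n := by
    have h1 : τ⁻¹ (Fin.last n) = i := by rw [← h]; simp
    rw [hρ, Equiv.Perm.mul_apply, h1, h']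
  set e : Option (Fin n) ≃ Option (Fin n) :=
    finSuccEquivLast.symm.trans (ρ.trans finSuccEquivLast) with he
  have hσ : ∀ k : Fin n, ρ k.castSucc = (e.removeNone k).castSucc := by
    intro k
    have h1 : ρ k.castSucc ≠ Fin.last n := by
      rw [← hρl]
      exact fun hk => (Fin.castSucc_lt_last k).ne (ρ.injective hk)
    obtain ⟨k', hk'⟩ := Fin.exists_castSucc_eq.2 h1
    have h2 : e (some k) = some k' := by
      simp only [he, Equiv.trans_apply, finSuccEquivLast_symm_some, ← hk',
        finSuccEquivLast_castSucc]
    have h3 := e.removeNone_some ⟨k', h2⟩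
    rw [h2] at h3
    rw [← hk', Option.some_injective _ h3]
  refine ⟨e.removeNone, fun ν w => ?_⟩
  have h1 : permL ρ (diagL ν w) = diagL ν (permL e.removeNone w) := by
    refine cfg_ext (by simp [diagL_apply]) ?_
    ext j : 1
    refine Fin.lastCases ?_ (fun k => ?_) j
    · simp [diagL_apply, hρl]
    · simp [diagL_apply, hσ]
  rw [← h1, permL_permL, hρ, inv_mul_cancel_right]

theorem IsSector.permL {ψ : L2 M n} (hψ : IsSector ψ) (σ : Equiv.Perm (Fin n)) :
    ∀ᵐ z : Cfg M n, ψ (IBC.permL σ z) = ψ z := by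
  simpa only [permL_eq] using hψ σ

/-- In an integral against a symmetric function, the position of the inserted particle matters, but
not the order of the others. -/
theorem integral_permL_congr {Θ : Type*} [MeasurableSpace Θ] {μ : Measure Θ} [SFinite μ]
    {ψ : L2 M n} (hψ : IsSector ψ) (Φ : Θ → Cfg M (n + 1) → ℂ) (ν : Fin M)
    {τ τ' : Equiv.Perm (Fin (n + 1))} {i : Fin (n + 1)} (h : τ i = Fin.last n)
    (h' : τ' i = Fin.last n) :
    ∫ q : Θ × Cfg M n, Φ q.1 (permL τ' (diagL ν q.2)) * ψ q.2 ∂μ.prod volume =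
      ∫ q : Θ × Cfg M n, Φ q.1 (permL τ (diagL ν q.2)) * ψ q.2 ∂μ.prod volume := by
  obtain ⟨σ, hσ⟩ := exists_perm_diagL (M := M) τ τ' i h h'
  have hmp : MeasurePreserving (Prod.map (id : Θ → Θ) (permL (M := M) σ)) (μ.prod volume)
      (μ.prod volume) := (MeasurePreserving.id μ).prod (measurePreserving_permL σ)
  have hemb : MeasurableEmbedding (Prod.map (id : Θ → Θ) (permL (M := M) σ)) :=
    MeasurableEmbedding.id.prodMap (permL σ).toHomeomorph.measurableEmbedding
  rw [← hmp.integral_comp hemb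
    (fun q : Θ × Cfg M n => Φ q.1 (permL τ (diagL ν q.2)) * ψ q.2)]
  refine integral_congr_ae ?_
  filter_upwards [(Measure.quasiMeasurePreserving_snd (μ := μ)
    (ν := (volume : Measure (Cfg M n)))).ae (hψ.permL σ)] with q hq
  simp only [Prod.map_fst, Prod.map_snd, id]
  rw [hq, hσ]

/-- The permutation which moves the `i`-th entry to the end and keeps the order of the others. -/
def insPerm (i : Fin (n + 1)) : Equiv.Perm (Fin (n + 1)) :=
  (finSuccEquiv' i).trans finSuccEquivLast.symm

theorem insPerm_self (i : Fin (n + 1)) : insPerm i i = Fin.last n := by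
  simp [insPerm, finSuccEquiv'_at]

theorem insertL_eq (ν : Fin M) (i : Fin (n + 1)) (w : Cfg M n) :
    insertL ν i w = permL (insPerm i) (diagL ν w) := by
  refine cfg_ext (by simp [insertL, diagL_apply]) ?_
  ext j : 1
  refine Fin.succAboveCases i ?_ (fun k => ?_) j
  · simp [insertL, diagL_apply, insPerm_self]
  · simp [insertL, diagL_apply, insPerm, finSuccEquiv'_succAbove]

end Permutations

/-! ### The function `Gψ` -/

section Potential

variable {M n : ℕ}

/-- The function `L⁻¹ δ_{x_ν}(y_i) ψ`, written with the heat kernel. -/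
def potTerm (m : ℝ) (ν : Fin M) (i : Fin (n + 1)) (ψ : Cfg M n → ℂ) : Cfg M (n + 1) → ℂ :=
  PosKernel.apply (volume.restrict (Set.Ioi 0)) (ContinuousLinearMap.id ℝ (Cfg M (n + 1)))
    (insL ν i) (fun t => heat m t) ψ

/-- The function `G ψ`. -/
def pot (m : ℝ) (ψ : Cfg M n → ℂ) (Z : Cfg M (n + 1)) : ℂ :=
  -(((1 / √((n : ℝ) + 1) : ℝ) : ℂ) * ∑ ν : Fin M, ∑ i : Fin (n + 1), potTerm m ν i ψ Z)

theorem measurable_coe (ψ : L2 M n) : Measurable (ψ : Cfg M n → ℂ) :=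
  (Lp.stronglyMeasurable ψ).measurable

theorem memLp_potTerm {m : ℝ} (hm : 0 < m) (ν : Fin M) (i : Fin (n + 1)) (ψ : L2 M n) :
    MemLp (potTerm m ν i ψ) 2 volume := by
  obtain ⟨C, hK⟩ := exists_posKernel_heat hm ν i
  exact hK.memLp_apply (measurable_coe ψ) (Lp.memLp ψ).2.ne

theorem memLp_pot {m : ℝ} (hm : 0 < m) (ψ : L2 M n) : MemLp (pot m ψ) 2 volume := by
  refine MemLp.neg (MemLp.const_mul ?_ _)
  exact memLp_finsetSum _ fun ν _ => memLp_finsetSum _ fun i _ => memLp_potTerm hm ν i ψ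

/-- For `ψ` in the sector, the particle inserted at `x_ν` may be moved to the `i`-th place by any
permutation. -/
theorem potTerm_eq {m : ℝ} {ψ : L2 M n} (hψ : IsSector ψ) (ν : Fin M) (i : Fin (n + 1))
    {τ : Equiv.Perm (Fin (n + 1))} (h : τ i = Fin.last n) (Z : Cfg M (n + 1)) :
    potTerm m ν i ψ Z = ∫ q : ℝ × Cfg M n, (heat m q.1 (Z - permL τ (diagL ν q.2)) : ℂ) * ψ q.2
      ∂(volume.restrict (Set.Ioi 0)).prod volume :=
  integral_permL_congr hψ (fun t Y => (heat m t (Z - Y) : ℂ)) ν h (Equiv.swap_apply_left _ _)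

theorem potTerm_permL {m : ℝ} {ψ : L2 M n} (hψ : IsSector ψ) (ν : Fin M) (i : Fin (n + 1))
    (σ : Equiv.Perm (Fin (n + 1))) (Z : Cfg M (n + 1)) :
    potTerm m ν i ψ (permL σ Z) = potTerm m ν (σ i) ψ Z := by
  have h : (swp i * σ⁻¹) (σ i) = Fin.last n := by
    simp
  rw [potTerm_eq hψ ν (σ i) h, potTerm, PosKernel.apply]
  refine integral_congr_ae (Eventually.of_forall fun q => ?_)
  simp only [ContinuousLinearMap.id_apply]
  rw [← permL_permL, ← insL_apply, ← heat_permL m q.1 σ (Z - _), map_sub,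
    permL_permL σ⁻¹ σ, inv_mul_cancel, permL_one]

theorem isSector_pot {m : ℝ} (hm : 0 < m) {ψ : L2 M n} (hψ : IsSector ψ) :
    IsSector ((memLp_pot hm ψ).toLp (pot m ψ)) := by
  intro σ
  have h1 := (memLp_pot hm ψ).coeFn_toLp
  have h2 := (measurePreserving_permL (M := M) σ).quasiMeasurePreserving.ae h1
  filter_upwards [h1, h2] with Z hZ hZ'
  rw [hZ, ← permL_eq, hZ', pot, pot]
  congr 2
  refine Finset.sum_congr rfl fun ν _ => ?_
  simp_rw [potTerm_permL hψ]
  exact Equiv.sum_comp σ (fun i => potTerm m ν i ψ Z)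

/-- The distributional form of `L⁻¹ δ_{x_ν}(y_i) ψ`. -/
theorem integral_mul_potTerm {m : ℝ} (hm : 0 < m) (ν : Fin M) (i : Fin (n + 1)) (ψ : L2 M n)
    (f : 𝓢(Cfg M (n + 1), ℂ)) :
    ∫ Z, f Z * potTerm m ν i ψ Z = ∫ w, (𝓕 (SchwartzMap.smulLeftCLM ℂ
      (fun ζ : Cfg M (n + 1) => (((symL m ((2 * Real.pi) • ζ))⁻¹ : ℝ) : ℂ)) (𝓕⁻ f)) :
        𝓢(Cfg M (n + 1), ℂ)) (insL ν i w) * ψ w := by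
  obtain ⟨C, hK⟩ := exists_posKernel_heat hm ν i
  set h : 𝓢(Cfg M (n + 1), ℂ) := SchwartzMap.smulLeftCLM ℂ
      (fun ζ : Cfg M (n + 1) => (((symL m ((2 * Real.pi) • ζ))⁻¹ : ℝ) : ℂ)) (𝓕⁻ f) with hh
  have hhf : ∀ ζ, h ζ = (((en m ζ)⁻¹ : ℝ) : ℂ) * (𝓕⁻ f) ζ := fun ζ => by
    rw [hh, SchwartzMap.smulLeftCLM_apply_apply
      (hasTemperateGrowth_resolvent m hm (Nat.succ_pos n))]
    rfl
  have hinj : Function.Injective (insL (M := M) ν i) := by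
    intro a b hab
    have h1 := (permL (swp i)).injective hab
    refine cfg_ext ?_ ?_
    · simpa [diagL_apply] using congrArg xs h1
    · ext k : 1
      simpa [diagL_apply] using congrFun (congrArg ys h1) k.castSucc
  obtain ⟨K, -, hKL⟩ := (insL (M := M) ν i : Cfg M n →ₗ[ℝ] Cfg M (n + 1)).exists_antilipschitzWith
    (LinearMap.ker_eq_bot.2 hinj)
  let k : 𝓢(Cfg M n, ℂ) := SchwartzMap.compCLMOfAntilipschitz ℂ (g := insL ν i)
    (insL ν i).hasTemperateGrowth hKL (𝓕 h)
  have hk : ∀ w, k w = (𝓕 h) (insL ν i w) := fun w => rfl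
  have hcont : Continuous fun ψ : L2 M n => ∫ w, (𝓕 h) (insL ν i w) * ψ w := by
    have h1 := (PointwiseConvergenceCLM.evalCLM (RingHom.id ℂ) ℂ k).continuous.comp
      (Lp.toTemperedDistributionCLM ℂ (volume : Measure (Cfg M n)) 2).continuous
    refine h1.congr fun ψ => ?_
    change (ψ : Dist M n) k = _
    rw [Lp.toTemperedDistribution_apply]
    rfl
  -- both sides are continuous in `ψ`, so that `ψ` may be taken to be a Schwartz function
  refine congrFun (Continuous.ext_on (SchwartzMap.denseRange_toLpCLM (F := ℂ) (by norm_num))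
    (hK.continuous_integral_mul_apply f) hcont ?_) ψ
  rintro _ ⟨g, rfl⟩
  change ∫ z, f z * PosKernel.apply _ _ _ _ (g.toLp 2 volume) z =
    ∫ w, (𝓕 h) (insL ν i w) * (g.toLp 2 volume) w
  have hg := SchwartzMap.coeFn_toLp g 2 (volume : Measure (Cfg M n))
  have e1 : ∫ w, (𝓕 h) (insL ν i w) * (g.toLp 2 volume) w = ∫ w, (𝓕 h) (insL ν i w) * g w := by
    refine integral_congr_ae ?_
    filter_upwards [hg] with w hw
    rw [hw]
  have e2 : ∀ z, PosKernel.apply (volume.restrict (Set.Ioi 0))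
      (ContinuousLinearMap.id ℝ (Cfg M (n + 1))) (insL ν i) (fun t => heat m t)
      (g.toLp 2 volume) z = PosKernel.apply (volume.restrict (Set.Ioi 0))
      (ContinuousLinearMap.id ℝ (Cfg M (n + 1))) (insL ν i) (fun t => heat m t) g z := by
    intro z
    refine integral_congr_ae ?_
    filter_upwards [(Measure.quasiMeasurePreserving_snd (μ := volume.restrict (Set.Ioi (0 : ℝ)))
      (ν := (volume : Measure (Cfg M n)))).ae hg] with q hq
    rw [hq]
  simp_rw [e1, e2]
  rw [hK.integral_mul_apply_schwartz]
  let L : Cfg M (n + 1) →ₗ[ℝ] Cfg M n →ₗ[ℝ] ℝ :=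
    LinearMap.mk₂ ℝ (fun ζ w => inner ℝ ζ (insL ν i w)) (fun a b c => inner_add_left _ _ _)
      (fun a b c => real_inner_smul_left _ _ _) (fun a b c => by rw [map_add, inner_add_right])
      (fun a b c => by
        rw [map_smul, real_inner_smul_right, smul_eq_mul])
  have hflip := VectorFourier.integral_fourierIntegral_smul_eq_flip (L := L)
    (μ := (volume : Measure (Cfg M (n + 1)))) (ν := (volume : Measure (Cfg M n)))
    Real.continuous_fourierChar
    (by change Continuous fun p : Cfg M (n + 1) × Cfg M n => inner ℝ p.1 (insL ν i p.2); fun_prop)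
    h.integrable g.integrable
  have hl : ∀ w, VectorFourier.fourierIntegral Real.fourierChar volume L h w =
      (𝓕 h) (insL ν i w) := by
    intro w
    rw [SchwartzMap.fourier_coe, Real.fourier_eq]
    rfl
  have hr : ∀ ζ, VectorFourier.fourierIntegral Real.fourierChar volume L.flip g ζ =
      (𝓕 g) (totL ν i ζ) := by
    intro ζ
    rw [SchwartzMap.fourier_coe, Real.fourier_eq]
    refine integral_congr_ae (Eventually.of_forall fun w => ?_)
    change Real.fourierChar (-(inner ℝ ζ (insL ν i w))) • g w = _
    rw [real_inner_comm, inner_insL]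
  simp_rw [hl, hr, smul_eq_mul] at hflip
  rw [hflip]
  refine integral_congr_ae (Eventually.of_forall fun ζ => ?_)
  simp only [ContinuousLinearMap.id_apply]
  rw [integral_complex_ofReal, (integral_exp_en hm ζ).2, hhf, mul_assoc]

/-- `insL` and `insertL` list the other y-particles in different orders, which is immaterial for `ψ`
in the sector. -/
theorem deltaMul_apply {ψ : L2 M n} (hψ : IsSector ψ) (ν : Fin M) (i : Fin (n + 1))
    (R : 𝓢(Cfg M (n + 1), ℂ)) : deltaMul ν i ψ R = ∫ w, R (insL ν i w) * ψ w := by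
  obtain ⟨σ, hσ⟩ := exists_perm_diagL (M := M) (insPerm i) (swp i) i (insPerm_self i)
    (Equiv.swap_apply_left _ _)
  have h1 : deltaMul ν i ψ R = ∫ w, R (insertL ν i w) * ψ w :=
    Lp.toTemperedDistribution_apply ψ (restrictTest ν i R)
  rw [h1, ← (measurePreserving_permL (M := M) σ).integral_comp
    (permL σ).toHomeomorph.measurableEmbedding]
  refine integral_congr_ae ?_
  filter_upwards [hψ.permL σ] with w hw
  rw [hw, insertL_eq, insL_apply, hσ]

theorem resolvent_create_apply {m : ℝ} (hm : 0 < m) {ψ : L2 M n} (hψ : IsSector ψ) (ν : Fin M)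
    (f : 𝓢(Cfg M (n + 1), ℂ)) : resolventL m (create ν ψ) f = ((1 / √((n : ℝ) + 1) : ℝ) : ℂ) *
      ∑ i : Fin (n + 1), ∫ Z, f Z * potTerm m ν i ψ Z := by
  simp_rw [integral_mul_potTerm hm]
  rw [resolventL, TemperedDistribution.fourierMultiplierCLM_apply_apply]
  generalize (𝓕 (SchwartzMap.smulLeftCLM ℂ
      (fun ζ : Cfg M (n + 1) => (((symL m ((2 * Real.pi) • ζ))⁻¹ : ℝ) : ℂ)) (𝓕⁻ f)) :
        𝓢(Cfg M (n + 1), ℂ)) = R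
  simp_rw [← deltaMul_apply hψ]
  change PointwiseConvergenceCLM.evalCLM (RingHom.id ℂ) ℂ R (create ν ψ) = _
  rw [create, map_smul, map_sum, smul_eq_mul]
  rfl

theorem integral_mul_pot {m : ℝ} (hm : 0 < m) (ψ : L2 M n) (f : 𝓢(Cfg M (n + 1), ℂ)) :
    ∫ Z, f Z * pot m ψ Z = -(((1 / √((n : ℝ) + 1) : ℝ) : ℂ) *
      ∑ ν : Fin M, ∑ i : Fin (n + 1), ∫ Z, f Z * potTerm m ν i ψ Z) := by
  have hint : ∀ ν i, Integrable fun Z => f Z * potTerm m ν i ψ Z := fun ν i =>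
    MemLp.integrable_mul (f.memLp 2 volume) (memLp_potTerm hm ν i ψ)
  have h1 : ∀ Z, f Z * pot m ψ Z = -(((1 / √((n : ℝ) + 1) : ℝ) : ℂ) *
      ∑ ν : Fin M, ∑ i : Fin (n + 1), f Z * potTerm m ν i ψ Z) := fun Z => by
    simp_rw [← Finset.mul_sum]
    rw [pot]
    ring
  simp_rw [h1]
  rw [integral_neg, integral_const_mul, integral_finsetSum _ fun ν _ =>
    integrable_finsetSum _ fun i _ => hint ν i]
  congr 2
  refine Finset.sum_congr rfl fun ν _ => ?_
  rw [integral_finsetSum _ fun i _ => hint ν i]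

/-- The function `pot m ψ` represents the distribution `G ψ`. -/
theorem toLp_pot_eq_G {m : ℝ} (hm : 0 < m) {ψ : L2 M n} (hψ : IsSector ψ) :
    (((memLp_pot hm ψ).toLp (pot m ψ) : L2 M (n + 1)) : Dist M (n + 1)) = G m ψ := by
  ext f
  have h1 : ∫ Z, f Z • (memLp_pot hm ψ).toLp (pot m ψ) Z = ∫ Z, f Z * pot m ψ Z := by
    refine integral_congr_ae ?_
    filter_upwards [(memLp_pot hm ψ).coeFn_toLp] with Z hZ
    rw [hZ, smul_eq_mul]
  rw [Lp.toTemperedDistribution_apply, h1, integral_mul_pot hm]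
  change _ = PointwiseConvergenceCLM.evalCLM (RingHom.id ℂ) ℂ f (G m ψ)
  rw [G, map_neg, map_sum, Finset.mul_sum]
  congr 1
  refine Finset.sum_congr rfl fun ν _ => ?_
  exact (resolvent_create_apply hm hψ ν f).symm

end Potential

/-! ### Elementary bounds for Gaussians -/

section Bounds

theorem one_add_pow_mul_exp_le (k : ℕ) {κ : ℝ} (hκ : 0 < κ) :
    ∃ C, 0 ≤ C ∧ ∀ x, 0 ≤ x → (1 + x) ^ k * Real.exp (-(κ * x)) ≤ C := by
  refine ⟨k.factorial * (κ ^ k)⁻¹ * Real.exp κ, by positivity, fun x hx => ?_⟩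
  have h := Real.pow_div_factorial_le_exp (κ * (1 + x)) (by positivity) k
  have hf : (0 : ℝ) < k.factorial := by positivity
  rw [div_le_iff₀ hf, mul_pow, mul_add, Real.exp_add, mul_one] at h
  have h2 : (1 + x) ^ k ≤ (κ ^ k)⁻¹ * (Real.exp κ * Real.exp (κ * x) * k.factorial) := by
    rw [← div_eq_inv_mul, le_div_iff₀ (by positivity), mul_comm]; exact h
  calc (1 + x) ^ k * Real.exp (-(κ * x))
      ≤ (κ ^ k)⁻¹ * (Real.exp κ * Real.exp (κ * x) * k.factorial) * Real.exp (-(κ * x)) := by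
        gcongr
    _ = k.factorial * (κ ^ k)⁻¹ * Real.exp κ * (Real.exp (κ * x) * Real.exp (-(κ * x))) := by ring
    _ = _ := by rw [← Real.exp_add, add_neg_cancel, Real.exp_zero, mul_one]

theorem inv_sqrt_le {t : ℝ} (ht : 0 < t) : (√t)⁻¹ ≤ 1 + t⁻¹ := by
  have h : (√t)⁻¹ ^ 2 = t⁻¹ := by rw [inv_pow, Real.sq_sqrt ht.le]
  nlinarith [sq_nonneg ((√t)⁻¹ - 1), sq_nonneg ((√t)⁻¹)]

/-- Integrable bound of a Gaussian heat kernel away from its singularity. -/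
theorem gaussian_le (D k : ℕ) {κ₁ κ₂ : ℝ} (h₁ : 0 < κ₁) (h₂ : 0 < κ₂) :
    ∃ C, 0 ≤ C ∧ ∀ t a, 0 < t → 0 ≤ a →
      (√t)⁻¹ ^ D * Real.exp (-t) * Real.exp (-((κ₁ * a + κ₂) / t)) ≤
        C * (Real.exp (-(t / 2)) * ((1 + a) ^ k)⁻¹) := by
  obtain ⟨C₁, hC₁, hb₁⟩ := one_add_pow_mul_exp_le D h₂
  obtain ⟨C₂, hC₂, hb₂⟩ := one_add_pow_mul_exp_le k h₁
  obtain ⟨C₃, hC₃, hb₃⟩ := one_add_pow_mul_exp_le k (κ := 1 / 2) (by norm_num)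
  refine ⟨C₁ * C₂ * C₃, by positivity, fun t a ht ha => ?_⟩
  have e1 : Real.exp (-((κ₁ * a + κ₂) / t)) =
      Real.exp (-(κ₁ * (a / t))) * Real.exp (-(κ₂ * t⁻¹)) := by
    rw [← Real.exp_add]; congr 1; field_simp; ring
  have e2 : Real.exp (-t) = Real.exp (-(1 / 2 * t)) * Real.exp (-(t / 2)) := by
    rw [← Real.exp_add]; congr 1; ring
  have i1 : (√t)⁻¹ ^ D * Real.exp (-(κ₂ * t⁻¹)) ≤ C₁ := by
    refine le_trans ?_ (hb₁ t⁻¹ (by positivity))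
    gcongr
    exact inv_sqrt_le ht
  -- `1 + a ≤ (1 + t) (1 + a / t)` turns decay in `a / t` into decay in `a`
  have i2 : Real.exp (-(κ₁ * (a / t))) ≤ C₂ * ((1 + t) ^ k * ((1 + a) ^ k)⁻¹) := by
    have h := hb₂ (a / t) (by positivity)
    have h3 : (1 + a) ^ k ≤ (1 + t) ^ k * (1 + a / t) ^ k := by
      rw [← mul_pow]
      gcongr
      have : (1 + t) * (1 + a / t) = 1 + a + (t + a / t) := by field_simp; ring
      rw [this]
      have : 0 ≤ t + a / t := by positivity
      linarith
    have h4 : 0 < (1 + a) ^ k := by positivity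
    rw [← mul_assoc, ← div_eq_mul_inv, le_div_iff₀ h4]
    calc Real.exp (-(κ₁ * (a / t))) * (1 + a) ^ k
        ≤ Real.exp (-(κ₁ * (a / t))) * ((1 + t) ^ k * (1 + a / t) ^ k) := by gcongr
      _ = (1 + a / t) ^ k * Real.exp (-(κ₁ * (a / t))) * (1 + t) ^ k := by ring
      _ ≤ C₂ * (1 + t) ^ k := by gcongr
  have i3 := hb₃ t ht.le
  rw [e1, e2]
  calc _ = ((√t)⁻¹ ^ D * Real.exp (-(κ₂ * t⁻¹))) * Real.exp (-(κ₁ * (a / t))) *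
        Real.exp (-(1 / 2 * t)) * Real.exp (-(t / 2)) := by ring
    _ ≤ C₁ * (C₂ * ((1 + t) ^ k * ((1 + a) ^ k)⁻¹)) * Real.exp (-(1 / 2 * t)) *
        Real.exp (-(t / 2)) := by gcongr
    _ = C₁ * C₂ * ((1 + t) ^ k * Real.exp (-(1 / 2 * t))) *
        (Real.exp (-(t / 2)) * ((1 + a) ^ k)⁻¹) := by ring
    _ ≤ C₁ * C₂ * C₃ * (Real.exp (-(t / 2)) * ((1 + a) ^ k)⁻¹) := by gcongr

end Bounds

/-! ### Continuity off the collisions -/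

section Continuity

variable {M n : ℕ}

theorem norm_diag_add_last (ν : Fin M) (x : Cfg M n) (v : R3) :
    (‖x‖ ^ 2 + ‖v‖ ^ 2) / 3 ≤ ‖diagL ν x + lastL v‖ ^ 2 := by
  have h1 : ‖diagL ν x + lastL v‖ ^ 2 = ‖x‖ ^ 2 + ‖xs x ν + v‖ ^ 2 := by
    rw [norm_sq_cfg, norm_sq_cfg, Fin.sum_univ_castSucc]
    simp [diagL_apply, lastL_apply]
    ring
  have h2 : ‖v‖ ≤ ‖xs x ν + v‖ + ‖xs x ν‖ := by
    have := norm_sub_le (xs x ν + v) (xs x ν)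
    rwa [add_sub_cancel_left] at this
  have h3 := norm_xs_le x ν
  have h4 := norm_nonneg (xs x ν)
  have h5 := norm_nonneg v
  rw [h1]
  nlinarith [sq_nonneg (‖xs x ν + v‖ - ‖xs x ν‖), norm_nonneg (xs x ν + v)]

/-- The Gaussian bound of the heat kernel in coordinates adapted to the plane `y_{n+1} = x_ν`. -/
theorem heat_diag_le {m t : ℝ} (hm : 0 < m) (ht : 0 < t) (ν : Fin M) (x : Cfg M n) (v : R3) :
    heat m t (diagL ν x + lastL v) ≤ heatConst M (n + 1) m *
      ((√t)⁻¹ ^ Fintype.card ((Fin M ⊕ Fin (n + 1)) × Fin 3) * Real.exp (-t) *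
        Real.exp (-(heatRate m / 3 * (‖x‖ ^ 2 + ‖v‖ ^ 2) / t))) := by
  have hδ := heatRate_pos hm
  have hc := heatConst_nonneg (M := M) (n := n + 1) m
  refine (heat_le hm ht _).trans ?_
  have e1 : Real.exp (-(t * ((n + 1 : ℕ) : ℝ))) ≤ Real.exp (-t) := by
    refine Real.exp_le_exp.2 (neg_le_neg ?_)
    push_cast
    have : (0 : ℝ) ≤ n := by positivity
    nlinarith
  have e2 : Real.exp (-(heatRate m * ‖diagL ν x + lastL v‖ ^ 2 / t)) ≤
      Real.exp (-(heatRate m / 3 * (‖x‖ ^ 2 + ‖v‖ ^ 2) / t)) := by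
    refine Real.exp_le_exp.2 (neg_le_neg ?_)
    calc _ = heatRate m * ((‖x‖ ^ 2 + ‖v‖ ^ 2) / 3) / t := by ring
      _ ≤ _ := by gcongr; exact norm_diag_add_last ν x v
  rw [mul_assoc _ _ (Real.exp _), mul_assoc _ _ (Real.exp _), ← mul_assoc (heatConst M (n + 1) m)]
  exact mul_le_mul_of_nonneg_left (mul_le_mul e1 e2 (Real.exp_pos _).le (Real.exp_pos _).le)
    (by positivity)

/-- The configuration without the last y-particle. -/
def initL (Z : Cfg M (n + 1)) : Cfg M n := mk (xs Z) (fun k => ys Z k.castSucc)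

@[fun_prop] theorem continuous_initL : Continuous (initL (M := M) (n := n)) :=
  continuous_mk (fun _ => by fun_prop) (fun _ => by fun_prop)

theorem diagL_initL (ν : Fin M) (Z : Cfg M (n + 1)) :
    Z = diagL ν (initL Z) + lastL (ys Z (Fin.last n) - xs Z ν) := by
  refine cfg_ext (by simp [diagL_apply, lastL_apply, initL]) ?_
  ext j : 1
  refine Fin.lastCases ?_ (fun k => ?_) j <;> simp [diagL_apply, lastL_apply, initL]

theorem integrable_inv_one_add_sq_pow_mul {k : ℕ} (hk : Module.finrank ℝ (Cfg M n) < k)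
    (z : Cfg M n) (ψ : L2 M n) :
    Integrable fun w => ((1 + ‖z - w‖ ^ 2) ^ k)⁻¹ * ‖ψ w‖ := by
  have h1 : Integrable fun x : Cfg M n => (((1 + ‖x‖ ^ 2) ^ k)⁻¹) ^ 2 := by
    have hk' : (Module.finrank ℝ (Cfg M n) : ℝ) < 4 * k := by
      have : (Module.finrank ℝ (Cfg M n) : ℝ) < k := by exact_mod_cast hk
      have : (0 : ℝ) ≤ k := by positivity
      linarith
    refine (integrable_rpow_neg_one_add_norm_sq (μ := volume) hk').congr
      (Eventually.of_forall fun x => ?_)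
    simp only
    rw [show (-(4 * k : ℝ) / 2) = -((k * 2 : ℕ) : ℝ) by push_cast; ring,
      Real.rpow_neg (by positivity), Real.rpow_natCast, pow_mul, inv_pow]
  have h2 : Continuous fun x : Cfg M n => ((1 + ‖x‖ ^ 2) ^ k)⁻¹ :=
    Continuous.inv₀ (by fun_prop) fun x => by positivity
  have h3 : MemLp (fun x : Cfg M n => ((1 + ‖x‖ ^ 2) ^ k)⁻¹) 2 volume :=
    (memLp_two_iff_integrable_sq h2.aestronglyMeasurable).2 h1
  have h4 := h3.comp_measurePreserving (Measure.measurePreserving_sub_left volume z)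
  exact MemLp.integrable_mul h4 (Lp.memLp ψ).norm

/-- Away from `y_i = x_ν` the Gaussian bound is uniform in the time, so that dominated convergence
applies. -/
theorem continuousAt_potTerm {m : ℝ} (hm : 0 < m) (ν : Fin M) (i : Fin (n + 1)) (ψ : L2 M n)
    {Z₀ : Cfg M (n + 1)} (h : xs Z₀ ν ≠ ys Z₀ i) : ContinuousAt (potTerm m ν i ψ) Z₀ := by
  set z : Cfg M (n + 1) → Cfg M n := fun Z => initL (permL (swp i) Z) with hz
  set v : Cfg M (n + 1) → R3 := fun Z => ys (permL (swp i) Z) (Fin.last n) -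
    xs (permL (swp i) Z) ν with hv
  have hzc : Continuous z := by fun_prop
  have hvc : Continuous v := by fun_prop
  have hv0 : 0 < ‖v Z₀‖ := by
    rw [norm_pos_iff, hv]
    simp only [ys_permL, xs_permL, Function.comp_apply, Equiv.swap_apply_right]
    exact sub_ne_zero.2 h.symm
  -- `z` is the configuration without the `i`-th y-particle, `v` the vector from `x_ν` to `y_i`
  have hheat : ∀ t Z w, heat m t (Z - insL ν i w) = heat m t (diagL ν (z Z - w) + lastL (v Z)) := by
    intro t Z w
    rw [← heat_permL m t (swp i), map_sub, insL_apply, permL_swp_swp,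
      diagL_initL ν (permL (swp i) Z), map_sub (diagL ν)]
    congr 1
    abel
  have hδ := heatRate_pos hm
  obtain ⟨C, hC, hbd⟩ := gaussian_le (Fintype.card ((Fin M ⊕ Fin (n + 1)) × Fin 3))
    (Module.finrank ℝ (Cfg M n) + 1) (κ₁ := heatRate m / 6) (κ₂ := heatRate m / 24 * ‖v Z₀‖ ^ 2)
    (by positivity) (by positivity)
  have hc := heatConst_nonneg (M := M) (n := n + 1) m
  have hpos : ∀ᵐ q ∂((volume.restrict (Set.Ioi (0 : ℝ))).prod (volume : Measure (Cfg M n))),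
      0 < q.1 :=
    Measure.quasiMeasurePreserving_fst.ae (by
      filter_upwards [ae_restrict_mem measurableSet_Ioi] with t ht using ht)
  refine continuousAt_of_dominated (bound := fun q : ℝ × Cfg M n => heatConst M (n + 1) m * C *
    (Real.exp (-(1 / 2) * q.1) * (((1 + ‖z Z₀ - q.2‖ ^ 2) ^ (Module.finrank ℝ (Cfg M n) + 1))⁻¹ *
      ‖ψ q.2‖))) ?_ ?_ ?_ ?_
  · refine Eventually.of_forall fun Z => ?_
    refine Measurable.aestronglyMeasurable (Measurable.mul ?_ ?_)
    · have : Measurable fun q : ℝ × Cfg M n => heat m q.1 (Z - insL ν i q.2) :=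
        (measurable_heat m).comp (measurable_fst.prodMk
          (measurable_const.sub ((insL ν i).measurable.comp measurable_snd)))
      exact Complex.measurable_ofReal.comp this
    · exact (measurable_coe ψ).comp measurable_snd
  · have e1 : ∀ᶠ Z in 𝓝 Z₀, ‖z Z - z Z₀‖ ^ 2 < ‖v Z₀‖ ^ 2 / 8 := by
      have : Continuous fun Z => ‖z Z - z Z₀‖ ^ 2 := by fun_prop
      refine this.continuousAt.eventually_lt continuousAt_const ?_
      have : 0 < ‖v Z₀‖ ^ 2 / 8 := by positivity
      simpa using this
    have e2 : ∀ᶠ Z in 𝓝 Z₀, ‖v Z₀‖ ^ 2 / 4 < ‖v Z‖ ^ 2 := by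
      have : Continuous fun Z => ‖v Z‖ ^ 2 := by fun_prop
      refine continuousAt_const.eventually_lt this.continuousAt ?_
      have : 0 < ‖v Z₀‖ ^ 2 := by positivity
      linarith
    filter_upwards [e1, e2] with Z h1 h2
    filter_upwards [hpos] with q hq
    have h3 : ‖z Z₀ - q.2‖ ^ 2 / 2 + ‖v Z₀‖ ^ 2 / 8 ≤ ‖z Z - q.2‖ ^ 2 + ‖v Z‖ ^ 2 := by
      have a1 : ‖z Z₀ - q.2‖ ≤ ‖z Z - q.2‖ + ‖z Z - z Z₀‖ := by
        have := norm_sub_le (z Z - q.2) (z Z - z Z₀)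
        rwa [sub_sub_sub_cancel_left] at this
      nlinarith [norm_nonneg (z Z₀ - q.2), norm_nonneg (z Z - q.2), norm_nonneg (z Z - z Z₀),
        sq_nonneg (‖z Z - q.2‖ - ‖z Z - z Z₀‖)]
    simp only [ContinuousLinearMap.id_apply]
    rw [norm_mul, Complex.norm_real, Real.norm_of_nonneg (heat_nonneg _ _ _), hheat]
    have h4 : heatRate m / 6 * ‖z Z₀ - q.2‖ ^ 2 + heatRate m / 24 * ‖v Z₀‖ ^ 2 ≤
        heatRate m / 3 * (‖z Z - q.2‖ ^ 2 + ‖v Z‖ ^ 2) := by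
      calc _ = heatRate m / 3 * (‖z Z₀ - q.2‖ ^ 2 / 2 + ‖v Z₀‖ ^ 2 / 8) := by ring
        _ ≤ _ := by gcongr
    calc heat m q.1 (diagL ν (z Z - q.2) + lastL (v Z)) * ‖ψ q.2‖
        ≤ heatConst M (n + 1) m * ((√q.1)⁻¹ ^ Fintype.card ((Fin M ⊕ Fin (n + 1)) × Fin 3) *
          Real.exp (-q.1) * Real.exp (-((heatRate m / 6 * ‖z Z₀ - q.2‖ ^ 2 +
            heatRate m / 24 * ‖v Z₀‖ ^ 2) / q.1))) * ‖ψ q.2‖ := by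
          gcongr
          refine (heat_diag_le hm hq ν _ _).trans ?_
          gcongr
      _ ≤ heatConst M (n + 1) m * (C * (Real.exp (-(q.1 / 2)) *
          ((1 + ‖z Z₀ - q.2‖ ^ 2) ^ (Module.finrank ℝ (Cfg M n) + 1))⁻¹)) * ‖ψ q.2‖ := by
          exact mul_le_mul_of_nonneg_right (mul_le_mul_of_nonneg_left
            (hbd q.1 _ hq (by positivity)) hc) (norm_nonneg _)
      _ = _ := by
          rw [show -(q.1 / 2) = -(1 / 2) * q.1 by ring]; ring
  · refine Integrable.const_mul ?_ _
    have i1 : Integrable (fun t : ℝ => Real.exp (-(1 / 2) * t)) (volume.restrict (Set.Ioi 0)) :=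
      integrableOn_exp_mul_Ioi (by norm_num) 0
    exact i1.mul_prod (integrable_inv_one_add_sq_pow_mul (Nat.lt_succ_self _) (z Z₀) ψ)
  · refine Eventually.of_forall fun q => Continuous.continuousAt ?_
    simp only [ContinuousLinearMap.id_apply]
    refine (Complex.continuous_ofReal.comp ?_).mul continuous_const
    exact (continuous_heat m q.1).comp (continuous_id.sub continuous_const)

theorem continuousOn_pot {m : ℝ} (hm : 0 < m) (ψ : L2 M n) :
    ContinuousOn (pot m ψ) (collisions M (n + 1))ᶜ := by
  refine continuousOn_of_forall_continuousAt fun Z hZ => ?_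
  have h : ∀ ν i, xs Z ν ≠ ys Z i := by
    intro ν i heq
    refine hZ ?_
    change ∏ μ, ∏ i, ‖xs Z μ - ys Z i‖ = 0
    rw [Finset.prod_eq_zero (Finset.mem_univ ν)]
    rw [Finset.prod_eq_zero (Finset.mem_univ i)]
    rw [heq, sub_self, norm_zero]
  unfold pot
  refine (continuousAt_const.mul ?_).neg
  refine tendsto_finsetSum _ fun ν _ => tendsto_finsetSum _ fun i _ => ?_
  exact continuousAt_potTerm hm ν i ψ (h ν i)

end Continuity

/-! ### Gaussian averages at Lebesgue points -/

section Lebesgue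

variable {E : Type*} [NormedAddCommGroup E] [InnerProductSpace ℝ E] [FiniteDimensional ℝ E]
  [MeasurableSpace E] [BorelSpace E]

/-- The Gaussian average at scale `√t` of the oscillation of `f` around its value at `z`. -/
def gaussOsc (κ : ℝ) (f : E → ℂ) (z : E) (t : ℝ) : ℝ≥0∞ :=
  ∫⁻ w, ‖f w - f z‖ₑ * ENNReal.ofReal ((√t)⁻¹ ^ Module.finrank ℝ E *
    Real.exp (-(κ * ‖z - w‖ ^ 2 / t)))

/-- The average over a ball of the oscillation of `f` around its value at `z`. -/
def ballOsc (f : E → ℂ) (z : E) (ρ : ℝ) : ℝ≥0∞ :=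
  (∫⁻ w in Metric.closedBall z ρ, ‖f w - f z‖ₑ) / volume (Metric.closedBall z ρ)

/-- Almost every point is a Lebesgue point. -/
theorem ae_tendsto_ballOsc {f : E → ℂ} (hf : MemLp f 2 volume) :
    ∀ᵐ z, Tendsto (ballOsc f z) (𝓝[>] 0) (𝓝 0) := by
  have h1 := (IsUnifLocDoublingMeasure.vitaliFamily (volume : Measure E)
    1).ae_tendsto_lintegral_enorm_sub_div (hf.locallyIntegrable (by norm_num))
  filter_upwards [h1] with z hz
  exact hz.comp (IsUnifLocDoublingMeasure.tendsto_closedBall_filterAt (K := 1) volume (fun _ => z)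
    (fun ρ => ρ) tendsto_id (by
      filter_upwards [self_mem_nhdsWithin] with ρ hρ
      have : (0 : ℝ) < ρ := hρ
      simp [this.le]))

/-- At a Lebesgue point of an `L²` function the averages are bounded over all radii: for small radii
they tend to zero, for large ones `|f| ≤ 1 + |f|²` is used. -/
theorem ballOsc_bounded {f : E → ℂ} (hf : MemLp f 2 volume) {z : E}
    (h : Tendsto (ballOsc f z) (𝓝[>] 0) (𝓝 0)) :
    ∃ C : ℝ≥0∞, C ≠ ∞ ∧ ∀ ρ, 0 < ρ → ballOsc f z ρ ≤ C := by
  have h1 : ∀ᶠ ρ in 𝓝[>] (0 : ℝ), ballOsc f z ρ < 1 := h.eventually_lt_const one_pos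
  obtain ⟨ρ₀, hρ₀, hsub⟩ := mem_nhdsGT_iff_exists_Ioc_subset.1 h1
  have hρ₀' : 0 < ρ₀ := hρ₀
  set B : ℝ≥0∞ := ∫⁻ w, ‖f w‖ₑ ^ 2 with hB
  have hBt : B ≠ ∞ := lintegral_enorm_sq_ne_top hf
  have hv0 : volume (Metric.closedBall z ρ₀) ≠ 0 :=
    (Metric.measure_closedBall_pos volume z hρ₀').ne'
  refine ⟨1 + (1 + ‖f z‖ₑ + B / volume (Metric.closedBall z ρ₀)), ?_, fun ρ hρ => ?_⟩
  · simp [ENNReal.div_eq_top, hBt, hv0]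
  by_cases hle : ρ ≤ ρ₀
  · have : ballOsc f z ρ < 1 := hsub ⟨hρ, hle⟩
    exact this.le.trans le_self_add
  · refine le_trans ?_ le_add_self
    have hlt := not_le.1 hle
    have hv : volume (Metric.closedBall z ρ) ≠ 0 := (Metric.measure_closedBall_pos volume z hρ).ne'
    have hvt : volume (Metric.closedBall z ρ) ≠ ∞ :=
      (isCompact_closedBall z ρ).measure_lt_top.ne
    have key : ∫⁻ w in Metric.closedBall z ρ, ‖f w - f z‖ₑ ≤
        (1 + ‖f z‖ₑ) * volume (Metric.closedBall z ρ) + B := by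
      calc _ ≤ ∫⁻ w in Metric.closedBall z ρ, ((1 + ‖f z‖ₑ) + ‖f w‖ₑ ^ 2) := by
            refine lintegral_mono fun w => ?_
            have h2 : ‖f w‖ₑ ≤ 1 + ‖f w‖ₑ ^ 2 := by
              rcases le_total ‖f w‖ₑ 1 with h | h
              · exact h.trans le_self_add
              · calc ‖f w‖ₑ ≤ ‖f w‖ₑ ^ 2 := le_self_pow₀ h (by norm_num)
                  _ ≤ _ := le_add_self
            calc ‖f w - f z‖ₑ ≤ ‖f w‖ₑ + ‖f z‖ₑ := enorm_sub_le
              _ ≤ 1 + ‖f w‖ₑ ^ 2 + ‖f z‖ₑ := by gcongr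
              _ = _ := by ring
        _ = (1 + ‖f z‖ₑ) * volume (Metric.closedBall z ρ) +
            ∫⁻ w in Metric.closedBall z ρ, ‖f w‖ₑ ^ 2 := by
            rw [lintegral_add_left measurable_const, setLIntegral_const]
        _ ≤ _ := by
            gcongr
            exact setLIntegral_le_lintegral _ _
    calc ballOsc f z ρ ≤ ((1 + ‖f z‖ₑ) * volume (Metric.closedBall z ρ) + B) /
          volume (Metric.closedBall z ρ) := ENNReal.div_le_div_right key _
      _ = (1 + ‖f z‖ₑ) + B / volume (Metric.closedBall z ρ) := by
          rw [ENNReal.add_div, ENNReal.mul_div_cancel_right hv hvt]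
      _ ≤ _ := by
          gcongr

/-- A Gaussian average is a superposition of averages over balls. -/
theorem gaussOsc_le {κ : ℝ} (hκ : 0 < κ) (f : E → ℂ) (hf : Measurable f) (z : E) {t : ℝ}
    (ht : 0 < t) :
    gaussOsc κ f z t ≤ ∑' k : ℕ, ENNReal.ofReal (Real.exp (-(κ * k)) *
      ((k : ℝ) + 1) ^ Module.finrank ℝ E) * volume (Metric.ball (0 : E) 1) *
      ballOsc f z (((k : ℝ) + 1) * √t) := by
  have hst : 0 < √t := Real.sqrt_pos.2 ht
  have hpt : ∀ w, ‖f w - f z‖ₑ * ENNReal.ofReal ((√t)⁻¹ ^ Module.finrank ℝ E *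
      Real.exp (-(κ * ‖z - w‖ ^ 2 / t))) ≤
      ∑' k : ℕ, ENNReal.ofReal ((√t)⁻¹ ^ Module.finrank ℝ E * Real.exp (-(κ * k))) *
        (Metric.closedBall z (((k : ℝ) + 1) * √t)).indicator (fun w => ‖f w - f z‖ₑ) w := by
    intro w
    -- `w` lies in the ball of radius `(k + 1) √t`, where the Gaussian is at most `exp (-κ k)`
    set k : ℕ := ⌊‖z - w‖ / √t⌋₊ with hk
    have hk1 : (k : ℝ) ≤ ‖z - w‖ / √t := Nat.floor_le (by positivity)
    have hk2 : ‖z - w‖ / √t < k + 1 := Nat.lt_floor_add_one _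
    have hmem : w ∈ Metric.closedBall z (((k : ℝ) + 1) * √t) := by
      rw [Metric.mem_closedBall, dist_comm, dist_eq_norm]
      exact ((div_lt_iff₀ hst).1 hk2).le
    refine le_trans ?_ (ENNReal.le_tsum k)
    rw [Set.indicator_of_mem hmem, mul_comm]
    gcongr
    have h3 : (k : ℝ) ≤ (k : ℝ) ^ 2 := by
      exact_mod_cast Nat.le_self_pow (by norm_num) k
    have h4 : (k : ℝ) ^ 2 ≤ ‖z - w‖ ^ 2 / t := by
      calc (k : ℝ) ^ 2 ≤ (‖z - w‖ / √t) ^ 2 := by gcongr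
        _ = _ := by rw [div_pow, Real.sq_sqrt ht.le]
    calc κ * k ≤ κ * (‖z - w‖ ^ 2 / t) := by gcongr; exact h3.trans h4
      _ = _ := by ring
  have hmeas : Measurable fun w => ‖f w - f z‖ₑ := (hf.sub_const _).enorm
  calc gaussOsc κ f z t ≤ ∫⁻ w, ∑' k : ℕ, ENNReal.ofReal ((√t)⁻¹ ^ Module.finrank ℝ E *
        Real.exp (-(κ * k))) * (Metric.closedBall z (((k : ℝ) + 1) * √t)).indicator
          (fun w => ‖f w - f z‖ₑ) w := lintegral_mono hpt
    _ = ∑' k : ℕ, ENNReal.ofReal ((√t)⁻¹ ^ Module.finrank ℝ E * Real.exp (-(κ * k))) *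
        ∫⁻ w in Metric.closedBall z (((k : ℝ) + 1) * √t), ‖f w - f z‖ₑ := by
        rw [lintegral_tsum fun k => ((hmeas.indicator
          Metric.isClosed_closedBall.measurableSet).const_mul _).aemeasurable]
        congr 1; ext k
        rw [lintegral_const_mul _ (hmeas.indicator Metric.isClosed_closedBall.measurableSet),
          lintegral_indicator Metric.isClosed_closedBall.measurableSet]
    _ = _ := by
        congr 1; ext k
        have hρ : 0 < ((k : ℝ) + 1) * √t := by positivity
        have hv : volume (Metric.closedBall z (((k : ℝ) + 1) * √t)) ≠ 0 :=
          (Metric.measure_closedBall_pos volume z hρ).ne'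
        have hvt : volume (Metric.closedBall z (((k : ℝ) + 1) * √t)) ≠ ∞ :=
          (isCompact_closedBall z _).measure_lt_top.ne
        have h5 : ∫⁻ w in Metric.closedBall z (((k : ℝ) + 1) * √t), ‖f w - f z‖ₑ =
            volume (Metric.closedBall z (((k : ℝ) + 1) * √t)) *
              ballOsc f z (((k : ℝ) + 1) * √t) := by
          rw [ballOsc, ENNReal.mul_div_cancel hv hvt]
        rw [h5, Measure.addHaar_closedBall _ _ hρ.le, ← mul_assoc, ← mul_assoc,
          ← ENNReal.ofReal_mul (by positivity)]
        congr 3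
        rw [mul_pow, inv_pow]
        field_simp

/-- At a Lebesgue point the Gaussian averages of the oscillation are bounded, and vanish at small
times. -/
theorem ae_gaussOsc {κ : ℝ} (hκ : 0 < κ) {f : E → ℂ} (hfm : Measurable f)
    (hf : MemLp f 2 volume) :
    ∀ᵐ z, (∃ C : ℝ≥0∞, C ≠ ∞ ∧ ∀ t, 0 < t → gaussOsc κ f z t ≤ C) ∧
      Tendsto (gaussOsc κ f z) (𝓝[>] 0) (𝓝 0) := by
  filter_upwards [ae_tendsto_ballOsc hf] with z hz
  obtain ⟨C, hC, hb⟩ := ballOsc_bounded hf hz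
  set c : ℕ → ℝ≥0∞ := fun k => ENNReal.ofReal (Real.exp (-(κ * k)) *
      ((k : ℝ) + 1) ^ Module.finrank ℝ E) * volume (Metric.ball (0 : E) 1) with hc
  have hct : ∀ k, c k ≠ ∞ := fun k =>
    ENNReal.mul_ne_top ENNReal.ofReal_ne_top Metric.isBounded_ball.measure_lt_top.ne
  have hcs : ∑' k, c k ≠ ∞ := by
    rw [hc, ENNReal.tsum_mul_right]
    refine ENNReal.mul_ne_top ?_ Metric.isBounded_ball.measure_lt_top.ne
    obtain ⟨C₁, hC₁, hb₁⟩ := one_add_pow_mul_exp_le (Module.finrank ℝ E) (κ := κ / 2) (by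
      positivity)
    have hr : Real.exp (-(κ / 2)) < 1 := by
      rw [← Real.exp_zero]; exact Real.exp_lt_exp.2 (by linarith)
    have hsum : Summable fun k : ℕ => C₁ * Real.exp (-(κ / 2)) ^ k :=
      (summable_geometric_of_lt_one (Real.exp_pos _).le hr).mul_left _
    have hle : ∀ k : ℕ, Real.exp (-(κ * k)) * ((k : ℝ) + 1) ^ Module.finrank ℝ E ≤
        C₁ * Real.exp (-(κ / 2)) ^ k := by
      intro k
      have h := hb₁ k (by positivity)
      rw [← Real.exp_nat_mul]
      calc _ = (1 + (k : ℝ)) ^ Module.finrank ℝ E * Real.exp (-(κ / 2 * k)) *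
            Real.exp (k * -(κ / 2)) := by
            rw [mul_assoc, ← Real.exp_add, mul_comm, add_comm (k : ℝ) 1]; congr 2; ring
        _ ≤ _ := by gcongr
    exact (hsum.of_nonneg_of_le (fun k => by positivity) hle).tsum_ofReal_ne_top
  have hle : ∀ t, 0 < t → gaussOsc κ f z t ≤ ∑' k, c k * ballOsc f z (((k : ℝ) + 1) * √t) :=
    fun t ht => gaussOsc_le hκ f hfm z ht
  constructor
  · refine ⟨(∑' k, c k) * C, ENNReal.mul_ne_top hcs hC, fun t ht => (hle t ht).trans ?_⟩
    rw [← ENNReal.tsum_mul_right]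
    refine ENNReal.tsum_le_tsum fun k => ?_
    gcongr
    exact hb _ (mul_pos (by positivity) (Real.sqrt_pos.2 ht))
  -- dominated convergence for the series over the radii
  · have hlim : Tendsto (fun t => ∑' k, c k * ballOsc f z (((k : ℝ) + 1) * √t)) (𝓝[>] 0)
        (𝓝 0) := by
      have := tendsto_lintegral_filter_of_dominated_convergence (μ := Measure.count)
        (l := 𝓝[>] (0 : ℝ)) (F := fun t (k : ℕ) => c k * ballOsc f z (((k : ℝ) + 1) * √t))
        (f := fun _ => 0) (fun k => c k * C) (Eventually.of_forall fun t => measurable_from_nat)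
        (by
          filter_upwards [self_mem_nhdsWithin] with t ht
          refine Eventually.of_forall fun k => ?_
          gcongr
          exact hb _ (mul_pos (by positivity) (Real.sqrt_pos.2 ht)))
        (by
          rw [lintegral_count, ENNReal.tsum_mul_right]
          exact ENNReal.mul_ne_top hcs hC)
        (Eventually.of_forall fun k => by
          have h1 : Tendsto (fun t : ℝ => ((k : ℝ) + 1) * √t) (𝓝[>] 0) (𝓝[>] 0) := by
            refine tendsto_nhdsWithin_iff.2 ⟨?_, ?_⟩
            · have : Continuous fun t : ℝ => ((k : ℝ) + 1) * √t := by fun_prop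
              have := this.tendsto 0
              rw [Real.sqrt_zero, mul_zero] at this
              exact this.mono_left nhdsWithin_le_nhds
            · filter_upwards [self_mem_nhdsWithin] with t ht
              exact mul_pos (by positivity) (Real.sqrt_pos.2 ht)
          have h2 := ENNReal.Tendsto.const_mul (a := c k) (hz.comp h1) (Or.inr (hct k))
          simpa using h2)
      simpa [lintegral_count] using this
    refine tendsto_of_tendsto_of_tendsto_of_le_of_le' tendsto_const_nhds hlim
      (Eventually.of_forall fun _ => zero_le) ?_
    filter_upwards [self_mem_nhdsWithin] with t ht using hle t ht

end Lebesgue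

/-! ### The dominance of small times -/

section SmallTime

/-- After multiplication by `r`, only small times contribute to the integral as `r → 0`. -/
theorem tendsto_smallTime {κ : ℝ} (hκ : 0 < κ) {g : ℝ → ℝ≥0∞} {C : ℝ≥0∞} (hC : C ≠ ∞)
    (hg : ∀ t, 0 < t → g t ≤ C) (hg0 : Tendsto g (𝓝[>] 0) (𝓝 0)) :
    Tendsto (fun r => ENNReal.ofReal r * ∫⁻ t in Set.Ioi 0, ENNReal.ofReal ((√t)⁻¹ ^ 3 *
      Real.exp (-t) * Real.exp (-(κ * r ^ 2 / t))) * g t) (𝓝[>] 0) (𝓝 0) := by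
  have hsκ : 0 < √κ := Real.sqrt_pos.2 hκ
  rw [ENNReal.tendsto_nhds_zero]
  intro δ hδ
  set K : ℝ≥0∞ := ENNReal.ofReal (√Real.pi / √κ) + 1 with hK
  have hK0 : K ≠ 0 := by simp [hK]
  have hKt : K ≠ ∞ := by simp [hK]
  set η : ℝ≥0∞ := δ / 2 / K with hη
  have hη0 : 0 < η := ENNReal.div_pos (ENNReal.half_pos hδ.ne').ne' hKt
  have hev : ∀ᶠ t in 𝓝[>] (0 : ℝ), g t ≤ η := (ENNReal.tendsto_nhds_zero.1 hg0) η hη0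
  obtain ⟨t₀, ht₀, hsub⟩ := mem_nhdsGT_iff_exists_Ioc_subset.1 hev
  have ht₀' : 0 < √t₀ := Real.sqrt_pos.2 ht₀
  -- `g` is small for `t ≤ t₀`; for larger times the singular factor `(√t)⁻¹ ^ 3` is compensated
  have hgle : ∀ t, 0 < t → g t ≤ η + C * ENNReal.ofReal (√t ^ 3 * (√t₀)⁻¹ ^ 3) := by
    intro t ht
    by_cases h : t ≤ t₀
    · exact le_trans (hsub ⟨ht, h⟩) le_self_add
    · refine le_trans (hg t ht) (le_trans ?_ le_add_self)
      refine le_mul_of_one_le_right zero_le ?_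
      rw [ENNReal.one_le_ofReal, ← mul_pow, ← div_eq_mul_inv]
      refine one_le_pow₀ ((one_le_div ht₀').2 (Real.sqrt_le_sqrt (not_le.1 h).le))
  have hmain : ∀ r, 0 < r → ENNReal.ofReal r * ∫⁻ t in Set.Ioi 0, ENNReal.ofReal ((√t)⁻¹ ^ 3 *
      Real.exp (-t) * Real.exp (-(κ * r ^ 2 / t))) * g t ≤
      η * K + ENNReal.ofReal r * (C * ENNReal.ofReal ((√t₀)⁻¹ ^ 3)) := by
    intro r hr
    have hA : ∫⁻ t in Set.Ioi 0, ENNReal.ofReal ((√t)⁻¹ ^ 3 * Real.exp (-t) *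
        Real.exp (-(κ * r ^ 2 / t))) ≤ ENNReal.ofReal (√Real.pi / (√κ * r)) := by
      obtain ⟨h1, h2⟩ := subordination_aux (a := √κ * r) (b := 1) (by positivity) one_pos
      have h3 : ∀ t : ℝ, (√t)⁻¹ ^ 3 * Real.exp (-t) * Real.exp (-(κ * r ^ 2 / t)) =
          (√t)⁻¹ ^ 3 * Real.exp (-((√κ * r) ^ 2 / t + 1 ^ 2 * t)) := fun t => by
        rw [mul_assoc, ← Real.exp_add, mul_pow, Real.sq_sqrt hκ.le]; congr 2; ring
      simp_rw [h3]
      rw [← ofReal_integral_eq_lintegral_ofReal h1 (Eventually.of_forall fun t => by positivity),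
        h2]
      refine ENNReal.ofReal_le_ofReal (mul_le_of_le_one_right (by positivity) ?_)
      exact Real.exp_le_one_iff.2 (by
        have : 0 < √κ * r := by positivity
        linarith)
    have hE : ∫⁻ t in Set.Ioi (0 : ℝ), ENNReal.ofReal (Real.exp (-t)) = 1 := by
      rw [← ofReal_integral_eq_lintegral_ofReal (integrableOn_exp_neg_Ioi 0)
        (Eventually.of_forall fun t => (Real.exp_pos _).le), integral_exp_neg_Ioi_zero]
      simp
    have hmA : Measurable fun t : ℝ => ENNReal.ofReal ((√t)⁻¹ ^ 3 * Real.exp (-t) *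
        Real.exp (-(κ * r ^ 2 / t))) := by
      have : Measurable fun t : ℝ => Real.exp (-(κ * r ^ 2 / t)) :=
        Real.measurable_exp.comp (measurable_const.div measurable_id).neg
      exact ((((Real.continuous_sqrt.measurable.inv).pow_const 3).mul (by fun_prop)).mul
        this).ennreal_ofReal
    have hint : ∫⁻ t in Set.Ioi 0, ENNReal.ofReal ((√t)⁻¹ ^ 3 * Real.exp (-t) *
        Real.exp (-(κ * r ^ 2 / t))) * g t ≤ η * ENNReal.ofReal (√Real.pi / (√κ * r)) +
          C * ENNReal.ofReal ((√t₀)⁻¹ ^ 3) := by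
      calc _ ≤ ∫⁻ t in Set.Ioi 0, (η * ENNReal.ofReal ((√t)⁻¹ ^ 3 * Real.exp (-t) *
            Real.exp (-(κ * r ^ 2 / t))) +
            C * ENNReal.ofReal ((√t₀)⁻¹ ^ 3) * ENNReal.ofReal (Real.exp (-t))) := by
            refine setLIntegral_mono' measurableSet_Ioi fun t ht => ?_
            have ht' : (0 : ℝ) < t := ht
            have hst : 0 < √t := Real.sqrt_pos.2 ht'
            refine (mul_le_mul_right (hgle t ht) _).trans ?_
            rw [mul_add, mul_comm _ η]
            refine add_le_add_right ?_ _
            rw [mul_left_comm, ← ENNReal.ofReal_mul (by positivity), mul_assoc C,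
              ← ENNReal.ofReal_mul (by positivity)]
            refine mul_le_mul_right (ENNReal.ofReal_le_ofReal ?_) _
            have e1 : (√t)⁻¹ ^ 3 * √t ^ 3 = 1 := by
              rw [← mul_pow, inv_mul_cancel₀ hst.ne', one_pow]
            calc _ = ((√t)⁻¹ ^ 3 * √t ^ 3) * ((√t₀)⁻¹ ^ 3 * Real.exp (-t)) *
                  Real.exp (-(κ * r ^ 2 / t)) := by ring
              _ ≤ _ := by
                rw [e1, one_mul]
                refine mul_le_of_le_one_right (by positivity) (Real.exp_le_one_iff.2 ?_)
                have : 0 ≤ κ * r ^ 2 / t := by positivity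
                linarith
        _ = η * (∫⁻ t in Set.Ioi 0, ENNReal.ofReal ((√t)⁻¹ ^ 3 * Real.exp (-t) *
            Real.exp (-(κ * r ^ 2 / t)))) + C * ENNReal.ofReal ((√t₀)⁻¹ ^ 3) := by
            rw [lintegral_add_left (hmA.const_mul _), lintegral_const_mul _ hmA,
              lintegral_const_mul _ (by fun_prop), hE, mul_one]
        _ ≤ _ := by gcongr
    refine (mul_le_mul_right hint _).trans ?_
    rw [mul_add, mul_left_comm, ← ENNReal.ofReal_mul hr.le]
    refine add_le_add_left (mul_le_mul_right ?_ _) _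
    rw [hK]
    refine le_trans (ENNReal.ofReal_le_ofReal (le_of_eq ?_)) le_self_add
    field_simp
  have hlim : Tendsto (fun r => ENNReal.ofReal r * (C * ENNReal.ofReal ((√t₀)⁻¹ ^ 3))) (𝓝[>] 0)
      (𝓝 0) := by
    have h1 : Tendsto (fun r : ℝ => ENNReal.ofReal r) (𝓝[>] 0) (𝓝 0) := by
      have := (ENNReal.continuous_ofReal.tendsto 0).mono_left
        (nhdsWithin_le_nhds (s := Set.Ioi (0 : ℝ)))
      simpa using this
    have := ENNReal.Tendsto.mul_const h1 (b := C * ENNReal.ofReal ((√t₀)⁻¹ ^ 3))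
      (Or.inr (ENNReal.mul_ne_top hC ENNReal.ofReal_ne_top))
    simpa using this
  have hev2 := (ENNReal.tendsto_nhds_zero.1 hlim) (δ / 2) (ENNReal.half_pos hδ.ne')
  filter_upwards [hev2, self_mem_nhdsWithin] with r hr hr0
  refine (hmain r hr0).trans ?_
  rw [hη, ENNReal.div_mul_cancel hK0 hKt, ← ENNReal.add_halves δ]
  simpa [ENNReal.add_halves] using add_le_add_right hr (δ / 2)

end SmallTime

/-! ### The heat kernel integrated over a plane `y_{n+1} = x_μ + v` -/

section Singularity

variable {M n : ℕ}

/-- The value at zero momentum of the Fourier inversion of `diagSym`. -/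
theorem integral_heat_diag {m t : ℝ} (hm : 0 < m) (ht : 0 < t) (μ : Fin M) (v : R3)
    (z : Cfg M n) :
    Integrable (fun w => heat m t (diagL μ (z - w) + lastL v)) ∧
    ∫ w, heat m t (diagL μ (z - w) + lastL v) = √(redMass m / (4 * Real.pi * t)) ^ 3 *
      Real.exp (-(t * ((n : ℝ) + 1) + redMass m * ‖v‖ ^ 2 / (4 * t))) := by
  obtain ⟨h1, h2⟩ := fourierInv_diagSym (n := n) hm ht μ v
  have hδ := heatRate_pos hm
  have hc := heatConst_nonneg (M := M) (n := n + 1) m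
  have hcont : Continuous fun x : Cfg M n => heat m t (diagL μ x + lastL v) := by fun_prop
  have hint : Integrable fun x : Cfg M n => heat m t (diagL μ x + lastL v) := by
    have hb : 0 < (((heatRate m / 3 / t : ℝ)) : ℂ).re := by
      rw [Complex.ofReal_re]; positivity
    have hG := ((GaussianFourier.integrable_cexp_neg_mul_sq_norm_add (V := Cfg M n) hb 0 0).norm)
    refine (hG.const_mul (heatConst M (n + 1) m *
      (√t)⁻¹ ^ Fintype.card ((Fin M ⊕ Fin (n + 1)) × Fin 3))).mono' hcont.aestronglyMeasurable
      (Eventually.of_forall fun x => ?_)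
    rw [Real.norm_of_nonneg (heat_nonneg _ _ _)]
    refine (heat_diag_le hm ht μ x v).trans ?_
    rw [← mul_assoc, ← mul_assoc]
    have e1 : Real.exp (-t) ≤ 1 := Real.exp_le_one_iff.2 (by linarith)
    have e2 : Real.exp (-(heatRate m / 3 * (‖x‖ ^ 2 + ‖v‖ ^ 2) / t)) ≤
        ‖Complex.exp (-((heatRate m / 3 / t : ℝ) : ℂ) * ‖x‖ ^ 2 + 0 * (inner ℝ 0 x : ℝ))‖ := by
      rw [zero_mul, add_zero, Complex.norm_exp]
      have e3 : (-((heatRate m / 3 / t : ℝ) : ℂ) * ‖x‖ ^ 2).re = -(heatRate m / 3 / t * ‖x‖ ^ 2) :=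
        by
        rw [← Complex.ofReal_pow, ← Complex.ofReal_neg, ← Complex.ofReal_mul, Complex.ofReal_re]
        ring
      rw [e3]
      refine Real.exp_le_exp.2 (neg_le_neg ?_)
      calc heatRate m / 3 / t * ‖x‖ ^ 2 = heatRate m / 3 * (‖x‖ ^ 2 + 0) / t := by ring
        _ ≤ _ := by gcongr; positivity
    calc _ ≤ heatConst M (n + 1) m * (√t)⁻¹ ^ Fintype.card ((Fin M ⊕ Fin (n + 1)) × Fin 3) * 1 *
          Real.exp (-(heatRate m / 3 * (‖x‖ ^ 2 + ‖v‖ ^ 2) / t)) := by gcongr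
      _ ≤ _ := by rw [mul_one]; gcongr
  have hcΓ : Continuous (diagSym (n := n) m μ t v) := by
    unfold diagSym
    have c1 : Continuous fun p : Cfg M n => √(redMass m / (4 * Real.pi * t)) ^ 3 *
      Real.exp (-(t * lam m μ ((2 * Real.pi) • p) + redMass m * ‖v‖ ^ 2 / (4 * t))) := by fun_prop
    have c2 : Continuous fun p : Cfg M n => (2 * Real.pi *
      inner ℝ v ((1 / (2 * m + 1)) • xs p μ) : ℝ) := by fun_prop
    have c3 : Continuous fun x : ℝ => Complex.exp ((x : ℂ) * Complex.I) := by fun_prop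
    exact (Complex.continuous_ofReal.comp c1).mul (c3.comp c2)
  have hF : 𝓕⁻ (diagSym (n := n) m μ t v) =
      fun x => ((heat m t (diagL μ x + lastL v) : ℝ) : ℂ) := funext h2
  have hintC : Integrable fun x : Cfg M n => ((heat m t (diagL μ x + lastL v) : ℝ) : ℂ) :=
    hint.ofReal
  have hF' : Integrable (𝓕 (diagSym (n := n) m μ t v)) := by
    have : 𝓕 (diagSym (n := n) m μ t v) =
        fun x => ((heat m t (diagL μ (-x) + lastL v) : ℝ) : ℂ) := by
      funext x
      rw [← h2, Real.fourierInv_eq_fourier_neg, neg_neg]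
    rw [this]
    exact hintC.comp_neg
  have hinv := congrFun (hcΓ.fourier_fourierInv_eq h1 hF') 0
  rw [hF, Real.fourier_eq'] at hinv
  simp only [inner_zero_right, mul_zero, Complex.ofReal_zero, zero_mul, Complex.exp_zero,
    one_smul] at hinv
  refine ⟨hint.comp_sub_left z, ?_⟩
  rw [integral_sub_left_eq_self (fun x => heat m t (diagL μ x + lastL v)) volume z]
  have h0 : lam m μ ((2 * Real.pi) • (0 : Cfg M n)) = (n : ℝ) + 1 := by
    simp [lam]
  rw [integral_complex_ofReal, diagSym, h0] at hinv
  simp only [xs_zero, Pi.zero_apply, smul_zero, inner_zero_right, mul_zero, Complex.ofReal_zero,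
    zero_mul, Complex.exp_zero, mul_one] at hinv
  exact_mod_cast hinv

theorem insL_last (μ : Fin M) (w : Cfg M n) : insL μ (Fin.last n) w = diagL μ w := by
  rw [insL_apply, swp, Equiv.swap_self, ← Equiv.Perm.one_def, permL_one]

end Singularity

/-! ### The boundary value `B G ψ` -/

section BoundaryValue

variable {M n : ℕ}

/-- The effect of the singular term on a constant function. -/
theorem integral_heat_diag_prod {m : ℝ} (hm : 0 < m) (μ : Fin M) {v : R3} (hv : v ≠ 0)
    (z : Cfg M n) :
    Integrable (fun q : ℝ × Cfg M n => heat m q.1 (diagL μ (z - q.2) + lastL v))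
      ((volume.restrict (Set.Ioi 0)).prod volume) ∧
    ∫ q : ℝ × Cfg M n, heat m q.1 (diagL μ (z - q.2) + lastL v)
      ∂(volume.restrict (Set.Ioi 0)).prod volume =
      redMass m / (4 * Real.pi * ‖v‖) * Real.exp (-(‖v‖ * √(redMass m * ((n : ℝ) + 1)))) := by
  have hv' : 0 < ‖v‖ := norm_pos_iff.2 hv
  obtain ⟨h1, h2⟩ := subordination (redMass_pos hm) hv' (Λ := (n : ℝ) + 1) (by positivity)
  have hmeas : Measurable fun q : ℝ × Cfg M n => heat m q.1 (diagL μ (z - q.2) + lastL v) := by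
    have h : Measurable fun q : ℝ × Cfg M n => (q.1, diagL μ (z - q.2) + lastL v) :=
      Continuous.measurable (by fun_prop)
    exact (measurable_heat m).comp h
  have hpos : ∀ᵐ t ∂(volume.restrict (Set.Ioi (0 : ℝ))), 0 < t := by
    filter_upwards [ae_restrict_mem measurableSet_Ioi] with t ht using ht
  have hint : Integrable (fun q : ℝ × Cfg M n => heat m q.1 (diagL μ (z - q.2) + lastL v))
      ((volume.restrict (Set.Ioi 0)).prod volume) := by
    refine (integrable_prod_iff hmeas.aestronglyMeasurable).2 ⟨?_, ?_⟩
    · filter_upwards [hpos] with t ht using (integral_heat_diag hm ht μ v z).1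
    · refine h1.integrable.congr ?_
      filter_upwards [hpos] with t ht
      rw [← (integral_heat_diag hm ht μ v z).2]
      refine integral_congr_ae (Eventually.of_forall fun w => ?_)
      exact (Real.norm_of_nonneg (heat_nonneg _ _ _)).symm
  refine ⟨hint, ?_⟩
  rw [integral_prod _ hint, ← h2]
  refine integral_congr_ae ?_
  filter_upwards [hpos] with t ht
  exact (integral_heat_diag hm ht μ v z).2

/-- The error made in replacing `f` by its value at `z` is controlled by the Gaussian averages of
the oscillation. -/
theorem lintegral_heat_osc_le {m : ℝ} (hm : 0 < m) (μ : Fin M) {f : Cfg M n → ℂ}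
    (hf : Measurable f) (v : R3) (z : Cfg M n) :
    ∫⁻ q : ℝ × Cfg M n, ‖(heat m q.1 (diagL μ (z - q.2) + lastL v) : ℂ) * (f q.2 - f z)‖ₑ
      ∂(volume.restrict (Set.Ioi 0)).prod volume ≤
    ENNReal.ofReal (heatConst M (n + 1) m) * ∫⁻ t in Set.Ioi 0, ENNReal.ofReal ((√t)⁻¹ ^ 3 *
      Real.exp (-t) * Real.exp (-(heatRate m / 3 * ‖v‖ ^ 2 / t))) *
      gaussOsc (heatRate m / 3) f z t := by
  have hmeas : Measurable fun q : ℝ × Cfg M n => heat m q.1 (diagL μ (z - q.2) + lastL v) := by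
    have h : Measurable fun q : ℝ × Cfg M n => (q.1, diagL μ (z - q.2) + lastL v) :=
      Continuous.measurable (by fun_prop)
    exact (measurable_heat m).comp h
  have hm2 : Measurable fun q : ℝ × Cfg M n =>
      (heat m q.1 (diagL μ (z - q.2) + lastL v) : ℂ) * (f q.2 - f z) :=
    (Complex.measurable_ofReal.comp hmeas).mul ((hf.comp measurable_snd).sub_const _)
  have hc := heatConst_nonneg (M := M) (n := n + 1) m
  have hfz : Measurable fun w => ‖f w - f z‖ₑ := (hf.sub_const _).enorm
  have hdim : Fintype.card ((Fin M ⊕ Fin (n + 1)) × Fin 3) = 3 + Module.finrank ℝ (Cfg M n) := by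
    simp; ring
  rw [lintegral_prod _ hm2.enorm.aemeasurable, ← lintegral_const_mul' _ _ ENNReal.ofReal_ne_top]
  refine setLIntegral_mono' measurableSet_Ioi fun t ht => ?_
  have ht' : (0 : ℝ) < t := ht
  rw [gaussOsc, ← mul_assoc, ← ENNReal.ofReal_mul hc, ← lintegral_const_mul' _ _
    ENNReal.ofReal_ne_top]
  refine lintegral_mono fun w => ?_
  rw [enorm_mul, ← ofReal_norm ((heat m t (diagL μ (z - w) + lastL v) : ℝ) : ℂ), Complex.norm_real,
    Real.norm_of_nonneg (heat_nonneg _ _ _), mul_left_comm, mul_comm,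
    ← ENNReal.ofReal_mul (by positivity)]
  refine mul_le_mul_right (ENNReal.ofReal_le_ofReal ((heat_diag_le hm ht' μ _ v).trans
    (le_of_eq ?_))) _
  have e : Real.exp (-(heatRate m / 3 * (‖z - w‖ ^ 2 + ‖v‖ ^ 2) / t)) =
      Real.exp (-(heatRate m / 3 * ‖v‖ ^ 2 / t)) *
        Real.exp (-(heatRate m / 3 * ‖z - w‖ ^ 2 / t)) := by
    rw [← Real.exp_add]; congr 1; ring
  rw [e, hdim, pow_add]
  ring

/-- The singular behaviour of `L⁻¹ δ_{x_μ}(y_{n+1}) ψ` at the plane `y_{n+1} = x_μ`. -/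
theorem ae_tendsto_potTerm_diag {m : ℝ} (hm : 0 < m) (μ : Fin M) (ψ : L2 M n) :
    ∀ᵐ z : Cfg M n, Tendsto (fun ε : R3 => (‖ε‖ : ℂ) * potTerm m μ (Fin.last n) ψ (addY z μ ε))
      (𝓝[≠] 0) (𝓝 (((redMass m / (4 * Real.pi) : ℝ) : ℂ) * ψ z)) := by
  have hκ : 0 < heatRate m / 3 := by have := heatRate_pos hm; positivity
  filter_upwards [ae_gaussOsc hκ (measurable_coe ψ) (Lp.memLp ψ)] with z hz
  obtain ⟨⟨C, hC, hb⟩, hlim⟩ := hz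
  have hα := redMass_pos hm
  -- `ψ` is replaced by its value at `z`, with an error `Er`
  set Er : R3 → ℂ := fun ε => ∫ q : ℝ × Cfg M n,
    (heat m q.1 (diagL μ (z - q.2) + lastL ε) : ℂ) * (ψ q.2 - ψ z)
      ∂(volume.restrict (Set.Ioi 0)).prod volume with hEr
  set ev : R3 → ℝ≥0∞ := fun ε => ∫⁻ q : ℝ × Cfg M n,
    ‖(heat m q.1 (diagL μ (z - q.2) + lastL ε) : ℂ) * (ψ q.2 - ψ z)‖ₑ
      ∂(volume.restrict (Set.Ioi 0)).prod volume with hevd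
  have hn : Tendsto (fun ε : R3 => ‖ε‖) (𝓝[≠] 0) (𝓝[>] 0) := tendsto_norm_nhdsNE_zero
  have hev0 : Tendsto (fun ε : R3 => ENNReal.ofReal ‖ε‖ * ev ε) (𝓝[≠] 0) (𝓝 0) := by
    have h1 := (tendsto_smallTime hκ hC hb hlim).comp hn
    have h2 := ENNReal.Tendsto.const_mul (a := ENNReal.ofReal (heatConst M (n + 1) m)) h1
      (Or.inr ENNReal.ofReal_ne_top)
    rw [mul_zero] at h2
    refine tendsto_of_tendsto_of_tendsto_of_le_of_le tendsto_const_nhds h2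
      (fun _ => zero_le) fun ε => ?_
    simp only [Function.comp_apply]
    rw [mul_left_comm]
    exact mul_le_mul_right (lintegral_heat_osc_le hm μ (measurable_coe ψ) ε z) _
  have hfin : ∀ᶠ ε in 𝓝[≠] (0 : R3), ev ε ≠ ∞ := by
    filter_upwards [hev0.eventually_lt_const one_pos, self_mem_nhdsWithin] with ε h1 h2 h3
    have h4 : ENNReal.ofReal ‖ε‖ ≠ 0 := by simpa using h2
    rw [h3, ENNReal.mul_top h4] at h1
    exact absurd h1 (by simp)
  have hErl : Tendsto (fun ε : R3 => (‖ε‖ : ℂ) * Er ε) (𝓝[≠] 0) (𝓝 0) := by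
    rw [tendsto_zero_iff_enorm_tendsto_zero]
    refine tendsto_of_tendsto_of_tendsto_of_le_of_le tendsto_const_nhds hev0
      (fun _ => zero_le) fun ε => ?_
    rw [enorm_mul, ← ofReal_norm ((‖ε‖ : ℝ) : ℂ), Complex.norm_real, norm_norm]
    exact mul_le_mul_right (enorm_integral_le_lintegral_enorm _) _
  have hmain : ∀ᶠ ε in 𝓝[≠] (0 : R3), (‖ε‖ : ℂ) * Er ε +
      ((redMass m / (4 * Real.pi) * Real.exp (-(‖ε‖ * √(redMass m * ((n : ℝ) + 1)))) : ℝ) : ℂ) *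
        ψ z = (‖ε‖ : ℂ) * potTerm m μ (Fin.last n) ψ (addY z μ ε) := by
    filter_upwards [hfin, self_mem_nhdsWithin] with ε h1 h2
    have hε : ε ≠ 0 := h2
    have hε' : 0 < ‖ε‖ := norm_pos_iff.2 hε
    obtain ⟨i1, i2⟩ := integral_heat_diag_prod hm μ hε z
    have i3 : Integrable (fun q : ℝ × Cfg M n =>
        (heat m q.1 (diagL μ (z - q.2) + lastL ε) : ℂ) * (ψ q.2 - ψ z))
        ((volume.restrict (Set.Ioi 0)).prod volume) := by
      refine ⟨?_, ?_⟩
      · exact i1.ofReal.aestronglyMeasurable.mul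
          ((((measurable_coe ψ).comp measurable_snd).sub_const _).aestronglyMeasurable)
      · rw [hasFiniteIntegral_iff_enorm]; exact h1.lt_top
    have i4 : potTerm m μ (Fin.last n) ψ (addY z μ ε) = Er ε +
        ((redMass m / (4 * Real.pi * ‖ε‖) *
          Real.exp (-(‖ε‖ * √(redMass m * ((n : ℝ) + 1)))) : ℝ) : ℂ) * ψ z := by
      rw [← i2, ← integral_complex_ofReal, ← integral_mul_const]
      refine Eq.trans ?_ (integral_add i3 (i1.ofReal.mul_const (ψ z)))
      refine integral_congr_ae (Eventually.of_forall fun q => ?_)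
      simp only [ContinuousLinearMap.id_apply]
      rw [insL_last, addY_eq, map_sub, show diagL μ z + lastL ε - diagL μ q.2 =
        diagL μ z - diagL μ q.2 + lastL ε by abel]
      ring
    have hc : ((redMass m / (4 * Real.pi) * Real.exp (-(‖ε‖ * √(redMass m * ((n : ℝ) + 1)))) : ℝ) :
      ℂ)
        = ((‖ε‖ : ℝ) : ℂ) * ((redMass m / (4 * Real.pi * ‖ε‖) *
          Real.exp (-(‖ε‖ * √(redMass m * ((n : ℝ) + 1)))) : ℝ) : ℂ) := by
      rw [← Complex.ofReal_mul]
      congr 1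
      field_simp
    rw [i4, hc]
    ring
  refine Tendsto.congr' hmain ?_
  have h5 : Tendsto (fun ε : R3 => ((redMass m / (4 * Real.pi) *
      Real.exp (-(‖ε‖ * √(redMass m * ((n : ℝ) + 1)))) : ℝ) : ℂ) * ψ z) (𝓝[≠] 0)
      (𝓝 (((redMass m / (4 * Real.pi) : ℝ) : ℂ) * ψ z)) := by
    have hc : Continuous fun ε : R3 => ((redMass m / (4 * Real.pi) *
      Real.exp (-(‖ε‖ * √(redMass m * ((n : ℝ) + 1)))) : ℝ) : ℂ) * ψ z :=
      (Complex.continuous_ofReal.comp (by fun_prop)).mul continuous_const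
    have := (hc.tendsto 0).mono_left (nhdsWithin_le_nhds (s := {0}ᶜ))
    simpa using this
  simpa using hErl.add h5

/-- Almost every configuration is free of collisions, among all particles that matter. -/
theorem ae_noncollision : ∀ᵐ z : Cfg M n, (∀ ν k, xs z ν ≠ ys z k) ∧
    ∀ μ ν, μ ≠ ν → xs z μ ≠ xs z ν := by
  have h1 : ∀ ν k, ∀ᵐ z : Cfg M n, xs z ν ≠ ys z k := fun ν k => by
    filter_upwards [ae_ne_zero_of_linear (μ := volume)
      (l := { toFun := fun z : Cfg M n => xs z ν - ys z k
              map_add' := fun a b => by simp; abel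
              map_smul' := fun a b => by simp [smul_sub] })
      ⟨mk (fun _ => EuclideanSpace.single 0 1) 0, by simp⟩] with z hz
    exact sub_ne_zero.1 hz
  have h2 : ∀ μ ν, ∀ᵐ z : Cfg M n, μ ≠ ν → xs z μ ≠ xs z ν := fun μ ν => by
    by_cases h : μ = ν
    · exact Eventually.of_forall fun z h' => absurd h h'
    filter_upwards [ae_ne_zero_of_linear (μ := volume)
      (l := { toFun := fun z : Cfg M n => xs z μ - xs z ν
              map_add' := fun a b => by simp; abel
              map_smul' := fun a b => by simp [smul_sub] })
      ⟨mk (Pi.single μ (EuclideanSpace.single 0 1)) 0, by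
        simp [Pi.single_eq_of_ne (Ne.symm h)]⟩] with z hz _
    exact sub_ne_zero.1 hz
  filter_upwards [ae_all_iff.2 fun ν => ae_all_iff.2 fun k => h1 ν k,
    ae_all_iff.2 fun μ => ae_all_iff.2 fun ν => h2 μ ν] with z h1 h2 using ⟨h1, h2⟩

/-- The off-diagonal terms have no singularity at the plane `y_{n+1} = x_μ`. -/
theorem tendsto_potTerm_off {m : ℝ} (hm : 0 < m) {μ ν : Fin M} {i : Fin (n + 1)}
    (h : OffDiag μ ν i) (ψ : L2 M n) {z : Cfg M n} (h1 : ∀ ν k, xs z ν ≠ ys z k)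
    (h2 : ∀ μ ν, μ ≠ ν → xs z μ ≠ xs z ν) :
    Tendsto (fun ε : R3 => (‖ε‖ : ℂ) * potTerm m ν i ψ (addY z μ ε)) (𝓝[≠] 0) (𝓝 0) := by
  have hne : xs (addY z μ 0) ν ≠ ys (addY z μ 0) i := by
    simp only [addY, xs_mk, ys_mk, add_zero]
    rcases Fin.eq_castSucc_or_eq_last i with ⟨k, rfl⟩ | rfl
    · simpa using h1 ν k
    · rcases h with h | h
      · exact absurd rfl h
      · simpa using (h2 μ ν h).symm
  have hc : Continuous fun ε : R3 => addY z μ ε := by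
    simp_rw [addY_eq]; fun_prop
  have h3 : ContinuousAt (fun ε : R3 => potTerm m ν i ψ (addY z μ ε)) 0 :=
    (continuousAt_potTerm hm ν i ψ hne).comp hc.continuousAt
  have h4 : ContinuousAt (fun ε : R3 => (‖ε‖ : ℂ)) 0 :=
    (Complex.continuous_ofReal.comp continuous_norm).continuousAt
  have h5 : ContinuousAt (fun ε : R3 => (‖ε‖ : ℂ) * potTerm m ν i ψ (addY z μ ε)) 0 := h4.mul h3
  simpa using h5.tendsto.mono_left (nhdsWithin_le_nhds (s := {0}ᶜ))

/-- The boundary value `B G ψ = M ψ`. -/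
theorem isB_pot {m : ℝ} (hm : 0 < m) (ψ : L2 M n) :
    IsB m (pot m ψ) fun z => (M : ℂ) * ψ z := by
  filter_upwards [ae_noncollision, ae_all_iff.2 fun μ => ae_tendsto_potTerm_diag hm μ ψ]
    with z ⟨h1, h2⟩ h3
  refine ⟨fun μ => -(((1 / √((n : ℝ) + 1) : ℝ) : ℂ) *
    (((redMass m / (4 * Real.pi) : ℝ) : ℂ) * ψ z)), fun μ => ?_, ?_⟩
  -- only the term with `ν = μ` and `i = n + 1` is singular
  · have h4 : ∀ ν i, Tendsto (fun ε : R3 => (‖ε‖ : ℂ) * potTerm m ν i ψ (addY z μ ε)) (𝓝[≠] 0)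
        (𝓝 (if i = Fin.last n then (if μ = ν then
          ((redMass m / (4 * Real.pi) : ℝ) : ℂ) * ψ z else 0) else 0)) := by
      intro ν i
      by_cases hi : i = Fin.last n
      · by_cases hμ : μ = ν
        · subst hi hμ
          simpa using h3 μ
        · simpa [hi, hμ] using tendsto_potTerm_off hm (Or.inr hμ) ψ h1 h2
      · simpa [hi] using tendsto_potTerm_off hm (Or.inl hi) ψ h1 h2
    have h5 := ((tendsto_finsetSum Finset.univ fun ν _ => tendsto_finsetSum Finset.univ
      fun i _ => h4 ν i).const_mul ((1 / √((n : ℝ) + 1) : ℝ) : ℂ)).neg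
    simp only [Finset.sum_ite_eq', Finset.sum_ite_eq, Finset.mem_univ, if_true] at h5
    refine h5.congr fun ε => ?_
    rw [pot]
    simp only [← Finset.mul_sum]
    ring
  · simp only [Finset.sum_const, Finset.card_univ, Fintype.card_fin, nsmul_eq_mul]
    have hs : √((n : ℝ) + 1) ≠ 0 := by positivity
    have hπ := Real.pi_pos
    have hr : (-(2 * Real.pi * (2 * m + 1) / m) * √((n : ℝ) + 1)) *
        -(1 / √((n : ℝ) + 1) * (redMass m / (4 * Real.pi))) = 1 := by
      rw [redMass]; field_simp; norm_num
    have hr' : (((-(2 * Real.pi * (2 * m + 1) / m) * √((n : ℝ) + 1)) : ℝ) : ℂ) *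
        -(((1 / √((n : ℝ) + 1) : ℝ) : ℂ) * ((redMass m / (4 * Real.pi) : ℝ) : ℂ)) = 1 := by
      rw [← Complex.ofReal_mul, ← Complex.ofReal_neg, ← Complex.ofReal_mul, hr, Complex.ofReal_one]
    calc (M : ℂ) * ψ z = M * ψ z * 1 := by ring
      _ = _ := by rw [← hr']; ring_nf

end BoundaryValue

/-! ### Sphere averages of `Gψ` -/

section SphereAverages

variable {M n : ℕ}

/-- The average of `L⁻¹ δ_{x_ν}(y_i) ψ` over the sphere `|y_{n+1} - x_μ| = r`. -/
def sphTerm (m r : ℝ) (μ ν : Fin M) (i : Fin (n + 1)) (ψ : Cfg M n → ℂ) : Cfg M n → ℂ :=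
  PosKernel.apply timeSph (diagL μ) (insL ν i) (transHeat m r) ψ

theorem sphTerm_diag (m r : ℝ) (μ : Fin M) (ψ : Cfg M n → ℂ) :
    sphTerm m r μ μ (Fin.last n) ψ = PosKernel.apply timeSph
      (ContinuousLinearMap.id ℝ (Cfg M n)) (ContinuousLinearMap.id ℝ (Cfg M n))
      (fun θ z => transHeat m r θ (diagL μ z)) ψ := by
  funext z
  simp only [sphTerm, PosKernel.apply, insL_last, map_sub, ContinuousLinearMap.id_apply]

theorem not_offDiag {μ ν : Fin M} {i : Fin (n + 1)} (h : ¬ OffDiag μ ν i) :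
    i = Fin.last n ∧ μ = ν := by
  unfold OffDiag at h
  push Not at h
  exact h

theorem memLp_sphTerm {m r : ℝ} (hm : 0 < m) (hr : 0 < r) (μ ν : Fin M) (i : Fin (n + 1))
    (ψ : L2 M n) : MemLp (sphTerm m r μ ν i ψ) 2 volume := by
  by_cases h : OffDiag μ ν i
  · obtain ⟨C, hK⟩ := exists_posKernel_off hm hr h
    exact hK.memLp_apply (measurable_coe ψ) (Lp.memLp ψ).2.ne
  · obtain ⟨rfl, rfl⟩ := not_offDiag h
    obtain ⟨C, hK⟩ := exists_posKernel_diag (n := n) hm hr μ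
    rw [sphTerm_diag]
    exact hK.memLp_apply (measurable_coe ψ) (Lp.memLp ψ).2.ne

theorem ae_integrable_transHeat {m r : ℝ} (hm : 0 < m) (hr : 0 < r) (μ ν : Fin M)
    (i : Fin (n + 1)) (ψ : L2 M n) : ∀ᵐ z : Cfg M n, Integrable (fun q : (ℝ × S2) × Cfg M n =>
      (transHeat m r q.1 (diagL μ z - insL ν i q.2) : ℂ) * ψ q.2) (timeSph.prod volume) := by
  by_cases h : OffDiag μ ν i
  · obtain ⟨C, hK⟩ := exists_posKernel_off hm hr h
    filter_upwards [hK.ae_applyAbs_lt_top (measurable_coe ψ) (Lp.memLp ψ).2.ne] with z hz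
    exact hK.integrable_of_applyAbs (measurable_coe ψ) hz
  · obtain ⟨rfl, rfl⟩ := not_offDiag h
    obtain ⟨C, hK⟩ := exists_posKernel_diag (n := n) hm hr μ
    filter_upwards [hK.ae_applyAbs_lt_top (measurable_coe ψ) (Lp.memLp ψ).2.ne] with z hz
    simpa only [insL_last, map_sub, ContinuousLinearMap.id_apply] using
      hK.integrable_of_applyAbs (measurable_coe ψ) hz

/-- Fubini's theorem for the sphere average and the heat kernel representation. -/
theorem integral_sphAvg_potTerm {m r : ℝ} {μ ν : Fin M} {i : Fin (n + 1)} {ψ : Cfg M n → ℂ}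
    {z : Cfg M n} (h : Integrable (fun q : (ℝ × S2) × Cfg M n =>
      (transHeat m r q.1 (diagL μ z - insL ν i q.2) : ℂ) * ψ q.2) (timeSph.prod volume)) :
    Integrable (fun ω : S2 => potTerm m ν i ψ (addY z μ (r • (ω : R3)))) sphAvg ∧
      ∫ ω : S2, potTerm m ν i ψ (addY z μ (r • (ω : R3))) ∂sphAvg = sphTerm m r μ ν i ψ z := by
  let e : (ℝ × S2) × Cfg M n ≃ᵐ S2 × (ℝ × Cfg M n) :=
    (MeasurableEquiv.prodCongr MeasurableEquiv.prodComm (MeasurableEquiv.refl _)).trans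
      MeasurableEquiv.prodAssoc
  have he : MeasurePreserving e (timeSph.prod volume)
      (sphAvg.prod ((volume.restrict (Set.Ioi 0)).prod volume)) :=
    (measurePreserving_prodAssoc sphAvg (volume.restrict (Set.Ioi (0 : ℝ)))
      (volume : Measure (Cfg M n))).comp ((Measure.measurePreserving_swap).prod
        (MeasurePreserving.id volume))
  let g : S2 × (ℝ × Cfg M n) → ℂ := fun q =>
    (heat m q.2.1 (addY z μ (r • (q.1 : R3)) - insL ν i q.2.2) : ℂ) * ψ q.2.2
  have hge : ∀ q, g (e q) =
      (transHeat m r q.1 (diagL μ z - insL ν i q.2) : ℂ) * ψ q.2 := by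
    intro q
    change (heat m q.1.1 (addY z μ (r • (q.1.2 : R3)) - insL ν i q.2) : ℂ) * ψ q.2 = _
    rw [transHeat, addY_eq, show diagL μ z + lastL (r • (q.1.2 : R3)) - insL ν i q.2 =
      diagL μ z - insL ν i q.2 + lastL (r • (q.1.2 : R3)) by abel]
  have hg : Integrable g (sphAvg.prod ((volume.restrict (Set.Ioi 0)).prod volume)) := by
    refine (he.integrable_comp_emb e.measurableEmbedding).1 (h.congr ?_)
    exact Eventually.of_forall fun q => (hge q).symm
  refine ⟨hg.integral_prod_left, ?_⟩
  have h1 := integral_prod g hg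
  rw [← he.integral_comp e.measurableEmbedding] at h1
  simp_rw [hge] at h1
  exact h1.symm

/-- The function whose limit for `r → 0` is `A G ψ`, in terms of averages over spheres. -/
def approxFun (m r : ℝ) (ψ : Cfg M n → ℂ) (z : Cfg M n) : ℂ :=
  ∑ μ : Fin M, (-(∑ ν : Fin M, ∑ i : Fin (n + 1), sphTerm m r μ ν i ψ z) +
    ((redMass m / (4 * Real.pi * r) : ℝ) : ℂ) * ψ z)

theorem memLp_approxFun {m r : ℝ} (hm : 0 < m) (hr : 0 < r) (ψ : L2 M n) :
    MemLp (approxFun m r ψ) 2 volume := by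
  have h1 : ∀ μ : Fin M, MemLp (fun z => -(∑ ν : Fin M, ∑ i : Fin (n + 1),
      sphTerm m r μ ν i ψ z)) 2 volume := fun μ =>
    MemLp.neg (memLp_finsetSum _ fun ν _ => memLp_finsetSum _ fun i _ => memLp_sphTerm hm hr μ ν i
      ψ)
  have h2 : MemLp (fun z => ((redMass m / (4 * Real.pi * r) : ℝ) : ℂ) * ψ z) 2 volume :=
    (Lp.memLp ψ).const_mul _
  exact memLp_finsetSum _ fun μ _ => (h1 μ).add h2

theorem coupling_eq (m r : ℝ) :
    m / (2 * Real.pi * (2 * m + 1)) * (1 / r) = redMass m / (4 * Real.pi * r) := by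
  rw [redMass, div_mul_div_comm, mul_one, div_div,
    show (2 * m + 1) * (4 * Real.pi * r) = 2 * (2 * Real.pi * (2 * m + 1) * r) by ring,
    mul_div_mul_left _ _ two_ne_zero]

/-- With `B G ψ = M ψ` the counterterm in the definition of `A` is `α ψ / (4π r)`, `α` being
`redMass m`; the normalisations `√(n + 1)` cancel. -/
theorem integrandA_pot (hM : 0 < M) (m r : ℝ) (ψ : L2 M n) (z : Cfg M n) (μ : Fin M) (ω : S2) :
    integrandA m (pot m ψ) (fun z => (M : ℂ) * ψ z) r z μ ω =
      -(∑ ν : Fin M, ∑ i : Fin (n + 1), potTerm m ν i ψ (addY z μ (r • (ω : R3)))) +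
        ((redMass m / (4 * Real.pi * r) : ℝ) : ℂ) * ψ z := by
  have hs : ((√((n : ℝ) + 1) : ℝ) : ℂ) * ((1 / √((n : ℝ) + 1) : ℝ) : ℂ) = 1 := by
    rw [← Complex.ofReal_mul, mul_one_div_cancel (by positivity), Complex.ofReal_one]
  have hM' : (M : ℂ) ≠ 0 := Nat.cast_ne_zero.2 hM.ne'
  have hd : ∀ a : ℂ, (M : ℂ) * a / M = a := fun a => mul_div_cancel_left₀ a hM'
  unfold integrandA pot
  beta_reduce
  generalize (∑ ν : Fin M, ∑ i : Fin (n + 1), potTerm m ν i ψ (addY z μ (r • (ω : R3)))) = S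
  rw [coupling_eq, hd, mul_neg, ← mul_assoc, hs, one_mul]

/-- The expressions whose limit defines `A G ψ` converge absolutely, and are sums of averages of
`L⁻¹ δ_{x_ν}(y_i) ψ` over spheres. -/
theorem ae_approxA_pot (hM : 0 < M) {m r : ℝ} (hm : 0 < m) (hr : 0 < r) (ψ : L2 M n) :
    ∀ᵐ z : Cfg M n,
      (∀ μ, Integrable (integrandA m (pot m ψ) (fun z => (M : ℂ) * ψ z) r z μ)
        (volume : Measure R3).toSphere) ∧
      approxA m (pot m ψ) (fun z => (M : ℂ) * ψ z) r z = approxFun m r ψ z := by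
  have hall := ae_all_iff.2 fun μ : Fin M => ae_all_iff.2 fun ν : Fin M =>
    ae_all_iff.2 fun i : Fin (n + 1) => ae_integrable_transHeat hm hr μ ν i ψ
  filter_upwards [hall] with z hz
  have h1 : ∀ μ ν i, Integrable (fun ω : S2 => potTerm m ν i ψ (addY z μ (r • (ω : R3)))) sphAvg :=
    fun μ ν i => (integral_sphAvg_potTerm (hz μ ν i)).1
  have h3 : ∀ μ, Integrable (fun ω : S2 => -(∑ ν : Fin M, ∑ i : Fin (n + 1),
      potTerm m ν i ψ (addY z μ (r • (ω : R3))))) sphAvg := fun μ =>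
    (integrable_finsetSum _ fun ν _ => integrable_finsetSum _ fun i _ => h1 μ ν i).neg
  refine ⟨fun μ => integrable_sphAvg_iff.1 ?_, ?_⟩
  · rw [funext (integrandA_pot hM m r ψ z μ)]
    exact (h3 μ).add (integrable_const _)
  · rw [approxA, approxFun]
    refine Finset.sum_congr rfl fun μ _ => ?_
    rw [← integral_sphAvg, funext (integrandA_pot hM m r ψ z μ),
      integral_add (h3 μ) (integrable_const _), integral_neg, integral_const,
      probReal_univ, one_smul, integral_finsetSum _ fun ν _ =>
        integrable_finsetSum _ fun i _ => h1 μ ν i]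
    congr 2
    refine Finset.sum_congr rfl fun ν _ => ?_
    rw [integral_finsetSum _ fun i _ => h1 μ ν i]
    exact Finset.sum_congr rfl fun i _ => (integral_sphAvg_potTerm (hz μ ν i)).2

end SphereAverages

/-! ### The off-diagonal terms in momentum space -/

section Symbols

variable {M n : ℕ}

/-- The off-diagonal term in momentum variables, with a cutoff at momenta of size `1 / r`; there is
no cutoff for `r = 0`. -/
def offSym (m r : ℝ) (μ ν : Fin M) (i : Fin (n + 1)) (Ψ : Cfg M n → ℂ) (p : Cfg M n) : ℂ :=
  ∫ ξ : R3, (((en m (shear μ (p, ξ)))⁻¹ * Real.sinc (2 * Real.pi * r * ‖ξ‖) : ℝ) : ℂ) *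
    Ψ (totL ν i (shear μ (p, ξ)))

/-- The corresponding absolutely convergent integral. -/
def offAbs (m : ℝ) (μ ν : Fin M) (i : Fin (n + 1)) (H : Cfg M n → ℝ≥0∞) (p : Cfg M n) : ℝ≥0∞ :=
  ∫⁻ ξ : R3, H (totL ν i (shear μ (p, ξ))) * ENNReal.ofReal (en m (shear μ (p, ξ)))⁻¹

theorem measurable_offAbs_integrand (m : ℝ) (ν : Fin M) (i : Fin (n + 1)) {H : Cfg M n → ℝ≥0∞}
    (hH : Measurable H) :
    Measurable fun ζ : Cfg M (n + 1) => H (totL ν i ζ) * ENNReal.ofReal (en m ζ)⁻¹ :=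
  (hH.comp (totL ν i).measurable).mul ((continuous_en m).measurable.inv).ennreal_ofReal

theorem measurable_offAbs (m : ℝ) (μ ν : Fin M) (i : Fin (n + 1)) {H : Cfg M n → ℝ≥0∞}
    (hH : Measurable H) : Measurable (offAbs m μ ν i H) :=
  ((measurable_offAbs_integrand m ν i hH).comp (shear μ).measurable).lintegral_prod_right'

theorem lintegral_mul_offAbs (m : ℝ) (μ ν : Fin M) (i : Fin (n + 1)) {F H : Cfg M n → ℝ≥0∞}
    (hF : Measurable F) (hH : Measurable H) : ∫⁻ p, F p * offAbs m μ ν i H p =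
      ∫⁻ ζ, F (totalL μ ζ) * H (totL ν i ζ) * ENNReal.ofReal (en m ζ)⁻¹ := by
  have h1 := measurable_offAbs_integrand m ν i hH
  have h2 : Measurable fun ζ : Cfg M (n + 1) =>
      F (totalL μ ζ) * (H (totL ν i ζ) * ENNReal.ofReal (en m ζ)⁻¹) :=
    (hF.comp (totalL μ).measurable).mul h1
  simp_rw [mul_assoc]
  rw [← (measurePreserving_shear (n := n) μ).lintegral_comp h2, Measure.volume_eq_prod,
    lintegral_prod (fun q : Cfg M n × R3 => F (totalL μ (shear μ q)) *
      (H (totL ν i (shear μ q)) * ENNReal.ofReal (en m (shear μ q))⁻¹))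
      (h2.comp (shear μ).measurable).aemeasurable]
  refine lintegral_congr fun p => ?_
  simp only [totalL_shear]
  have h3 : Measurable fun ξ : R3 =>
      H (totL ν i (shear μ (p, ξ))) * ENNReal.ofReal (en m (shear μ (p, ξ)))⁻¹ :=
    h1.comp ((shear μ).measurable.comp measurable_prodMk_left)
  rw [offAbs, lintegral_const_mul _ h3]

/-- The off-diagonal terms are bounded from `L²` to `H⁻¹`, in momentum variables. -/
theorem offAbs_bound {m : ℝ} (hm : 0 < m) {μ ν : Fin M} {i : Fin (n + 1)} (h : OffDiag μ ν i)
    {H : Cfg M n → ℝ≥0∞} (hH : Measurable H) (hH2 : ∫⁻ x, H x ^ 2 ≠ ∞) :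
    ∫⁻ p, (ENNReal.ofReal (wt p)⁻¹ * offAbs m μ ν i H p) ^ 2 ≠ ∞ := by
  obtain ⟨C, hC, hb⟩ := offDiag_schur hm h
  have hw : Measurable fun p : Cfg M n => ENNReal.ofReal (wt p)⁻¹ :=
    continuous_wt.measurable.inv.ennreal_ofReal
  refine ((lintegral_sq_le_of_forall_mul_le (D := C * (∫⁻ x, H x ^ 2) ^ (1 / 2 : ℝ))
    (hw.mul (measurable_offAbs m μ ν i hH)) fun F hF _ => ?_).trans_lt
    (ENNReal.pow_lt_top (ENNReal.mul_lt_top hC.lt_top (sq_rpow_half_ne_top hH2).lt_top))).ne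
  have h1 := (hb F H hF hH).1
  calc _ = ∫⁻ p, F p * ENNReal.ofReal (wt p)⁻¹ * offAbs m μ ν i H p :=
        lintegral_congr fun p => by rw [Pi.mul_apply, mul_assoc]
    _ = ∫⁻ ζ, F (totalL μ ζ) * ENNReal.ofReal (wt (totalL μ ζ))⁻¹ * H (totL ν i ζ) *
          ENNReal.ofReal (en m ζ)⁻¹ := lintegral_mul_offAbs m μ ν i (hF.mul hw) hH
    _ ≤ _ := by
      refine le_trans (le_of_eq (lintegral_congr fun ζ => ?_)) h1
      rw [ENNReal.ofReal_mul (inv_nonneg.2 (wt_pos _).le)]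
      ring
    _ = _ := by ring

/-- The off-diagonal integrals converge absolutely almost everywhere for every `L²` function. -/
theorem ae_offAbs_ne_top {m : ℝ} (hm : 0 < m) {μ ν : Fin M} {i : Fin (n + 1)} (h : OffDiag μ ν i)
    {H : Cfg M n → ℝ≥0∞} (hH : Measurable H) (hH2 : ∫⁻ x, H x ^ 2 ≠ ∞) :
    ∀ᵐ p, offAbs m μ ν i H p ≠ ∞ := by
  have hw : Measurable fun p : Cfg M n => ENNReal.ofReal (wt p)⁻¹ :=
    continuous_wt.measurable.inv.ennreal_ofReal
  filter_upwards [ae_ne_top_of_lintegral_sq (hw.mul (measurable_offAbs m μ ν i hH))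
    (offAbs_bound hm h hH hH2)] with p hp hp'
  rw [Pi.mul_apply, hp', ENNReal.mul_top] at hp
  · exact hp rfl
  · simpa using wt_pos p

theorem measurable_offSym_integrand (m r : ℝ) (μ ν : Fin M) (i : Fin (n + 1)) {Ψ : Cfg M n → ℂ}
    (hΨ : Measurable Ψ) : Measurable fun q : Cfg M n × R3 =>
      (((en m (shear μ q))⁻¹ * Real.sinc (2 * Real.pi * r * ‖q.2‖) : ℝ) : ℂ) *
        Ψ (totL ν i (shear μ q)) := by
  have h1 : Measurable fun q : Cfg M n × R3 => Real.sinc (2 * Real.pi * r * ‖q.2‖) :=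
    (Real.continuous_sinc.comp (by fun_prop)).measurable
  have h2 : Measurable fun q : Cfg M n × R3 => (en m (shear μ q))⁻¹ :=
    ((continuous_en m).measurable.comp (shear μ).measurable).inv
  exact (Complex.measurable_ofReal.comp (h2.mul h1)).mul
    (hΨ.comp ((totL ν i).measurable.comp (shear μ).measurable))

theorem stronglyMeasurable_offSym (m r : ℝ) (μ ν : Fin M) (i : Fin (n + 1)) {Ψ : Cfg M n → ℂ}
    (hΨ : Measurable Ψ) : StronglyMeasurable (offSym m r μ ν i Ψ) :=
  StronglyMeasurable.integral_prod_right'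
    (measurable_offSym_integrand m r μ ν i hΨ).stronglyMeasurable

theorem enorm_offSym_integrand_le {m : ℝ} (hm : 0 < m) (r : ℝ) (μ ν : Fin M) (i : Fin (n + 1))
    (Ψ : Cfg M n → ℂ) (p : Cfg M n) (ξ : R3) :
    ‖(((en m (shear μ (p, ξ)))⁻¹ * Real.sinc (2 * Real.pi * r * ‖ξ‖) : ℝ) : ℂ) *
        Ψ (totL ν i (shear μ (p, ξ)))‖ₑ ≤
      ‖Ψ (totL ν i (shear μ (p, ξ)))‖ₑ * ENNReal.ofReal (en m (shear μ (p, ξ)))⁻¹ := by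
  have h := (inv_pos.2 (en_pos hm (shear μ (p, ξ)))).le
  rw [enorm_mul, mul_comm, ← ofReal_norm (((en m (shear μ (p, ξ)))⁻¹ *
    Real.sinc (2 * Real.pi * r * ‖ξ‖) : ℝ) : ℂ), Complex.norm_real, norm_mul,
    Real.norm_of_nonneg h]
  exact mul_le_mul_right (ENNReal.ofReal_le_ofReal
    (mul_le_of_le_one_right h (Real.abs_sinc_le_one _))) _

theorem enorm_offSym_le {m : ℝ} (hm : 0 < m) (r : ℝ) (μ ν : Fin M) (i : Fin (n + 1))
    (Ψ : Cfg M n → ℂ) (p : Cfg M n) :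
    ‖offSym m r μ ν i Ψ p‖ₑ ≤ offAbs m μ ν i (fun x => ‖Ψ x‖ₑ) p :=
  (enorm_integral_le_lintegral_enorm _).trans
    (lintegral_mono fun ξ => enorm_offSym_integrand_le hm r μ ν i Ψ p ξ)

theorem integrable_offSym_integrand {m : ℝ} (hm : 0 < m) (r : ℝ) (μ ν : Fin M) (i : Fin (n + 1))
    {Ψ : Cfg M n → ℂ} (hΨ : Measurable Ψ) {p : Cfg M n}
    (hp : offAbs m μ ν i (fun x => ‖Ψ x‖ₑ) p ≠ ∞) : Integrable fun ξ : R3 =>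
      (((en m (shear μ (p, ξ)))⁻¹ * Real.sinc (2 * Real.pi * r * ‖ξ‖) : ℝ) : ℂ) *
        Ψ (totL ν i (shear μ (p, ξ))) := by
  refine ⟨((measurable_offSym_integrand m r μ ν i hΨ).comp
    measurable_prodMk_left).aestronglyMeasurable, ?_⟩
  rw [hasFiniteIntegral_iff_enorm]
  exact (lintegral_mono fun ξ => enorm_offSym_integrand_le hm r μ ν i Ψ p ξ).trans_lt hp.lt_top

/-- Removal of the cutoff. -/
theorem tendsto_offSym {m : ℝ} (hm : 0 < m) (μ ν : Fin M) (i : Fin (n + 1))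
    {Ψ : Cfg M n → ℂ} (hΨ : Measurable Ψ) {p : Cfg M n}
    (hp : offAbs m μ ν i (fun x => ‖Ψ x‖ₑ) p ≠ ∞) :
    Tendsto (fun r => offSym m r μ ν i Ψ p) (𝓝 0) (𝓝 (offSym m 0 μ ν i Ψ p)) := by
  have hi := integrable_offSym_integrand hm 0 μ ν i hΨ hp
  refine tendsto_integral_filter_of_dominated_convergence _ (Eventually.of_forall fun r =>
    (integrable_offSym_integrand hm r μ ν i hΨ hp).aestronglyMeasurable)
    (Eventually.of_forall fun r => Eventually.of_forall fun ξ => ?_) hi.norm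
    (Eventually.of_forall fun ξ => ?_)
  · simp only [mul_zero, zero_mul, Real.sinc_zero, mul_one]
    rw [norm_mul, norm_mul, Complex.norm_real, Complex.norm_real, norm_mul]
    gcongr
    exact mul_le_of_le_one_right (norm_nonneg _) (Real.abs_sinc_le_one _)
  · have h1 : Continuous fun r : ℝ => (((en m (shear μ (p, ξ)))⁻¹ *
        Real.sinc (2 * Real.pi * r * ‖ξ‖) : ℝ) : ℂ) * Ψ (totL ν i (shear μ (p, ξ))) :=
      (Complex.continuous_ofReal.comp (continuous_const.mul
        (Real.continuous_sinc.comp (by fun_prop)))).mul continuous_const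
    exact h1.tendsto 0

/-- Fubini's theorem in the variables total momentum and momentum of the last y-particle. -/
theorem integral_mul_offSym {m : ℝ} (r : ℝ) (μ ν : Fin M) (i : Fin (n + 1))
    {f Ψ : Cfg M n → ℂ}
    (h : Integrable fun ζ : Cfg M (n + 1) =>
      (((en m ζ)⁻¹ * Real.sinc (2 * Real.pi * r * ‖ys ζ (Fin.last n)‖) : ℝ) : ℂ) *
        (f (totalL μ ζ) * Ψ (totL ν i ζ))) :
    Integrable (fun p => f p * offSym m r μ ν i Ψ p) ∧
    ∫ p, f p * offSym m r μ ν i Ψ p = ∫ ζ : Cfg M (n + 1),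
      (((en m ζ)⁻¹ * Real.sinc (2 * Real.pi * r * ‖ys ζ (Fin.last n)‖) : ℝ) : ℂ) *
        (f (totalL μ ζ) * Ψ (totL ν i ζ)) := by
  have hmp := measurePreserving_shear (n := n) μ
  have hemb := (shear (n := n) μ).measurableEmbedding
  have h1 := (hmp.integrable_comp_emb hemb).2 h
  have h2 : ∀ p, ∫ ξ : R3, ((fun ζ : Cfg M (n + 1) =>
      (((en m ζ)⁻¹ * Real.sinc (2 * Real.pi * r * ‖ys ζ (Fin.last n)‖) : ℝ) : ℂ) *
        (f (totalL μ ζ) * Ψ (totL ν i ζ))) ∘ shear μ) (p, ξ) = f p * offSym m r μ ν i Ψ p := by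
    intro p
    rw [offSym, ← integral_const_mul]
    refine integral_congr_ae (Eventually.of_forall fun ξ => ?_)
    simp only [Function.comp_apply, totalL_shear, last_shear]
    ring
  rw [Measure.volume_eq_prod] at h1
  refine ⟨h1.integral_prod_left.congr (Eventually.of_forall h2), ?_⟩
  rw [← hmp.integral_comp hemb, Measure.volume_eq_prod]
  have h3 := integral_prod _ h1
  simp_rw [h2] at h3
  exact h3.symm

end Symbols

/-! ### Dominated convergence in `L²` -/

section DominatedL2

variable {V : Type*} [MeasurableSpace V] {μ : Measure V}

theorem memLp_of_enorm_le {f : V → ℂ} {U : V → ℝ≥0∞} (hf : AEStronglyMeasurable f μ)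
    (hU : ∫⁻ x, U x ^ 2 ∂μ ≠ ∞) (hb : ∀ᵐ x ∂μ, ‖f x‖ₑ ≤ U x) : MemLp f 2 μ := by
  refine ⟨hf, ?_⟩
  rw [← lintegral_sq_rpow_half]
  have h1 : ∫⁻ x, ‖f x‖ₑ ^ 2 ∂μ ≤ ∫⁻ x, U x ^ 2 ∂μ := by
    refine lintegral_mono_ae ?_
    filter_upwards [hb] with x hx
    gcongr
  exact (sq_rpow_half_ne_top (h1.trans_lt hU.lt_top).ne).lt_top

/-- The class in `L²` of a function, and zero if the function is not in `L²`. -/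
def toL2 (μ : Measure V) (f : V → ℂ) : Lp ℂ 2 μ :=
  open scoped Classical in if h : MemLp f 2 μ then h.toLp f else 0

theorem toL2_eq {f : V → ℂ} (h : MemLp f 2 μ) : toL2 μ f = h.toLp f := by
  rw [toL2, dif_pos h]

/-- Dominated convergence in `L²` for functions that depend on a parameter `r → 0`. -/
theorem tendsto_toL2 {f : ℝ → V → ℂ} {f₀ : V → ℂ} {U : V → ℝ≥0∞} (hU : ∫⁻ x, U x ^ 2 ∂μ ≠ ∞)
    (hf : ∀ r, 0 < r → r ≤ 1 → AEStronglyMeasurable (f r) μ)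
    (hb : ∀ᵐ x ∂μ, ∀ r, 0 < r → r ≤ 1 → ‖f r x‖ₑ ≤ U x)
    (hlim : ∀ᵐ x ∂μ, Tendsto (fun r => f r x) (𝓝[>] 0) (𝓝 (f₀ x))) :
    MemLp f₀ 2 μ ∧ Tendsto (fun r => toL2 μ (f r)) (𝓝[>] 0) (𝓝 (toL2 μ f₀)) := by
  have hev : ∀ᶠ r : ℝ in 𝓝[>] 0, 0 < r ∧ r ≤ 1 := by
    filter_upwards [Ioc_mem_nhdsGT (one_pos : (0 : ℝ) < 1)] with r hr using hr
  have hfr : ∀ r, 0 < r → r ≤ 1 → MemLp (f r) 2 μ := fun r h1 h2 =>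
    memLp_of_enorm_le (hf r h1 h2) hU (hb.mono fun x hx => hx r h1 h2)
  have hb0 : ∀ᵐ x ∂μ, ‖f₀ x‖ₑ ≤ U x := by
    filter_upwards [hb, hlim] with x h1 h2
    exact le_of_tendsto h2.enorm (hev.mono fun r hr => h1 r hr.1 hr.2)
  -- measurability of the limit is obtained along a sequence
  have hseq : Tendsto (fun k : ℕ => (1 : ℝ) / ((k : ℝ) + 1)) atTop (𝓝[>] 0) :=
    tendsto_nhdsWithin_iff.2 ⟨tendsto_one_div_add_atTop_nhds_zero_nat,
      Eventually.of_forall fun k => by simp only [Set.mem_Ioi]; positivity⟩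
  have hm0 : AEStronglyMeasurable f₀ μ := by
    refine aestronglyMeasurable_of_tendsto_ae atTop (f := fun k : ℕ => f (1 / ((k : ℝ) + 1)))
      (fun k => hf _ (by positivity) ?_) (hlim.mono fun x hx => hx.comp hseq)
    rw [div_le_one (by positivity)]
    have : (0 : ℝ) ≤ k := by positivity
    linarith
  have h0 : MemLp f₀ 2 μ := memLp_of_enorm_le hm0 hU hb0
  refine ⟨h0, ?_⟩
  have hint : Tendsto (fun r => ∫⁻ x, ‖f r x - f₀ x‖ₑ ^ 2 ∂μ) (𝓝[>] 0) (𝓝 (∫⁻ _, 0 ∂μ)) := by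
    refine tendsto_lintegral_filter_of_dominated_convergence' (fun x => 4 * U x ^ 2)
      (hev.mono fun r hr => ((hf r hr.1 hr.2).sub hm0).enorm.pow_const 2)
      (hev.mono fun r hr => ?_) ?_ ?_
    · filter_upwards [hb, hb0] with x h1 h2
      calc ‖f r x - f₀ x‖ₑ ^ 2 ≤ (U x + U x) ^ 2 := by
            gcongr
            exact (enorm_sub_le).trans (add_le_add (h1 r hr.1 hr.2) h2)
        _ = 4 * U x ^ 2 := by ring
    · rw [lintegral_const_mul' _ _ (by norm_num)]
      exact ENNReal.mul_ne_top (by norm_num) hU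
    · filter_upwards [hlim] with x hx
      have h3 := ((ENNReal.continuous_pow 2).tendsto _).comp ((hx.sub_const (f₀ x)).enorm)
      simpa [Function.comp_def] using h3
  rw [lintegral_zero] at hint
  rw [tendsto_iff_edist_tendsto_0]
  have h4 := hint.ennrpow_const (1 / 2)
  rw [ENNReal.zero_rpow_of_pos (by norm_num)] at h4
  refine h4.congr' (hev.mono fun r hr => ?_)
  beta_reduce
  rw [toL2_eq (hfr r hr.1 hr.2), toL2_eq h0, Lp.edist_toLp_toLp, ← lintegral_sq_rpow_half]
  rfl

end DominatedL2

/-! ### Sphere averages paired with test functions -/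

section Pairings

variable {M n : ℕ}

theorem toL2_apply {f : Cfg M n → ℂ} (h : MemLp f 2 volume) (g : 𝓢(Cfg M n, ℂ)) :
    ((toL2 volume f : L2 M n) : Dist M n) g = ∫ p, g p * f p := by
  rw [toL2_eq h, Lp.toTemperedDistribution_apply]
  refine integral_congr_ae ?_
  filter_upwards [h.coeFn_toLp] with p hp
  rw [hp, smul_eq_mul]

/-- Parseval's formula for a Schwartz function and a function in `L²`. -/
theorem integral_mul_fourier (g : 𝓢(Cfg M n, ℂ)) (ψ : L2 M n) :
    ∫ z, g z * ψ z = ∫ p, (𝓕⁻ g) p * (𝓕 ψ : L2 M n) p := by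
  have h1 := congrArg (fun τ : Dist M n => τ (𝓕⁻ g)) (Lp.fourier_toTemperedDistribution_eq ψ)
  simp only [TemperedDistribution.fourier_apply, FourierTransform.fourier_fourierInv_eq,
    Lp.toTemperedDistribution_apply, smul_eq_mul] at h1
  exact h1

/-- The momentum space form of the off-diagonal terms is absolutely convergent if one of the
functions is in the form domain `H¹`. -/
theorem integrable_offForm {m : ℝ} (hm : 0 < m) {μ ν : Fin M} {i : Fin (n + 1)}
    (h : OffDiag μ ν i) (r : ℝ) {f Ψ : Cfg M n → ℂ} (hf : Measurable f) (hΨ : Measurable Ψ)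
    (hf2 : MemLp (fun x => (wt x : ℂ) * f x) 2 volume) (hΨ2 : MemLp Ψ 2 volume) :
    Integrable fun ζ : Cfg M (n + 1) =>
      (((en m ζ)⁻¹ * Real.sinc (2 * Real.pi * r * ‖ys ζ (Fin.last n)‖) : ℝ) : ℂ) *
        (f (totalL μ ζ) * Ψ (totL ν i ζ)) := by
  obtain ⟨C, hC, hb⟩ := offDiag_schur hm h
  have hs : Measurable fun ζ : Cfg M (n + 1) =>
      Real.sinc (2 * Real.pi * r * ‖ys ζ (Fin.last n)‖) :=
    (Real.continuous_sinc.comp (by fun_prop)).measurable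
  refine ⟨((Complex.measurable_ofReal.comp ((continuous_en m).measurable.inv.mul hs)).mul
    ((hf.comp (totalL μ).measurable).mul (hΨ.comp (totL ν i).measurable))).aestronglyMeasurable, ?_⟩
  rw [hasFiniteIntegral_iff_enorm]
  refine (lintegral_mono fun ζ => ?_).trans_lt ((hb (fun x => ‖(wt x : ℂ) * f x‖ₑ)
    (fun x => ‖Ψ x‖ₑ) ((Complex.measurable_ofReal.comp continuous_wt.measurable).mul hf).enorm
    hΨ.enorm).1.trans_lt (ENNReal.mul_lt_top hC.lt_top (ENNReal.mul_lt_top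
      (sq_rpow_half_ne_top (lintegral_enorm_sq_ne_top hf2)).lt_top
      (sq_rpow_half_ne_top (lintegral_enorm_sq_ne_top hΨ2)).lt_top)))
  have hw := wt_pos (totalL μ ζ)
  have he := (inv_pos.2 (en_pos hm ζ)).le
  have h0 : ENNReal.ofReal (wt (totalL μ ζ)) ≠ 0 := by simpa using hw
  simp only
  rw [enorm_mul, enorm_mul, enorm_mul, ← ofReal_norm (wt (totalL μ ζ) : ℂ), Complex.norm_real,
    Real.norm_of_nonneg hw.le, ENNReal.ofReal_mul (inv_nonneg.2 hw.le),
    ENNReal.ofReal_inv_of_pos hw, show ∀ a b c d e : ℝ≥0∞, a * b * c * (d * e) =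
      (a * d) * (e * (b * c)) by intros; ring, ENNReal.mul_inv_cancel h0 ENNReal.ofReal_ne_top,
    one_mul, ← ofReal_norm (((en m ζ)⁻¹ * _ : ℝ) : ℂ), Complex.norm_real, norm_mul,
    Real.norm_of_nonneg he]
  refine mul_le_mul_left (ENNReal.ofReal_le_ofReal ?_) _
  exact mul_le_of_le_one_right he (Real.abs_sinc_le_one _)

/-- In momentum variables the sphere average of an off-diagonal term is the off-diagonal term with a
cutoff. -/
theorem integral_mul_sphTerm_off {m r : ℝ} (hm : 0 < m) (hr : 0 < r) {μ ν : Fin M}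
    {i : Fin (n + 1)} (h : OffDiag μ ν i) (f : 𝓢(Cfg M n, ℂ)) (ψ : L2 M n) :
    ∫ z, f z * sphTerm m r μ ν i ψ z =
      ∫ p, (𝓕⁻ f) p * offSym m r μ ν i (𝓕 ψ : L2 M n) p := by
  obtain ⟨C, hK⟩ := exists_posKernel_off hm hr h
  have h1 := hK.integral_mul_apply f ψ
  simp_rw [integral_transSym hm hr] at h1
  rw [sphTerm, h1]
  exact (integral_mul_offSym r μ ν i (integrable_offForm hm h r (𝓕⁻ f).continuous.measurable
    (measurable_coe _) (memLp_wt_mul _) (Lp.memLp _))).2.symm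

/-- In momentum variables the sphere average of the diagonal term is multiplication by
`diagMult`. -/
theorem integral_mul_sphTerm_diag {m r : ℝ} (hm : 0 < m) (hr : 0 < r) (μ : Fin M)
    (f : 𝓢(Cfg M n, ℂ)) (ψ : L2 M n) :
    ∫ z, f z * sphTerm m r μ μ (Fin.last n) ψ z =
      ∫ p, (diagMult m r μ p : ℂ) * ((𝓕⁻ f) p * (𝓕 ψ : L2 M n) p) := by
  obtain ⟨C, hK⟩ := exists_posKernel_diag (n := n) hm hr μ
  have h1 := hK.integral_mul_apply f ψ
  simp_rw [integral_diagSym_timeSph hm hr] at h1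
  rw [sphTerm_diag, h1]
  rfl

end Pairings

/-! ### The renormalised diagonal term -/

section DiagonalSymbol

variable {M n : ℕ}

/-- The symbol of the renormalised diagonal term. -/
def diagRem (m r : ℝ) (μ : Fin M) (p : Cfg M n) : ℝ :=
  redMass m / (4 * Real.pi * r) - diagMult m r μ p

/-- The symbol of the `μ`-th summand of the diagonal part of `T`. -/
def diagT (m : ℝ) (μ : Fin M) (p : Cfg M n) : ℝ :=
  redMass m / (4 * Real.pi) * √(redMass m * lam m μ ((2 * Real.pi) • p))

theorem continuous_diagMult (m r : ℝ) (μ : Fin M) : Continuous (diagMult (n := n) m r μ) := by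
  have h : Continuous fun p : Cfg M n =>
      Real.sinc (2 * Real.pi * r / (2 * m + 1) * ‖xs p μ‖) :=
    Real.continuous_sinc.comp (by fun_prop)
  unfold diagMult
  exact Continuous.mul (by fun_prop) h

theorem weighted_sum_le {a b A B C : ℝ} (ha : 0 ≤ a) (hb : 0 ≤ b) (hA : 0 ≤ A) (hB : 0 ≤ B)
    (hC : 0 ≤ C) : a * A + b * B + C ≤ (a + b + 1) * (A + B + C) := by
  have h1 := mul_nonneg ha hB
  have h2 := mul_nonneg ha hC
  have h3 := mul_nonneg hb hA
  have h4 := mul_nonneg hb hC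
  nlinarith

/-- The symbol of the diagonal part of `T` is at most linear in the momentum. -/
theorem lam_le {m : ℝ} (hm : 0 < m) (μ : Fin M) :
    ∃ K, 0 ≤ K ∧ ∀ p : Cfg M n, √(redMass m * lam m μ ((2 * Real.pi) • p)) ≤ K * wt p := by
  have hα := redMass_pos hm
  set c : ℝ := 1 / (2 * m + 1) + 1 / (2 * m) + 1 with hc
  have hc0 : 0 < c := by positivity
  set D : ℝ := redMass m * ((n : ℝ) + 1 + c * (2 * Real.pi) ^ 2) with hD
  have hD0 : 0 ≤ D := by positivity
  refine ⟨√D, Real.sqrt_nonneg _, fun p => ?_⟩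
  rw [wt, ← Real.sqrt_mul hD0]
  refine Real.sqrt_le_sqrt ?_
  rw [hD, mul_assoc]
  refine mul_le_mul_of_nonneg_left ?_ hα.le
  have h1 : lam m μ ((2 * Real.pi) • p) ≤ (n : ℝ) + 1 + c * ‖(2 * Real.pi) • p‖ ^ 2 := by
    generalize (2 * Real.pi) • p = q
    have e := weighted_sum_le (show 0 ≤ 1 / (2 * m + 1) by positivity)
      (show 0 ≤ 1 / (2 * m) by positivity) (sq_nonneg ‖xs q μ‖)
      (show 0 ≤ ∑ ν ∈ Finset.univ.erase μ, ‖xs q ν‖ ^ 2 by positivity)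
      (show 0 ≤ ∑ i, ‖ys q i‖ ^ 2 by positivity)
    rw [norm_sq_cfg, ← Finset.add_sum_erase _ _ (Finset.mem_univ μ), lam, add_assoc, add_assoc,
      ← add_assoc (1 / (2 * m + 1) * _)]
    exact add_le_add_right e _
  refine h1.trans ?_
  rw [norm_smul, Real.norm_of_nonneg (by positivity), mul_pow]
  have h2 : 0 ≤ ‖p‖ ^ 2 := by positivity
  have h3 : 0 ≤ ((n : ℝ) + 1) * ‖p‖ ^ 2 := by positivity
  have h4 : 0 ≤ c * (2 * Real.pi) ^ 2 := by positivity
  nlinarith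

/-- The counterterm cancels the divergent part `α / (4π r)` of the diagonal symbol. -/
theorem diagRem_eq (m r : ℝ) (μ : Fin M) (p : Cfg M n) :
    diagRem m r μ p = redMass m / (4 * Real.pi) * (r⁻¹ *
      ((1 - Real.exp (-(r * √(redMass m * lam m μ ((2 * Real.pi) • p))))) +
      Real.exp (-(r * √(redMass m * lam m μ ((2 * Real.pi) • p)))) *
        (1 - Real.sinc (2 * Real.pi * r / (2 * m + 1) * ‖xs p μ‖)))) := by
  rw [diagRem, diagMult, ← div_div, div_eq_mul_inv _ r]
  ring

/-- The renormalised symbols are bounded by the weight of `H¹`, uniformly in `r`. -/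
theorem abs_diagRem_le {m : ℝ} (hm : 0 < m) (μ : Fin M) :
    ∃ K, ∀ r, 0 < r → ∀ p : Cfg M n, |diagRem m r μ p| ≤ K * wt p := by
  have hα := redMass_pos hm
  obtain ⟨K, hK, hl⟩ := lam_le (n := n) hm μ
  refine ⟨redMass m / (4 * Real.pi) * (K + 2 * (2 * Real.pi / (2 * m + 1))), fun r hr p => ?_⟩
  set a := √(redMass m * lam m μ ((2 * Real.pi) • p)) with ha
  have ha0 : 0 ≤ a := Real.sqrt_nonneg _
  set x := 2 * Real.pi * r / (2 * m + 1) * ‖xs p μ‖ with hx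
  have hx0 : 0 ≤ x := by positivity
  have h1 : |1 - Real.exp (-(r * a))| ≤ r * a := by
    have e1 := Real.add_one_le_exp (-(r * a))
    have e2 : Real.exp (-(r * a)) ≤ 1 := Real.exp_le_one_iff.2 (by
      have : 0 ≤ r * a := by positivity
      linarith)
    rw [abs_of_nonneg (by linarith)]
    linarith
  have h2 : |Real.exp (-(r * a)) * (1 - Real.sinc x)| ≤ 2 * x := by
    have e2 : Real.exp (-(r * a)) ≤ 1 := Real.exp_le_one_iff.2 (by
      have : 0 ≤ r * a := by positivity
      linarith)
    have e3 := abs_sinc_sub_one_le x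
    rw [abs_sub_comm, abs_of_nonneg hx0] at e3
    rw [abs_mul, abs_of_pos (Real.exp_pos _)]
    exact (mul_le_of_le_one_left (abs_nonneg _) e2).trans e3
  have h3 : ‖xs p μ‖ ≤ wt p := (norm_xs_le p μ).trans (norm_le_wt p)
  rw [diagRem_eq, abs_mul, abs_of_nonneg (by positivity), abs_mul, abs_of_pos (inv_pos.2 hr),
    mul_assoc (redMass m / _)]
  refine mul_le_mul_of_nonneg_left ?_ (by positivity)
  calc r⁻¹ * |_ + _| ≤ r⁻¹ * (r * a + 2 * x) := by
        gcongr
        exact (abs_add_le _ _).trans (add_le_add h1 h2)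
    _ = a + 2 * (2 * Real.pi / (2 * m + 1)) * ‖xs p μ‖ := by
        rw [hx]; field_simp
    _ ≤ K * wt p + 2 * (2 * Real.pi / (2 * m + 1)) * wt p := by
        gcongr
        exact hl p
    _ = _ := by ring

/-- Only the exponential contributes to the limit, since `1 - sinc x` vanishes to second order. -/
theorem tendsto_diagRem (m : ℝ) (μ : Fin M) (p : Cfg M n) :
    Tendsto (fun r => diagRem m r μ p) (𝓝[>] 0) (𝓝 (diagT m μ p)) := by
  simp_rw [diagRem_eq]
  rw [diagT]
  refine Tendsto.const_mul _ ?_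
  set a := √(redMass m * lam m μ ((2 * Real.pi) • p)) with ha
  set c := 2 * Real.pi / (2 * m + 1) * ‖xs p μ‖ with hc
  -- the limit is a derivative at `r = 0`
  have h1 : HasDerivAt (fun r : ℝ => Real.exp (-(r * a))) (-a) 0 := by
    have h := (((hasDerivAt_id (0 : ℝ)).mul_const a).neg).exp
    simpa using h
  have h2 := h1.tendsto_slope_zero_right.neg
  have h3 : Tendsto (fun r : ℝ => Real.exp (-(r * a)) *
      (r⁻¹ * (1 - Real.sinc (2 * Real.pi * r / (2 * m + 1) * ‖xs p μ‖)))) (𝓝[>] 0)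
      (𝓝 (1 * 0)) := by
    refine Tendsto.mul ?_ ?_
    · have h : Continuous fun r : ℝ => Real.exp (-(r * a)) := by fun_prop
      have := (h.tendsto 0).mono_left (nhdsWithin_le_nhds (s := Set.Ioi 0))
      simpa using this
    · have h4 : Tendsto (fun r : ℝ => r * c ^ 2) (𝓝[>] 0) (𝓝 0) := by
        have h : Continuous fun r : ℝ => r * c ^ 2 := by fun_prop
        have := (h.tendsto 0).mono_left (nhdsWithin_le_nhds (s := Set.Ioi 0))
        simpa using this
      refine squeeze_zero_norm' ?_ h4
      filter_upwards [self_mem_nhdsWithin] with r hr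
      have hr' : (0 : ℝ) < r := hr
      have h5 := abs_sinc_sub_one_le_sq (2 * Real.pi * r / (2 * m + 1) * ‖xs p μ‖)
      rw [abs_sub_comm] at h5
      rw [norm_mul, Real.norm_of_nonneg (inv_pos.2 hr').le, Real.norm_eq_abs]
      calc _ ≤ r⁻¹ * (2 * Real.pi * r / (2 * m + 1) * ‖xs p μ‖) ^ 2 := by gcongr
        _ = r⁻¹ * (r * c) ^ 2 := by rw [hc]; ring
        _ = r * c ^ 2 := by field_simp
  have h6 := h2.add h3
  rw [neg_neg, mul_zero, add_zero] at h6
  refine h6.congr' ?_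
  filter_upwards with r
  simp only [zero_add, zero_mul, neg_zero, Real.exp_zero, smul_eq_mul]
  ring

end DiagonalSymbol

/-! ### The limit in `H⁻¹` -/

section Limit

variable {M n : ℕ}

/-- The off-diagonal terms in momentum variables, extended by zero to the diagonal. -/
def offPart (m r : ℝ) (μ ν : Fin M) (i : Fin (n + 1)) (Ψ : Cfg M n → ℂ) : Cfg M n → ℂ :=
  open scoped Classical in if OffDiag μ ν i then offSym m r μ ν i Ψ else 0

theorem offPart_of_offDiag {m r : ℝ} {μ ν : Fin M} {i : Fin (n + 1)} (h : OffDiag μ ν i)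
    (Ψ : Cfg M n → ℂ) : offPart m r μ ν i Ψ = offSym m r μ ν i Ψ := if_pos h

@[simp] theorem offPart_last (m r : ℝ) (μ : Fin M) (Ψ : Cfg M n → ℂ) :
    offPart m r μ μ (Fin.last n) Ψ = 0 := if_neg (by simp [OffDiag])

/-- Separation of the diagonal term from a sum over all terms. -/
theorem sum_eq_add_diag {A : Type*} [AddCommGroup A] (μ : Fin M) (f g : Fin M → Fin (n + 1) → A)
    (h : ∀ ν i, OffDiag μ ν i → f ν i = g ν i) (h0 : g μ (Fin.last n) = 0) :
    ∑ ν, ∑ i, f ν i = (∑ ν, ∑ i, g ν i) + f μ (Fin.last n) := by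
  have h1 : ∑ ν, ∑ i, (f ν i - g ν i) = f μ (Fin.last n) := by
    rw [Finset.sum_eq_single μ, Finset.sum_eq_single (Fin.last n), h0, sub_zero]
    · exact fun i _ hi => by rw [h μ i (Or.inl hi), sub_self]
    · simp
    · exact fun ν _ hν => Finset.sum_eq_zero fun i _ => by rw [h ν i (Or.inr hν.symm), sub_self]
    · simp
  rw [← h1]
  simp only [Finset.sum_sub_distrib]
  abel

theorem enorm_wt_inv (p : Cfg M n) : ‖(((wt p)⁻¹ : ℝ) : ℂ)‖ₑ = ENNReal.ofReal (wt p)⁻¹ := by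
  rw [← ofReal_norm, Complex.norm_real, Real.norm_of_nonneg (inv_nonneg.2 (wt_pos p).le)]

theorem continuous_wt_inv : Continuous fun p : Cfg M n => (((wt p)⁻¹ : ℝ) : ℂ) :=
  Complex.continuous_ofReal.comp (continuous_wt.inv₀ fun p => (wt_pos p).ne')

theorem lintegral_offAbs_ne_top {m : ℝ} (hm : 0 < m) {μ ν : Fin M} {i : Fin (n + 1)}
    (h : OffDiag μ ν i) (Ψ : L2 M n) :
    ∫⁻ p, (ENNReal.ofReal (wt p)⁻¹ * offAbs m μ ν i (fun x => ‖Ψ x‖ₑ) p) ^ 2 ≠ ∞ :=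
  offAbs_bound hm h (measurable_coe Ψ).enorm (lintegral_enorm_sq_ne_top (Lp.memLp Ψ))

theorem memLp_wt_inv_offPart {m : ℝ} (hm : 0 < m) (r : ℝ) (μ ν : Fin M) (i : Fin (n + 1))
    (Ψ : L2 M n) :
    MemLp (fun p => (((wt p)⁻¹ : ℝ) : ℂ) * offPart m r μ ν i Ψ p) 2 volume := by
  by_cases h : OffDiag μ ν i
  · rw [offPart_of_offDiag h]
    refine memLp_of_enorm_le (continuous_wt_inv.aestronglyMeasurable.mul
      (stronglyMeasurable_offSym m r μ ν i (measurable_coe Ψ)).aestronglyMeasurable)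
      (lintegral_offAbs_ne_top hm h Ψ) (Eventually.of_forall fun p => ?_)
    rw [enorm_mul, enorm_wt_inv]
    exact mul_le_mul_right (enorm_offSym_le hm r μ ν i Ψ p) _
  · obtain ⟨rfl, rfl⟩ := not_offDiag h
    simp

theorem tendsto_wt_inv_offPart {m : ℝ} (hm : 0 < m) (μ ν : Fin M) (i : Fin (n + 1))
    (Ψ : L2 M n) :
    Tendsto (fun r => toL2 volume fun p => (((wt p)⁻¹ : ℝ) : ℂ) * offPart m r μ ν i Ψ p) (𝓝[>] 0)
      (𝓝 (toL2 volume fun p => (((wt p)⁻¹ : ℝ) : ℂ) * offPart m 0 μ ν i Ψ p)) := by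
  by_cases h : OffDiag μ ν i
  · simp_rw [offPart_of_offDiag h]
    refine (tendsto_toL2 (lintegral_offAbs_ne_top hm h Ψ)
      (fun r _ _ => continuous_wt_inv.aestronglyMeasurable.mul
        (stronglyMeasurable_offSym m r μ ν i (measurable_coe Ψ)).aestronglyMeasurable)
      (Eventually.of_forall fun p r _ _ => ?_) ?_).2
    · change ‖(((wt p)⁻¹ : ℝ) : ℂ) * offSym m r μ ν i Ψ p‖ₑ ≤ _
      rw [enorm_mul, enorm_wt_inv]
      exact mul_le_mul_right (enorm_offSym_le hm r μ ν i Ψ p) _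
    · filter_upwards [ae_offAbs_ne_top hm h (measurable_coe Ψ).enorm
        (lintegral_enorm_sq_ne_top (Lp.memLp Ψ))] with p hp
      exact ((tendsto_offSym hm μ ν i (measurable_coe Ψ) hp).mono_left
        nhdsWithin_le_nhds).const_mul _
  · obtain ⟨rfl, rfl⟩ := not_offDiag h
    simp only [offPart_last, Pi.zero_apply, mul_zero]
    exact tendsto_const_nhds

theorem continuous_diagRem (m r : ℝ) (μ : Fin M) : Continuous (diagRem (n := n) m r μ) := by
  unfold diagRem
  exact continuous_const.sub (continuous_diagMult m r μ)

/-- The diagonal symbols have the order of the weight. -/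
theorem exists_enorm_diagRem_le {m : ℝ} (hm : 0 < m) (μ : Fin M) (Ψ : L2 M n) :
    ∃ U : Cfg M n → ℝ≥0∞, ∫⁻ p, U p ^ 2 ≠ ∞ ∧ ∀ r, 0 < r → ∀ p,
      ‖(((wt p)⁻¹ : ℝ) : ℂ) * ((diagRem m r μ p : ℂ) * Ψ p)‖ₑ ≤ U p := by
  obtain ⟨K, hK⟩ := abs_diagRem_le (n := n) hm μ
  refine ⟨fun p => ENNReal.ofReal K * ‖Ψ p‖ₑ, ?_, fun r hr p => ?_⟩
  · simp_rw [mul_pow]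
    rw [lintegral_const_mul' _ _ (by finiteness)]
    exact ENNReal.mul_ne_top (by finiteness) (lintegral_enorm_sq_ne_top (Lp.memLp Ψ))
  · have hw := wt_pos p
    rw [← mul_assoc, ← Complex.ofReal_mul, enorm_mul]
    refine mul_le_mul_left ?_ _
    rw [← ofReal_norm, Complex.norm_real, norm_mul, Real.norm_of_nonneg (inv_pos.2 hw).le,
      Real.norm_eq_abs]
    refine ENNReal.ofReal_le_ofReal ?_
    calc (wt p)⁻¹ * |diagRem m r μ p| ≤ (wt p)⁻¹ * (K * wt p) := by
          gcongr; exact hK r hr p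
      _ = K := by field_simp

theorem memLp_wt_inv_diagRem {m r : ℝ} (hm : 0 < m) (hr : 0 < r) (μ : Fin M) (Ψ : L2 M n) :
    MemLp (fun p => (((wt p)⁻¹ : ℝ) : ℂ) * ((diagRem m r μ p : ℂ) * Ψ p)) 2 volume := by
  obtain ⟨U, hU, hb⟩ := exists_enorm_diagRem_le hm μ Ψ
  exact memLp_of_enorm_le (continuous_wt_inv.aestronglyMeasurable.mul
    ((Complex.continuous_ofReal.comp (continuous_diagRem m r μ)).aestronglyMeasurable.mul
      (Lp.aestronglyMeasurable Ψ))) hU (Eventually.of_forall (hb r hr))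

theorem tendsto_wt_inv_diagRem {m : ℝ} (hm : 0 < m) (μ : Fin M) (Ψ : L2 M n) :
    MemLp (fun p => (((wt p)⁻¹ : ℝ) : ℂ) * ((diagT m μ p : ℂ) * Ψ p)) 2 volume ∧
    Tendsto (fun r => toL2 volume fun p => (((wt p)⁻¹ : ℝ) : ℂ) * ((diagRem m r μ p : ℂ) * Ψ p))
      (𝓝[>] 0) (𝓝 (toL2 volume fun p => (((wt p)⁻¹ : ℝ) : ℂ) * ((diagT m μ p : ℂ) * Ψ p))) := by
  obtain ⟨U, hU, hb⟩ := exists_enorm_diagRem_le hm μ Ψ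
  refine tendsto_toL2 hU (fun r _ _ => continuous_wt_inv.aestronglyMeasurable.mul
    ((Complex.continuous_ofReal.comp (continuous_diagRem m r μ)).aestronglyMeasurable.mul
      (Lp.aestronglyMeasurable Ψ))) (Eventually.of_forall fun p r hr _ => hb r hr p)
    (Eventually.of_forall fun p => ?_)
  exact (((Complex.continuous_ofReal.tendsto _).comp (tendsto_diagRem m μ p)).mul_const
    _).const_mul _

/-- The function `(1 + |ζ|²)^{-1/2}` times a momentum space function made of the off-diagonal terms
and of a diagonal term with symbol `d`. -/
def symL2 (m r : ℝ) (d : Fin M → Cfg M n → ℝ) (Ψ : L2 M n) : L2 M n :=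
  ∑ μ : Fin M, (-(∑ ν : Fin M, ∑ i : Fin (n + 1),
      toL2 volume fun p => (((wt p)⁻¹ : ℝ) : ℂ) * offPart m r μ ν i Ψ p) +
    toL2 volume fun p => (((wt p)⁻¹ : ℝ) : ℂ) * ((d μ p : ℂ) * Ψ p))

/-- Both parts converge by dominated convergence in momentum space. -/
theorem tendsto_symL2 {m : ℝ} (hm : 0 < m) (Ψ : L2 M n) :
    Tendsto (fun r => symL2 m r (diagRem m r) Ψ) (𝓝[>] 0) (𝓝 (symL2 m 0 (diagT m) Ψ)) :=
  tendsto_finsetSum _ fun μ _ => ((tendsto_finsetSum _ fun ν _ => tendsto_finsetSum _ fun i _ =>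
    tendsto_wt_inv_offPart hm μ ν i Ψ).neg).add (tendsto_wt_inv_diagRem hm μ Ψ).2

/-- The pairing of `L²` functions with a Schwartz function, as a linear map. -/
def pairing (g : 𝓢(Cfg M n, ℂ)) : L2 M n →ₗ[ℂ] ℂ :=
  (PointwiseConvergenceCLM.evalCLM (RingHom.id ℂ) ℂ g).toLinearMap ∘ₗ
    (Lp.toTemperedDistributionCLM ℂ (volume : Measure (Cfg M n)) 2).toLinearMap

theorem pairing_apply (g : 𝓢(Cfg M n, ℂ)) (ψ : L2 M n) : pairing g ψ = (ψ : Dist M n) g := rfl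

theorem symL2_apply {m : ℝ} (hm : 0 < m) (r : ℝ) {d : Fin M → Cfg M n → ℝ} (Ψ : L2 M n)
    (hd : ∀ μ, MemLp (fun p => (((wt p)⁻¹ : ℝ) : ℂ) * ((d μ p : ℂ) * Ψ p)) 2 volume)
    (g : 𝓢(Cfg M n, ℂ)) : (symL2 m r d Ψ : Dist M n) g =
      ∑ μ : Fin M, (-(∑ ν : Fin M, ∑ i : Fin (n + 1),
        ∫ p, g p * ((((wt p)⁻¹ : ℝ) : ℂ) * offPart m r μ ν i Ψ p)) +
        ∫ p, g p * ((((wt p)⁻¹ : ℝ) : ℂ) * ((d μ p : ℂ) * Ψ p))) := by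
  rw [← pairing_apply, symL2]
  simp only [map_sum, map_add, map_neg, pairing_apply]
  refine Finset.sum_congr rfl fun μ _ => ?_
  rw [toL2_apply (hd μ)]
  congr 2
  refine Finset.sum_congr rfl fun ν _ => Finset.sum_congr rfl fun i _ => ?_
  exact toL2_apply (memLp_wt_inv_offPart hm r μ ν i Ψ) g

theorem bessel_symbol_neg (p : Cfg M n) :
    ((1 + ‖p‖ ^ 2) ^ ((-1 : ℝ) / 2) : ℝ) = (wt p)⁻¹ := by
  rw [wt, Real.sqrt_eq_rpow, ← Real.rpow_neg (by positivity)]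
  norm_num

theorem bessel_symbol_one (p : Cfg M n) : ((1 + ‖p‖ ^ 2) ^ ((1 : ℝ) / 2) : ℝ) = wt p := by
  rw [wt, Real.sqrt_eq_rpow]

theorem hasTemperateGrowth_bessel (s : ℝ) : Function.HasTemperateGrowth
    fun x : Cfg M n => (((1 + ‖x‖ ^ 2) ^ (s / 2) : ℝ) : ℂ) :=
  (Complex.ofRealCLM.hasTemperateGrowth).comp
    (Function.hasTemperateGrowth_one_add_norm_sq_rpow (Cfg M n) (s / 2))

theorem integral_sum_terms {A : Fin M → Fin M → Fin (n + 1) → Cfg M n → ℂ}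
    {B : Fin M → Cfg M n → ℂ} (hA : ∀ μ ν i, Integrable (A μ ν i)) (hB : ∀ μ, Integrable (B μ)) :
    Integrable (fun p => ∑ μ, (-(∑ ν, ∑ i, A μ ν i p) + B μ p)) ∧
      ∫ p, ∑ μ, (-(∑ ν, ∑ i, A μ ν i p) + B μ p) =
        ∑ μ, (-(∑ ν, ∑ i, ∫ p, A μ ν i p) + ∫ p, B μ p) := by
  have h1 : ∀ μ, Integrable fun p => -(∑ ν, ∑ i, A μ ν i p) := fun μ =>
    (integrable_finsetSum _ fun ν _ => integrable_finsetSum _ fun i _ => hA μ ν i).neg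
  have h2 : ∀ μ, Integrable fun p => -(∑ ν, ∑ i, A μ ν i p) + B μ p := fun μ => (h1 μ).add (hB μ)
  refine ⟨integrable_finsetSum _ fun μ _ => h2 μ, ?_⟩
  rw [integral_finsetSum _ fun μ _ => h2 μ]
  refine Finset.sum_congr rfl fun μ _ => ?_
  rw [integral_add (h1 μ) (hB μ), integral_neg, integral_finsetSum _ fun ν _ =>
    integrable_finsetSum _ fun i _ => hA μ ν i]
  congr 2
  exact Finset.sum_congr rfl fun ν _ => integral_finsetSum _ fun i _ => hA μ ν i

theorem integral_mul_approxFun {m r : ℝ} (hm : 0 < m) (hr : 0 < r) (f : 𝓢(Cfg M n, ℂ))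
    (ψ : L2 M n) : ∫ z, f z * approxFun m r ψ z =
      ∑ μ : Fin M, (-(∑ ν : Fin M, ∑ i : Fin (n + 1), ∫ z, f z * sphTerm m r μ ν i ψ z) +
        ((redMass m / (4 * Real.pi * r) : ℝ) : ℂ) * ∫ z, f z * ψ z) := by
  have h1 : ∀ μ ν i, Integrable fun z => f z * sphTerm m r μ ν i ψ z := fun μ ν i =>
    MemLp.integrable_mul (f.memLp 2 volume) (memLp_sphTerm hm hr μ ν i ψ)
  have h2 : Integrable fun z => f z * ψ z :=
    MemLp.integrable_mul (f.memLp 2 volume) (Lp.memLp ψ)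
  have h5 : ∀ z, f z * approxFun m r ψ z = ∑ μ : Fin M, (-(∑ ν : Fin M, ∑ i : Fin (n + 1),
      f z * sphTerm m r μ ν i ψ z) + ((redMass m / (4 * Real.pi * r) : ℝ) : ℂ) * (f z * ψ z)) := by
    intro z
    rw [approxFun, Finset.mul_sum]
    refine Finset.sum_congr rfl fun μ _ => ?_
    simp only [← Finset.mul_sum]
    ring
  simp_rw [h5]
  rw [(integral_sum_terms h1 fun _ => h2.const_mul _).2, integral_const_mul]

/-- The regularised expression for `A G ψ` in momentum variables. -/
theorem besselPotential_approxFun {m r : ℝ} (hm : 0 < m) (hr : 0 < r) (ψ : L2 M n) :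
    TemperedDistribution.besselPotential (Cfg M n) ℂ (-1)
      ((toL2 volume (approxFun m r ψ) : L2 M n) : Dist M n) =
      ((𝓕⁻ (symL2 m r (diagRem m r) (𝓕 ψ : L2 M n)) : L2 M n) : Dist M n) := by
  ext f
  set Ψ : L2 M n := 𝓕 ψ with hΨ
  set k : 𝓢(Cfg M n, ℂ) := SchwartzMap.smulLeftCLM ℂ
    (fun x : Cfg M n => (((1 + ‖x‖ ^ 2) ^ ((-1 : ℝ) / 2) : ℝ) : ℂ)) (𝓕⁻ f) with hk
  have hkp : ∀ p, k p = (𝓕⁻ f) p * (((wt p)⁻¹ : ℝ) : ℂ) := fun p => by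
    rw [hk, SchwartzMap.smulLeftCLM_apply_apply (hasTemperateGrowth_bessel (-1)),
      bessel_symbol_neg, smul_eq_mul, mul_comm]
  have hkf : 𝓕⁻ (𝓕 k) = k := FourierTransform.fourierInv_fourier_eq k
  rw [TemperedDistribution.besselPotential, TemperedDistribution.fourierMultiplierCLM_apply_apply,
    toL2_apply (memLp_approxFun hm hr ψ), integral_mul_approxFun hm hr,
    ← Lp.fourierInv_toTemperedDistribution_eq, TemperedDistribution.fourierInv_apply,
    symL2_apply hm r Ψ (fun μ => memLp_wt_inv_diagRem hm hr μ Ψ)]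
  refine Finset.sum_congr rfl fun μ _ => ?_
  have h1 : ∀ ν i, OffDiag μ ν i → ∫ z, (𝓕 k) z * sphTerm m r μ ν i ψ z =
      ∫ p, (𝓕⁻ f) p * ((((wt p)⁻¹ : ℝ) : ℂ) * offPart m r μ ν i Ψ p) := by
    intro ν i h
    rw [integral_mul_sphTerm_off hm hr h, hkf, offPart_of_offDiag h]
    refine integral_congr_ae (Eventually.of_forall fun p => ?_)
    simp only [hkp, mul_assoc]
    rfl
  have h2 : ∫ p, (𝓕⁻ f) p * ((((wt p)⁻¹ : ℝ) : ℂ) *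
      offPart m r μ μ (Fin.last n) Ψ p) = 0 := by simp
  have h3 := sum_eq_add_diag μ (fun ν i => ∫ z, (𝓕 k) z * sphTerm m r μ ν i ψ z)
    (fun ν i => ∫ p, (𝓕⁻ f) p * ((((wt p)⁻¹ : ℝ) : ℂ) * offPart m r μ ν i Ψ p)) h1 h2
  refine (congrArg (fun x => -x + _) h3).trans ?_
  -- the diagonal term and the counterterm combine to `diagRem`
  rw [integral_mul_sphTerm_diag hm hr, integral_mul_fourier, hkf, neg_add, add_assoc]
  congr 1
  have i1 : Integrable fun p => k p * Ψ p := MemLp.integrable_mul (k.memLp 2 volume) (Lp.memLp Ψ)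
  have i2 : Integrable fun p => (diagRem m r μ p : ℂ) * (k p * Ψ p) := by
    have h := MemLp.integrable_mul ((𝓕⁻ f).memLp 2 volume) (memLp_wt_inv_diagRem hm hr μ Ψ)
    refine h.congr (Eventually.of_forall fun p => ?_)
    simp only [Pi.mul_apply, hkp]; ring
  have i3 : Integrable fun p => -((diagMult m r μ p : ℂ) * (k p * Ψ p)) := by
    refine (i2.sub (i1.const_mul ((redMass m / (4 * Real.pi * r) : ℝ) : ℂ))).congr
      (Eventually.of_forall fun p => ?_)
    simp only [Pi.sub_apply, diagRem, Complex.ofReal_sub]; ring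
  rw [← integral_const_mul, ← integral_neg, ← integral_add i3 (i1.const_mul _)]
  refine integral_congr_ae (Eventually.of_forall fun p => ?_)
  simp only [diagRem, Complex.ofReal_sub, hkp, hΨ]
  ring

/-- The function `Tψ` in the momentum variables `p / 2π`. -/
def TSym (m : ℝ) (Ψ : Cfg M n → ℂ) (p : Cfg M n) : ℂ :=
  ∑ μ : Fin M, (-(∑ ν : Fin M, ∑ i : Fin (n + 1), offPart m 0 μ ν i Ψ p) +
    (diagT m μ p : ℂ) * Ψ p)

/-- The element `Tψ` of `H⁻¹`. -/
def TDist (m : ℝ) (ψ : L2 M n) : Dist M n :=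
  TemperedDistribution.besselPotential (Cfg M n) ℂ 1
    ((𝓕⁻ (symL2 m 0 (diagT m) (𝓕 ψ : L2 M n)) : L2 M n) : Dist M n)

theorem besselPotential_TDist (m : ℝ) (ψ : L2 M n) :
    TemperedDistribution.besselPotential (Cfg M n) ℂ (-1) (TDist m ψ) =
      ((𝓕⁻ (symL2 m 0 (diagT m) (𝓕 ψ : L2 M n)) : L2 M n) : Dist M n) :=
  (TemperedDistribution.besselPotential_neg_apply_eq_iff _ _ _).2 rfl

/-- The Fourier transform of `TDist m ψ` is the function `TSym`. -/
theorem fourier_TDist_apply {m : ℝ} (hm : 0 < m) (ψ : L2 M n) (f : 𝓢(Cfg M n, ℂ)) :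
    Integrable (fun p => f p * TSym m (𝓕 ψ : L2 M n) p) ∧
      (𝓕 (TDist m ψ) : Dist M n) f = ∫ p, f p * TSym m (𝓕 ψ : L2 M n) p := by
  set Ψ : L2 M n := 𝓕 ψ with hΨ
  set k : 𝓢(Cfg M n, ℂ) := SchwartzMap.smulLeftCLM ℂ
    (fun x : Cfg M n => (((1 + ‖x‖ ^ 2) ^ ((1 : ℝ) / 2) : ℝ) : ℂ)) f with hk
  have hkp : ∀ p, k p = (wt p : ℂ) * f p := fun p => by
    rw [hk, SchwartzMap.smulLeftCLM_apply_apply (hasTemperateGrowth_bessel 1),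
      bessel_symbol_one, smul_eq_mul]
  have hcancel : ∀ (x : ℂ) p, k p * ((((wt p)⁻¹ : ℝ) : ℂ) * x) = f p * x := fun x p => by
    have h0 : (wt p : ℂ) ≠ 0 := Complex.ofReal_ne_zero.2 (wt_pos p).ne'
    rw [hkp, Complex.ofReal_inv]
    field_simp
  have i1 : ∀ μ ν i, Integrable fun p => f p * offPart m 0 μ ν i Ψ p := fun μ ν i =>
    (MemLp.integrable_mul (k.memLp 2 volume) (memLp_wt_inv_offPart hm 0 μ ν i Ψ)).congr
      (Eventually.of_forall fun p => hcancel _ p)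
  have i2 : ∀ μ, Integrable fun p => f p * ((diagT m μ p : ℂ) * Ψ p) := fun μ =>
    (MemLp.integrable_mul (k.memLp 2 volume) (tendsto_wt_inv_diagRem hm μ Ψ).1).congr
      (Eventually.of_forall fun p => hcancel _ p)
  have hexp : ∀ p, f p * TSym m Ψ p = ∑ μ : Fin M, (-(∑ ν : Fin M, ∑ i : Fin (n + 1),
      f p * offPart m 0 μ ν i Ψ p) + f p * ((diagT m μ p : ℂ) * Ψ p)) := fun p => by
    rw [TSym, Finset.mul_sum]
    refine Finset.sum_congr rfl fun μ _ => ?_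
    simp only [← Finset.mul_sum]
    ring
  simp_rw [hexp]
  refine ⟨(integral_sum_terms i1 i2).1, ?_⟩
  rw [TemperedDistribution.fourier_apply, TDist, TemperedDistribution.besselPotential,
    TemperedDistribution.fourierMultiplierCLM_apply_apply, FourierTransform.fourierInv_fourier_eq,
    ← hk, ← Lp.fourierInv_toTemperedDistribution_eq, TemperedDistribution.fourierInv_apply,
    FourierTransform.fourierInv_fourier_eq,
    symL2_apply hm 0 _ (fun μ => (tendsto_wt_inv_diagRem hm μ Ψ).1), (integral_sum_terms i1 i2).2]
  simp_rw [hcancel]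

/-- Convergence in `H⁻¹` of the regularised expressions for `A G ψ`. -/
theorem tendstoSobolev_approxFun {m : ℝ} (hm : 0 < m) (ψ : L2 M n) :
    TendstoSobolev (-1) (𝓝[>] 0)
      (fun r => ((toL2 volume (approxFun m r ψ) : L2 M n) : Dist M n)) (TDist m ψ) := by
  refine ⟨fun r => 𝓕⁻ (symL2 m r (diagRem m r) (𝓕 ψ : L2 M n)),
    𝓕⁻ (symL2 m 0 (diagT m) (𝓕 ψ : L2 M n)), ?_, besselPotential_TDist m ψ, ?_⟩
  · filter_upwards [self_mem_nhdsWithin] with r hr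
    exact besselPotential_approxFun hm hr ψ
  · exact ((ContinuousFourierInv.continuous_fourierInv (E := L2 M n) (F := L2 M n)).tendsto _).comp
      (tendsto_symL2 hm _)

/-- The operator `A` applied to `G ψ` gives `TDist m ψ`. -/
theorem hasA_pot (hM : 0 < M) {m : ℝ} (hm : 0 < m) (ψ : L2 M n) :
    HasA m ((memLp_pot hm ψ).toLp (pot m ψ)) (TDist m ψ) := by
  refine ⟨pot m ψ, (memLp_pot hm ψ).coeFn_toLp, continuousOn_pot hm ψ, fun z => (M : ℂ) * ψ z,
    isB_pot hm ψ, fun r => toL2 volume (approxFun m r ψ), fun r hr => ⟨?_, ?_⟩,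
    tendstoSobolev_approxFun hm ψ⟩
  · exact (ae_approxA_pot hM hm hr ψ).mono fun z hz => hz.1
  · simp only
    rw [toL2_eq (memLp_approxFun hm hr ψ)]
    filter_upwards [(memLp_approxFun hm hr ψ).coeFn_toLp, ae_approxA_pot hM hm hr ψ] with z h1 h2
    rw [h1, h2.2]

end Limit

/-! ### The formulas for `T_d` and `T_od` -/

section Formulas

variable {M n : ℕ}

theorem shear_smul (μ : Fin M) (c : ℝ) (p : Cfg M n) (ξ : R3) :
    shear μ (c • p, c • ξ) = c • shear μ (p, ξ) := by
  rw [shear_apply, shear_apply]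
  refine cfg_ext ?_ ?_
  · simp [subX, Pi.single_smul, smul_sub]
  · ext i : 1
    refine Fin.lastCases ?_ (fun i => ?_) i <;> simp

theorem totL_last_shear (μ ν : Fin M) (p : Cfg M n) (ξ : R3) :
    totL ν (Fin.last n) (shear μ (p, ξ)) = mk (subX (xs p) μ ξ + Pi.single ν ξ) (ys p) := by
  rw [totL_last, totalL_apply, shear_apply]
  simp

theorem totL_castSucc_shear (μ ν : Fin M) (k : Fin n) (p : Cfg M n) (ξ : R3) :
    totL ν k.castSucc (shear μ (p, ξ)) =
      mk (subX (xs p) μ ξ + Pi.single ν (ys p k)) (Function.update (ys p) k ξ) := by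
  rw [totL_apply, totalL_apply, shear_apply]
  refine cfg_ext ?_ ?_
  · simp [Equiv.swap_apply_right]
  · ext j : 1
    simp only [ys_mk, ys_permL, Function.comp_apply]
    by_cases h : j = k
    · subst h
      simp [Equiv.swap_apply_left]
    · have h1 : j.castSucc ≠ k.castSucc := fun h' => h (Fin.castSucc_injective n h')
      rw [Equiv.swap_apply_of_ne_of_ne h1 (Fin.castSucc_lt_last j).ne]
      simp [h]

/-- The factor relating Mathlib's Fourier transform to the unitary one. -/
def hatC (M n : ℕ) : ℝ := (2 * Real.pi) ^ (-(3 * ((M : ℝ) + n) / 2))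

theorem hatC_mul : (2 * Real.pi) ^ (3 * ((M : ℝ) + n) / 2) * hatC M n = 1 := by
  rw [hatC, ← Real.rpow_add (by positivity), add_neg_cancel, Real.rpow_zero]

theorem hat_smul (ψ : L2 M n) (ζ : Cfg M n) :
    hat ψ ((2 * Real.pi) • ζ) = (hatC M n : ℂ) * (𝓕 ψ : L2 M n) ζ := by
  rw [hat, smul_smul, inv_mul_cancel₀ (by positivity), one_smul]
  rfl

theorem symL_shear (m : ℝ) (μ : Fin M) (ζ : Cfg M n) (η : R3) :
    symL m (mk (subX (xs ((2 * Real.pi) • ζ)) μ ((2 * Real.pi) • η))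
      (Fin.snoc (ys ((2 * Real.pi) • ζ)) ((2 * Real.pi) • η) : Fin (n + 1) → R3)) =
      en m (shear μ (ζ, η)) := by
  rw [← shear_apply, shear_smul, en]

theorem offInt₁_smul (m : ℝ) (ψ : L2 M n) (ζ : Cfg M n) (μ ν : Fin M) (k : Fin n) (η : R3) :
    offInt₁ m (hat ψ) ((2 * Real.pi) • ζ) μ ν k ((2 * Real.pi) • η) = (hatC M n : ℂ) *
      ((((en m (shear μ (ζ, η)))⁻¹ * Real.sinc (2 * Real.pi * 0 * ‖η‖) : ℝ) : ℂ) *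
        (𝓕 ψ : L2 M n) (totL ν k.castSucc (shear μ (ζ, η)))) := by
  rw [offInt₁, symL_shear, ← totL_castSucc_shear, shear_smul, map_smul, hat_smul]
  simp only [mul_zero, zero_mul, Real.sinc_zero, mul_one, Complex.ofReal_inv]
  rw [div_eq_mul_inv]
  ring

theorem offInt₂_smul (m : ℝ) (ψ : L2 M n) (ζ : Cfg M n) (μ ν : Fin M) (η : R3) :
    offInt₂ m (hat ψ) ((2 * Real.pi) • ζ) μ ν ((2 * Real.pi) • η) = (hatC M n : ℂ) *
      ((((en m (shear μ (ζ, η)))⁻¹ * Real.sinc (2 * Real.pi * 0 * ‖η‖) : ℝ) : ℂ) *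
        (𝓕 ψ : L2 M n) (totL ν (Fin.last n) (shear μ (ζ, η)))) := by
  rw [offInt₂, symL_shear, ← totL_last_shear, shear_smul, map_smul, hat_smul]
  simp only [mul_zero, zero_mul, Real.sinc_zero, mul_one, Complex.ofReal_inv]
  rw [div_eq_mul_inv]
  ring

theorem integral_scale (f : R3 → ℂ) :
    ∫ ξ, f ξ = (((2 * Real.pi) ^ 3 : ℝ) : ℂ) * ∫ η : R3, f ((2 * Real.pi) • η) := by
  have hπ : 0 < (2 * Real.pi) ^ 3 := by positivity
  rw [Measure.integral_comp_smul, show Module.finrank ℝ R3 = 3 by simp,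
    abs_of_pos (inv_pos.2 hπ), Complex.real_smul, ← mul_assoc, ← Complex.ofReal_mul,
    mul_inv_cancel₀ hπ.ne', Complex.ofReal_one, one_mul]

/-- The exchange terms of `T_od` are the off-diagonal terms with `i ≤ n`. -/
theorem integral_offInt₁ (m : ℝ) (ψ : L2 M n) (ζ : Cfg M n) (μ ν : Fin M) (k : Fin n) :
    ∫ ξ, offInt₁ m (hat ψ) ((2 * Real.pi) • ζ) μ ν k ξ = (((2 * Real.pi) ^ 3 : ℝ) : ℂ) *
      ((hatC M n : ℂ) * offPart m 0 μ ν k.castSucc (𝓕 ψ : L2 M n) ζ) := by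
  rw [integral_scale, offPart_of_offDiag (Or.inl (Fin.castSucc_lt_last k).ne), offSym]
  simp_rw [offInt₁_smul, integral_const_mul]

/-- The terms of `T_od` that keep the y-momenta are the off-diagonal terms with `i = n + 1`. -/
theorem integral_offInt₂ (m : ℝ) (ψ : L2 M n) (ζ : Cfg M n) {μ ν : Fin M} (h : μ ≠ ν) :
    ∫ ξ, offInt₂ m (hat ψ) ((2 * Real.pi) • ζ) μ ν ξ = (((2 * Real.pi) ^ 3 : ℝ) : ℂ) *
      ((hatC M n : ℂ) * offPart m 0 μ ν (Fin.last n) (𝓕 ψ : L2 M n) ζ) := by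
  rw [integral_scale, offPart_of_offDiag (Or.inr h), offSym]
  simp_rw [offInt₂_smul, integral_const_mul]

theorem TdHat_smul {m : ℝ} (hm : 0 < m) (ψ : L2 M n) (ζ : Cfg M n) :
    TdHat m (hat ψ) ((2 * Real.pi) • ζ) =
      (hatC M n : ℂ) * ∑ μ : Fin M, (diagT m μ ζ : ℂ) * (𝓕 ψ : L2 M n) ζ := by
  have hα := redMass_pos hm
  have h1 : ∀ μ : Fin M, diagT m μ ζ = 1 / (4 * Real.pi) * redMass m ^ (3 / 2 : ℝ) *
      √(lam m μ ((2 * Real.pi) • ζ)) := fun μ => by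
    rw [diagT, Real.sqrt_mul hα.le, show (3 / 2 : ℝ) = 1 + 1 / 2 by norm_num,
      Real.rpow_add hα, Real.rpow_one, ← Real.sqrt_eq_rpow]
    ring
  rw [← Finset.sum_mul, ← Complex.ofReal_sum, mul_left_comm, TdHat, hat_smul]
  congr 2
  rw [Finset.sum_congr rfl fun μ _ => h1 μ, ← Finset.mul_sum]
  rfl

theorem TodHat_smul (m : ℝ) (ψ : L2 M n) (ζ : Cfg M n) :
    TodHat m (hat ψ) ((2 * Real.pi) • ζ) = (hatC M n : ℂ) *
      ∑ μ : Fin M, -∑ ν : Fin M, ∑ i : Fin (n + 1), offPart m 0 μ ν i (𝓕 ψ : L2 M n) ζ := by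
  have hc : ((1 / (2 * Real.pi) ^ 3 : ℝ) : ℂ) * (((2 * Real.pi) ^ 3 : ℝ) : ℂ) = 1 := by
    rw [← Complex.ofReal_mul, one_div_mul_cancel (by positivity), Complex.ofReal_one]
  have h2 : ∀ μ : Fin M, ∑ ν ∈ Finset.univ.erase μ,
      (∫ ξ, offInt₂ m (hat ψ) ((2 * Real.pi) • ζ) μ ν ξ) = ∑ ν : Fin M,
        (((2 * Real.pi) ^ 3 : ℝ) : ℂ) *
          ((hatC M n : ℂ) * offPart m 0 μ ν (Fin.last n) (𝓕 ψ : L2 M n) ζ) := by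
    intro μ
    rw [← Finset.add_sum_erase Finset.univ (fun ν => (((2 * Real.pi) ^ 3 : ℝ) : ℂ) *
      ((hatC M n : ℂ) * offPart m 0 μ ν (Fin.last n) (𝓕 ψ : L2 M n) ζ)) (Finset.mem_univ μ),
      offPart_last, Pi.zero_apply, mul_zero, mul_zero, zero_add]
    exact Finset.sum_congr rfl fun ν hν => integral_offInt₂ m ψ ζ (Finset.ne_of_mem_erase hν).symm
  rw [TodHat, Finset.sum_congr rfl fun μ _ => h2 μ]
  simp_rw [integral_offInt₁, Fin.sum_univ_castSucc, Finset.sum_add_distrib, ← Finset.mul_sum,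
    Finset.sum_neg_distrib, Finset.sum_add_distrib]
  linear_combination (-((hatC M n : ℂ) *
    ((∑ μ : Fin M, ∑ ν : Fin M, ∑ i : Fin n, offPart m 0 μ ν i.castSucc (𝓕 ψ : L2 M n) ζ) +
      ∑ μ : Fin M, ∑ ν : Fin M, offPart m 0 μ ν (Fin.last n) (𝓕 ψ : L2 M n) ζ))) * hc

/-- The momentum space formula for `Tψ`, in the two normalisations of the Fourier transform. -/
theorem THat_smul {m : ℝ} (hm : 0 < m) (ψ : L2 M n) (ζ : Cfg M n) :
    THat m (hat ψ) ((2 * Real.pi) • ζ) = (hatC M n : ℂ) * TSym m (𝓕 ψ : L2 M n) ζ := by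
  rw [THat, TdHat_smul hm, TodHat_smul, TSym, ← mul_add, ← Finset.sum_add_distrib]
  congr 1
  exact Finset.sum_congr rfl fun μ _ => add_comm _ _

theorem hasHat_TDist {m : ℝ} (hm : 0 < m) (ψ : L2 M n) : HasHat (TDist m ψ) (THat m (hat ψ)) := by
  intro f
  have h : ∀ ζ, f ζ * ((((2 * Real.pi) ^ (3 * ((M : ℝ) + n) / 2) : ℝ) : ℂ) *
      THat m (hat ψ) ((2 * Real.pi) • ζ)) = f ζ * TSym m (𝓕 ψ : L2 M n) ζ := fun ζ => by
    rw [THat_smul hm, ← mul_assoc, ← mul_assoc, mul_assoc (f ζ), ← Complex.ofReal_mul, hatC_mul,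
      Complex.ofReal_one, mul_one]
  simp_rw [h]
  exact fourier_TDist_apply hm ψ f

theorem ae_smul {P : Cfg M n → Prop} (h : ∀ᵐ ζ, P ((2 * Real.pi) • ζ)) : ∀ᵐ p, P p := by
  have hπ : (2 * Real.pi) ≠ 0 := by positivity
  filter_upwards [(Measure.quasiMeasurePreserving_smul (volume : Measure (Cfg M n))
    (inv_ne_zero hπ)).ae h] with p hp
  rwa [smul_smul, mul_inv_cancel₀ hπ, one_smul] at hp

/-- The absolute convergence of the integrals in `T_od`, in the variables of Mathlib's Fourier
transform. -/
theorem ae_integrable_off {m : ℝ} (hm : 0 < m) (ψ : L2 M n) :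
    ∀ᵐ ζ : Cfg M n, ∀ (μ ν : Fin M) (i : Fin (n + 1)), OffDiag μ ν i → Integrable fun η : R3 =>
      (hatC M n : ℂ) * ((((en m (shear μ (ζ, η)))⁻¹ * Real.sinc (2 * Real.pi * 0 * ‖η‖) : ℝ) : ℂ) *
        (𝓕 ψ : L2 M n) (totL ν i (shear μ (ζ, η)))) := by
  refine ae_all_iff.2 fun μ => ae_all_iff.2 fun ν => ae_all_iff.2 fun i => ?_
  by_cases h : OffDiag μ ν i
  · filter_upwards [ae_offAbs_ne_top hm h (measurable_coe (𝓕 ψ : L2 M n)).enorm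
      (lintegral_enorm_sq_ne_top (Lp.memLp _))] with ζ hζ _
    exact (integrable_offSym_integrand hm 0 μ ν i (measurable_coe _) hζ).const_mul _
  · exact Eventually.of_forall fun ζ h' => absurd h' h

theorem integrable_offInt₁ {m : ℝ} (hm : 0 < m) (ψ : L2 M n) : ∀ᵐ p : Cfg M n,
    ∀ (μ ν : Fin M) (i : Fin n), Integrable (offInt₁ m (hat ψ) p μ ν i) := by
  refine ae_smul ?_
  filter_upwards [ae_integrable_off hm ψ] with ζ hζ μ ν k
  refine (integrable_comp_smul_iff volume _ (show 2 * Real.pi ≠ 0 by positivity)).1 ?_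
  simp_rw [offInt₁_smul]
  exact hζ μ ν k.castSucc (Or.inl (Fin.castSucc_lt_last k).ne)

theorem integrable_offInt₂ {m : ℝ} (hm : 0 < m) (ψ : L2 M n) : ∀ᵐ p : Cfg M n,
    ∀ μ ν : Fin M, μ ≠ ν → Integrable (offInt₂ m (hat ψ) p μ ν) := by
  refine ae_smul ?_
  filter_upwards [ae_integrable_off hm ψ] with ζ hζ μ ν h
  refine (integrable_comp_smul_iff volume _ (show 2 * Real.pi ≠ 0 by positivity)).1 ?_
  simp_rw [offInt₂_smul]
  exact hζ μ ν (Fin.last n) (Or.inr h)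

end Formulas

/-! ### The symmetry of `T` -/

section Duality

variable {M n : ℕ}

theorem toDist_injective {a b : L2 M n} (h : (a : Dist M n) = (b : Dist M n)) : a = b := by
  have hinj := LinearMap.ker_eq_bot.1 (Lp.ker_toTemperedDistributionCLM_eq_bot (F := ℂ)
    (μ := (volume : Measure (Cfg M n))) (p := 2))
  exact hinj h

/-- The momentum space description of `H¹`. -/
theorem memLp_wt_mul_fourier {χ : L2 M n}
    (h : TemperedDistribution.MemSobolev 1 2 (χ : Dist M n)) :
    MemLp (fun p => (wt p : ℂ) * (𝓕 χ : L2 M n) p) 2 volume := by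
  obtain ⟨g, hg⟩ := h
  have hg' := (TemperedDistribution.besselPotential_neg_apply_eq_iff 1 _ _).2 hg
  set G : L2 M n := 𝓕 g with hG
  have hGm : MemLp (fun p => (((wt p)⁻¹ : ℝ) : ℂ) * G p) 2 volume := by
    refine memLp_of_enorm_le (U := fun p => ‖G p‖ₑ) (continuous_wt_inv.aestronglyMeasurable.mul
      (Lp.aestronglyMeasurable G)) (lintegral_enorm_sq_ne_top (Lp.memLp G))
      (Eventually.of_forall fun p => ?_)
    rw [enorm_mul, enorm_wt_inv]
    refine mul_le_of_le_one_left (zero_le) (ENNReal.ofReal_le_one.2 (inv_le_one_of_one_le₀ ?_))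
    rw [wt, Real.one_le_sqrt]
    have := sq_nonneg ‖p‖
    linarith
  -- `χ` is the Bessel potential of order `-1` of an `L²` function
  have hχ : χ = (𝓕⁻ (toL2 volume fun p => (((wt p)⁻¹ : ℝ) : ℂ) * G p) : L2 M n) := by
    refine toDist_injective ?_
    rw [← hg']
    ext f
    set k : 𝓢(Cfg M n, ℂ) := SchwartzMap.smulLeftCLM ℂ
      (fun x : Cfg M n => (((1 + ‖x‖ ^ 2) ^ ((-1 : ℝ) / 2) : ℝ) : ℂ)) (𝓕⁻ f) with hk
    have hkp : ∀ p, k p = (((wt p)⁻¹ : ℝ) : ℂ) * (𝓕⁻ f) p := fun p => by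
      rw [hk, SchwartzMap.smulLeftCLM_apply_apply (hasTemperateGrowth_bessel (-1)),
        bessel_symbol_neg, smul_eq_mul]
    rw [TemperedDistribution.besselPotential, TemperedDistribution.fourierMultiplierCLM_apply_apply,
      ← Lp.fourierInv_toTemperedDistribution_eq, TemperedDistribution.fourierInv_apply,
      toL2_apply hGm, Lp.toTemperedDistribution_apply, ← hk]
    simp_rw [smul_eq_mul]
    rw [integral_mul_fourier, FourierTransform.fourierInv_fourier_eq]
    refine integral_congr_ae (Eventually.of_forall fun p => ?_)
    simp only [hkp, hG]
    ring
  have hF : (𝓕 χ : L2 M n) = hGm.toLp _ := by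
    rw [hχ, FourierTransform.fourier_fourierInv_eq, toL2_eq hGm]
  refine (memLp_congr_ae ?_).1 (Lp.memLp G)
  rw [hF]
  filter_upwards [hGm.coeFn_toLp] with p hp
  have h0 : (wt p : ℂ) ≠ 0 := Complex.ofReal_ne_zero.2 (wt_pos p).ne'
  rw [hp, Complex.ofReal_inv]
  field_simp

theorem star_offSym (m r : ℝ) (μ ν : Fin M) (i : Fin (n + 1)) (X : Cfg M n → ℂ) (p : Cfg M n) :
    star (offSym m r μ ν i X p) = offSym m r μ ν i (fun x => star (X x)) p := by
  rw [offSym, offSym]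
  refine (integral_conj (𝕜 := ℂ)).symm.trans ?_
  refine integral_congr_ae (Eventually.of_forall fun ξ => ?_)
  simp only [map_mul, Complex.conj_ofReal]
  rfl

/-- The off-diagonal form with its kernel. -/
def offForm (m : ℝ) (μ ν : Fin M) (i : Fin (n + 1)) (f Ψ : Cfg M n → ℂ) (ζ : Cfg M (n + 1)) : ℂ :=
  (((en m ζ)⁻¹ * Real.sinc (2 * Real.pi * 0 * ‖ys ζ (Fin.last n)‖) : ℝ) : ℂ) *
    (f (totalL μ ζ) * Ψ (totL ν i ζ))

/-- Exchanging the roles of the two interacting particles corresponds to the transposition of the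
two y-momenta. -/
theorem offForm_permL (m : ℝ) (μ ν : Fin M) (i : Fin (n + 1)) (f Ψ : Cfg M n → ℂ)
    (ζ : Cfg M (n + 1)) : offForm m μ ν i f Ψ (permL (swp i) ζ) = offForm m ν μ i Ψ f ζ := by
  rw [offForm, offForm, en_permL, totL_apply ν, permL_swp_swp, ← totL_apply μ, mul_comm (f _),
    mul_zero, zero_mul, zero_mul]

theorem integrable_offForm_zero {m : ℝ} (hm : 0 < m) {μ ν : Fin M} {i : Fin (n + 1)}
    (h : OffDiag μ ν i) {f Ψ : Cfg M n → ℂ} (hf : Measurable f) (hΨ : Measurable Ψ)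
    (hf2 : MemLp (fun x => (wt x : ℂ) * f x) 2 volume) (hΨ2 : MemLp Ψ 2 volume) :
    Integrable (offForm m μ ν i f Ψ) :=
  integrable_offForm hm h 0 hf hΨ hf2 hΨ2

/-- The transpose of the off-diagonal term `(μ, ν, i)` is the term `(ν, μ, i)`, by the change of
variables that interchanges the `i`-th and the last y-momentum. -/
theorem integral_mul_offSym_comm {m : ℝ} (μ ν : Fin M) (i : Fin (n + 1)) {f Ψ : Cfg M n → ℂ}
    (hg : Integrable (offForm m μ ν i f Ψ)) :
    Integrable (fun p => f p * offSym m 0 μ ν i Ψ p) ∧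
    Integrable (fun p => Ψ p * offSym m 0 ν μ i f p) ∧
    ∫ p, f p * offSym m 0 μ ν i Ψ p = ∫ p, Ψ p * offSym m 0 ν μ i f p := by
  have hmp := measurePreserving_permL (M := M) (swp i)
  have hemb := (permL (M := M) (swp i)).toHomeomorph.measurableEmbedding
  have hg' : Integrable (offForm m ν μ i Ψ f) :=
    ((hmp.integrable_comp_emb hemb).2 hg).congr
      (Eventually.of_forall (offForm_permL m μ ν i f Ψ))
  have hgg : ∫ ζ, offForm m μ ν i f Ψ ζ = ∫ ζ, offForm m ν μ i Ψ f ζ := by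
    rw [← hmp.integral_comp hemb]
    exact integral_congr_ae (Eventually.of_forall (offForm_permL m μ ν i f Ψ))
  obtain ⟨a1, a2⟩ := integral_mul_offSym 0 μ ν i hg
  obtain ⟨b1, b2⟩ := integral_mul_offSym 0 ν μ i hg'
  exact ⟨a1, b1, a2.trans (hgg.trans b2.symm)⟩

theorem memLp_wt_mul_star {X : Cfg M n → ℂ} (hX : Measurable X)
    (hX2 : MemLp (fun x => (wt x : ℂ) * X x) 2 volume) :
    MemLp (fun x => (wt x : ℂ) * star (X x)) 2 volume := by
  have hms : Measurable fun x : Cfg M n => (wt x : ℂ) :=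
    Complex.measurable_ofReal.comp continuous_wt.measurable
  have hXs : Measurable fun x => star (X x) := continuous_star.measurable.comp hX
  refine MemLp.congr_norm hX2 (hms.mul hXs).aestronglyMeasurable
    (Eventually.of_forall fun x => ?_)
  rw [norm_mul, norm_mul, norm_star]

/-- The off-diagonal part is symmetric. -/
theorem integral_star_mul_offPart {m : ℝ} (hm : 0 < m) (μ ν : Fin M) (i : Fin (n + 1))
    {X Ψ : Cfg M n → ℂ} (hX : Measurable X) (hΨ : Measurable Ψ)
    (hX2 : MemLp (fun x => (wt x : ℂ) * X x) 2 volume) (hΨ2 : MemLp Ψ 2 volume) :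
    Integrable (fun p => star (X p) * offPart m 0 μ ν i Ψ p) ∧
    Integrable (fun p => star (offPart m 0 ν μ i X p) * Ψ p) ∧
    ∫ p, star (X p) * offPart m 0 μ ν i Ψ p = ∫ p, star (offPart m 0 ν μ i X p) * Ψ p := by
  by_cases h : OffDiag μ ν i
  swap
  · obtain ⟨rfl, rfl⟩ := not_offDiag h
    simp only [offPart_last, Pi.zero_apply, mul_zero, star_zero, zero_mul]
    exact ⟨integrable_zero _ _ _, integrable_zero _ _ _, trivial⟩
  have h' : OffDiag ν μ i := h.imp id Ne.symm
  rw [offPart_of_offDiag h, offPart_of_offDiag h']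
  have hXs : Measurable fun x => star (X x) := continuous_star.measurable.comp hX
  have hX2s := memLp_wt_mul_star hX hX2
  have hst : ∀ p, star (offSym m 0 ν μ i X p) * Ψ p =
      Ψ p * offSym m 0 ν μ i (fun x => star (X x)) p := fun p => by
    rw [star_offSym, mul_comm]
  have hi : Integrable (offForm m μ ν i (fun x => star (X x)) Ψ) :=
    integrable_offForm_zero hm h hXs hΨ hX2s hΨ2
  obtain ⟨a, b, c⟩ := integral_mul_offSym_comm μ ν i hi
  rw [funext hst]
  exact ⟨a, b, c⟩

/-- `T` is symmetric: it may be moved to the function in `H¹`. -/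
theorem integral_star_mul_TSym {m : ℝ} (hm : 0 < m) (X Ψ : L2 M n)
    (hX2 : MemLp (fun x => (wt x : ℂ) * X x) 2 volume) :
    Integrable (fun p => star (X p) * TSym m Ψ p) ∧
    Integrable (fun p => star (TSym m X p) * Ψ p) ∧
    ∫ p, star (X p) * TSym m Ψ p = ∫ p, star (TSym m X p) * Ψ p := by
  have hoff := fun μ ν i => integral_star_mul_offPart hm μ ν i (measurable_coe X)
    (measurable_coe Ψ) hX2 (Lp.memLp Ψ)
  have hd : ∀ μ, Integrable fun p => star (X p) * ((diagT m μ p : ℂ) * Ψ p) := fun μ => by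
    have hX3 : MemLp (fun x => star ((wt x : ℂ) * X x)) 2 volume := hX2.star
    refine (MemLp.integrable_mul hX3 (tendsto_wt_inv_diagRem hm μ Ψ).1).congr
      (Eventually.of_forall fun p => ?_)
    have h0 : (wt p : ℂ) ≠ 0 := Complex.ofReal_ne_zero.2 (wt_pos p).ne'
    simp only [Pi.mul_apply, star_mul', Complex.ofReal_inv, Complex.star_def, Complex.conj_ofReal]
    field_simp
  have e1 : ∀ p, star (X p) * TSym m Ψ p = ∑ μ : Fin M, (-(∑ ν : Fin M, ∑ i : Fin (n + 1),
      star (X p) * offPart m 0 μ ν i Ψ p) + star (X p) * ((diagT m μ p : ℂ) * Ψ p)) := fun p => by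
    rw [TSym, Finset.mul_sum]
    refine Finset.sum_congr rfl fun μ _ => ?_
    simp only [← Finset.mul_sum]
    ring
  have e2 : ∀ p, star (TSym m X p) * Ψ p = ∑ μ : Fin M, (-(∑ ν : Fin M, ∑ i : Fin (n + 1),
      star (offPart m 0 μ ν i X p) * Ψ p) + star (X p) * ((diagT m μ p : ℂ) * Ψ p)) := fun p => by
    rw [TSym, star_sum, Finset.sum_mul]
    refine Finset.sum_congr rfl fun μ _ => ?_
    simp only [← Finset.sum_mul, star_add, star_neg, star_sum, star_mul', Complex.star_def,
      Complex.conj_ofReal]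
    ring
  simp_rw [e1, e2]
  have s1 := integral_sum_terms (fun μ ν i => (hoff μ ν i).1) hd
  have s2 := integral_sum_terms (fun μ ν i => (hoff ν μ i).2.1) hd
  refine ⟨s1.1, s2.1, ?_⟩
  rw [s1.2, s2.2, Finset.sum_add_distrib, Finset.sum_add_distrib, Finset.sum_neg_distrib,
    Finset.sum_neg_distrib]
  congr 2
  rw [Finset.sum_comm]
  exact Finset.sum_congr rfl fun μ _ => Finset.sum_congr rfl fun ν _ =>
    Finset.sum_congr rfl fun i _ => (hoff ν μ i).2.2

/-- The distribution `TDist m ψ` is the value at `ψ` of the extension of `T`. -/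
theorem isT_TDist {m : ℝ} (hm : 0 < m) (ψ : L2 M n) : IsT m ψ (TDist m ψ) := by
  refine ⟨⟨_, besselPotential_TDist m ψ⟩, integrable_offInt₁ hm ψ, integrable_offInt₂ hm ψ,
    hasHat_TDist hm ψ, fun χ _ hχ => ?_⟩
  obtain ⟨h1, h2, h3⟩ := integral_star_mul_TSym hm (𝓕 χ : L2 M n) (𝓕 ψ : L2 M n)
    (memLp_wt_mul_fourier hχ)
  -- the dilation by `2π` passes to the unitary Fourier transform
  have hπ : 2 * Real.pi ≠ 0 := by positivity
  have e1 : ∀ ζ : Cfg M n, star (hat χ ((2 * Real.pi) • ζ)) * THat m (hat ψ) ((2 * Real.pi) • ζ) =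
      ((hatC M n : ℂ) * (hatC M n : ℂ)) *
        (star ((𝓕 χ : L2 M n) ζ) * TSym m (𝓕 ψ : L2 M n) ζ) := fun ζ => by
    rw [hat_smul, THat_smul hm, star_mul', Complex.star_def, Complex.conj_ofReal]
    ring
  have e2 : ∀ ζ : Cfg M n, star (THat m (hat χ) ((2 * Real.pi) • ζ)) * hat ψ ((2 * Real.pi) • ζ) =
      ((hatC M n : ℂ) * (hatC M n : ℂ)) *
        (star (TSym m (𝓕 χ : L2 M n) ζ) * (𝓕 ψ : L2 M n) ζ) := fun ζ => by
    rw [hat_smul, THat_smul hm, star_mul', Complex.star_def, Complex.conj_ofReal]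
    ring
  refine ⟨?_, ?_, ?_⟩
  · refine (integrable_comp_smul_iff volume _ hπ).1 ?_
    simp_rw [e1]
    exact h1.const_mul _
  · refine (integrable_comp_smul_iff volume _ hπ).1 ?_
    simp_rw [e2]
    exact h2.const_mul _
  · have s1 := Measure.integral_comp_smul volume
      (fun p => star (hat χ p) * THat m (hat ψ) p) (2 * Real.pi)
    have s2 := Measure.integral_comp_smul volume
      (fun p => star (THat m (hat χ) p) * hat ψ p) (2 * Real.pi)
    simp_rw [e1] at s1
    simp_rw [e2] at s2
    rw [integral_const_mul, h3, ← integral_const_mul, s2] at s1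
    exact (smul_right_injective ℂ (r := |((2 * Real.pi) ^ Module.finrank ℝ (Cfg M n))⁻¹|)
      (by positivity) s1.symm)

end Duality

end IBC

end

theorem lemma3p6 {M n : ℕ} (hM : 0 < M) (m : ℝ) (hm : 0 < m)
    (ψ : IBC.L2 M n) (hψ : IBC.IsSector ψ) :
    ∃ φ : IBC.L2 M (n + 1), (φ : 𝓢'(IBC.Cfg M (n + 1), ℂ)) = IBC.G m ψ ∧ IBC.IsSector φ ∧
      ∃ τ : 𝓢'(IBC.Cfg M n, ℂ), IBC.HasA m φ τ ∧ IBC.IsT m ψ τ :=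
  ⟨_, IBC.toLp_pot_eq_G hm hψ, IBC.isSector_pot hm hψ, _, IBC.hasA_pot hM hm ψ, IBC.isT_TDist hm ψ⟩
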